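/- **Setting.** Let $\gamma>0$, $p(\rho)=\rho^\gamma/\gamma$, $c(\rho)=\sqrt{p'(\rho)}$, $0<a<b$, $I^-=[a,b]$, $I^+=[b,\infty)$, and $\Omega_T^\pm=[0,T]\times I^\pm$. A piecewise function $g=(g_-,g_+)$ consists of functions $g_\pm$ on $\Omega_T^\pm$ (or on $I^\pm$); it is piecewise $C^1$ if each $g_\pm$ is $C^1$ up to the boundary. For a piecewise $C^1$ state $U=(\rho,u,v)$ put $$\varphi(t)=b+\int_0^t u_-(s,b)\,ds,\qquad \Phi(t,r)=a+\frac{\varphi(t)-a}{b-a}(r-a),$$ $$B(U,\varphi)=\frac1{\Phi_r}\begin{pmatrix}u-\Phi_t&\rho&0\\ c^2/\rho&u-\Phi_t&0\\0&0&u-\Phi_t\end{pmatrix}.$$ Let $\|\cdot\|$ be the supremum norm in $r$ over both sides, and let $$\nabla g=\Big(\partial_t g-\frac{\Phi_t}{\Phi_r}\partial_r g,\ \frac1{\Phi_r}\partial_r g\Big),$$ that is, the gradient of $g$ with respect to the original (unstraightened) variables $(t,\Phi(t,r))$. A piecewise function $g$ is called bounded in $C^1$ by $K$ if it is piecewise $C^1$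 with $|g|\le K$ and $|\nabla g|\le K$; for functions of $r$ alone, $|\partial_r g|\le K$ replaces the latter. Let $\lambda_1,\lambda_2,\lambda_3=\frac1{\Phi_r}(u-\Phi_t-c),\ \frac1{\Phi_r}(u-\Phi_t),\ \frac1{\Phi_r}(u-\Phi_t+c)$, let $R$ be the matrix with columns $(\rho,-c,0)^T,(0,0,1)^T,(\rho,c,0)^T$, let $\Lambda=\mathrm{diag}(\lambda_1,\lambda_2,\lambda_3)$, and let $m=(\partial_tR^{-1}+\Lambda\,\partial_rR^{-1})R$. Write $\|m\|$ for the supremum of the absolute values of the entries of $m$ over $\Omega_T^-$ and $\Omega_T^+$. **Proposition 2.4.** Let $T_0,K,\delta>0$. There are constants $C,M>0$, depending only on $\gamma,a,b,T_0,K,\delta$, such that the following holds for every $T\in(0,T_0]$ and every $U=(\rho,u,v)$ that is bounded in $C^1$ by $K$, satisfies $\rho\ge\delta$ and $\varphi\ge a+\delta$ on $[0,T]$, $u_-=0$ on $r=a$, and $\rho_+=\rho_-$, $u_+=u_-$ on $r=b$. One has $\|m\|\le M$. Let $f$ and $w^0$ be bounded in $C^1$ (by some constants), and consider $$(2.15)\quad\begin{cases}\partial_tw+B(U,\varphi)\partial_rw=f,\\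 w_{+,1}=w_{-,1},\quad w_{+,2}=w_{-,2},& r=b,\\ w_{-,2}=0,& r=a,\\ w|_{t=0}=w^0(r).\end{cases}$$ Assume the compatibility conditions of orders $0$ and $1$: both $w^0$ and $f(0,\cdot)-B(U,\varphi)|_{t=0}\,\partial_rw^0$ satisfy the three boundary conditions of (2.15), at $r=b$ and $r=a$. Then (2.15) has a unique piecewise $C^1$ solution $w$. It is bounded in $C^1$, and for all $t\in[0,T]$ and every $M'\ge\|m\|$ $$(2.13)\quad\|w(t)\|\le C\Big(e^{M'Ct}\|w^0\|+\int_0^te^{M'C(t-s)}\|f(s)\|\,ds\Big),$$ $$(2.16)\quad\|\nabla w(t)\|\le C\Big\{e^{MCt}\big(\|\partial_rw^0\|+\|f(0)\|\big)+\int_0^te^{MC(t-s)}\big(\|f(s)\|+\|\nabla f(s)\|\big)ds\Big\}.$$ -/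

import Mathlib

open Set

noncomputable section

namespace VortexSheet

/-- The two sides of the straightened front `r = b`. -/
inductive Side
  | minus
  | plus

/-- The radial interval on each side: `[a, b]` inside and `[b, ∞)` outside the front. -/
def Side.interval (a b : ℝ) : Side → Set ℝ
  | Side.minus => Icc a b
  | Side.plus => Ici b

/-- The space-time domain (with its boundary) on one side of the front, for times in `[0, T]`. -/
def slab (a b T : ℝ) (σ : Side) : Set (ℝ × ℝ) :=
  Icc (0 : ℝ) T ×ˢ σ.interval a b

/-- A state `(ρ, u, v)`: density, radial velocity, angular velocity (indices 0, 1, 2). -/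
abbrev State := Fin 3 → ℝ

/-- A pair of functions of `(t, r)`, one for each side of the front. -/
abbrev Field := Side → ℝ × ℝ → State

/-- A pair of functions of `r`, one for each side of the front. -/
abbrev InitialField := Side → ℝ → State

/-- Partial derivative in `t` of a function on `S`, one-sided at the boundary of `S`. -/
def dt {E : Type*} [NormedAddCommGroup E] [NormedSpace ℝ E]
    (S : Set (ℝ × ℝ)) (g : ℝ × ℝ → E) (p : ℝ × ℝ) : E :=
  fderivWithin ℝ g S p (1, 0)

/-- Partial derivative in `r` of a function on `S`, one-sided at the boundary of `S`. -/
def dr {E : Type*} [NormedAddCommGroup E] [NormedSpace ℝ E]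
    (S : Set (ℝ × ℝ)) (g : ℝ × ℝ → E) (p : ℝ × ℝ) : E :=
  fderivWithin ℝ g S p (0, 1)

/-- The `C⁰` norm of a pair of functions of `r`: the supremum over both sides. -/
def supNorm {E : Type*} [NormedAddCommGroup E] (a b : ℝ) (h : Side → ℝ → E) : ℝ :=
  sSup {x | ∃ σ : Side, ∃ r ∈ σ.interval a b, x = ‖h σ r‖}

/-! ### The gas law -/

/-- The pressure law `p(ρ) = ρ ^ γ / γ`. -/
def pressure (γ ρ : ℝ) : ℝ := ρ ^ γ / γ

/-- The sound speed `c`, with `c² = p'(ρ)`. -/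
def soundSpeed (γ ρ : ℝ) : ℝ := Real.sqrt (deriv (pressure γ) ρ)

/-! ### The front and the straightening -/

/-- The front `φ(t) = b + ∫₀ᵗ u₋(s, b) ds`. -/
def front (b : ℝ) (U : Field) (t : ℝ) : ℝ :=
  b + ∫ s in (0 : ℝ)..t, U Side.minus (s, b) 1

/-- The straightening `Φ(t, r) = a + (φ(t) - a) / (b - a) * (r - a)`; it maps `r = b` to the
front. -/
def straighten (a b : ℝ) (U : Field) (t r : ℝ) : ℝ :=
  a + (front b U t - a) / (b - a) * (r - a)

/-- The derivative `Φ_r`. -/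
def straightenR (a b : ℝ) (U : Field) (t : ℝ) : ℝ :=
  (front b U t - a) / (b - a)

/-- The derivative `Φ_t`; recall `φ'(t) = u₋(t, b)`. -/
def straightenT (a b : ℝ) (U : Field) (t r : ℝ) : ℝ :=
  U Side.minus (t, b) 1 / (b - a) * (r - a)

theorem hasDerivAt_straighten_r (a b : ℝ) (U : Field) (t r : ℝ) :
    HasDerivAt (fun x => straighten a b U t x) (straightenR a b U t) r := by
  unfold straighten straightenR
  simpa using (((hasDerivAt_id r).sub_const a).const_mul ((front b U t - a) / (b - a))).const_add a

theorem hasDerivWithinAt_straighten_t (a b T : ℝ) (U : Field)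
    (hU : ContinuousOn (fun s => U Side.minus (s, b) 1) (Icc 0 T)) (t r : ℝ)
    (ht : t ∈ Icc 0 T) :
    HasDerivWithinAt (fun s => straighten a b U s r) (straightenT a b U t r) (Icc 0 T) t := by
  have hφ : HasDerivWithinAt (front b U) (U Side.minus (t, b) 1) (Icc 0 T) t := by
    unfold front
    have : Fact (t ∈ Icc 0 T) := ⟨ht⟩
    have hc : ContinuousOn (fun s => U Side.minus (s, b) 1) (uIcc 0 t) :=
      hU.mono (by rw [uIcc_of_le ht.1]; exact Icc_subset_Icc_right ht.2)
    exact (intervalIntegral.integral_hasDerivWithinAt_right hc.intervalIntegrable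
      (hU.stronglyMeasurableAtFilter_nhdsWithin measurableSet_Icc t) (hU t ht)).const_add b
  unfold straighten straightenT
  exact (((hφ.sub_const a).div_const (b - a)).mul_const (r - a)).const_add a

/-- The gradient of `g` with respect to the original (not straightened) variables: if
`g(t, r) = G(t, Φ(t, r))`, this is the pair `(∂_t G, ∂_R G)` evaluated at `(t, Φ(t, r))`, that is
`(∂_t g - (Φ_t / Φ_r) ∂_r g, (1 / Φ_r) ∂_r g)`. -/
def grad (a b T : ℝ) (U : Field) (g : Field) (σ : Side) (p : ℝ × ℝ) : State × State :=
  (dt (slab a b T σ) (g σ) p -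
      (straightenT a b U p.1 p.2 / straightenR a b U p.1) • dr (slab a b T σ) (g σ) p,
    (1 / straightenR a b U p.1) • dr (slab a b T σ) (g σ) p)

/-! ### The coefficients -/

/-- The matrix `B(U, φ)`. -/
def matB (γ a b : ℝ) (U : Field) (σ : Side) (p : ℝ × ℝ) : Matrix (Fin 3) (Fin 3) ℝ :=
  (1 / straightenR a b U p.1) •
    !![U σ p 1 - straightenT a b U p.1 p.2, U σ p 0, 0;
       soundSpeed γ (U σ p 0) ^ 2 / U σ p 0, U σ p 1 - straightenT a b U p.1 p.2, 0;
       0, 0, U σ p 1 - straightenT a b U p.1 p.2]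

/-- The diagonal matrix `Λ(U, φ)` of the eigenvalues of `B(U, φ)`. -/
def matLambda (γ a b : ℝ) (U : Field) (σ : Side) (p : ℝ × ℝ) : Matrix (Fin 3) (Fin 3) ℝ :=
  Matrix.diagonal
    ![(U σ p 1 - straightenT a b U p.1 p.2 - soundSpeed γ (U σ p 0)) / straightenR a b U p.1,
      (U σ p 1 - straightenT a b U p.1 p.2) / straightenR a b U p.1,
      (U σ p 1 - straightenT a b U p.1 p.2 + soundSpeed γ (U σ p 0)) / straightenR a b U p.1]

/-- The matrix `R` whose columns are the right eigenvectors
`(ρ, -c, 0)`, `(0, 0, 1)`, `(ρ, c, 0)`. -/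
def matR (γ : ℝ) (V : State) : Matrix (Fin 3) (Fin 3) ℝ :=
  !![V 0, 0, V 0;
     -soundSpeed γ (V 0), 0, soundSpeed γ (V 0);
     0, 1, 0]

/-- The inverse of `R`. -/
def matRInv (γ : ℝ) (V : State) : Matrix (Fin 3) (Fin 3) ℝ :=
  (1 / (2 * V 0 * soundSpeed γ (V 0))) •
    !![soundSpeed γ (V 0), -V 0, 0;
       0, 0, 2 * V 0 * soundSpeed γ (V 0);
       soundSpeed γ (V 0), V 0, 0]

/-- The matrix `m = (∂_t R⁻¹ + Λ ∂_r R⁻¹) R`, the zeroth-order coefficient of the diagonalized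
system. -/
def matM (γ a b T : ℝ) (U : Field) (σ : Side) (p : ℝ × ℝ) : Matrix (Fin 3) (Fin 3) ℝ :=
  (Matrix.of (fun i j => dt (slab a b T σ) (fun q => matRInv γ (U σ q) i j) p) +
    matLambda γ a b U σ p *
      Matrix.of (fun i j => dr (slab a b T σ) (fun q => matRInv γ (U σ q) i j) p)) *
    matR γ (U σ p)

/-! ### Function classes -/

/-- `g` is `C¹` on each side up to the boundary, and `g` and its gradient (in the original
variables) are bounded by `K`. -/
structure BoundedC1 (a b T : ℝ) (U g : Field) (K : ℝ) : Prop where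
  contDiffOn : ∀ σ, ContDiffOn ℝ 1 (g σ) (slab a b T σ)
  bound : ∀ σ, ∀ p ∈ slab a b T σ, ‖g σ p‖ ≤ K
  grad_bound : ∀ σ, ∀ p ∈ slab a b T σ, ‖grad a b T U g σ p‖ ≤ K

/-- A pair of initial functions, `C¹` on each side up to the boundary, bounded by `K` together
with its derivative. -/
structure BoundedInitialC1 (a b : ℝ) (w₀ : InitialField) (K : ℝ) : Prop where
  contDiffOn : ∀ σ, ContDiffOn ℝ 1 (w₀ σ) (σ.interval a b)
  bound : ∀ σ, ∀ r ∈ σ.interval a b, ‖w₀ σ r‖ ≤ K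
  deriv_bound : ∀ σ, ∀ r ∈ σ.interval a b, ‖derivWithin (w₀ σ) (σ.interval a b) r‖ ≤ K

/-- The states around which one linearizes: bounded in `C¹` by `K`, density at least `δ`,
satisfying the wall condition `u₋ = 0` and the vortex-sheet conditions `ρ₊ = ρ₋`, `u₊ = u₋`, and
whose front stays at distance at least `δ` from the wall `r = a`. -/
structure IsBackground (a b T : ℝ) (U : Field) (K δ : ℝ) : Prop where
  boundedC1 : BoundedC1 a b T U U K
  density : ∀ σ, ∀ p ∈ slab a b T σ, δ ≤ U σ p 0
  wall : ∀ t ∈ Icc 0 T, U Side.minus (t, a) 1 = 0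
  sheet_density : ∀ t ∈ Icc 0 T, U Side.plus (t, b) 0 = U Side.minus (t, b) 0
  sheet_velocity : ∀ t ∈ Icc 0 T, U Side.plus (t, b) 1 = U Side.minus (t, b) 1
  front_away : ∀ t ∈ Icc 0 T, a + δ ≤ front b U t

/-! ### The linearized problem -/

/-- The value of `∂_t w` at `t = 0` prescribed by the equation:
`f(0, r) - B(U(0, r), φ(0)) ∂_r w₀(r)`. -/
def initialTimeDeriv (γ a b : ℝ) (U f : Field) (w₀ : InitialField) (σ : Side) (r : ℝ) : State :=
  f σ (0, r) - (matB γ a b U σ (0, r)).mulVec (derivWithin (w₀ σ) (σ.interval a b) r)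

/-- The homogeneous conditions at the front and at the wall, for a pair of functions of `r`. -/
structure BoundaryConditions (a b : ℝ) (h : InitialField) : Prop where
  sheet_fst : h Side.plus b 0 = h Side.minus b 0
  sheet_snd : h Side.plus b 1 = h Side.minus b 1
  wall : h Side.minus a 1 = 0

/-- The compatibility conditions of order zero and of order one. -/
structure Compatible (γ a b : ℝ) (U f : Field) (w₀ : InitialField) : Prop where
  order_zero : BoundaryConditions a b w₀
  order_one : BoundaryConditions a b (initialTimeDeriv γ a b U f w₀)

/-- `w` is a piecewise `C¹` solution of the linearized problem on `[0, T]`. -/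
structure IsSolution (γ a b T : ℝ) (U f : Field) (w₀ : InitialField) (w : Field) : Prop where
  contDiffOn : ∀ σ, ContDiffOn ℝ 1 (w σ) (slab a b T σ)
  equation : ∀ σ, ∀ p ∈ slab a b T σ,
    dt (slab a b T σ) (w σ) p + (matB γ a b U σ p).mulVec (dr (slab a b T σ) (w σ) p) = f σ p
  boundary : ∀ t ∈ Icc 0 T, BoundaryConditions a b (fun σ r => w σ (t, r))
  initial : ∀ σ, ∀ r ∈ σ.interval a b, w σ (0, r) = w₀ σ r

end VortexSheet

end

/-! Put λ = (u - Φ_t)/Φ_r, κ = c/Φ_r and θ = ½ log(ρ/c). The off-diagonal entries of B are then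
κe^{2θ} and κe^{-2θ}: the third component of w is transported with speed λ, and the first two form
an acoustic system. Since λ vanishes at the wall and on both sides of the front, the third component
needs no boundary condition and is treated on each side separately (`exists_transport`,
`abs_le_of_transport`).

The Riemann invariants p, q = (e^{-θ}w₁ ∓ e^{θ}w₂)/2 travel with the speeds λ ∓ κ and are coupled
only through the derivatives of θ along these waves. The boundary conditions say that p and q are
continuous at the front and that p = q at the wall. Hence the function Y that equals p at a + x for
x > 0 and q at a - x for x < 0 is continuous on the whole line, and the boundary conditions
disappear: Y_t + μY_x = G - ϑm·Ỹ with Ỹ(t,x) = Y(t,-x). The unfolded speed μ is continuous and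
equals -κ ≠ 0 at the three breaks 0 and ±(b - a), so a characteristic meets the breaks only
countably often, and jumps of the coefficients there do not disturb integrals along characteristics.

The background is only C¹, so ϑm, already a derivative of θ, cannot be differentiated. But ϑm = Dϑ
with D = ∂_t + μ∂_x, and an integration by parts along characteristics
(`hasDerivAt_integral_along_mul`) shows that V = Y_x + ϑ_x Ỹ satisfies DV + μ_x V = G_x + ϑ_x G̃ +
ϑm(t,-x) Ṽ, in which only first derivatives occur. This V is the Riemann invariant formed from ∂_r
w, and its initial value is continuous when the radial derivatives of the data match. Picard
iteration for Y and V together gives a C¹ solution (`ReflectedData.exists_solution`); Grönwall's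
inequality for V bounds ∂_r w without involving w itself, as (2.16) requires.

If f jumps at the front, ∂_r w jumps as well. A primitive in r of a multiple of the jumping part of
f is subtracted first (`exists_lift`); for the rest, compatibility of order one is the matching of
radial derivatives (`exists_isAcousticSolution_of_compatible`).

The coefficients λ and Φ_t may grow linearly in r, but ∂_t + λ∂_r is the material derivative in the
original variables and is therefore controlled by the gradient (`along_eq_grad`). Grönwall's
inequality is applied on compact cones, so it needs no prior bound on the solution and also yields
uniqueness. Finally C may depend on T₀: all growth is absorbed in C, and the exponential weights in
(2.13) and (2.16), having nonnegative rates, only enlarge the right-hand sides. -/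

namespace VortexSheet
open Filter Topology MeasureTheory

/-! ### Flows of scalar Lipschitz fields -/

/-- A differential inequality `|g'| ≤ c g` controls `g` in both time directions. -/
theorem le_mul_exp_of_abs_deriv_le {T c : ℝ} {g g' : ℝ → ℝ} (hg : ContinuousOn g (Icc 0 T))
    (hd : ∀ s ∈ Ioo 0 T, HasDerivAt g (g' s) s) (hb : ∀ s ∈ Ioo 0 T, |g' s| ≤ c * g s)
    {s t : ℝ} (hs : s ∈ Icc 0 T) (ht : t ∈ Icc 0 T) :
    g s ≤ g t * Real.exp (c * |s - t|) := by
  have hexp : ∀ k s : ℝ, HasDerivAt (fun s => Real.exp (k * s)) (Real.exp (k * s) * k) s :=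
    fun k s => by simpa using ((hasDerivAt_id s).const_mul k).exp
  have key : ∀ k : ℝ, ∀ s ∈ Ioo 0 T, HasDerivAt (fun s => g s * Real.exp (k * s))
      ((g' s + k * g s) * Real.exp (k * s)) s := fun k s hs =>
    ((hd s hs).mul (hexp k s)).congr_deriv (by ring)
  have hc : ∀ k : ℝ, ContinuousOn (fun s => g s * Real.exp (k * s)) (Icc 0 T) := fun k =>
    hg.mul (by fun_prop)
  rcases le_total s t with h | h
  · have hm : MonotoneOn (fun s => g s * Real.exp (c * s)) (Icc 0 T) := by
      apply monotoneOn_of_deriv_nonneg (convex_Icc 0 T) (hc c)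
      · rw [interior_Icc]
        exact fun s hs => (key c s hs).differentiableAt.differentiableWithinAt
      · rw [interior_Icc]
        intro s hs
        rw [(key c s hs).deriv]
        have := (abs_le.1 (hb s hs)).1
        exact mul_nonneg (by linarith) (Real.exp_pos _).le
    have := hm hs ht h
    rw [abs_of_nonpos (by linarith), show c * -(s - t) = c * t - c * s by ring, Real.exp_sub,
      mul_div_assoc', le_div_iff₀ (Real.exp_pos _)]
    exact this
  · have hm : AntitoneOn (fun s => g s * Real.exp ((-c) * s)) (Icc 0 T) := by
      apply antitoneOn_of_deriv_nonpos (convex_Icc 0 T) (hc (-c))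
      · rw [interior_Icc]
        exact fun s hs => (key (-c) s hs).differentiableAt.differentiableWithinAt
      · rw [interior_Icc]
        intro s hs
        rw [(key (-c) s hs).deriv]
        have := (abs_le.1 (hb s hs)).2
        exact mul_nonpos_of_nonpos_of_nonneg (by linarith) (Real.exp_pos _).le
    have := hm ht hs h
    rw [abs_of_nonneg (by linarith), show c * (s - t) = (-c) * t - (-c) * s by ring, Real.exp_sub,
      mul_div_assoc', le_div_iff₀ (Real.exp_pos _)]
    exact this

/-- `X t x s` is the position at time `s` of the integral curve of `μ` that is at `x` at time
`t`, for `s, t ∈ [0, T]`. -/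
structure IsFlow (T : ℝ) (μ : ℝ → ℝ → ℝ) (X : ℝ → ℝ → ℝ → ℝ) : Prop where
  continuous : Continuous fun p : ℝ × ℝ × ℝ => X p.1 p.2.1 p.2.2
  initial : ∀ t ∈ Icc 0 T, ∀ x, X t x t = x
  hasDerivAt : ∀ t ∈ Icc 0 T, ∀ x, ∀ s ∈ Ioo 0 T, HasDerivAt (X t x) (μ s (X t x s)) s

/-- Grönwall's inequality is applied to the squared distance, which is differentiable even where the
distance is not; its rate 2L is halved by the square root. -/
theorem abs_sub_le_of_trajectories {T L : ℝ} {μ : ℝ → ℝ → ℝ}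
    (hμ : ∀ t x y, |μ t x - μ t y| ≤ L * |x - y|) {x y : ℝ → ℝ}
    (hx : ContinuousOn x (Icc 0 T)) (hy : ContinuousOn y (Icc 0 T))
    (hx' : ∀ s ∈ Ioo 0 T, HasDerivAt x (μ s (x s)) s)
    (hy' : ∀ s ∈ Ioo 0 T, HasDerivAt y (μ s (y s)) s)
    {s t : ℝ} (hs : s ∈ Icc 0 T) (ht : t ∈ Icc 0 T) :
    |x s - y s| ≤ |x t - y t| * Real.exp (L * |s - t|) := by
  have h := le_mul_exp_of_abs_deriv_le (T := T) (c := 2 * L) (g := fun s => (x s - y s) ^ 2)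
    ((hx.sub hy).pow 2) (fun s hs => ((hx' s hs).sub (hy' s hs)).pow 2) (fun s _ => by
      have h1 := hμ s (x s) (y s)
      simp only [Nat.cast_ofNat, Nat.add_one_sub_one, pow_one, abs_mul, Pi.sub_apply]
      rw [← sq_abs (x s - y s), abs_of_pos (by norm_num : (0 : ℝ) < 2)]
      nlinarith [abs_nonneg (x s - y s)]) hs ht
  apply abs_le_of_sq_le_sq' _ (by positivity) |> abs_le.2
  rw [mul_pow, sq_abs, ← Real.exp_nat_mul]
  have e : ((2 : ℕ) : ℝ) * (L * |s - t|) = 2 * L * |s - t| := by push_cast; ring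
  rw [e]
  exact h

/-- A globally Lipschitz field grows at most linearly. Truncating the space argument to [-N, N]
makes the field bounded, so one application of Picard–Lindelöf covers all of [0, T]; the growth
bound then shows that the truncation is never felt. -/
theorem exists_trajectory {T L : ℝ} (hT : 0 < T) (hL : 0 ≤ L) {μ : ℝ → ℝ → ℝ}
    (hc : Continuous (Function.uncurry μ)) (hμ : ∀ t x y, |μ t x - μ t y| ≤ L * |x - y|)
    {t : ℝ} (ht : t ∈ Icc 0 T) (x : ℝ) :
    ∃ α : ℝ → ℝ, α t = x ∧ ContinuousOn α (Icc 0 T) ∧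
      ∀ s ∈ Ioo 0 T, HasDerivAt α (μ s (α s)) s := by
  obtain ⟨A, hA⟩ : ∃ A, ∀ s ∈ Icc 0 T, |μ s 0| ≤ A := by
    have : Continuous fun s => μ s 0 := hc.comp (by fun_prop : Continuous fun s : ℝ => (s, (0 : ℝ)))
    exact isCompact_Icc.exists_bound_of_continuousOn this.continuousOn
  have hA0 : 0 ≤ A := (abs_nonneg _).trans (hA t ht)
  have hgrow : ∀ s ∈ Icc 0 T, ∀ y, |μ s y| ≤ A + L * |y| := fun s hs y => by
    have h1 := hμ s y 0
    have h2 := hA s hs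
    rw [sub_zero] at h1
    have h3 : |μ s y| ≤ |μ s y - μ s 0| + |μ s 0| := by
      have := abs_add_le (μ s y - μ s 0) (μ s 0); simpa using this
    linarith
  -- From |μ s y| ≤ A + L|y| the quantity α² + 1 grows at rate at most A + 2L, and |α| ≤ α² + 1.
  -- Hence N bounds the trajectory on [0, T].
  set N : ℝ := (x ^ 2 + 1) * Real.exp ((A + 2 * L) * T) with hN
  have hN0 : 0 ≤ N := by positivity
  have hclamp : ∀ y : ℝ, |max (-N) (min N y)| ≤ N := fun y =>
    abs_le.2 ⟨le_max_left _ _, max_le (by linarith) (min_le_left _ _)⟩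
  have hclamp' : ∀ y : ℝ, |max (-N) (min N y)| ≤ |y| := fun y => by
    rcases abs_cases y with ⟨h, _⟩ | ⟨h, _⟩ <;> rw [h] <;> apply abs_le.2 <;> constructor
    · rcases le_total N y with h1 | h1
      · rw [min_eq_left h1]; apply le_max_of_le_right; linarith
      · rw [min_eq_right h1]; apply le_max_of_le_right; linarith
    · exact max_le (by linarith) (min_le_right _ _)
    · rw [min_eq_right (by linarith)]; apply le_max_of_le_right; linarith
    · exact max_le (by linarith [min_le_right N y]) (by linarith [min_le_right N y])
  have hclL : ∀ y z : ℝ, |max (-N) (min N y) - max (-N) (min N z)| ≤ |y - z| := fun y z => by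
    have h1 := abs_max_sub_max_le_abs (min N y) (min N z) (-N)
    have h2 := abs_min_sub_min_le_max N y N z
    rw [max_comm (-N), max_comm (-N)]
    refine h1.trans (h2.trans ?_)
    simp
  let ν : ℝ → ℝ → ℝ := fun s y => μ s (max (-N) (min N y))
  -- The radius is the maximal speed times T, so the local existence theorem reaches the ends of the
  -- interval.
  have hPL : IsPicardLindelof (tmin := 0) (tmax := T) ν ⟨t, ht⟩ x
      ((A + L * N).toNNReal * T.toNNReal) 0 (A + L * N).toNNReal L.toNNReal :=
    { lipschitzOnWith := fun s _ => LipschitzOnWith.of_dist_le_mul fun y _ z _ => by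
        rw [Real.dist_eq, Real.dist_eq, Real.coe_toNNReal _ hL]
        exact (hμ _ _ _).trans (mul_le_mul_of_nonneg_left (hclL _ _) hL)
      continuousOn := fun y _ =>
        (hc.comp (by fun_prop : Continuous fun s : ℝ => (s, max (-N) (min N y)))).continuousOn
      norm_le := fun s hs y _ => by
        rw [Real.coe_toNNReal _ (by positivity)]
        exact (hgrow s hs _).trans (add_le_add_right (mul_le_mul_of_nonneg_left (hclamp y) hL) A)
      mul_max_le := by
        rw [NNReal.coe_mul, Real.coe_toNNReal _ hT.le, NNReal.coe_zero, sub_zero, sub_zero]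
        have : max (T - t) t ≤ T := max_le (by linarith [ht.1]) (by linarith [ht.2])
        exact mul_le_mul_of_nonneg_left this (NNReal.coe_nonneg _) }
  obtain ⟨α, h0, hα⟩ := hPL.exists_eq_forall_mem_Icc_hasDerivWithinAt₀
  have hαc : ContinuousOn α (Icc 0 T) := fun s hs => (hα s hs).continuousWithinAt
  have hαd : ∀ s ∈ Ioo 0 T, HasDerivAt α (ν s (α s)) s := fun s hs =>
    (hα s (Ioo_subset_Icc_self hs)).hasDerivAt (Icc_mem_nhds hs.1 hs.2)
  have hbound : ∀ s ∈ Icc 0 T, |α s| ≤ N := fun s hs => by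
    have h := le_mul_exp_of_abs_deriv_le (T := T) (c := A + 2 * L) (g := fun s => α s ^ 2 + 1)
      ((hαc.pow 2).add continuousOn_const) (fun s hs => ((hαd s hs).pow 2).add_const 1)
      (fun s hs => by
        have h1 : |ν s (α s)| ≤ A + L * |α s| :=
          (hgrow s (Ioo_subset_Icc_self hs) _).trans
            (add_le_add_right (mul_le_mul_of_nonneg_left (hclamp' _) hL) A)
        simp only [Nat.cast_ofNat, Nat.add_one_sub_one, pow_one, abs_mul]
        rw [← sq_abs (α s), abs_of_pos (by norm_num : (0 : ℝ) < 2)]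
        have h2 := abs_nonneg (α s)
        have h3 : 2 * |α s| * |ν s (α s)| ≤ 2 * |α s| * (A + L * |α s|) := by gcongr
        nlinarith [mul_nonneg hA0 (sq_nonneg (|α s| - 1)), mul_nonneg hL (sq_nonneg (|α s|))])
      hs ht
    simp only at h0
    rw [h0] at h
    have h4 : |s - t| ≤ T := abs_le.2 ⟨by linarith [hs.1, ht.2], by linarith [hs.2, ht.1]⟩
    have h5 : Real.exp ((A + 2 * L) * |s - t|) ≤ Real.exp ((A + 2 * L) * T) := by gcongr
    have h6 : α s ^ 2 + 1 ≤ N := h.trans (by rw [hN]; gcongr)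
    have h7 : |α s| ≤ α s ^ 2 + 1 := by
      rw [← sq_abs]; nlinarith [sq_nonneg (|α s| - 1), abs_nonneg (α s)]
    linarith
  refine ⟨α, h0, hαc, fun s hs => ?_⟩
  have h := hαd s hs
  have h1 := abs_le.1 (hbound s (Ioo_subset_Icc_self hs))
  have h2 : max (-N) (min N (α s)) = α s := by rw [min_eq_right h1.2, max_eq_right h1.1]
  simp only [ν, h2] at h
  exact h

/-- Global existence of the flow of a continuous field which is Lipschitz in space. -/
theorem exists_isFlow {T L : ℝ} (hT : 0 < T) (hL : 0 ≤ L) {μ : ℝ → ℝ → ℝ}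
    (hc : Continuous (Function.uncurry μ)) (hμ : ∀ t x y, |μ t x - μ t y| ≤ L * |x - y|) :
    ∃ X, IsFlow T μ X := by
  have hex : ∀ t : Icc 0 T, ∀ x : ℝ, ∃ α : ℝ → ℝ, α t = x ∧ ContinuousOn α (Icc 0 T) ∧
      ∀ s ∈ Ioo 0 T, HasDerivAt α (μ s (α s)) s := fun t x => exists_trajectory hT hL hc hμ t.2 x
  choose Y hY0 hYc hYd using hex
  let P : ℝ → Icc 0 T := projIcc 0 T hT.le
  have hP : Continuous P := continuous_projIcc
  -- Both times are projected to [0, T], which makes the flow continuous on the whole space.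
  refine ⟨fun t x s => Y (P t) x (P s), ?_, fun t ht x => ?_, fun t ht x s hs => ?_⟩
  · rw [continuous_iff_continuousAt]
    rintro ⟨t₀, x₀, s₀⟩
    have hcl : Continuous fun s => Y (P t₀) x₀ (P s) := by
      exact (hYc (P t₀) x₀).comp_continuous (continuous_subtype_val.comp hP) fun s => (P s).2
    have hT1 : Tendsto (fun p : ℝ × ℝ × ℝ => Y (P t₀) x₀ (P p.2.2)) (𝓝 (t₀, x₀, s₀))
        (𝓝 (Y (P t₀) x₀ (P s₀))) :=
      (hcl.comp (by fun_prop : Continuous fun p : ℝ × ℝ × ℝ => p.2.2)).tendsto (t₀, x₀, s₀)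
    have hT2 : Tendsto (fun p : ℝ × ℝ × ℝ => |p.2.1 - Y (P t₀) x₀ (P p.1)| * Real.exp (L * T))
        (𝓝 (t₀, x₀, s₀)) (𝓝 0) := by
      have : Continuous fun p : ℝ × ℝ × ℝ => |p.2.1 - Y (P t₀) x₀ (P p.1)| * Real.exp (L * T) :=
        (((by fun_prop : Continuous fun p : ℝ × ℝ × ℝ => p.2.1).sub
          (hcl.comp (by fun_prop : Continuous fun p : ℝ × ℝ × ℝ => p.1))).abs).mul
          continuous_const
      have h := this.tendsto (t₀, x₀, s₀)
      simpa [hY0] using h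
    -- The two curves are compared at the starting time of the nearby one, where its position is
    -- prescribed; the Lipschitz bound carries their distance to all other times.
    have hT3 : Tendsto (fun p : ℝ × ℝ × ℝ => Y (P p.1) p.2.1 (P p.2.2) - Y (P t₀) x₀ (P p.2.2))
        (𝓝 (t₀, x₀, s₀)) (𝓝 0) := by
      refine squeeze_zero_norm (fun p => ?_) hT2
      have := abs_sub_le_of_trajectories hμ (hYc (P p.1) p.2.1) (hYc (P t₀) x₀)
        (hYd (P p.1) p.2.1) (hYd (P t₀) x₀) (P p.2.2).2 (P p.1).2
      rw [hY0] at this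
      refine this.trans ?_
      gcongr
      exact abs_le.2 ⟨by linarith [(P p.2.2).2.1, (P p.1).2.2],
        by linarith [(P p.2.2).2.2, (P p.1).2.1]⟩
    have := hT3.add hT1
    simpa [ContinuousAt] using this
  · have h : P t = ⟨t, ht⟩ := projIcc_of_mem hT.le ht
    simpa [h] using hY0 ⟨t, ht⟩ x
  · have h1 := hYd (P t) x s hs
    have h2 : ∀ r ∈ Icc 0 T, ((P r : Icc 0 T) : ℝ) = r := fun r hr => by
      simp only [P]; rw [projIcc_of_mem hT.le hr]
    simp only [h2 s (Ioo_subset_Icc_self hs)]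
    refine h1.congr_of_eventuallyEq ?_
    filter_upwards [Ioo_mem_nhds hs.1 hs.2] with r hr
    simp only [h2 r (Ioo_subset_Icc_self hr)]

namespace IsFlow

variable {T L : ℝ} {μ : ℝ → ℝ → ℝ} {X : ℝ → ℝ → ℝ → ℝ}

theorem continuous_curve (hX : IsFlow T μ X) (t x : ℝ) : Continuous (X t x) :=
  hX.continuous.comp (by fun_prop : Continuous fun s : ℝ => (t, x, s))

theorem abs_sub_le (hX : IsFlow T μ X) (hμ : ∀ t x y, |μ t x - μ t y| ≤ L * |x - y|)
    {t s r : ℝ} (ht : t ∈ Icc 0 T) (hr : r ∈ Icc 0 T) (hs : s ∈ Icc 0 T) {q : ℝ}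
    (hq : q ∈ Icc 0 T) (x y : ℝ) :
    |X t x s - X r y s| ≤ |X t x q - X r y q| * Real.exp (L * |s - q|) :=
  abs_sub_le_of_trajectories hμ (hX.continuous_curve t x).continuousOn
    (hX.continuous_curve r y).continuousOn (hX.hasDerivAt t ht x) (hX.hasDerivAt r hr y) hs hq

theorem eq_of_eq (hX : IsFlow T μ X) (hμ : ∀ t x y, |μ t x - μ t y| ≤ L * |x - y|)
    {t s r : ℝ} (ht : t ∈ Icc 0 T) (hr : r ∈ Icc 0 T) (hs : s ∈ Icc 0 T) {q : ℝ}
    (hq : q ∈ Icc 0 T) {x y : ℝ} (h : X t x q = X r y q) : X t x s = X r y s := by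
  have := hX.abs_sub_le hμ ht hr hs hq x y
  rw [h, sub_self, abs_zero, zero_mul] at this
  exact sub_eq_zero.1 (abs_eq_zero.1 (le_antisymm this (abs_nonneg _)))

theorem comp (hX : IsFlow T μ X) (hμ : ∀ t x y, |μ t x - μ t y| ≤ L * |x - y|)
    {t s r : ℝ} (ht : t ∈ Icc 0 T) (hr : r ∈ Icc 0 T) (hs : s ∈ Icc 0 T) (x : ℝ) :
    X s (X t x s) r = X t x r :=
  hX.eq_of_eq hμ hs ht hr hs (hX.initial s hs _)

theorem abs_sub_le_exp (hX : IsFlow T μ X) (hL : 0 ≤ L)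
    (hμ : ∀ t x y, |μ t x - μ t y| ≤ L * |x - y|)
    {t s : ℝ} (ht : t ∈ Icc 0 T) (hs : s ∈ Icc 0 T) (x y : ℝ) :
    |X t x s - X t y s| ≤ |x - y| * Real.exp (L * T) := by
  have := hX.abs_sub_le hμ ht ht hs ht x y
  rw [hX.initial t ht, hX.initial t ht] at this
  refine this.trans ?_
  gcongr
  exact abs_le.2 ⟨by linarith [hs.1, ht.2], by linarith [hs.2, ht.1]⟩

theorem injective (hX : IsFlow T μ X) (hμ : ∀ t x y, |μ t x - μ t y| ≤ L * |x - y|)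
    {t s : ℝ} (ht : t ∈ Icc 0 T) (hs : s ∈ Icc 0 T) : Function.Injective fun x => X t x s :=
  fun x y h => by
    have := hX.eq_of_eq hμ ht ht ht hs h
    rwa [hX.initial t ht, hX.initial t ht] at this

/-- The curves meet a level at which the field does not vanish only countably often. -/
theorem countable_meet (hX : IsFlow T μ X) {t : ℝ} (ht : t ∈ Icc 0 T) (x e : ℝ)
    (he : ∀ s, μ s e ≠ 0) : {s | s ∈ Ioo 0 T ∧ X t x s = e}.Countable := by
  set S := {s | s ∈ Ioo 0 T ∧ X t x s = e}
  -- The curve passes the level with nonzero speed, so the meeting times are isolated, and a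
  -- discrete subspace of the line is countable.
  have : DiscreteTopology S := by
    rw [discreteTopology_subtype_iff]
    intro s hs
    have h := hX.hasDerivAt t ht x s hs.1
    have h1 := h.eventually_ne (c := e) (by rw [hs.2]; exact he s)
    rw [← _root_.disjoint_iff, Filter.disjoint_principal_right]
    filter_upwards [h1] with r hr hrS using hr hrS.2
  exact Set.countable_coe_iff.1 (countable_of_Lindelof_of_discrete)

end IsFlow
end VortexSheet

namespace VortexSheet
open Filter Topology MeasureTheory

/-! ### Functions with jumps along `x ∈ E` -/

/-- Truncation of the time variable to `[0, T]`. -/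
noncomputable def clampTime (T t : ℝ) : ℝ := max 0 (min t T)

theorem continuous_clampTime (T : ℝ) : Continuous (clampTime T) := by
  unfold clampTime; fun_prop

theorem clampTime_mem {T : ℝ} (hT : 0 ≤ T) (t : ℝ) : clampTime T t ∈ Icc 0 T :=
  ⟨le_max_left _ _, max_le hT (min_le_right _ _)⟩

theorem clampTime_of_mem {T t : ℝ} (ht : t ∈ Icc 0 T) : clampTime T t = t := by
  unfold clampTime; rw [min_eq_left ht.2, max_eq_right ht.1]

theorem clampTime_eventuallyEq {T t : ℝ} (ht : t ∈ Ioo 0 T) : clampTime T =ᶠ[𝓝 t] id := by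
  filter_upwards [Ioo_mem_nhds ht.1 ht.2] with s hs
  exact clampTime_of_mem (Ioo_subset_Icc_self hs)

/-- `B` is bounded by `C`, and continuous except possibly where `x ∈ E`. -/
structure BddContOff (E : Set ℝ) (C : ℝ) (B : ℝ → ℝ → ℝ) : Prop where
  continuousOn : ContinuousOn (Function.uncurry B) (univ ×ˢ Eᶜ)
  bound : ∀ t x, |B t x| ≤ C

namespace BddContOff

variable {E : Set ℝ} {C C' : ℝ} {A B : ℝ → ℝ → ℝ}

theorem continuousAt (hB : BddContOff E C B) (hE : IsClosed E) {t x : ℝ} (hx : x ∉ E) :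
    ContinuousAt (Function.uncurry B) (t, x) :=
  hB.continuousOn.continuousAt ((isOpen_univ.prod hE.isOpen_compl).mem_nhds ⟨mem_univ _, hx⟩)

theorem mono (hB : BddContOff E C B) (h : C ≤ C') : BddContOff E C' B :=
  ⟨hB.continuousOn, fun t x => (hB.bound t x).trans h⟩

theorem of_continuous (hB : Continuous (Function.uncurry B)) (h : ∀ t x, |B t x| ≤ C) :
    BddContOff E C B := ⟨hB.continuousOn, h⟩

theorem add (hA : BddContOff E C A) (hB : BddContOff E C' B) :
    BddContOff E (C + C') fun t x => A t x + B t x :=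
  ⟨hA.continuousOn.add hB.continuousOn, fun t x =>
    (abs_add_le _ _).trans (add_le_add (hA.bound t x) (hB.bound t x))⟩

theorem sub (hA : BddContOff E C A) (hB : BddContOff E C' B) :
    BddContOff E (C + C') fun t x => A t x - B t x :=
  ⟨hA.continuousOn.sub hB.continuousOn, fun t x =>
    (abs_sub _ _).trans (add_le_add (hA.bound t x) (hB.bound t x))⟩

theorem neg (hA : BddContOff E C A) : BddContOff E C fun t x => - A t x :=
  ⟨hA.continuousOn.neg, fun t x => by rw [abs_neg]; exact hA.bound t x⟩

theorem mul (hA : BddContOff E C A) (hB : BddContOff E C' B) :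
    BddContOff E (C * C') fun t x => A t x * B t x :=
  ⟨hA.continuousOn.mul hB.continuousOn, fun t x => by
    rw [abs_mul]
    exact mul_le_mul (hA.bound t x) (hB.bound t x) (abs_nonneg _)
      ((abs_nonneg _).trans (hA.bound t x))⟩

theorem comp_neg (hA : BddContOff E C A) (hE : ∀ x ∈ E, -x ∈ E) :
    BddContOff E C fun t x => A t (-x) :=
  ⟨hA.continuousOn.comp (f := fun p : ℝ × ℝ => (p.1, -p.2)) (by fun_prop)
    fun p hp => ⟨mem_univ _, fun h => hp.2 (by simpa using hE _ h)⟩, fun t x => hA.bound t (-x)⟩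

theorem continuousOn_slice (hB : BddContOff E C B) (t : ℝ) : ContinuousOn (B t) Eᶜ :=
  hB.continuousOn.comp (f := fun x : ℝ => (t, x)) (by fun_prop) fun _ hx => ⟨mem_univ _, hx⟩

theorem intervalIntegrable_slice (hB : BddContOff E C B) (hE : IsClosed E) (hE' : E.Countable)
    (t x y : ℝ) : IntervalIntegrable (B t) volume x y := by
  have h1 : AEStronglyMeasurable (B t) volume := by
    have := (hB.continuousOn_slice t).aestronglyMeasurable (μ := volume) hE.isOpen_compl.measurableSet
    rwa [Measure.restrict_eq_self_of_ae_mem] at this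
    exact hE'.ae_notMem volume
  refine (intervalIntegrable_const (c := C)).mono_fun h1.restrict (ae_of_all _ fun y => ?_)
  simp only [Real.norm_eq_abs]
  exact (hB.bound t y).trans (le_abs_self C)

/-- Values along a curve that is in `E` only countably often are measurable. -/
theorem aestronglyMeasurable_curve (hB : BddContOff E C B) {T : ℝ} {z : ℝ → ℝ}
    (hz : Continuous z) (hm : {s | s ∈ Ioo 0 T ∧ z s ∈ E}.Countable) :
    AEStronglyMeasurable (fun s => B s (z s)) (volume.restrict (Icc 0 T)) := by
  have h1 : volume.restrict (Ioo 0 T \ {s | s ∈ Ioo 0 T ∧ z s ∈ E}) =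
      volume.restrict (Icc (0 : ℝ) T) := by
    refine Measure.restrict_congr_set (EventuallyEq.trans ?_ Ioo_ae_eq_Icc)
    exact sdiff_null_ae_eq_self (hm.measure_zero _)
  rw [← h1]
  refine ContinuousOn.aestronglyMeasurable ?_ (measurableSet_Ioo.diff hm.measurableSet)
  exact hB.continuousOn.comp (f := fun s => (s, z s)) (by fun_prop)
    fun s hs => ⟨mem_univ _, fun h => hs.2 ⟨hs.1, h⟩⟩

theorem intervalIntegrable_curve (hB : BddContOff E C B) {T : ℝ} {z : ℝ → ℝ}
    (hz : Continuous z) (hm : {s | s ∈ Ioo 0 T ∧ z s ∈ E}.Countable) {p q : ℝ}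
    (hp : p ∈ Icc 0 T) (hq : q ∈ Icc 0 T) :
    IntervalIntegrable (fun s => B s (z s)) volume p q := by
  have h1 := hB.aestronglyMeasurable_curve hz hm
  have hsub : uIoc p q ⊆ Icc 0 T := uIoc_subset_uIcc.trans (ordConnected_Icc.uIcc_subset hp hq)
  refine (intervalIntegrable_const (c := C)).mono_fun
    (h1.mono_measure (Measure.restrict_mono hsub le_rfl)) (ae_of_all _ fun y => ?_)
  simp only [Real.norm_eq_abs]
  exact (hB.bound y _).trans (le_abs_self C)

end BddContOff

/-- Integrals of a function with jumps along curves crossing the jumps depend continuously on the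
curves. -/
theorem continuous_integral_curve {P : Type*} [TopologicalSpace P] [FirstCountableTopology P]
    {E : Set ℝ} {C Cj T : ℝ} {B : ℝ → ℝ → ℝ} (hT : 0 < T) (hE : IsClosed E)
    (hB : BddContOff E C B) {z j : P → ℝ → ℝ} (hz : Continuous (Function.uncurry z))
    (hj : ∀ p, Continuous (j p)) (hj' : ∀ s ∈ Icc 0 T, Continuous fun p => j p s)
    (hjb : ∀ p, ∀ s ∈ Icc 0 T, |j p s| ≤ Cj)
    (hm : ∀ p, {s | s ∈ Ioo 0 T ∧ z p s ∈ E}.Countable) {τ₀ τ : P → ℝ}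
    (hτ₀ : Continuous τ₀) (hτ : Continuous τ) (hτ₀m : ∀ p, τ₀ p ∈ Icc 0 T)
    (hτm : ∀ p, τ p ∈ Icc 0 T) :
    Continuous fun p => ∫ s in τ₀ p..τ p, j p s * B s (z p s) := by
  have hzp : ∀ p, Continuous (z p) := fun p => hz.comp (by fun_prop : Continuous fun s : ℝ => (p, s))
  -- Extension by zero outside [0, T] gives a family with a uniform bound, and the endpoints 0 and T
  -- become interior points of (-1, T + 1).
  let F : P → ℝ → ℝ := fun p => (Icc 0 T).indicator fun s => j p s * B s (z p s)
  have hmeas : ∀ p, AEStronglyMeasurable (fun s => j p s * B s (z p s))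
      (volume.restrict (Icc 0 T)) := fun p =>
    (hj p).aestronglyMeasurable.mul (hB.aestronglyMeasurable_curve (hzp p) (hm p))
  have hFm : ∀ p, AEStronglyMeasurable (F p) volume := fun p =>
    (aestronglyMeasurable_indicator_iff measurableSet_Icc).2 (hmeas p)
  have hC : 0 ≤ C := (abs_nonneg _).trans (hB.bound 0 0)
  have hFb : ∀ p s, |F p s| ≤ |Cj| * C := fun p s => by
    by_cases hs : s ∈ Icc 0 T
    · simp only [F, indicator_of_mem hs, abs_mul]
      exact mul_le_mul ((hjb p s hs).trans (le_abs_self _)) (hB.bound _ _) (abs_nonneg _)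
        (abs_nonneg _)
    · simp only [F, indicator_of_notMem hs, abs_zero]; positivity
  have hF0 : ∀ {σ : P → ℝ}, Continuous σ → (∀ p, σ p ∈ Icc 0 T) →
      Continuous fun p => ∫ s in (0 : ℝ)..σ p, F p s := by
    intro σ hσ hσm
    rw [continuous_iff_continuousAt]
    intro p₀
    have h := intervalIntegral.continuousAt_parametric_primitive_of_dominated (μ := volume)
      (F := F) (x₀ := p₀) (b₀ := σ p₀) (a₀ := 0) (fun _ => |Cj| * C) (-1) (T + 1)
      (fun p => (hFm p).restrict) (Eventually.of_forall fun p => ae_of_all _ fun s => by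
        rw [Real.norm_eq_abs]; exact hFb p s) intervalIntegrable_const ?_
      ⟨by norm_num, by linarith⟩ ⟨by linarith [(hσm p₀).1], by linarith [(hσm p₀).2]⟩
      (measure_singleton _)
    · exact h.comp (f := fun p => (p, σ p)) (by fun_prop)
    -- At all but countably many times the curve of the limiting parameter is off `E`, where `B` is
    -- continuous; at those times the integrand is continuous in the parameter.
    · refine ae_restrict_of_ae ?_
      have hn : ({0, T} ∪ {s | s ∈ Ioo 0 T ∧ z p₀ s ∈ E}).Countable :=
        ((countable_singleton T).insert 0).union (hm p₀)
      filter_upwards [hn.ae_notMem volume] with s hs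
      by_cases hs' : s ∈ Icc 0 T
      · simp only [F, indicator_of_mem hs']
        have h1 : s ∈ Ioo 0 T := by
          refine ⟨lt_of_le_of_ne hs'.1 fun h => hs (by simp [← h]), lt_of_le_of_ne hs'.2 fun h =>
            hs (by simp [h])⟩
        have h2 : z p₀ s ∉ E := fun h => hs (Or.inr ⟨h1, h⟩)
        refine (hj' s hs').continuousAt.mul ?_
        have h3 : ContinuousAt (fun p => (s, z p s)) p₀ :=
          (Continuous.prodMk continuous_const
            (hz.comp (by fun_prop : Continuous fun p : P => (p, s)))).continuousAt
        exact ContinuousAt.comp (f := fun p => (s, z p s)) (hB.continuousAt hE h2) h3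
      · simp only [F, indicator_of_notMem hs']
        exact continuousAt_const
  have hFi : ∀ p q r, IntervalIntegrable (F p) volume q r := fun p q r =>
    (intervalIntegrable_const (c := |Cj| * C)).mono_fun (hFm p).restrict (ae_of_all _ fun s => by
      simp only [Real.norm_eq_abs]; exact (hFb p s).trans (le_abs_self _))
  have : (fun p => ∫ s in τ₀ p..τ p, j p s * B s (z p s)) =
      fun p => (∫ s in (0 : ℝ)..τ p, F p s) - ∫ s in (0 : ℝ)..τ₀ p, F p s := by
    funext p
    rw [intervalIntegral.integral_interval_sub_left (hFi _ _ _) (hFi _ _ _)]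
    refine intervalIntegral.integral_congr fun s hs => ?_
    have := ordConnected_Icc.uIcc_subset (hτ₀m p) (hτm p) hs
    simp only [F, indicator_of_mem this]
  rw [this]
  exact (hF0 hτ hτm).sub (hF0 hτ₀ hτ₀m)

/-- A continuous function whose derivative off a countable closed set is bounded is Lipschitz. -/
theorem abs_sub_le_of_hasDerivAt_off {E : Set ℝ} (hE' : E.Countable)
    {C : ℝ} {g g' : ℝ → ℝ} (hg : Continuous g) (hd : ∀ x, x ∉ E → HasDerivAt g (g' x) x)
    (hi : ∀ x y, IntervalIntegrable g' volume x y)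
    (hb : ∀ x, |g' x| ≤ C) (x y : ℝ) : |g x - g y| ≤ C * |x - y| := by
  rw [← integral_eq_of_hasDerivAt_off_countable g g' hE' hg.continuousOn
    (fun z hz => hd z hz.2) (hi y x), ← Real.norm_eq_abs]
  exact intervalIntegral.norm_integral_le_of_norm_le_const fun z _ => hb z

/-! ### Characteristic fields -/

/-- A field `μ` that is continuous, Lipschitz in `x`, and `C¹` in `x` off the set `E`, with its flow
`X`, whose curves are in `E` only countably often. -/
structure CharField (T L : ℝ) (E : Set ℝ) (μ μx : ℝ → ℝ → ℝ) (X : ℝ → ℝ → ℝ → ℝ) : Prop where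
  pos : 0 < T
  closed : IsClosed E
  countable : E.Countable
  continuous : Continuous (Function.uncurry μ)
  hasDerivAt : ∀ t, ∀ x ∉ E, HasDerivAt (μ t) (μx t x) x
  deriv : BddContOff E L μx
  flow : IsFlow T μ X
  meet : ∀ t ∈ Icc 0 T, ∀ x, {s | s ∈ Ioo 0 T ∧ X t x s ∈ E}.Countable

/-- The derivative of the flow in the initial position. -/
noncomputable def flowDeriv (μx : ℝ → ℝ → ℝ) (X : ℝ → ℝ → ℝ → ℝ) (t x s : ℝ) : ℝ :=
  Real.exp (∫ r in t..s, μx r (X t x r))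

namespace CharField

variable {T L : ℝ} {E : Set ℝ} {μ μx : ℝ → ℝ → ℝ} {X : ℝ → ℝ → ℝ → ℝ}

theorem nonneg (h : CharField T L E μ μx X) : 0 ≤ L := (abs_nonneg _).trans (h.deriv.bound 0 0)

theorem lipschitz (h : CharField T L E μ μx X) (t x y : ℝ) : |μ t x - μ t y| ≤ L * |x - y| :=
  abs_sub_le_of_hasDerivAt_off h.countable (h.continuous.comp (by fun_prop :
    Continuous fun x : ℝ => (t, x))) (h.hasDerivAt t)
    (h.deriv.intervalIntegrable_slice h.closed h.countable t) (h.deriv.bound t) x y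

theorem flowDeriv_pos (t x s : ℝ) : 0 < flowDeriv μx X t x s := Real.exp_pos _

theorem flowDeriv_le (h : CharField T L E μ μx X) {t s : ℝ} (ht : t ∈ Icc 0 T) (hs : s ∈ Icc 0 T)
    (x : ℝ) : |flowDeriv μx X t x s| ≤ Real.exp (L * T) := by
  rw [abs_of_pos (flowDeriv_pos _ _ _)]
  refine Real.exp_le_exp.2 ((le_abs_self _).trans ?_)
  have := intervalIntegral.norm_integral_le_of_norm_le_const (a := t) (b := s) (C := L)
    (f := fun r => μx r (X t x r)) fun r _ => h.deriv.bound _ _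
  refine (Real.norm_eq_abs _ ▸ this).trans ?_
  have h1 := h.nonneg
  gcongr
  exact abs_le.2 ⟨by linarith [hs.1, ht.2], by linarith [hs.2, ht.1]⟩

theorem continuous_flowDeriv (h : CharField T L E μ μx X) :
    Continuous fun p : ℝ × ℝ × ℝ => flowDeriv μx X (clampTime T p.1) p.2.1 (clampTime T p.2.2) := by
  have hc := continuous_clampTime T
  have := continuous_integral_curve (P := ℝ × ℝ × ℝ) (Cj := 1) h.pos h.closed h.deriv
    (z := fun p r => X (clampTime T p.1) p.2.1 r) (j := fun _ _ => 1)
    (h.flow.continuous.comp (f := fun q : (ℝ × ℝ × ℝ) × ℝ => (clampTime T q.1.1, q.1.2.1, q.2))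
      (by fun_prop)) (fun _ => continuous_const) (fun _ _ => continuous_const)
    (fun _ _ _ => by simp) (fun p => h.meet _ (clampTime_mem h.pos.le _) _)
    (τ₀ := fun p => clampTime T p.1) (τ := fun p => clampTime T p.2.2)
    (by fun_prop) (by fun_prop) (fun p => clampTime_mem h.pos.le _)
    (fun p => clampTime_mem h.pos.le _)
  simp only [one_mul] at this
  exact Real.continuous_exp.comp this

theorem ae_notMem (h : CharField T L E μ μx X) {t : ℝ} (ht : t ∈ Icc 0 T) (x : ℝ) {p q : ℝ}
    (hp : p ∈ Icc 0 T) (hq : q ∈ Icc 0 T) :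
    ∀ᵐ s, s ∈ uIoc p q → s ∈ Ioo 0 T ∧ X t x s ∉ E := by
  have hn : ({0, T} ∪ {s | s ∈ Ioo 0 T ∧ X t x s ∈ E}).Countable :=
    ((countable_singleton T).insert 0).union (h.meet t ht x)
  filter_upwards [hn.ae_notMem volume] with s hs hs'
  have hs' : s ∈ Icc 0 T := ordConnected_Icc.uIcc_subset hp hq (uIoc_subset_uIcc hs')
  have h1 : s ∈ Ioo 0 T := by
    refine ⟨lt_of_le_of_ne hs'.1 fun h => hs (by simp [← h]), lt_of_le_of_ne hs'.2 fun h =>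
      hs (by simp [h])⟩
  exact ⟨h1, fun h => hs (Or.inr ⟨h1, h⟩)⟩

/-- The difference of two curves solves a linear equation whose coefficient is the difference
quotient of the field. This uses no derivative of the field, which may fail to exist on `E`. -/
theorem sub_eq_mul_exp (h : CharField T L E μ μx X) {t s : ℝ} (ht : t ∈ Icc 0 T)
    (hs : s ∈ Icc 0 T) {x y : ℝ} (hxy : y ≠ x) :
    X t y s - X t x s = (y - x) *
      Real.exp (∫ r in t..s, (μ r (X t y r) - μ r (X t x r)) / (X t y r - X t x r)) := by
  have hne : ∀ r ∈ Icc 0 T, X t y r - X t x r ≠ 0 := fun r hr h0 =>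
    hxy (h.flow.injective h.lipschitz ht hr (sub_eq_zero.1 h0))
  set q : ℝ → ℝ := fun r => (μ r (X t y r) - μ r (X t x r)) / (X t y r - X t x r)
  have hcy := h.flow.continuous_curve t y
  have hcx := h.flow.continuous_curve t x
  have hq : ContinuousOn q (Icc 0 T) := by
    refine ContinuousOn.div ?_ (hcy.sub hcx).continuousOn hne
    exact ((h.continuous.comp (by fun_prop : Continuous fun r => (r, X t y r))).sub
      (h.continuous.comp (by fun_prop : Continuous fun r => (r, X t x r)))).continuousOn
  have hqi : ∀ r ∈ Icc 0 T, IntervalIntegrable q volume t r := fun r hr =>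
    (hq.mono (ordConnected_Icc.uIcc_subset ht hr)).intervalIntegrable
  have hI : ContinuousOn (fun r => ∫ r' in t..r, q r') (Icc 0 T) := by
    have := intervalIntegral.continuousOn_primitive_interval' (μ := volume) (f := q) (a := t)
      (b₁ := 0) (b₂ := T) (by
        refine (hq.mono ?_).intervalIntegrable; rw [uIcc_of_le h.pos.le])
      (by rwa [uIcc_of_le h.pos.le])
    rwa [uIcc_of_le h.pos.le] at this
  set g : ℝ → ℝ := fun r => (X t y r - X t x r) * Real.exp (-∫ r' in t..r, q r')
  have hg : ContinuousOn g (Icc 0 T) :=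
    (hcy.sub hcx).continuousOn.mul (Real.continuous_exp.comp_continuousOn hI.neg)
  have hgd : ∀ r ∈ Ioo 0 T, HasDerivAt g 0 r := fun r hr => by
    have h1 := h.flow.hasDerivAt t ht y r hr
    have h2 := h.flow.hasDerivAt t ht x r hr
    have hrI := Ioo_subset_Icc_self hr
    have h3 : HasDerivAt (fun r => ∫ r' in t..r, q r') (q r) r :=
      intervalIntegral.integral_hasDerivAt_right (hqi r hrI)
        (hq.stronglyMeasurableAtFilter_nhdsWithin measurableSet_Icc r |> fun h => by
          rwa [nhdsWithin_eq_nhds.2 (Icc_mem_nhds hr.1 hr.2)] at h)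
        (hq.continuousAt (Icc_mem_nhds hr.1 hr.2))
    refine ((h1.sub h2).mul h3.neg.exp).congr_deriv ?_
    have : q r * (X t y r - X t x r) = μ r (X t y r) - μ r (X t x r) :=
      div_mul_cancel₀ _ (hne r hrI)
    rw [← this]; simp only [Pi.sub_apply]; ring
  -- The difference divided by its exponential factor has derivative zero; the comparison inequality
  -- with rate 0 turns this into constancy up to the ends of the interval.
  have hconst := le_mul_exp_of_abs_deriv_le (T := T) (c := 0) (g := fun r => (g r - g t) ^ 2)
    ((hg.sub continuousOn_const).pow 2) (fun r hr => ((hgd r hr).sub_const _).pow 2)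
    (fun r _ => by simp) hs ht
  have h5 : g s = g t := by
    have : (g s - g t) ^ 2 ≤ 0 := by simpa using hconst
    have := pow_eq_zero_iff (two_ne_zero) |>.1 (le_antisymm this (sq_nonneg _))
    linarith
  simp only [g, intervalIntegral.integral_same, neg_zero, Real.exp_zero, mul_one,
    h.flow.initial t ht] at h5
  rw [← h5, mul_assoc, ← Real.exp_add, neg_add_cancel, Real.exp_zero, mul_one]

/-- The difference quotients of the field are bounded by `L` and converge to `μx` except at the
countably many times when the curve is in `E`. The exponent in `sub_eq_mul_exp` therefore converges
by dominated convergence. -/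
theorem hasDerivAt_flow (h : CharField T L E μ μx X) {t s : ℝ} (ht : t ∈ Icc 0 T)
    (hs : s ∈ Icc 0 T) (x : ℝ) :
    HasDerivAt (fun y => X t y s) (flowDeriv μx X t x s) x := by
  rw [hasDerivAt_iff_tendsto_slope]
  have hT : Tendsto (fun y => Real.exp (∫ r in t..s,
      (μ r (X t y r) - μ r (X t x r)) / (X t y r - X t x r))) (𝓝[≠] x)
      (𝓝 (flowDeriv μx X t x s)) := by
    refine (Real.continuous_exp.tendsto _).comp ?_
    refine intervalIntegral.tendsto_integral_filter_of_dominated_convergence (fun _ => L)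
      ?_ ?_ intervalIntegrable_const ?_
    · refine Eventually.of_forall fun y => Measurable.aestronglyMeasurable ?_
      have hcy := h.flow.continuous_curve t y
      have hcx := h.flow.continuous_curve t x
      have h1 : Continuous fun r => μ r (X t y r) - μ r (X t x r) :=
        (h.continuous.comp (by fun_prop : Continuous fun r => (r, X t y r))).sub
          (h.continuous.comp (by fun_prop : Continuous fun r => (r, X t x r)))
      exact h1.measurable.div (hcy.sub hcx).measurable
    · refine Eventually.of_forall fun y => ae_of_all _ fun r _ => ?_
      rw [Real.norm_eq_abs, abs_div]
      exact div_le_of_le_mul₀ (abs_nonneg _) h.nonneg (h.lipschitz _ _ _)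
    · filter_upwards [h.ae_notMem ht x ht hs] with r hr hr'
      obtain ⟨hr0, hrE⟩ := hr hr'
      have hr1 := Ioo_subset_Icc_self hr0
      have hd := (h.hasDerivAt r _ hrE).tendsto_slope
      have hcont : Tendsto (fun y => X t y r) (𝓝[≠] x) (𝓝[≠] (X t x r)) := by
        refine tendsto_nhdsWithin_iff.2 ⟨?_, ?_⟩
        · exact ((h.flow.continuous.comp
            (by fun_prop : Continuous fun y : ℝ => (t, y, r))).tendsto x).mono_left
            nhdsWithin_le_nhds
        · filter_upwards [self_mem_nhdsWithin] with y hy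
          exact fun he => hy (h.flow.injective h.lipschitz ht hr1 he)
      refine (hd.comp hcont).congr fun y => ?_
      simp only [Function.comp, slope_def_field]
  refine hT.congr' ?_
  filter_upwards [self_mem_nhdsWithin] with y hy
  rw [slope_def_field, h.sub_eq_mul_exp ht hs hy, mul_div_cancel_left₀ _ (sub_ne_zero.2 hy)]

end CharField
end VortexSheet

namespace VortexSheet
open Filter Topology MeasureTheory

/-! ### Differentiability of integrals along characteristics -/

/-- `g` is continuous and, off `E`, differentiable with bounded continuous derivatives `gx` in `x`
and `gm = ∂_t g + μ ∂_x g` along the field `μ`. -/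
structure PwC1 (T C : ℝ) (E : Set ℝ) (μ g gm gx : ℝ → ℝ → ℝ) : Prop where
  continuous : Continuous (Function.uncurry g)
  hasDerivAt : ∀ t ∈ Icc 0 T, ∀ x ∉ E, HasDerivAt (g t) (gx t x) x
  hasFDerivAt : ∀ t ∈ Ioo 0 T, ∀ x ∉ E, HasFDerivAt (Function.uncurry g)
    ((gm t x - μ t x * gx t x) • ContinuousLinearMap.fst ℝ ℝ ℝ +
      gx t x • ContinuousLinearMap.snd ℝ ℝ ℝ) (t, x)
  along : BddContOff E C gm
  deriv_x : BddContOff E C gx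

namespace CharField

variable {T L : ℝ} {E : Set ℝ} {μ μx : ℝ → ℝ → ℝ} {X : ℝ → ℝ → ℝ → ℝ}

theorem continuous_comp_curve {g : ℝ → ℝ → ℝ} (h : CharField T L E μ μx X)
    (hg : Continuous (Function.uncurry g)) (t x : ℝ) : Continuous fun s => g s (X t x s) := by
  have := h.flow.continuous_curve t x
  exact hg.comp (f := fun s => (s, X t x s)) (by fun_prop)

theorem continuous_initial (h : CharField T L E μ μx X) (t s : ℝ) :
    Continuous fun y => X t y s :=
  h.flow.continuous.comp (by fun_prop : Continuous fun y : ℝ => (t, y, s))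

theorem lipschitz_of_pwC1 {C : ℝ} {g gx : ℝ → ℝ → ℝ} (h : CharField T L E μ μx X)
    (hg : Continuous (Function.uncurry g)) (hd : ∀ t ∈ Icc 0 T, ∀ x ∉ E, HasDerivAt (g t) (gx t x) x)
    (hx : BddContOff E C gx) {t : ℝ} (ht : t ∈ Icc 0 T) (x y : ℝ) :
    |g t x - g t y| ≤ C * |x - y| :=
  abs_sub_le_of_hasDerivAt_off h.countable (hg.comp (by fun_prop :
    Continuous fun x : ℝ => (t, x))) (hd t ht) (hx.intervalIntegrable_slice h.closed h.countable t)
    (hx.bound t) x y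

theorem hasDerivAt_along {C : ℝ} {g gm gx : ℝ → ℝ → ℝ} (h : CharField T L E μ μx X)
    (hg : PwC1 T C E μ g gm gx) {t : ℝ} (ht : t ∈ Icc 0 T) {s : ℝ} (hs : s ∈ Ioo 0 T) {x : ℝ}
    (hx : X t x s ∉ E) : HasDerivAt (fun s => g s (X t x s)) (gm s (X t x s)) s := by
  have h1 := (hasDerivAt_id s).prodMk (h.flow.hasDerivAt t ht x s hs)
  have h2 := (hg.hasFDerivAt s hs _ hx).comp_hasDerivAt s h1
  refine h2.congr_deriv ?_
  simp only [add_apply, FunLike.coe_smul, Pi.smul_apply, ContinuousLinearMap.coe_fst',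
    ContinuousLinearMap.coe_snd', smul_eq_mul]
  ring

/-- Difference quotients in the starting point pass to the limit under the integral, being bounded
by the Lipschitz constants of `g` and of the flow. The weight `B` may be taken along the moving
curve or along the fixed one; the integration by parts in `hasDerivAt_integral_along_mul` produces
one term of each kind. -/
theorem tendsto_integral_slope {C : ℝ} {g gx : ℝ → ℝ → ℝ} (h : CharField T L E μ μx X)
    (hg : Continuous (Function.uncurry g)) (hd : ∀ t ∈ Icc 0 T, ∀ x ∉ E, HasDerivAt (g t) (gx t x) x)
    (hx : BddContOff E C gx) {C' : ℝ} {B : ℝ → ℝ → ℝ} (hB : BddContOff E C' B)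
    {t : ℝ} (ht : t ∈ Icc 0 T) (x : ℝ)
    {z : ℝ → ℝ → ℝ} (hz : ∀ y, z y = X t y ∨ z y = X t x) :
    Tendsto (fun y => ∫ s in (0 : ℝ)..t, slope (fun y => g s (X t y s)) x y * B s (z y s))
      (𝓝[≠] x) (𝓝 (∫ s in (0 : ℝ)..t,
        flowDeriv μx X t x s * gx s (X t x s) * B s (X t x s))) := by
  have h0 : (0 : ℝ) ∈ Icc 0 T := ⟨le_rfl, h.pos.le⟩
  have hC : 0 ≤ C := (abs_nonneg _).trans (hx.bound 0 0)
  have hsub : uIoc 0 t ⊆ Icc 0 T := uIoc_subset_uIcc.trans (ordConnected_Icc.uIcc_subset h0 ht)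
  have hzc : ∀ y, Continuous (z y) ∧ {s | s ∈ Ioo 0 T ∧ z y s ∈ E}.Countable := fun y => by
    rcases hz y with h1 | h1 <;> rw [h1] <;> exact ⟨h.flow.continuous_curve _ _, h.meet t ht _⟩
  refine intervalIntegral.tendsto_integral_filter_of_dominated_convergence
    (fun _ => C * Real.exp (L * T) * C') ?_ ?_ intervalIntegrable_const ?_
  · refine Eventually.of_forall fun y => AEStronglyMeasurable.mul ?_ ?_
    · have : Continuous fun s => slope (fun y => g s (X t y s)) x y := by
        simp only [slope_def_field]
        exact ((h.continuous_comp_curve hg t y).sub (h.continuous_comp_curve hg t x)).div_const _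
      exact this.aestronglyMeasurable
    · exact (hB.aestronglyMeasurable_curve (hzc y).1 (hzc y).2).mono_measure
        (Measure.restrict_mono hsub le_rfl)
  · filter_upwards [self_mem_nhdsWithin] with y hy
    refine ae_of_all _ fun s hs => ?_
    rw [Real.norm_eq_abs, abs_mul]
    refine mul_le_mul ?_ (hB.bound _ _) (abs_nonneg _) (by positivity)
    rw [slope_def_field, abs_div]
    refine div_le_of_le_mul₀ (abs_nonneg _) (by positivity) ?_
    rw [mul_assoc]
    refine (h.lipschitz_of_pwC1 hg hd hx (hsub hs) _ _).trans (mul_le_mul_of_nonneg_left ?_ hC)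
    rw [mul_comm]
    exact h.flow.abs_sub_le_exp h.nonneg h.lipschitz ht (hsub hs) y x
  · filter_upwards [h.ae_notMem ht x h0 ht] with s hs hs'
    obtain ⟨hs0, hsE⟩ := hs hs'
    have h1 : HasDerivAt (fun y => g s (X t y s)) (gx s (X t x s) * flowDeriv μx X t x s) x :=
      (hd s (Ioo_subset_Icc_self hs0) _ hsE).comp x (h.hasDerivAt_flow ht (Ioo_subset_Icc_self hs0) x)
    have h2 := h1.tendsto_slope
    rw [mul_comm (gx s (X t x s))] at h2
    refine h2.mul ?_
    have h3 : Tendsto (fun y => z y s) (𝓝[≠] x) (𝓝 (X t x s)) := by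
      have h4 : Tendsto (fun y => X t y s) (𝓝[≠] x) (𝓝 (X t x s)) :=
        ((h.continuous_initial t s).tendsto x).mono_left nhdsWithin_le_nhds
      rw [Metric.tendsto_nhds] at h4 ⊢
      intro ε hε
      filter_upwards [h4 ε hε] with y hy
      rcases hz y with h5 | h5 <;> rw [h5]
      · exact hy
      · simpa using hε
    have h5 := (hB.continuousAt h.closed hsE (t := s)).tendsto.comp
      ((tendsto_const_nhds (x := s)).prodMk_nhds h3)
    exact h5

theorem hasDerivAt_integral_flow {C : ℝ} {g gx : ℝ → ℝ → ℝ} (h : CharField T L E μ μx X)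
    (hg : Continuous (Function.uncurry g)) (hd : ∀ t ∈ Icc 0 T, ∀ x ∉ E, HasDerivAt (g t) (gx t x) x)
    (hx : BddContOff E C gx) {t : ℝ} (ht : t ∈ Icc 0 T) (x : ℝ) :
    HasDerivAt (fun y => ∫ s in (0 : ℝ)..t, g s (X t y s))
      (∫ s in (0 : ℝ)..t, flowDeriv μx X t x s * gx s (X t x s)) x := by
  rw [hasDerivAt_iff_tendsto_slope]
  have h1 := h.tendsto_integral_slope hg hd hx (B := fun _ _ => 1) (C' := 1)
    (BddContOff.of_continuous (by fun_prop) (by simp)) ht x (z := fun _ => X t x)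
    (fun y => Or.inr rfl)
  simp only [mul_one] at h1
  refine h1.congr fun y => ?_
  simp only [slope_def_field]
  rw [intervalIntegral.integral_div, intervalIntegral.integral_sub
    ((h.continuous_comp_curve hg t y).intervalIntegrable _ _)
    ((h.continuous_comp_curve hg t x).intervalIntegrable _ _)]

/-- The `x`-derivative of `∫ (∂_t ϑ + μ ∂_x ϑ) W` along characteristics involves only first
derivatives of `ϑ` and `W`. -/
theorem hasDerivAt_integral_along_mul {C C' : ℝ} {ϑ ϑm ϑx W Wm Wx : ℝ → ℝ → ℝ}
    (h : CharField T L E μ μx X) (hϑ : PwC1 T C E μ ϑ ϑm ϑx) (hW : PwC1 T C' E μ W Wm Wx)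
    {t : ℝ} (ht : t ∈ Icc 0 T) {x : ℝ} (hx : x ∉ E) (hx0 : X t x 0 ∉ E) :
    HasDerivAt (fun y => ∫ s in (0 : ℝ)..t, ϑm s (X t y s) * W s (X t y s))
      (ϑx t x * W t x - flowDeriv μx X t x 0 * ϑx 0 (X t x 0) * W 0 (X t x 0) +
        ∫ s in (0 : ℝ)..t, flowDeriv μx X t x s *
          (ϑm s (X t x s) * Wx s (X t x s) - ϑx s (X t x s) * Wm s (X t x s))) x := by
  have h0 : (0 : ℝ) ∈ Icc 0 T := ⟨le_rfl, h.pos.le⟩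
  have hcv := h.flow.continuous_curve t
  have iϑm : ∀ y, IntervalIntegrable (fun s => ϑm s (X t y s)) volume 0 t := fun y =>
    hϑ.along.intervalIntegrable_curve (hcv y) (h.meet t ht y) h0 ht
  have iWm : ∀ y, IntervalIntegrable (fun s => Wm s (X t y s)) volume 0 t := fun y =>
    hW.along.intervalIntegrable_curve (hcv y) (h.meet t ht y) h0 ht
  have iϑx : IntervalIntegrable (fun s => ϑx s (X t x s)) volume 0 t :=
    hϑ.deriv_x.intervalIntegrable_curve (hcv x) (h.meet t ht x) h0 ht
  have cϑ := h.continuous_comp_curve hϑ.continuous t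
  have cW := h.continuous_comp_curve hW.continuous t
  -- The integrand is the derivative of (ϑ on the moving curve - ϑ on the fixed curve) · W on the
  -- moving curve. In this way the increment of `ϑm` is traded for increments of `ϑ`, and `ϑm` is
  -- never differentiated.
  have hby : ∀ y, ∫ s in (0 : ℝ)..t, ((ϑm s (X t y s) - ϑm s (X t x s)) * W s (X t y s) +
      (ϑ s (X t y s) - ϑ s (X t x s)) * Wm s (X t y s)) =
      (ϑ t (X t y t) - ϑ t (X t x t)) * W t (X t y t) -
        (ϑ 0 (X t y 0) - ϑ 0 (X t x 0)) * W 0 (X t y 0) := fun y => by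
    refine integral_eq_of_hasDerivAt_off_countable
      (fun s => (ϑ s (X t y s) - ϑ s (X t x s)) * W s (X t y s)) _
      ((h.meet t ht y).union (h.meet t ht x)) (((cϑ y).sub (cϑ x)).mul (cW y)).continuousOn ?_ ?_
    · intro s hs
      have hs0 : s ∈ Ioo 0 T := by
        have := hs.1
        rw [min_eq_left ht.1, max_eq_right ht.1] at this
        exact ⟨this.1, this.2.trans_le ht.2⟩
      have hy : X t y s ∉ E := fun he => hs.2 (Or.inl ⟨hs0, he⟩)
      have hx : X t x s ∉ E := fun he => hs.2 (Or.inr ⟨hs0, he⟩)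
      exact ((h.hasDerivAt_along hϑ ht hs0 hy).sub (h.hasDerivAt_along hϑ ht hs0 hx)).mul
        (h.hasDerivAt_along hW ht hs0 hy)
    · exact (((iϑm y).sub (iϑm x)).mul_continuousOn (cW y).continuousOn).add
        ((iWm y).continuousOn_mul ((cϑ y).sub (cϑ x)).continuousOn)
  -- The increment of the product ϑm·W is split with the increment of `W` weighted by `ϑm` on the
  -- fixed curve, so that only quotients of `ϑ` and `W` remain.
  have hdiff : ∀ y, slope (fun y => ∫ s in (0 : ℝ)..t, ϑm s (X t y s) * W s (X t y s)) x y =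
      slope (ϑ t) x y * W t y - slope (fun y => ϑ 0 (X t y 0)) x y * W 0 (X t y 0) -
      (∫ s in (0 : ℝ)..t, slope (fun y => ϑ s (X t y s)) x y * Wm s (X t y s)) +
      ∫ s in (0 : ℝ)..t, slope (fun y => W s (X t y s)) x y * ϑm s (X t x s) := fun y => by
    have i1 := (iϑm y).mul_continuousOn (cW y).continuousOn
    have i2 := (iϑm x).mul_continuousOn (cW x).continuousOn
    have i3 := (iϑm x).mul_continuousOn (cW y).continuousOn
    have i4 : IntervalIntegrable (fun s => (ϑ s (X t y s) - ϑ s (X t x s)) * Wm s (X t y s))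
        volume 0 t := (iWm y).continuousOn_mul ((cϑ y).sub (cϑ x)).continuousOn
    have e := hby y
    rw [intervalIntegral.integral_add (((iϑm y).sub (iϑm x)).mul_continuousOn (cW y).continuousOn)
      i4] at e
    simp only [sub_mul, h.flow.initial t ht] at e
    rw [intervalIntegral.integral_sub i1 i3] at e
    simp only [slope_def_field, div_mul_eq_mul_div, intervalIntegral.integral_div]
    rw [← sub_div, ← sub_div, ← add_div]
    congr 1
    have e2 : ∫ s in (0 : ℝ)..t, (W s (X t y s) - W s (X t x s)) * ϑm s (X t x s) =
        (∫ s in (0 : ℝ)..t, ϑm s (X t x s) * W s (X t y s)) -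
        ∫ s in (0 : ℝ)..t, ϑm s (X t x s) * W s (X t x s) := by
      rw [← intervalIntegral.integral_sub i3 i2]
      congr 1; funext s; ring
    rw [e2]
    simp only [sub_mul] at e ⊢
    linarith
  rw [hasDerivAt_iff_tendsto_slope]
  refine Tendsto.congr (fun y => (hdiff y).symm) ?_
  have l1 := (hϑ.hasDerivAt t ht x hx).tendsto_slope
  have l2 : Tendsto (fun y => W t y) (𝓝[≠] x) (𝓝 (W t x)) :=
    ((hW.continuous.comp (by fun_prop : Continuous fun y : ℝ => (t, y))).tendsto x).mono_left
      nhdsWithin_le_nhds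
  have l3 := ((hϑ.hasDerivAt 0 h0 _ hx0).comp x (h.hasDerivAt_flow ht h0 x)).tendsto_slope
  have l4 : Tendsto (fun y => W 0 (X t y 0)) (𝓝[≠] x) (𝓝 (W 0 (X t x 0))) := by
    have := h.continuous_initial t 0
    exact ((hW.continuous.comp (by fun_prop : Continuous fun y : ℝ => ((0 : ℝ), X t y 0))).tendsto
      x).mono_left nhdsWithin_le_nhds
  have l5 := h.tendsto_integral_slope hϑ.continuous hϑ.hasDerivAt hϑ.deriv_x hW.along ht x
    (z := fun y => X t y) (fun y => Or.inl rfl)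
  have l6 := h.tendsto_integral_slope hW.continuous hW.hasDerivAt hW.deriv_x hϑ.along ht x
    (z := fun y => X t x) (fun y => Or.inr rfl)
  have l := (((l1.mul l2).sub (l3.mul l4)).sub l5).add l6
  refine l.congr' (EventuallyEq.refl _ _) |>.trans (le_of_eq ?_)
  congr 1
  have cJ : ContinuousOn (fun s => flowDeriv μx X t x s) (uIcc 0 t) := by
    have h1 := h.continuous_flowDeriv.comp (by fun_prop : Continuous fun s : ℝ => (t, x, s))
    refine h1.continuousOn.congr fun s hs => ?_
    have hs' := ordConnected_Icc.uIcc_subset h0 ht hs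
    simp only [Function.comp, clampTime_of_mem hs', clampTime_of_mem ht]
  have cJ' : ∀ {k : ℝ → ℝ}, IntervalIntegrable k volume 0 t →
      IntervalIntegrable (fun s => flowDeriv μx X t x s * k s) volume 0 t := fun hk =>
    hk.continuousOn_mul cJ
  have iWx : IntervalIntegrable (fun s => Wx s (X t x s)) volume 0 t :=
    hW.deriv_x.intervalIntegrable_curve (hcv x) (h.meet t ht x) h0 ht
  have b1 : IntervalIntegrable (fun s => flowDeriv μx X t x s * (ϑx s (X t x s) * Wm s (X t x s)))
      volume 0 t := cJ' ((hϑ.deriv_x.mul hW.along).intervalIntegrable_curve (hcv x)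
        (h.meet t ht x) h0 ht)
  have b2 : IntervalIntegrable (fun s => flowDeriv μx X t x s * (ϑm s (X t x s) * Wx s (X t x s)))
      volume 0 t := cJ' ((hϑ.along.mul hW.deriv_x).intervalIntegrable_curve (hcv x)
        (h.meet t ht x) h0 ht)
  have e1 : ∫ s in (0 : ℝ)..t, flowDeriv μx X t x s *
      (ϑm s (X t x s) * Wx s (X t x s) - ϑx s (X t x s) * Wm s (X t x s)) =
      (∫ s in (0 : ℝ)..t, flowDeriv μx X t x s * Wx s (X t x s) * ϑm s (X t x s)) -
      ∫ s in (0 : ℝ)..t, flowDeriv μx X t x s * ϑx s (X t x s) * Wm s (X t x s) := by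
    simp only [mul_sub]
    rw [intervalIntegral.integral_sub b2 b1]
    congr 1
    · congr 1; funext s; ring
    · congr 1; funext s; ring
  rw [e1]; ring

end CharField
end VortexSheet

namespace VortexSheet
open Filter Topology MeasureTheory

/-! ### One step of the transport iteration -/

/-- The solution of `∂_t Y + μ ∂_x Y = S`, `Y(0, ·) = Y₀`, along the curves of the flow `X`. -/
noncomputable def transported (T : ℝ) (X : ℝ → ℝ → ℝ → ℝ) (Y₀ : ℝ → ℝ) (S : ℝ → ℝ → ℝ)
    (t x : ℝ) : ℝ :=
  Y₀ (X (clampTime T t) x 0) + ∫ s in (0 : ℝ)..clampTime T t, S s (X (clampTime T t) x s)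

/-- The solution of `∂_t V + μ ∂_x V + μx V = S`, `V(0, ·) = V₀`, along the curves of the flow
`X`. -/
noncomputable def transportedDensity (T : ℝ) (μx : ℝ → ℝ → ℝ) (X : ℝ → ℝ → ℝ → ℝ) (V₀ : ℝ → ℝ)
    (S : ℝ → ℝ → ℝ) (t x : ℝ) : ℝ :=
  flowDeriv μx X (clampTime T t) x 0 * V₀ (X (clampTime T t) x 0) +
    ∫ s in (0 : ℝ)..clampTime T t,
      flowDeriv μx X (clampTime T t) x s * S s (X (clampTime T t) x s)

/-- A function that is differentiable along a curve and has a continuous partial derivative in `x`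
is differentiable. -/
theorem hasFDerivAt_of_curve {g gx : ℝ → ℝ → ℝ} {ξ : ℝ → ℝ} {t x σ m : ℝ}
    (hξ : HasDerivAt ξ m t) (hξt : ξ t = x)
    (hg : HasDerivAt (fun s => g s (ξ s)) σ t)
    (hx : ∀ᶠ p : ℝ × ℝ in 𝓝 (t, x), HasDerivAt (g p.1) (gx p.1 p.2) p.2)
    (hc : ContinuousAt (Function.uncurry gx) (t, x)) :
    HasFDerivAt (Function.uncurry g) ((σ - m * gx t x) • ContinuousLinearMap.fst ℝ ℝ ℝ +
      gx t x • ContinuousLinearMap.snd ℝ ℝ ℝ) (t, x) := by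
  have hfst : HasFDerivAt (fun p : ℝ × ℝ => p.1) (ContinuousLinearMap.fst ℝ ℝ ℝ) (t, x) :=
    hasFDerivAt_fst
  have hsnd : HasFDerivAt (fun p : ℝ × ℝ => p.2) (ContinuousLinearMap.snd ℝ ℝ ℝ) (t, x) :=
    hasFDerivAt_snd
  have h1 : HasFDerivAt (fun p : ℝ × ℝ => g p.1 (ξ p.1)) (σ • ContinuousLinearMap.fst ℝ ℝ ℝ)
      (t, x) := HasDerivAt.comp_hasFDerivAt (h₂ := fun s => g s (ξ s)) (t, x) hg hfst
  have h2 : HasFDerivAt (fun p : ℝ × ℝ => p.2 - ξ p.1)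
      (ContinuousLinearMap.snd ℝ ℝ ℝ - m • ContinuousLinearMap.fst ℝ ℝ ℝ) (t, x) :=
    hsnd.sub (HasDerivAt.comp_hasFDerivAt (h₂ := ξ) (t, x) hξ hfst)
  -- The remaining term is the error of the linear expansion in `x` about the curve. By the mean
  -- value inequality and the continuity of `gx` it is at most ε times the distance to the curve,
  -- hence negligible.
  have h3 : HasFDerivAt (fun p : ℝ × ℝ => g p.1 p.2 - g p.1 (ξ p.1) - gx t x * (p.2 - ξ p.1))
      (0 : ℝ × ℝ →L[ℝ] ℝ) (t, x) := by
    rw [hasFDerivAt_iff_isLittleO]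
    have h4 : (fun p : ℝ × ℝ => p.2 - ξ p.1) =O[𝓝 (t, x)] fun p => p - (t, x) := by
      have := h2.isBigO_sub
      simpa [hξt] using this
    refine Asymptotics.IsLittleO.trans_isBigO ?_ h4
    rw [Asymptotics.isLittleO_iff]
    intro ε hε
    have h5 : ∀ᶠ p : ℝ × ℝ in 𝓝 (t, x), |gx p.1 p.2 - gx t x| ≤ ε := by
      have := Metric.tendsto_nhds.1 hc.tendsto ε hε
      filter_upwards [this] with p hp using (Real.dist_eq _ _ ▸ hp).le
    obtain ⟨η, hη, hball⟩ := Metric.eventually_nhds_iff_ball.1 (hx.and h5)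
    have h6 : ∀ᶠ p : ℝ × ℝ in 𝓝 (t, x), |ξ p.1 - x| < η := by
      have : Tendsto (fun p : ℝ × ℝ => ξ p.1) (𝓝 (t, x)) (𝓝 x) := by
        have h := hξ.continuousAt.tendsto
        rw [hξt] at h
        exact h.comp (continuous_fst.tendsto (t, x))
      have := Metric.tendsto_nhds.1 this η hη
      filter_upwards [this] with p hp using (Real.dist_eq _ _ ▸ hp)
    filter_upwards [Metric.ball_mem_nhds (t, x) hη, h6] with p hp hp6
    have hp' : |p.1 - t| < η ∧ |p.2 - x| < η := by
      rw [Metric.mem_ball, Prod.dist_eq, max_lt_iff] at hp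
      exact hp
    have hmem : ∀ y ∈ uIcc (ξ p.1) p.2, (p.1, y) ∈ Metric.ball (t, x) η := fun y hy => by
      rw [Metric.mem_ball, Prod.dist_eq, max_lt_iff, Real.dist_eq, Real.dist_eq]
      refine ⟨hp'.1, ?_⟩
      have : uIcc (ξ p.1) p.2 ⊆ Metric.ball x η := (convex_ball x η).ordConnected.uIcc_subset
        (by rwa [Metric.mem_ball, Real.dist_eq]) (by rw [Metric.mem_ball, Real.dist_eq]; exact hp'.2)
      have := this hy
      rwa [Metric.mem_ball, Real.dist_eq] at this
    have h7 : ∀ y ∈ uIcc (ξ p.1) p.2, HasDerivWithinAt (fun y => g p.1 y - gx t x * y)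
        (gx p.1 y - gx t x) (uIcc (ξ p.1) p.2) y := fun y hy => by
      have := (hball _ (hmem y hy)).1
      have h8 := (this.sub ((hasDerivAt_id y).const_mul (gx t x)))
      exact (h8.congr_deriv (by simp)).hasDerivWithinAt
    have h9 := (convex_uIcc (ξ p.1) p.2).norm_image_sub_le_of_norm_hasDerivWithin_le h7
      (fun y hy => (hball _ (hmem y hy)).2) left_mem_uIcc right_mem_uIcc
    simp only [hξt, sub_self, mul_zero, sub_zero, zero_apply]
    refine le_trans (le_of_eq ?_) h9
    congr 1; ring
  have h10 := (h1.add (h2.const_mul (gx t x))).add h3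
  have e : Function.uncurry g = ((fun p : ℝ × ℝ => g p.1 (ξ p.1)) +
      (fun p : ℝ × ℝ => gx t x * (p.2 - ξ p.1))) +
      fun p : ℝ × ℝ => g p.1 p.2 - g p.1 (ξ p.1) - gx t x * (p.2 - ξ p.1) := by
    funext p
    simp only [Function.uncurry, Pi.add_apply]
    ring
  rw [e]
  refine h10.congr_fderiv ?_
  ext <;> simp; ring

namespace CharField

variable {T L : ℝ} {E : Set ℝ} {μ μx : ℝ → ℝ → ℝ} {X : ℝ → ℝ → ℝ → ℝ}

theorem continuous_clamp_flow (h : CharField T L E μ μx X) :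
    Continuous fun q : (ℝ × ℝ) × ℝ => X (clampTime T q.1.1) q.1.2 q.2 := by
  have := continuous_clampTime T
  exact h.flow.continuous.comp (f := fun q : (ℝ × ℝ) × ℝ => (clampTime T q.1.1, q.1.2, q.2))
    (by fun_prop)

theorem continuous_clamp_flowDeriv (h : CharField T L E μ μx X) (s : ℝ) (hs : s ∈ Icc 0 T) :
    Continuous fun p : ℝ × ℝ => flowDeriv μx X (clampTime T p.1) p.2 s := by
  have := h.continuous_flowDeriv.comp (f := fun p : ℝ × ℝ => (p.1, p.2, s)) (by fun_prop)
  simpa only [Function.comp_def, clampTime_of_mem hs] using this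

theorem continuous_transported (h : CharField T L E μ μx X) {Y₀ : ℝ → ℝ} (hY₀ : Continuous Y₀)
    {G S : ℝ → ℝ → ℝ} (hG : Continuous (Function.uncurry G)) {C : ℝ} (hS : BddContOff E C S) :
    Continuous (Function.uncurry (transported T X Y₀ fun s y => G s y + S s y)) := by
  have hc := continuous_clampTime T
  have hX := h.continuous_clamp_flow
  have h1 : Continuous fun p : ℝ × ℝ => Y₀ (X (clampTime T p.1) p.2 0) :=
    hY₀.comp (hX.comp (f := fun p : ℝ × ℝ => (p, (0 : ℝ))) (by fun_prop))
  have h2 := continuous_integral_curve (P := ℝ × ℝ) (Cj := 1) h.pos h.closed hS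
    (z := fun p r => X (clampTime T p.1) p.2 r) (j := fun _ _ => 1) hX
    (fun _ => continuous_const) (fun _ _ => continuous_const)
    (fun _ _ _ => by simp) (fun p => h.meet _ (clampTime_mem h.pos.le _) _)
    (τ₀ := fun p => 0) (τ := fun p => clampTime T p.1)
    (by fun_prop) (by fun_prop) (fun p => ⟨le_rfl, h.pos.le⟩) (fun p => clampTime_mem h.pos.le _)
  have h3 : Continuous fun p : ℝ × ℝ =>
      ∫ s in (0 : ℝ)..clampTime T p.1, G s (X (clampTime T p.1) p.2 s) :=
    intervalIntegral.continuous_parametric_intervalIntegral_of_continuous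
      (f := fun (p : ℝ × ℝ) s => G s (X (clampTime T p.1) p.2 s))
      (hG.comp (continuous_snd.prodMk hX)) (hc.comp continuous_fst)
  refine (h1.fun_add (h3.fun_add h2)).congr fun p => ?_
  have hm := clampTime_mem h.pos.le p.1
  simp only [Function.uncurry, transported, one_mul]
  rw [intervalIntegral.integral_add ((h.continuous_comp_curve hG _ _).intervalIntegrable _ _)
    (hS.intervalIntegrable_curve (h.flow.continuous_curve _ _) (h.meet _ hm _)
      ⟨le_rfl, h.pos.le⟩ hm)]

theorem continuous_transportedDensity (h : CharField T L E μ μx X) {V₀ : ℝ → ℝ}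
    (hV₀ : Continuous V₀) {S : ℝ → ℝ → ℝ} {C : ℝ} (hS : BddContOff E C S) :
    Continuous (Function.uncurry (transportedDensity T μx X V₀ S)) := by
  have hc := continuous_clampTime T
  have hX := h.continuous_clamp_flow
  have h0 : (0 : ℝ) ∈ Icc 0 T := ⟨le_rfl, h.pos.le⟩
  have h1 : Continuous fun p : ℝ × ℝ => V₀ (X (clampTime T p.1) p.2 0) :=
    hV₀.comp (hX.comp (f := fun p : ℝ × ℝ => (p, (0 : ℝ))) (by fun_prop))
  have hJ := h.continuous_flowDeriv
  have h2 := continuous_integral_curve (P := ℝ × ℝ) (Cj := Real.exp (L * T)) h.pos h.closed hS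
    (z := fun p r => X (clampTime T p.1) p.2 r)
    (j := fun p r => flowDeriv μx X (clampTime T p.1) p.2 (clampTime T r)) hX
    (fun p => hJ.comp (f := fun r : ℝ => (p.1, p.2, r)) (by fun_prop))
    (fun r _ => hJ.comp (f := fun p : ℝ × ℝ => (p.1, p.2, r)) (by fun_prop))
    (fun p s hs => h.flowDeriv_le (clampTime_mem h.pos.le _) (clampTime_mem h.pos.le _) _)
    (fun p => h.meet _ (clampTime_mem h.pos.le _) _)
    (τ₀ := fun p => 0) (τ := fun p => clampTime T p.1)
    (by fun_prop) (by fun_prop) (fun p => h0) (fun p => clampTime_mem h.pos.le _)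
  refine (((h.continuous_clamp_flowDeriv 0 h0).fun_mul h1).fun_add h2).congr fun p => ?_
  simp only [Function.uncurry, transportedDensity]
  congr 1
  apply intervalIntegral.integral_congr
  intro s hs
  have := ordConnected_Icc.uIcc_subset h0 (clampTime_mem h.pos.le p.1) hs
  simp only [clampTime_of_mem this]

theorem abs_transported_le (h : CharField T L E μ μx X) {Y₀ : ℝ → ℝ} {C₀ : ℝ}
    (hY₀ : ∀ x, |Y₀ x| ≤ C₀) {S : ℝ → ℝ → ℝ} {C : ℝ} (hS : ∀ t x, |S t x| ≤ C) (t x : ℝ) :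
    |transported T X Y₀ S t x| ≤ C₀ + C * T := by
  have hC : 0 ≤ C := (abs_nonneg _).trans (hS 0 0)
  refine (abs_add_le _ _).trans (add_le_add (hY₀ _) ?_)
  have h1 := intervalIntegral.norm_integral_le_of_norm_le_const (a := 0) (b := clampTime T t)
    (f := fun s => S s (X (clampTime T t) x s)) fun s _ => hS s _
  have := clampTime_mem h.pos.le t
  rw [sub_zero, abs_of_nonneg this.1] at h1
  exact h1.trans (mul_le_mul_of_nonneg_left this.2 hC)

theorem abs_transportedDensity_le (h : CharField T L E μ μx X) {V₀ : ℝ → ℝ} {C₀ : ℝ}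
    (hV₀ : ∀ x, |V₀ x| ≤ C₀) {S : ℝ → ℝ → ℝ} {C : ℝ} (hS : ∀ t x, |S t x| ≤ C) (t x : ℝ) :
    |transportedDensity T μx X V₀ S t x| ≤ Real.exp (L * T) * (C₀ + C * T) := by
  have hC : 0 ≤ C := (abs_nonneg _).trans (hS 0 0)
  have hm := clampTime_mem h.pos.le t
  have h0 : (0 : ℝ) ∈ Icc 0 T := ⟨le_rfl, h.pos.le⟩
  rw [mul_add]
  refine (abs_add_le _ _).trans (add_le_add ?_ ?_)
  · rw [abs_mul]
    exact mul_le_mul (h.flowDeriv_le hm h0 _) (hV₀ _) (abs_nonneg _) (Real.exp_pos _).le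
  · have h1 := intervalIntegral.norm_integral_le_of_norm_le_const (a := 0) (b := clampTime T t)
      (C := Real.exp (L * T) * C)
      (f := fun s => flowDeriv μx X (clampTime T t) x s * S s (X (clampTime T t) x s))
      fun s hs => by
        have hs' := ordConnected_Icc.uIcc_subset h0 hm (uIoc_subset_uIcc hs)
        rw [Real.norm_eq_abs, abs_mul]
        exact mul_le_mul (h.flowDeriv_le hm hs' _) (hS _ _) (abs_nonneg _) (Real.exp_pos _).le
    rw [sub_zero, abs_of_nonneg hm.1, mul_assoc] at h1
    exact h1.trans (mul_le_mul_of_nonneg_left (mul_le_mul_of_nonneg_left hm.2 hC)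
      (Real.exp_pos _).le)

/-- The transported function along a curve of the flow. -/
theorem transported_curve (h : CharField T L E μ μx X) {Y₀ : ℝ → ℝ} {S : ℝ → ℝ → ℝ} {t s : ℝ}
    (ht : t ∈ Icc 0 T) (hs : s ∈ Icc 0 T) (x : ℝ) :
    transported T X Y₀ S s (X t x s) = Y₀ (X t x 0) + ∫ r in (0 : ℝ)..s, S r (X t x r) := by
  have h0 : (0 : ℝ) ∈ Icc 0 T := ⟨le_rfl, h.pos.le⟩
  simp only [transported, clampTime_of_mem hs]
  rw [h.flow.comp h.lipschitz ht h0 hs]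
  congr 1
  apply intervalIntegral.integral_congr
  intro r hr
  have := ordConnected_Icc.uIcc_subset h0 hs hr
  simp only [h.flow.comp h.lipschitz ht this hs]

section Step

variable {C C' C'' : ℝ} {ϑ ϑm ϑx W Wm Wx G Gx : ℝ → ℝ → ℝ} {Y₀ Y₀' V₀ : ℝ → ℝ}

/-- Points whose characteristic starts in `E` are excluded, because the initial values need not be
differentiable there. The boundary term of the integration by parts at time zero combines with `Y₀'`
into `V₀`, and the one at time `t` gives the correction `ϑx * W`. -/
theorem hasDerivAt_transported_generic (h : CharField T L E μ μx X)
    (hϑ : PwC1 T C E μ ϑ ϑm ϑx) (hW : PwC1 T C' E μ W Wm Wx)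
    (hG : Continuous (Function.uncurry G))
    (hGd : ∀ t ∈ Icc 0 T, ∀ x ∉ E, HasDerivAt (G t) (Gx t x) x) (hGx : BddContOff E C'' Gx)
    (hY₀' : ∀ x ∉ E, HasDerivAt Y₀ (Y₀' x) x)
    (hV₀' : ∀ x ∉ E, V₀ x = Y₀' x + ϑx 0 x * W 0 x)
    {t : ℝ} (ht : t ∈ Icc 0 T) {x : ℝ} (hx : x ∉ E) (hx0 : X t x 0 ∉ E) :
    HasDerivAt (transported T X Y₀ (fun s y => G s y + -(ϑm s y * W s y)) t)
      (transportedDensity T μx X V₀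
        (fun s y => Gx s y - ϑm s y * Wx s y + ϑx s y * Wm s y) t x - ϑx t x * W t x) x := by
  have h0 : (0 : ℝ) ∈ Icc 0 T := ⟨le_rfl, h.pos.le⟩
  have hcv := h.flow.continuous_curve t
  have d1 := (hY₀' _ hx0).comp x (h.hasDerivAt_flow ht h0 x)
  have d2 := h.hasDerivAt_integral_flow hG hGd hGx ht x
  have d3 := h.hasDerivAt_integral_along_mul hϑ hW ht hx hx0
  have hfun : transported T X Y₀ (fun s y => G s y + -(ϑm s y * W s y)) t =
      fun y => (Y₀ (X t y 0) + ∫ s in (0 : ℝ)..t, G s (X t y s)) -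
        ∫ s in (0 : ℝ)..t, ϑm s (X t y s) * W s (X t y s) := by
    funext y
    simp only [transported, clampTime_of_mem ht]
    rw [add_sub_assoc, ← intervalIntegral.integral_sub
      ((h.continuous_comp_curve hG t y).intervalIntegrable _ _)
      ((hϑ.along.intervalIntegrable_curve (hcv y) (h.meet t ht y) h0 ht).mul_continuousOn
        (h.continuous_comp_curve hW.continuous t y).continuousOn)]
    simp only [sub_eq_add_neg]
  rw [hfun]
  refine ((d1.add d2).sub d3).congr_deriv ?_
  simp only [transportedDensity, clampTime_of_mem ht]
  rw [hV₀' _ hx0]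
  have cJ : ContinuousOn (fun s => flowDeriv μx X t x s) (uIcc 0 t) := by
    have h1 := h.continuous_flowDeriv.comp (by fun_prop : Continuous fun s : ℝ => (t, x, s))
    refine h1.continuousOn.congr fun s hs => ?_
    have hs' := ordConnected_Icc.uIcc_subset h0 ht hs
    simp only [Function.comp, clampTime_of_mem hs', clampTime_of_mem ht]
  have i1 : IntervalIntegrable (fun s => flowDeriv μx X t x s * Gx s (X t x s)) volume 0 t :=
    (hGx.intervalIntegrable_curve (hcv x) (h.meet t ht x) h0 ht).continuousOn_mul cJ
  have i2 : IntervalIntegrable (fun s => flowDeriv μx X t x s *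
      (ϑm s (X t x s) * Wx s (X t x s) - ϑx s (X t x s) * Wm s (X t x s))) volume 0 t :=
    (((hϑ.along.mul hW.deriv_x).sub (hϑ.deriv_x.mul hW.along)).intervalIntegrable_curve (hcv x)
      (h.meet t ht x) h0 ht).continuousOn_mul cJ
  have e : ∫ s in (0 : ℝ)..t, flowDeriv μx X t x s * (Gx s (X t x s) -
      ϑm s (X t x s) * Wx s (X t x s) + ϑx s (X t x s) * Wm s (X t x s)) =
      (∫ s in (0 : ℝ)..t, flowDeriv μx X t x s * Gx s (X t x s)) -
      ∫ s in (0 : ℝ)..t, flowDeriv μx X t x s *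
      (ϑm s (X t x s) * Wx s (X t x s) - ϑx s (X t x s) * Wm s (X t x s)) := by
    rw [← intervalIntegral.integral_sub i1 i2]
    congr 1; funext s; ring
  rw [e]; ring

/-- The regularity of the transported function. -/
theorem hasDerivAt_transported (h : CharField T L E μ μx X)
    (hϑ : PwC1 T C E μ ϑ ϑm ϑx) (hW : PwC1 T C' E μ W Wm Wx)
    {CW : ℝ} (hWb : ∀ t x, |W t x| ≤ CW)
    (hG : Continuous (Function.uncurry G))
    (hGd : ∀ t ∈ Icc 0 T, ∀ x ∉ E, HasDerivAt (G t) (Gx t x) x) (hGx : BddContOff E C'' Gx)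
    (hY₀ : Continuous Y₀) (hY₀' : ∀ x ∉ E, HasDerivAt Y₀ (Y₀' x) x)
    (hV₀ : Continuous V₀) (hV₀' : ∀ x ∉ E, V₀ x = Y₀' x + ϑx 0 x * W 0 x)
    {t : ℝ} (ht : t ∈ Icc 0 T) {x : ℝ} (hx : x ∉ E) :
    HasDerivAt (transported T X Y₀ (fun s y => G s y + -(ϑm s y * W s y)) t)
      (transportedDensity T μx X V₀
        (fun s y => Gx s y - ϑm s y * Wx s y + ϑx s y * Wm s y) t x - ϑx t x * W t x) x := by
  have hbW := BddContOff.of_continuous (E := E) hW.continuous hWb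
  have hN : BddContOff E _ (fun s y => Gx s y - ϑm s y * Wx s y + ϑx s y * Wm s y) :=
    (hGx.sub (hϑ.along.mul hW.deriv_x)).add (hϑ.deriv_x.mul hW.along)
  set Y := transported T X Y₀ (fun s y => G s y + -(ϑm s y * W s y))
  set V := transportedDensity T μx X V₀
    (fun s y => Gx s y - ϑm s y * Wx s y + ϑx s y * Wm s y)
  have hYc : Continuous (Function.uncurry Y) := h.continuous_transported hY₀ hG
    (hϑ.along.mul hbW).neg
  have hVc : Continuous (Function.uncurry V) := h.continuous_transportedDensity hV₀ hN
  have hYt : Continuous (Y t) := hYc.comp (by fun_prop : Continuous fun y : ℝ => (t, y))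
  have hVt : Continuous (V t) := hVc.comp (by fun_prop : Continuous fun y : ℝ => (t, y))
  have hϑW := hϑ.deriv_x.mul hbW
  have hi : ∀ y z, IntervalIntegrable (fun y => V t y - ϑx t y * W t y) volume y z := fun y z =>
    (hVt.intervalIntegrable y z).sub (hϑW.intervalIntegrable_slice h.closed h.countable t y z)
  -- The flow is injective, so only countably many further points were excluded. The derivative
  -- formula is continuous off `E`, because `V₀` and hence the density are continuous, and the
  -- fundamental theorem of calculus extends it to those points.
  have hZ : (E ∪ (fun y => X t y 0) ⁻¹' E).Countable := h.countable.union
    (h.countable.preimage (h.flow.injective h.lipschitz ht ⟨le_rfl, h.pos.le⟩))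
  have hint : ∀ y, Y t y = Y t x + ∫ z in x..y, (V t z - ϑx t z * W t z) := fun y => by
    rw [integral_eq_of_hasDerivAt_off_countable (Y t) _ hZ hYt.continuousOn
      (fun z hz => h.hasDerivAt_transported_generic hϑ hW hG hGd hGx hY₀' hV₀' ht
        (fun h1 => hz.2 (Or.inl h1)) fun h1 => hz.2 (Or.inr h1)) (hi x y)]
    ring
  have hcont : ContinuousOn (fun y => V t y - ϑx t y * W t y) Eᶜ :=
    hVt.continuousOn.sub (hϑW.continuousOn_slice t)
  have hopen := h.closed.isOpen_compl
  have hd : HasDerivAt (fun y => ∫ z in x..y, (V t z - ϑx t z * W t z))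
      (V t x - ϑx t x * W t x) x :=
    intervalIntegral.integral_hasDerivAt_right (hi x x)
      (hcont.stronglyMeasurableAtFilter hopen x hx) (hcont.continuousAt (hopen.mem_nhds hx))
  exact (hd.const_add (Y t x)).congr_of_eventuallyEq (Eventually.of_forall hint)

/-- Along a characteristic the transported function is a primitive of its source. Together with the
continuous derivative in `x` this gives full differentiability through `hasFDerivAt_of_curve`. -/
theorem hasFDerivAt_transported (h : CharField T L E μ μx X) {Y₀ : ℝ → ℝ} {G S Yx : ℝ → ℝ → ℝ}
    (hG : Continuous (Function.uncurry G)) {C : ℝ} (hS : BddContOff E C S)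
    (hd : ∀ t ∈ Icc 0 T, ∀ x ∉ E,
      HasDerivAt (transported T X Y₀ (fun s y => G s y + S s y) t) (Yx t x) x)
    (hYx : ContinuousOn (Function.uncurry Yx) (univ ×ˢ Eᶜ)) {t : ℝ} (ht : t ∈ Ioo 0 T)
    {x : ℝ} (hx : x ∉ E) :
    HasFDerivAt (Function.uncurry (transported T X Y₀ fun s y => G s y + S s y))
      ((G t x + S t x - μ t x * Yx t x) • ContinuousLinearMap.fst ℝ ℝ ℝ +
        Yx t x • ContinuousLinearMap.snd ℝ ℝ ℝ) (t, x) := by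
  have h0 : (0 : ℝ) ∈ Icc 0 T := ⟨le_rfl, h.pos.le⟩
  have ht' := Ioo_subset_Icc_self ht
  have hopen := h.closed.isOpen_compl
  have hXt : X t x t = x := h.flow.initial t ht' x
  have hcv := h.flow.continuous_curve t x
  refine hasFDerivAt_of_curve (ξ := X t x) (by
    have := h.flow.hasDerivAt t ht' x t ht; rwa [hXt] at this) hXt ?_ ?_ ?_
  · have hi : IntervalIntegrable (fun r => G r (X t x r) + S r (X t x r)) volume 0 t :=
      ((h.continuous_comp_curve hG t x).intervalIntegrable _ _).add
        (hS.intervalIntegrable_curve hcv (h.meet t ht' x) h0 ht')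
    set D : Set ℝ := Ioo 0 T ∩ {r | X t x r ∉ E}
    have hD : IsOpen D := isOpen_Ioo.inter (hopen.preimage hcv)
    have htD : t ∈ D := ⟨ht, by simpa only [mem_ofPred_eq, hXt] using hx⟩
    have hc : ContinuousOn (fun r => G r (X t x r) + S r (X t x r)) D :=
      (h.continuous_comp_curve hG t x).continuousOn.add
        (hS.continuousOn.comp (f := fun r => (r, X t x r)) (by fun_prop)
          fun r hr => ⟨mem_univ _, hr.2⟩)
    have hd' := intervalIntegral.integral_hasDerivAt_right hi
      (hc.stronglyMeasurableAtFilter hD t htD) (hc.continuousAt (hD.mem_nhds htD))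
    rw [hXt] at hd'
    refine (hd'.const_add (Y₀ (X t x 0))).congr_of_eventuallyEq ?_
    filter_upwards [Ioo_mem_nhds ht.1 ht.2] with s hs
    exact h.transported_curve ht' (Ioo_subset_Icc_self hs) x
  · have : Ioo 0 T ×ˢ Eᶜ ∈ 𝓝 (t, x) := (isOpen_Ioo.prod hopen).mem_nhds ⟨ht, hx⟩
    filter_upwards [this] with p hp
    exact hd p.1 (Ioo_subset_Icc_self hp.1) p.2 hp.2
  · exact hYx.continuousAt ((isOpen_univ.prod hopen).mem_nhds ⟨mem_univ _, hx⟩)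

end Step
end CharField
end VortexSheet

namespace VortexSheet
open Filter Topology MeasureTheory

/-! ### The reflected transport equation -/

/-- The data of the problem `∂_t Y + μ ∂_x Y = G - ϑm Ỹ`, `Y(0, ·) = Y₀` on the line, where
`Ỹ(t, x) = Y(t, -x)` and `ϑm = ∂_t ϑ + μ ∂_x ϑ` for an even function `ϑ`. The function
`V₀ = Y₀' + ϑx Ỹ₀` is continuous even though `Y₀'` and `ϑx` may jump on `E`. -/
structure ReflectedData (T L C : ℝ) (E : Set ℝ) (μ μx : ℝ → ℝ → ℝ) (X : ℝ → ℝ → ℝ → ℝ)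
    (ϑ ϑm ϑx G Gx : ℝ → ℝ → ℝ) (Y₀ Y₀' V₀ : ℝ → ℝ) : Prop where
  field : CharField T L E μ μx X
  symm : ∀ x ∈ E, -x ∈ E
  coeff : PwC1 T C E μ ϑ ϑm ϑx
  coeff_bound : ∀ t x, |ϑ t x| ≤ C
  coeff_x_neg : ∀ t x, ϑx t (-x) = -ϑx t x
  coeff_along_neg : ∀ t x, ϑm t (-x) = ϑm t x - (μ t x + μ t (-x)) * ϑx t x
  sum_bound : ∀ t x, |μ t x + μ t (-x)| ≤ C
  source : Continuous (Function.uncurry G)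
  source_bound : ∀ t x, |G t x| ≤ C
  source_deriv : ∀ t ∈ Icc 0 T, ∀ x ∉ E, HasDerivAt (G t) (Gx t x) x
  source_x : BddContOff E C Gx
  init : Continuous Y₀
  init_bound : ∀ x, |Y₀ x| ≤ C
  init_deriv : ∀ x ∉ E, HasDerivAt Y₀ (Y₀' x) x
  init_density : Continuous V₀
  init_density_bound : ∀ x, |V₀ x| ≤ C
  init_eq : ∀ x ∉ E, V₀ x = Y₀' x + ϑx 0 x * Y₀ (-x)

/-- Reflection does not carry the field to itself: the speed at x is not minus the speed at -x. The
mismatch μ(t,x) + μ(t,-x) multiplies the x-derivative; only this sum has to be bounded, while μ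
itself may grow. -/
theorem PwC1.reflect {T C C' : ℝ} {E : Set ℝ} {μ g gm gx : ℝ → ℝ → ℝ} (hg : PwC1 T C E μ g gm gx)
    (hE : ∀ x ∈ E, -x ∈ E) (hμ : Continuous (Function.uncurry μ))
    (hs : ∀ t x, |μ t x + μ t (-x)| ≤ C') :
    PwC1 T (C + C' * C) E μ (fun t x => g t (-x))
      (fun t x => gm t (-x) - (μ t x + μ t (-x)) * gx t (-x)) (fun t x => -gx t (-x)) := by
  have hE' : ∀ x, x ∉ E → -x ∉ E := fun x hx h => hx (by simpa using hE _ h)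
  have hneg : Continuous fun p : ℝ × ℝ => (p.1, -p.2) := by fun_prop
  have hC : 0 ≤ C := (abs_nonneg _).trans (hg.along.bound 0 0)
  have hC' : 0 ≤ C' := (abs_nonneg _).trans (hs 0 0)
  have hsum : BddContOff E C' fun t x => μ t x + μ t (-x) :=
    BddContOff.of_continuous (hμ.add (hμ.comp hneg)) hs
  refine ⟨hg.continuous.comp hneg, fun t ht x hx => ?_, fun t ht x hx => ?_,
    (hg.along.comp_neg hE).sub (hsum.mul (hg.deriv_x.comp_neg hE)),
    ((hg.deriv_x.comp_neg hE).neg).mono (by nlinarith [mul_nonneg hC' hC])⟩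
  · exact ((hg.hasDerivAt t ht (-x) (hE' x hx)).comp x (hasDerivAt_neg x)).congr_deriv (by ring)
  · have h1 := hg.hasFDerivAt t ht (-x) (hE' x hx)
    have h2 : HasFDerivAt (fun p : ℝ × ℝ => (p.1, -p.2)) ((ContinuousLinearMap.fst ℝ ℝ ℝ).prod
        (-ContinuousLinearMap.snd ℝ ℝ ℝ)) (t, x) := hasFDerivAt_fst.prodMk hasFDerivAt_snd.neg
    have h3 := HasFDerivAt.comp (t, x) (f := fun p : ℝ × ℝ => (p.1, -p.2)) h1 h2
    refine h3.congr_fderiv ?_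
    ext <;> simp; ring

/-- A continuous function that is differentiable off a countable set with derivative given by a
continuous function is differentiable everywhere. -/
theorem hasDerivAt_of_hasDerivAt_off {E : Set ℝ} (hE : E.Countable) {g g' : ℝ → ℝ}
    (hg : Continuous g) (hg' : Continuous g') (hd : ∀ x ∉ E, HasDerivAt g (g' x) x) (x : ℝ) :
    HasDerivAt g (g' x) x := by
  have h1 : ∀ y, g y = g x + ∫ z in x..y, g' z := fun y => by
    rw [integral_eq_of_hasDerivAt_off_countable g g' hE hg.continuousOn (fun z hz => hd z hz.2)
      (hg'.intervalIntegrable _ _)]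
    ring
  have h2 := (hg'.integral_hasStrictDerivAt x x).hasDerivAt.const_add (g x)
  exact h2.congr_of_eventuallyEq (Eventually.of_forall h1)

/-- Successive differences are halved in the norm with weight exp(-lam t). The weight is bounded
above and below on [0, T], so the convergence is geometric and uniform, and continuity passes to the
limit. -/
theorem exists_limit_of_contraction {T lam : ℝ} (hT : 0 ≤ T) (hlam : 0 ≤ lam)
    (Z : ℕ → ℝ → ℝ → ℝ) (hc : ∀ n, Continuous (Function.uncurry (Z n)))
    (hb : ∃ k, ∀ t x, |Z 1 t x - Z 0 t x| ≤ k)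
    (hcon : ∀ n k, (∀ t x, |Z (n + 1) t x - Z n t x| ≤ k * Real.exp (lam * clampTime T t)) →
      ∀ t x, |Z (n + 2) t x - Z (n + 1) t x| ≤ k / 2 * Real.exp (lam * clampTime T t)) :
    ∃ z : ℝ → ℝ → ℝ, Continuous (Function.uncurry z) ∧
      ∀ ε > 0, ∀ᶠ n in atTop, ∀ t x, |Z n t x - z t x| ≤ ε := by
  obtain ⟨k, hk⟩ := hb
  have hk0 : 0 ≤ k := (abs_nonneg _).trans (hk 0 0)
  have h1 : ∀ n t x, |Z (n + 1) t x - Z n t x| ≤ k / 2 ^ n * Real.exp (lam * clampTime T t) := by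
    intro n
    induction n with
    | zero =>
      intro t x
      have : 1 ≤ Real.exp (lam * clampTime T t) :=
        Real.one_le_exp (mul_nonneg hlam (clampTime_mem hT t).1)
      simp only [pow_zero, div_one]
      exact (hk t x).trans (le_mul_of_one_le_right hk0 this)
    | succ n ih =>
      intro t x
      have := hcon n _ ih t x
      rwa [div_div, ← pow_succ] at this
  set K := 2 * (k * Real.exp (lam * T)) with hK
  have hK0 : 0 ≤ K := by positivity
  have h2 : ∀ t x n, dist (Z n t x) (Z (n + 1) t x) ≤ K / 2 / 2 ^ n := fun t x n => by
    rw [dist_comm, Real.dist_eq]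
    refine (h1 n t x).trans ?_
    rw [hK, mul_div_cancel_left₀ _ (two_ne_zero), div_mul_eq_mul_div]
    have := (clampTime_mem hT t).2
    gcongr
  have h3 : ∀ t x, ∃ l, Tendsto (fun n => Z n t x) atTop (𝓝 l) := fun t x =>
    cauchySeq_tendsto_of_complete (cauchySeq_of_le_geometric_two (h2 t x))
  choose z hz using h3
  have h4 : ∀ n t x, |Z n t x - z t x| ≤ K / 2 ^ n := fun n t x => by
    have := dist_le_of_le_geometric_two_of_tendsto (h2 t x) (hz t x) n
    rwa [Real.dist_eq] at this
  have h5 : ∀ ε > 0, ∀ᶠ n in atTop, ∀ t x, |Z n t x - z t x| ≤ ε := fun ε hε => by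
    have : Tendsto (fun n : ℕ => K / 2 ^ n) atTop (𝓝 0) :=
      tendsto_const_nhds.div_atTop (tendsto_pow_atTop_atTop_of_one_lt one_lt_two)
    filter_upwards [this.eventually (gt_mem_nhds hε)] with n hn t x
    exact (h4 n t x).trans hn.le
  refine ⟨z, ?_, h5⟩
  refine TendstoUniformly.continuous (F := fun n => Function.uncurry (Z n)) (p := atTop) ?_
    (Frequently.of_forall hc)
  rw [Metric.tendstoUniformly_iff]
  intro ε hε
  filter_upwards [h5 (ε / 2) (by linarith)] with n hn p
  rw [dist_comm, Real.dist_eq]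
  exact (hn p.1 p.2).trans_lt (by linarith)

namespace CharField

variable {T L : ℝ} {E : Set ℝ} {μ μx : ℝ → ℝ → ℝ} {X : ℝ → ℝ → ℝ → ℝ}

/-- Integrating the exponential weight gains a factor 1/lam. For large lam this makes the iteration
contract on the whole time interval at once. -/
theorem abs_integral_curve_le (h : CharField T L E μ μx X) {lam M k : ℝ} (hlam : 0 < lam)
    (hk : 0 ≤ k) (hM : 0 ≤ M) {t : ℝ} (ht : t ∈ Icc 0 T) {f : ℝ → ℝ}
    (hf : ∀ s ∈ Icc 0 T, |f s| ≤ M * (k * Real.exp (lam * s))) :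
    |∫ s in (0 : ℝ)..t, f s| ≤ M / lam * (k * Real.exp (lam * t)) := by
  have h0 : (0 : ℝ) ∈ Icc 0 T := ⟨le_rfl, h.pos.le⟩
  have h1 := intervalIntegral.norm_integral_le_of_norm_le (μ := volume) (f := f)
    (g := fun s => M * (k * Real.exp (lam * s))) ht.1
    (Eventually.of_forall fun s hs => hf s ⟨hs.1.le, hs.2.trans ht.2⟩)
    (Continuous.intervalIntegrable (by fun_prop) _ _)
  rw [Real.norm_eq_abs] at h1
  refine h1.trans ?_
  have h2 : ∫ s in (0 : ℝ)..t, M * (k * Real.exp (lam * s)) =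
      M / lam * (k * Real.exp (lam * t)) - M / lam * (k * Real.exp (lam * 0)) := by
    refine intervalIntegral.integral_eq_sub_of_hasDerivAt
      (f := fun s => M / lam * (k * Real.exp (lam * s))) (fun s _ => ?_)
      (Continuous.intervalIntegrable (by fun_prop) _ _)
    have := (((hasDerivAt_id s).const_mul lam).exp.const_mul k).const_mul (M / lam)
    refine this.congr_deriv ?_
    simp only [id]
    field_simp
  rw [h2]
  have : 0 ≤ M / lam * (k * Real.exp (lam * 0)) := by positivity
  linarith

/-- The difference of two transported densities. -/
theorem abs_transportedDensity_sub_le (h : CharField T L E μ μx X) {V₀ : ℝ → ℝ}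
    {S S' : ℝ → ℝ → ℝ} {C C' : ℝ} (hS : BddContOff E C S) (hS' : BddContOff E C' S')
    {lam M k : ℝ} (hlam : 0 < lam) (hk : 0 ≤ k) (hM : 0 ≤ M)
    (hd : ∀ s ∈ Icc 0 T, ∀ x, |S s x - S' s x| ≤ M * (k * Real.exp (lam * s))) (t x : ℝ) :
    |transportedDensity T μx X V₀ S t x - transportedDensity T μx X V₀ S' t x| ≤
      Real.exp (L * T) * M / lam * (k * Real.exp (lam * clampTime T t)) := by
  have h0 : (0 : ℝ) ∈ Icc 0 T := ⟨le_rfl, h.pos.le⟩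
  have hm := clampTime_mem h.pos.le t
  have hcv := h.flow.continuous_curve (clampTime T t) x
  have cJ : ContinuousOn (fun s => flowDeriv μx X (clampTime T t) x s)
      (uIcc 0 (clampTime T t)) := by
    have h1 := h.continuous_flowDeriv.comp (by fun_prop : Continuous fun s : ℝ => (t, x, s))
    refine h1.continuousOn.congr fun s hs => ?_
    have hs' := ordConnected_Icc.uIcc_subset h0 hm hs
    simp only [Function.comp, clampTime_of_mem hs']
  simp only [transportedDensity, add_sub_add_left_eq_sub]
  rw [← intervalIntegral.integral_sub
    ((hS.intervalIntegrable_curve hcv (h.meet _ hm x) h0 hm).continuousOn_mul cJ)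
    ((hS'.intervalIntegrable_curve hcv (h.meet _ hm x) h0 hm).continuousOn_mul cJ)]
  refine h.abs_integral_curve_le hlam hk (by positivity) hm fun s hs => ?_
  rw [← mul_sub, abs_mul, mul_assoc]
  exact mul_le_mul (h.flowDeriv_le hm hs _) (hd s hs _) (abs_nonneg _) (Real.exp_pos _).le

/-- The difference of two transported functions. -/
theorem abs_transported_sub_le (h : CharField T L E μ μx X) {Y₀ : ℝ → ℝ}
    {S S' : ℝ → ℝ → ℝ} {C C' : ℝ} (hS : BddContOff E C S) (hS' : BddContOff E C' S')
    {lam M k : ℝ} (hlam : 0 < lam) (hk : 0 ≤ k) (hM : 0 ≤ M)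
    (hd : ∀ s ∈ Icc 0 T, ∀ x, |S s x - S' s x| ≤ M * (k * Real.exp (lam * s))) (t x : ℝ) :
    |transported T X Y₀ S t x - transported T X Y₀ S' t x| ≤
      M / lam * (k * Real.exp (lam * clampTime T t)) := by
  have h0 : (0 : ℝ) ∈ Icc 0 T := ⟨le_rfl, h.pos.le⟩
  have hm := clampTime_mem h.pos.le t
  have hcv := h.flow.continuous_curve (clampTime T t) x
  simp only [transported, add_sub_add_left_eq_sub]
  rw [← intervalIntegral.integral_sub
    (hS.intervalIntegrable_curve hcv (h.meet _ hm x) h0 hm)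
    (hS'.intervalIntegrable_curve hcv (h.meet _ hm x) h0 hm)]
  exact h.abs_integral_curve_le hlam hk hM hm fun s hs => hd s hs _

/-- A `C¹` function transported along the flow. -/
theorem pwC1_comp_flow (h : CharField T L E μ μx X) {A A' : ℝ → ℝ} {C : ℝ} (hA : Continuous A)
    (hA' : Continuous A') (hb : ∀ x, |A' x| ≤ C) (hd : ∀ x, HasDerivAt A (A' x) x) :
    PwC1 T (C * Real.exp (L * T)) E μ (fun t x => A (X (clampTime T t) x 0)) (fun _ _ => 0)
      (fun t x => A' (X (clampTime T t) x 0) * flowDeriv μx X (clampTime T t) x 0) := by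
  have h0 : (0 : ℝ) ∈ Icc 0 T := ⟨le_rfl, h.pos.le⟩
  have hC : 0 ≤ C := (abs_nonneg _).trans (hb 0)
  have hX : Continuous fun p : ℝ × ℝ => X (clampTime T p.1) p.2 0 :=
    h.continuous_clamp_flow.comp (f := fun p : ℝ × ℝ => (p, (0 : ℝ))) (by fun_prop)
  have hcx : Continuous fun p : ℝ × ℝ =>
      A' (X (clampTime T p.1) p.2 0) * flowDeriv μx X (clampTime T p.1) p.2 0 :=
    (hA'.comp hX).fun_mul (h.continuous_clamp_flowDeriv 0 h0)
  have hder : ∀ t ∈ Icc 0 T, ∀ x ∉ E, HasDerivAt (fun x => A (X (clampTime T t) x 0))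
      (A' (X (clampTime T t) x 0) * flowDeriv μx X (clampTime T t) x 0) x := fun t _ x _ =>
    (hd _).comp x (h.hasDerivAt_flow (clampTime_mem h.pos.le t) h0 x)
  have hfun : (fun t x => A (X (clampTime T t) x 0)) =
      transported T X A fun s y => (0 : ℝ → ℝ → ℝ) s y + (0 : ℝ → ℝ → ℝ) s y := by
    funext t x; simp [transported]
  have hzero : BddContOff E 0 (0 : ℝ → ℝ → ℝ) :=
    BddContOff.of_continuous (by exact continuous_const) (by simp)
  refine ⟨hA.comp hX, hder, fun t ht x hx => ?_,
    hzero.mono (by positivity), BddContOff.of_continuous hcx fun t x => ?_⟩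
  · rw [hfun]
    have := h.hasFDerivAt_transported (Y₀ := A) (G := 0) (S := 0) (Yx := fun t x =>
        A' (X (clampTime T t) x 0) * flowDeriv μx X (clampTime T t) x 0)
      (by exact continuous_const) hzero (fun t ht x hx => by
        have h1 := hder t ht x hx
        rwa [show (fun x => A (X (clampTime T t) x 0)) = _ from congrFun hfun t] at h1) hcx.continuousOn ht hx
    refine this.congr_fderiv ?_
    simp
  · rw [abs_mul]
    exact mul_le_mul (hb _) (h.flowDeriv_le (clampTime_mem h.pos.le t) h0 _) (abs_nonneg _) hC

end CharField
end VortexSheet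

/-! ### Existence for the reflected problem by Picard iteration -/

namespace VortexSheet
open Filter Topology MeasureTheory

/-- The transport of the solution of the reflected problem is a contraction; its fixed point is the
solution. -/
structure IsReflectedSolution (T : ℝ) (E : Set ℝ) (μ μx : ℝ → ℝ → ℝ) (X : ℝ → ℝ → ℝ → ℝ)
    (ϑm ϑx G Gx : ℝ → ℝ → ℝ) (Y₀ V₀ : ℝ → ℝ) (Y V : ℝ → ℝ → ℝ) : Prop where
  continuous : Continuous (Function.uncurry Y)
  continuous_density : Continuous (Function.uncurry V)
  eq_transported : ∀ t x, Y t x =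
    transported T X Y₀ (fun s y => G s y + -(ϑm s y * Y s (-y))) t x
  density_eq : ∀ t x, V t x = transportedDensity T μx X V₀
    (fun s y => Gx s y + ϑx s y * G s (-y) + ϑm s (-y) * V s (-y)) t x
  hasFDerivAt : ∀ t ∈ Ioo 0 T, ∀ x ∉ E, HasFDerivAt (Function.uncurry Y)
    ((G t x - ϑm t x * Y t (-x) - μ t x * (V t x - ϑx t x * Y t (-x))) •
      ContinuousLinearMap.fst ℝ ℝ ℝ +
      (V t x - ϑx t x * Y t (-x)) • ContinuousLinearMap.snd ℝ ℝ ℝ) (t, x)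

namespace ReflectedData

variable {T L C : ℝ} {E : Set ℝ} {μ μx : ℝ → ℝ → ℝ} {X : ℝ → ℝ → ℝ → ℝ}
  {ϑ ϑm ϑx G Gx : ℝ → ℝ → ℝ} {Y₀ Y₀' V₀ : ℝ → ℝ}

theorem nonneg (D : ReflectedData T L C E μ μx X ϑ ϑm ϑx G Gx Y₀ Y₀' V₀) : 0 ≤ C :=
  (abs_nonneg _).trans (D.init_bound 0)

theorem exists_base (D : ReflectedData T L C E μ μx X ϑ ϑm ϑx G Gx Y₀ Y₀' V₀) :
    ∃ (W Wm Wx : ℝ → ℝ → ℝ) (K : ℝ), PwC1 T K E μ W Wm Wx ∧ (∀ t x, |W t x| ≤ K) ∧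
      ∀ x, W 0 x = Y₀ x := by
  have h := D.field
  have hC := D.nonneg
  have h0 : (0 : ℝ) ∈ Icc 0 T := ⟨le_rfl, h.pos.le⟩
  have hE' : ∀ x, x ∉ E → -x ∉ E := fun x hx h => hx (by simpa using D.symm _ h)
  have hYn : ∀ x ∉ E, HasDerivAt (fun x => Y₀ (-x)) (-Y₀' (-x)) x := fun x hx =>
    ((D.init_deriv (-x) (hE' x hx)).comp x (hasDerivAt_neg x)).congr_deriv (by ring)
  have cY := D.init
  have cV := D.init_density
  have cϑ0 : Continuous (ϑ 0) :=
    D.coeff.continuous.comp (by fun_prop : Continuous fun x : ℝ => ((0 : ℝ), x))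
  -- The initial values may have kinks on `E`, and transporting them directly would move the kinks
  -- off `E`. In `A` and `B` the jumps of `Y₀'` and `ϑx` cancel, leaving derivatives given by the
  -- continuous `V₀`. So `A` and `B` are C¹ and can be transported; the inverse combination, with ϑ
  -- taken at time t, restores `Y₀` at time zero and has kinks at most on `E`.
  let A : ℝ → ℝ := fun x => Real.exp (ϑ 0 x) * (Y₀ x + Y₀ (-x))
  let A' : ℝ → ℝ := fun x => Real.exp (ϑ 0 x) * (V₀ x - V₀ (-x))
  let B : ℝ → ℝ := fun x => Real.exp (-ϑ 0 x) * (Y₀ (-x) - Y₀ x)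
  let B' : ℝ → ℝ := fun x => -(Real.exp (-ϑ 0 x) * (V₀ x + V₀ (-x)))
  have hA : Continuous A := by fun_prop
  have hA' : Continuous A' := by fun_prop
  have hB : Continuous B := by fun_prop
  have hB' : Continuous B' := by fun_prop
  have bexp : ∀ t x, |Real.exp (ϑ t x)| ≤ Real.exp C := fun t x => by
    rw [abs_of_pos (Real.exp_pos _)]
    exact Real.exp_le_exp.2 (abs_le.1 (D.coeff_bound t x)).2
  have bexpn : ∀ t x, |Real.exp (-ϑ t x)| ≤ Real.exp C := fun t x => by
    rw [abs_of_pos (Real.exp_pos _)]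
    exact Real.exp_le_exp.2 (by linarith [(abs_le.1 (D.coeff_bound t x)).1])
  have hpm : ∀ {a b : ℝ}, |a| ≤ C → |b| ≤ C → |a + b| ≤ 2 * C ∧ |a - b| ≤ 2 * C :=
    fun ha hb => ⟨(abs_add_le _ _).trans (by linarith), (abs_sub _ _).trans (by linarith)⟩
  have bA : ∀ x, |A x| ≤ Real.exp C * (2 * C) := fun x => by
    simp only [A, abs_mul]
    exact mul_le_mul (bexp 0 x) (hpm (D.init_bound _) (D.init_bound _)).1 (abs_nonneg _)
      (Real.exp_pos _).le
  have bB : ∀ x, |B x| ≤ Real.exp C * (2 * C) := fun x => by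
    simp only [B, abs_mul]
    exact mul_le_mul (bexpn 0 x) (hpm (D.init_bound _) (D.init_bound _)).2 (abs_nonneg _)
      (Real.exp_pos _).le
  have bA' : ∀ x, |A' x| ≤ Real.exp C * (2 * C) := fun x => by
    simp only [A', abs_mul]
    exact mul_le_mul (bexp 0 x) (hpm (D.init_density_bound _) (D.init_density_bound _)).2
      (abs_nonneg _) (Real.exp_pos _).le
  have bB' : ∀ x, |B' x| ≤ Real.exp C * (2 * C) := fun x => by
    simp only [B', abs_neg, abs_mul]
    exact mul_le_mul (bexpn 0 x) (hpm (D.init_density_bound _) (D.init_density_bound _)).1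
      (abs_nonneg _) (Real.exp_pos _).le
  have hϑ0 : ∀ x ∉ E, HasDerivAt (ϑ 0) (ϑx 0 x) x := D.coeff.hasDerivAt 0 h0
  have hY' : ∀ x ∉ E, Y₀' (-x) = V₀ (-x) + ϑx 0 x * Y₀ x := fun x hx => by
    have := D.init_eq (-x) (hE' x hx)
    rw [neg_neg, D.coeff_x_neg] at this
    linarith
  have dA := hasDerivAt_of_hasDerivAt_off h.countable hA hA' fun x hx => by
    refine ((hϑ0 x hx).exp.mul ((D.init_deriv x hx).add (hYn x hx))).congr_deriv ?_
    simp only [A', hY' x hx, D.init_eq x hx, Pi.add_apply]; ring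
  have dB := hasDerivAt_of_hasDerivAt_off h.countable hB hB' fun x hx => by
    refine ((hϑ0 x hx).neg.exp.mul ((hYn x hx).sub (D.init_deriv x hx))).congr_deriv ?_
    simp only [B', hY' x hx, D.init_eq x hx, Pi.sub_apply, Pi.neg_apply]; ring
  have pA := h.pwC1_comp_flow hA hA' bA' dA
  have pB := h.pwC1_comp_flow hB hB' bB' dB
  have e1 : Continuous (Function.uncurry fun t x => Real.exp (ϑ t x)) :=
    Real.continuous_exp.comp D.coeff.continuous
  have e2 : Continuous (Function.uncurry fun t x => Real.exp (-ϑ t x)) :=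
    Real.continuous_exp.comp D.coeff.continuous.neg
  have b1 := BddContOff.of_continuous (E := E) e1 bexp
  have b2 := BddContOff.of_continuous (E := E) e2 bexpn
  have b3 := BddContOff.of_continuous (E := E) pA.continuous fun t x => bA _
  have b4 := BddContOff.of_continuous (E := E) pB.continuous fun t x => bB _
  set At : ℝ → ℝ → ℝ := fun t x => A (X (clampTime T t) x 0)
  set Bt : ℝ → ℝ → ℝ := fun t x => B (X (clampTime T t) x 0)
  set Ax : ℝ → ℝ → ℝ := fun t x => A' (X (clampTime T t) x 0) * flowDeriv μx X (clampTime T t) x 0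
  set Bx : ℝ → ℝ → ℝ := fun t x => B' (X (clampTime T t) x 0) * flowDeriv μx X (clampTime T t) x 0
  have bhalf : BddContOff E 1 fun _ _ : ℝ => (1 / 2 : ℝ) :=
    BddContOff.of_continuous (by exact continuous_const)
      (fun _ _ => by rw [abs_of_pos] <;> norm_num)
  have hW := bhalf.mul ((b2.mul b3).sub (b1.mul b4))
  have hWm := bhalf.mul (((D.coeff.along.neg.mul (b2.mul b3))).sub (D.coeff.along.mul (b1.mul b4)))
  have hWx := bhalf.mul ((((D.coeff.deriv_x.neg.mul (b2.mul b3))).add (b2.mul pA.deriv_x)).sub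
    ((D.coeff.deriv_x.mul (b1.mul b4)).add (b1.mul pB.deriv_x)))
  obtain ⟨K, hK1, hK2, hK3⟩ : ∃ K : ℝ, _ ≤ K ∧ _ ≤ K ∧ _ ≤ K :=
    ⟨max _ (max _ _), le_max_left _ _, (le_max_left _ _).trans (le_max_right _ _),
      (le_max_right _ _).trans (le_max_right _ _)⟩
  refine ⟨_, _, _, K, ⟨?_, fun t ht x hx => ?_, fun t ht x hx => ?_, hWm.mono hK1, hWx.mono hK2⟩,
    (hW.mono hK3).bound, fun x => ?_⟩
  · exact continuous_const.mul ((e2.mul pA.continuous).sub (e1.mul pB.continuous))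
  · have d := D.coeff.hasDerivAt t ht x hx
    refine (((d.neg.exp.mul (pA.hasDerivAt t ht x hx)).sub
      (d.exp.mul (pB.hasDerivAt t ht x hx))).const_mul (1 / 2)).congr_deriv ?_
    simp only [Pi.neg_apply]; ring
  · have d := D.coeff.hasFDerivAt t ht x hx
    have dA := pA.hasFDerivAt t ht x hx
    have dB := pB.hasFDerivAt t ht x hx
    have := (((d.neg.exp).mul dA).sub ((d.exp).mul dB)).const_mul (1 / 2)
    refine this.congr_fderiv ?_
    ext <;> simp [Function.uncurry] <;> ring
  · simp only [At, Bt, A, B, clampTime_of_mem h0, h.flow.initial 0 h0]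
    rw [← mul_assoc, ← mul_assoc, ← Real.exp_add, ← Real.exp_add]
    simp only [neg_add_cancel, add_neg_cancel, Real.exp_zero]
    ring

/-- One step of the iteration. -/
theorem step (D : ReflectedData T L C E μ μx X ϑ ϑm ϑx G Gx Y₀ Y₀' V₀) {W Wm Wx : ℝ → ℝ → ℝ} {K : ℝ}
    (hW : PwC1 T K E μ W Wm Wx) (hWb : ∀ t x, |W t x| ≤ K) (hW0 : ∀ x, W 0 x = Y₀ (-x)) :
    ∃ K', PwC1 T K' E μ (transported T X Y₀ fun s y => G s y + -(ϑm s y * W s y))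
      (fun t x => G t x - ϑm t x * W t x)
      (fun t x => transportedDensity T μx X V₀
        (fun s y => Gx s y - ϑm s y * Wx s y + ϑx s y * Wm s y) t x - ϑx t x * W t x) ∧
      (∀ t x, |transported T X Y₀ (fun s y => G s y + -(ϑm s y * W s y)) t x| ≤ K') ∧
      Continuous (Function.uncurry (transportedDensity T μx X V₀
        (fun s y => Gx s y - ϑm s y * Wx s y + ϑx s y * Wm s y))) ∧
      ∀ t x, |transportedDensity T μx X V₀
        (fun s y => Gx s y - ϑm s y * Wx s y + ϑx s y * Wm s y) t x| ≤ K' := by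
  have h := D.field
  have h0 : (0 : ℝ) ∈ Icc 0 T := ⟨le_rfl, h.pos.le⟩
  have hbW := BddContOff.of_continuous (E := E) hW.continuous hWb
  have hbG := BddContOff.of_continuous (E := E) D.source D.source_bound
  have hN : BddContOff E _ (fun s y => Gx s y - ϑm s y * Wx s y + ϑx s y * Wm s y) :=
    (D.source_x.sub (D.coeff.along.mul hW.deriv_x)).add (D.coeff.deriv_x.mul hW.along)
  have hϑW := D.coeff.along.mul hbW
  have hVc := h.continuous_transportedDensity D.init_density hN
  have hVb := h.abs_transportedDensity_le D.init_density_bound hN.bound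
  have hYc := h.continuous_transported D.init D.source hϑW.neg
  have hYb := h.abs_transported_le D.init_bound (hbG.add hϑW.neg).bound
  have hV := BddContOff.of_continuous (E := E) hVc hVb
  have hx := hV.sub (D.coeff.deriv_x.mul hbW)
  have hm := hbG.sub hϑW
  have hd : ∀ t ∈ Icc 0 T, ∀ x ∉ E, HasDerivAt
      (transported T X Y₀ (fun s y => G s y + -(ϑm s y * W s y)) t)
      (transportedDensity T μx X V₀
        (fun s y => Gx s y - ϑm s y * Wx s y + ϑx s y * Wm s y) t x - ϑx t x * W t x) x :=
    fun t ht x hx => h.hasDerivAt_transported D.coeff hW hWb D.source D.source_deriv D.source_x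
      D.init D.init_deriv D.init_density (fun x hx => by rw [D.init_eq x hx, hW0]) ht hx
  obtain ⟨K', h1, h2, h3, h4⟩ : ∃ K : ℝ, _ ≤ K ∧ _ ≤ K ∧ _ ≤ K ∧ _ ≤ K :=
    ⟨max (max _ _) (max _ _), (le_max_left _ _).trans (le_max_left _ _),
      (le_max_right _ _).trans (le_max_left _ _), (le_max_left _ _).trans (le_max_right _ _),
      (le_max_right _ _).trans (le_max_right _ _)⟩
  refine ⟨K', ⟨hYc, hd, fun t ht x hxE => ?_, hm.mono h1, hx.mono h2⟩,
    fun t x => (hYb t x).trans h3, hVc, fun t x => (hVb t x).trans h4⟩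
  exact h.hasFDerivAt_transported D.source hϑW.neg hd hx.continuousOn ht hxE

theorem exists_solution (D : ReflectedData T L C E μ μx X ϑ ϑm ϑx G Gx Y₀ Y₀' V₀) :
    ∃ Y V, IsReflectedSolution T E μ μx X ϑm ϑx G Gx Y₀ V₀ Y V := by
  have h := D.field
  have hC := D.nonneg
  have h0 : (0 : ℝ) ∈ Icc 0 T := ⟨le_rfl, h.pos.le⟩
  have hneg : Continuous fun p : ℝ × ℝ => (p.1, -p.2) := by fun_prop
  obtain ⟨Yb, Ybm, Ybx, Kb, hYb, hYbb, hYb0⟩ := D.exists_base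
  have hWb := hYb.reflect D.symm h.continuous D.sum_bound
  let opY : (ℝ → ℝ → ℝ) → ℝ → ℝ → ℝ := fun Z =>
    transported T X Y₀ fun s y => G s y + -(ϑm s y * Z s (-y))
  let opV : (ℝ → ℝ → ℝ) → ℝ → ℝ → ℝ := fun Z => transportedDensity T μx X V₀ fun s y =>
    Gx s y + ϑx s y * G s (-y) + ϑm s (-y) * Z s (-y)
  let Ys : ℕ → ℝ → ℝ → ℝ := fun n => opY^[n] Yb
  -- The index is shifted: `Vs n` is the density of `Ys (n + 1)`. The base `Yb` is not produced by
  -- the iteration step, so the first density is computed from the derivatives of its reflection.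
  let Vb : ℝ → ℝ → ℝ := transportedDensity T μx X V₀ fun s y =>
    Gx s y - ϑm s y * (-Ybx s (-y)) +
      ϑx s y * (Ybm s (-y) - (μ s y + μ s (-y)) * Ybx s (-y))
  let Vs : ℕ → ℝ → ℝ → ℝ := fun n => opV^[n] Vb
  have hYs : ∀ n, Ys (n + 1) = opY (Ys n) := fun n => Function.iterate_succ_apply' _ _ _
  have hVs : ∀ n, Vs (n + 1) = opV (Vs n) := fun n => Function.iterate_succ_apply' _ _ _
  have hY0 : ∀ n x, Ys n 0 x = Y₀ x := fun n x => by
    cases n with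
    | zero => exact hYb0 x
    | succ n =>
      rw [hYs]
      simp [opY, transported, clampTime_of_mem h0, h.flow.initial 0 h0]
  have hQ : ∀ n, ∃ K, PwC1 T K E μ (Ys (n + 1)) (fun t x => G t x - ϑm t x * Ys n t (-x))
      (fun t x => Vs n t x - ϑx t x * Ys n t (-x)) ∧ (∀ t x, |Ys (n + 1) t x| ≤ K) ∧
      Continuous (Function.uncurry (Vs n)) ∧ ∀ t x, |Vs n t x| ≤ K := by
    intro n
    induction n with
    | zero =>
      obtain ⟨K', hK'⟩ : ∃ K', Kb ≤ K' ∧ Kb + C * Kb ≤ K' :=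
        ⟨max _ _, le_max_left _ _, le_max_right _ _⟩
      exact D.step (K := K') ⟨hWb.continuous, hWb.hasDerivAt, hWb.hasFDerivAt,
        hWb.along.mono hK'.2, hWb.deriv_x.mono hK'.2⟩ (fun t x => (hYbb t (-x)).trans hK'.1)
        fun x => hYb0 (-x)
    | succ n ih =>
      obtain ⟨K, hP, hb, -, -⟩ := ih
      have hR := hP.reflect D.symm h.continuous D.sum_bound
      obtain ⟨K', hK'⟩ : ∃ K', K ≤ K' ∧ K + C * K ≤ K' :=
        ⟨max _ _, le_max_left _ _, le_max_right _ _⟩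
      have hst := D.step (K := K') ⟨hR.continuous, hR.hasDerivAt, hR.hasFDerivAt,
        hR.along.mono hK'.2, hR.deriv_x.mono hK'.2⟩ (fun t x => (hb t (-x)).trans hK'.1)
        fun x => hY0 (n + 1) (-x)
      -- When the derivatives of the reflected iterate are inserted, every term containing `Ys`
      -- itself cancels by the reflection rules for `ϑx` and `ϑm`. The densities therefore obey an
      -- iteration of their own.
      have hN : (fun s y => Gx s y - ϑm s y * -(Vs n s (-y) - ϑx s (-y) * Ys n s (- -y)) +
          ϑx s y * (G s (-y) - ϑm s (-y) * Ys n s (- -y) -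
            (μ s y + μ s (-y)) * (Vs n s (-y) - ϑx s (-y) * Ys n s (- -y)))) =
          fun s y => Gx s y + ϑx s y * G s (-y) + ϑm s (-y) * Vs n s (-y) := by
        funext s y
        rw [D.coeff_x_neg, D.coeff_along_neg]; ring
      rw [hN] at hst
      rw [hYs (n + 1), hVs]
      exact hst
  have cY : ∀ n, Continuous (Function.uncurry (Ys n)) := fun n => by
    cases n with
    | zero => exact hYb.continuous
    | succ n => obtain ⟨K, hP, -⟩ := hQ n; exact hP.continuous
  have bY : ∀ n, ∃ K, ∀ t x, |Ys n t x| ≤ K := fun n => by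
    cases n with
    | zero => exact ⟨Kb, hYbb⟩
    | succ n => obtain ⟨K, -, hb, -⟩ := hQ n; exact ⟨K, hb⟩
  have cV : ∀ n, Continuous (Function.uncurry (Vs n)) := fun n => (hQ n).choose_spec.2.2.1
  have bV : ∀ n, ∃ K, ∀ t x, |Vs n t x| ≤ K := fun n => ⟨_, (hQ n).choose_spec.2.2.2⟩
  have hbG := BddContOff.of_continuous (E := E) D.source D.source_bound
  have srcY : ∀ {Z : ℝ → ℝ → ℝ} {K : ℝ}, Continuous (Function.uncurry Z) → (∀ t x, |Z t x| ≤ K) →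
      BddContOff E (C + C * K) fun s y => G s y + -(ϑm s y * Z s (-y)) := fun hZ hK =>
    hbG.add (D.coeff.along.mul ((BddContOff.of_continuous hZ hK).comp_neg D.symm)).neg
  have srcV : ∀ {Z : ℝ → ℝ → ℝ} {K : ℝ}, Continuous (Function.uncurry Z) → (∀ t x, |Z t x| ≤ K) →
      BddContOff E (C + C * C + C * K) fun s y =>
        Gx s y + ϑx s y * G s (-y) + ϑm s (-y) * Z s (-y) := fun hZ hK =>
    (D.source_x.add (D.coeff.deriv_x.mul (hbG.comp_neg D.symm))).add
      ((D.coeff.along.comp_neg D.symm).mul ((BddContOff.of_continuous hZ hK).comp_neg D.symm))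
  have dY : ∀ {lam : ℝ}, 0 < lam → ∀ {Z Z' : ℝ → ℝ → ℝ} {K K' k : ℝ},
      Continuous (Function.uncurry Z) → (∀ t x, |Z t x| ≤ K) →
      Continuous (Function.uncurry Z') → (∀ t x, |Z' t x| ≤ K') →
      (∀ t x, |Z t x - Z' t x| ≤ k * Real.exp (lam * clampTime T t)) →
      ∀ t x, |opY Z t x - opY Z' t x| ≤ C / lam * (k * Real.exp (lam * clampTime T t)) := by
    intro lam hlam Z Z' K K' k hZ hK hZ' hK' hd t x
    have hk : 0 ≤ k := by
      have := (abs_nonneg _).trans (hd 0 0)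
      exact nonneg_of_mul_nonneg_left this (Real.exp_pos _)
    refine h.abs_transported_sub_le (srcY hZ hK) (srcY hZ' hK') hlam hk hC (fun s hs y => ?_) t x
    have := hd s (-y)
    rw [clampTime_of_mem hs] at this
    rw [show G s y + -(ϑm s y * Z s (-y)) - (G s y + -(ϑm s y * Z' s (-y))) =
      -(ϑm s y * (Z s (-y) - Z' s (-y))) by ring, abs_neg, abs_mul]
    exact mul_le_mul (D.coeff.along.bound _ _) this (abs_nonneg _) hC
  have dV : ∀ {lam : ℝ}, 0 < lam → ∀ {Z Z' : ℝ → ℝ → ℝ} {K K' k : ℝ},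
      Continuous (Function.uncurry Z) → (∀ t x, |Z t x| ≤ K) →
      Continuous (Function.uncurry Z') → (∀ t x, |Z' t x| ≤ K') →
      (∀ t x, |Z t x - Z' t x| ≤ k * Real.exp (lam * clampTime T t)) →
      ∀ t x, |opV Z t x - opV Z' t x| ≤
        Real.exp (L * T) * C / lam * (k * Real.exp (lam * clampTime T t)) := by
    intro lam hlam Z Z' K K' k hZ hK hZ' hK' hd t x
    have hk : 0 ≤ k := by
      have := (abs_nonneg _).trans (hd 0 0)
      exact nonneg_of_mul_nonneg_left this (Real.exp_pos _)
    refine h.abs_transportedDensity_sub_le (srcV hZ hK) (srcV hZ' hK') hlam hk hC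
      (fun s hs y => ?_) t x
    have := hd s (-y)
    rw [clampTime_of_mem hs] at this
    rw [add_sub_add_left_eq_sub, ← mul_sub, abs_mul]
    exact mul_le_mul (D.coeff.along.bound _ _) this (abs_nonneg _) hC
  -- The two rates are chosen so that a/(2a + 1) ≤ 1/2 gives the contraction factor, with a = C for
  -- the functions and a = e^{LT}C for the densities.
  have hlY : 0 < 2 * C + 1 := by linarith
  have hexp : 0 < Real.exp (L * T) := Real.exp_pos _
  have hlV : 0 < 2 * (Real.exp (L * T) * C) + 1 := by positivity
  have contr : ∀ {a k e : ℝ}, 0 ≤ a → 0 ≤ k * e → a / (2 * a + 1) * (k * e) ≤ k / 2 * e := by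
    intro a k e ha hke
    have : a / (2 * a + 1) ≤ 1 / 2 := by
      rw [div_le_div_iff₀ (by linarith) two_pos]; linarith
    calc a / (2 * a + 1) * (k * e) ≤ 1 / 2 * (k * e) := mul_le_mul_of_nonneg_right this hke
      _ = k / 2 * e := by ring
  have bdiff : ∀ {Z Z' : ℝ → ℝ → ℝ}, (∃ K, ∀ t x, |Z t x| ≤ K) → (∃ K, ∀ t x, |Z' t x| ≤ K) →
      ∃ K, ∀ t x, |Z t x - Z' t x| ≤ K := fun ⟨K, hK⟩ ⟨K', hK'⟩ =>
    ⟨K + K', fun t x => (abs_sub _ _).trans (add_le_add (hK t x) (hK' t x))⟩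
  obtain ⟨Y, hYc, hYl⟩ := exists_limit_of_contraction h.pos.le hlY.le Ys cY
    (bdiff (bY 1) (bY 0)) fun n k hd t x => by
      obtain ⟨K, hK⟩ := bY (n + 1)
      obtain ⟨K', hK'⟩ := bY n
      have := dY hlY (cY (n + 1)) hK (cY n) hK' hd t x
      rw [← hYs, ← hYs] at this
      exact this.trans (contr hC ((abs_nonneg _).trans (hd t x)))
  obtain ⟨V, hVc, hVl⟩ := exists_limit_of_contraction h.pos.le hlV.le Vs cV
    (bdiff (bV 1) (bV 0)) fun n k hd t x => by
      obtain ⟨K, hK⟩ := bV (n + 1)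
      obtain ⟨K', hK'⟩ := bV n
      have := dV hlV (cV (n + 1)) hK (cV n) hK' hd t x
      rw [← hVs, ← hVs] at this
      exact this.trans (contr (by positivity) ((abs_nonneg _).trans (hd t x)))
  have lim : ∀ {Zs : ℕ → ℝ → ℝ → ℝ} {Z : ℝ → ℝ → ℝ},
      (∀ ε > 0, ∀ᶠ n in atTop, ∀ t x, |Zs n t x - Z t x| ≤ ε) →
      ∀ t x, Tendsto (fun n => Zs n t x) atTop (𝓝 (Z t x)) := fun hl t x => by
    rw [Metric.tendsto_nhds]
    intro ε hε
    filter_upwards [hl (ε / 2) (by linarith)] with n hn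
    rw [Real.dist_eq]
    exact (hn t x).trans_lt (by linarith)
  have bnd : ∀ {Zs : ℕ → ℝ → ℝ → ℝ} {Z : ℝ → ℝ → ℝ},
      (∀ ε > 0, ∀ᶠ n in atTop, ∀ t x, |Zs n t x - Z t x| ≤ ε) →
      (∀ n, ∃ K, ∀ t x, |Zs n t x| ≤ K) → ∃ K, ∀ t x, |Z t x| ≤ K := fun hl hb => by
    obtain ⟨n, hn⟩ := (hl 1 one_pos).exists
    obtain ⟨K, hK⟩ := hb n
    refine ⟨K + 1, fun t x => ?_⟩
    have h1 := hn t x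
    have h2 := hK t x
    rw [abs_le] at *
    constructor <;> linarith
  obtain ⟨KY, hKY⟩ := bnd hYl bY
  obtain ⟨KV, hKV⟩ := bnd hVl bV
  have fix : ∀ {op : (ℝ → ℝ → ℝ) → ℝ → ℝ → ℝ} {Zs : ℕ → ℝ → ℝ → ℝ} {Z : ℝ → ℝ → ℝ} {c : ℝ},
      0 ≤ c → (∀ ε > 0, ∀ᶠ n in atTop, ∀ t x, |Zs n t x - Z t x| ≤ ε) →
      (∀ n, Zs (n + 1) = op (Zs n)) → (∀ n k, (∀ t x, |Zs n t x - Z t x| ≤ k) →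
        ∀ t x, |op (Zs n) t x - op Z t x| ≤ c * k) → ∀ t x, Z t x = op Z t x := by
    intro op Zs Z c hc hl hs hop t x
    have h1 : Tendsto (fun n => Zs (n + 1) t x) atTop (𝓝 (op Z t x)) := by
      rw [Metric.tendsto_nhds]
      intro ε hε
      have hε' : 0 < ε / (c + 1) := by positivity
      filter_upwards [hl _ hε'] with n hn
      rw [Real.dist_eq, hs]
      refine (hop n _ hn t x).trans_lt ?_
      rw [mul_div_assoc', div_lt_iff₀ (by linarith)]
      nlinarith
    exact tendsto_nhds_unique ((tendsto_add_atTop_iff_nat 1).2 (lim hl t x)) h1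
  have one_le_exp : ∀ t, 1 ≤ Real.exp (1 * clampTime T t) := fun t =>
    Real.one_le_exp (by rw [one_mul]; exact (clampTime_mem h.pos.le t).1)
  have exp_le : ∀ t, Real.exp (1 * clampTime T t) ≤ Real.exp T := fun t =>
    Real.exp_le_exp.2 (by rw [one_mul]; exact (clampTime_mem h.pos.le t).2)
  have eqY : ∀ t x, Y t x = opY Y t x := by
    refine fix (c := C / 1 * Real.exp T) (by positivity) hYl hYs fun n k hk t x => ?_
    obtain ⟨K, hK⟩ := bY n
    have hk0 : 0 ≤ k := (abs_nonneg _).trans (hk 0 0)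
    refine (dY one_pos (cY n) hK hYc hKY (fun t x =>
      (hk t x).trans (le_mul_of_one_le_right hk0 (one_le_exp t))) t x).trans ?_
    rw [mul_assoc, mul_comm (Real.exp T)]
    have := exp_le t
    gcongr
  have eqV : ∀ t x, V t x = opV V t x := by
    refine fix (c := Real.exp (L * T) * C / 1 * Real.exp T) (by positivity) hVl hVs
      fun n k hk t x => ?_
    obtain ⟨K, hK⟩ := bV n
    have hk0 : 0 ≤ k := (abs_nonneg _).trans (hk 0 0)
    refine (dV one_pos (cV n) hK hVc hKV (fun t x =>
      (hk t x).trans (le_mul_of_one_le_right hk0 (one_le_exp t))) t x).trans ?_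
    rw [mul_assoc, mul_comm (Real.exp T)]
    have := exp_le t
    gcongr
  -- Off `E` the derivatives of the iterates converge uniformly, because `ϑx` is bounded and both
  -- sequences converge uniformly; the limit is therefore differentiable with the limiting
  -- derivative.
  have hder : ∀ t ∈ Icc 0 T, ∀ x ∉ E, HasDerivAt (Y t) (V t x - ϑx t x * Y t (-x)) x := by
    intro t ht x hx
    refine hasDerivAt_of_tendstoUniformlyOn (f := fun n => Ys (n + 1) t)
      (f' := fun n x => Vs n t x - ϑx t x * Ys n t (-x))
      (g' := fun x => V t x - ϑx t x * Y t (-x)) (l := atTop) h.closed.isOpen_compl ?_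
      (Eventually.of_forall fun n y hy => ?_)
      (fun y _ => (tendsto_add_atTop_iff_nat 1).2 (lim hYl t y)) hx
    · rw [Metric.tendstoUniformlyOn_iff]
      intro ε hε
      have hε' : 0 < ε / (2 * (C + 1)) := by positivity
      filter_upwards [hYl _ hε', hVl (ε / 3) (by linarith)] with n hn1 hn2 y _
      rw [dist_comm, Real.dist_eq, show Vs n t y - ϑx t y * Ys n t (-y) -
        (V t y - ϑx t y * Y t (-y)) = (Vs n t y - V t y) -
          ϑx t y * (Ys n t (-y) - Y t (-y)) by ring]
      have h1 : |ϑx t y * (Ys n t (-y) - Y t (-y))| ≤ C * (ε / (2 * (C + 1))) := by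
        rw [abs_mul]
        exact mul_le_mul (D.coeff.deriv_x.bound _ _) (hn1 t (-y)) (abs_nonneg _) hC
      have h2 : C * (ε / (2 * (C + 1))) ≤ ε / 2 := by
        rw [mul_div_assoc', div_le_div_iff₀ (by linarith) two_pos]; nlinarith
      have h3 := hn2 t y
      have h4 := abs_sub (Vs n t y - V t y) (ϑx t y * (Ys n t (-y) - Y t (-y)))
      linarith
    · obtain ⟨K, hP, -⟩ := hQ n
      exact hP.hasDerivAt t ht y hy
  refine ⟨Y, V, hYc, hVc, eqY, eqV, fun t ht x hx => ?_⟩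
  have hbY := BddContOff.of_continuous (E := E) hYc hKY
  have := h.hasFDerivAt_transported (Y₀ := Y₀) (G := G)
    (S := fun s y => -(ϑm s y * Y s (-y))) (Yx := fun t x => V t x - ϑx t x * Y t (-x)) D.source
    (D.coeff.along.mul (hbY.comp_neg D.symm)).neg
    (fun t ht x hx => (hder t ht x hx).congr_of_eventuallyEq
      (Eventually.of_forall fun y => (eqY t y).symm))
    ((BddContOff.of_continuous (E := E) hVc hKV).sub
      (D.coeff.deriv_x.mul (hbY.comp_neg D.symm))).continuousOn ht hx
  rw [← sub_eq_add_neg] at this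
  exact this.congr_of_eventuallyEq (Eventually.of_forall fun p => eqY p.1 p.2)

end ReflectedData
end VortexSheet

namespace VortexSheet
open Filter Topology MeasureTheory

/-! ### Comparison along curves -/

/-- A quantitative form of the linear growth of the field, which supplies the cones in
`abs_le_of_integral_inequality`. -/
theorem IsFlow.one_add_sq_le {T L : ℝ} {μ : ℝ → ℝ → ℝ} {X : ℝ → ℝ → ℝ → ℝ} (hX : IsFlow T μ X)
    (hT : 0 ≤ T) (hc : Continuous (Function.uncurry μ))
    (hμ : ∀ t x y, |μ t x - μ t y| ≤ L * |x - y|) :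
    ∃ c, 0 ≤ c ∧ ∀ t ∈ Icc 0 T, ∀ s ∈ Icc 0 T, ∀ x,
      1 + X t x s ^ 2 ≤ (1 + x ^ 2) * Real.exp (c * |s - t|) := by
  obtain ⟨A, hA⟩ : ∃ A, ∀ s ∈ Icc 0 T, |μ s 0| ≤ A := by
    have : Continuous fun s => μ s 0 := hc.comp (by fun_prop : Continuous fun s : ℝ => (s, (0 : ℝ)))
    exact isCompact_Icc.exists_bound_of_continuousOn this.continuousOn
  have hA0 : 0 ≤ A := (abs_nonneg _).trans (hA 0 ⟨le_rfl, hT⟩)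
  have hL : 0 ≤ L := by
    have := (abs_nonneg _).trans (hμ 0 1 0)
    simpa using this
  refine ⟨A + 2 * L, by positivity, fun t ht s hs x => ?_⟩
  have := le_mul_exp_of_abs_deriv_le (T := T) (c := A + 2 * L) (g := fun s => 1 + X t x s ^ 2)
    (by have := hX.continuous_curve t x; fun_prop)
    (fun s hs => ((hX.hasDerivAt t ht x s hs).pow 2).const_add 1) (fun s hs => by
      have h1 := hμ s (X t x s) 0
      have h2 := hA s (Ioo_subset_Icc_self hs)
      have h3 : |μ s (X t x s)| ≤ A + L * |X t x s| := by
        have := abs_add_le (μ s (X t x s) - μ s 0) (μ s 0)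
        rw [sub_add_cancel] at this
        rw [sub_zero] at h1
        linarith
      simp only [Nat.cast_ofNat, Nat.add_one_sub_one, pow_one, abs_mul]
      rw [abs_of_pos (by norm_num : (0 : ℝ) < 2), ← sq_abs (X t x s)]
      have h4 := abs_nonneg (X t x s)
      have h5 := mul_le_mul_of_nonneg_left h3 h4
      nlinarith [mul_nonneg hA0 (sq_nonneg (|X t x s| - 1))]) hs ht
  simpa only [hX.initial t ht] using this

/-- Grönwall's inequality for a function that is not known to be bounded. The set (1 + y²)e^{ct} ≤ N
with 0 ≤ t ≤ τ is compact, contains the backward characteristics of its points and is symmetric in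
y, so |Y|e^{-4Mt} attains a maximum on it. At the maximum the rate 4M makes the integral at most
half of the left-hand side, whence the factor 2. -/
theorem IsFlow.abs_le_of_integral_inequality {T L M A : ℝ} {μ : ℝ → ℝ → ℝ} {X : ℝ → ℝ → ℝ → ℝ}
    (hX : IsFlow T μ X) (hc : Continuous (Function.uncurry μ))
    (hμ : ∀ t x y, |μ t x - μ t y| ≤ L * |x - y|) {Y : ℝ → ℝ → ℝ}
    (hY : Continuous (Function.uncurry Y)) (hM : 0 ≤ M) {τ : ℝ} (hτ : τ ∈ Icc 0 T)
    (h : ∀ t ∈ Icc 0 τ, ∀ x, |Y t x| ≤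
      A + ∫ s in (0 : ℝ)..t, M * (|Y s (X t x s)| + |Y s (-X t x s)|)) (x : ℝ) :
    |Y τ x| ≤ 2 * A * Real.exp (4 * M * τ) := by
  have hT := hτ.1.trans hτ.2
  obtain ⟨c, hc0, hcone⟩ := hX.one_add_sq_le hT hc hμ
  have hA : 0 ≤ A := by
    have := h 0 ⟨le_rfl, hτ.1⟩ 0
    rw [intervalIntegral.integral_same, add_zero] at this
    exact (abs_nonneg _).trans this
  set N := (1 + x ^ 2) * Real.exp (c * τ) with hN
  let S : Set (ℝ × ℝ) := {p | p.1 ∈ Icc 0 τ ∧ (1 + p.2 ^ 2) * Real.exp (c * p.1) ≤ N}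
  have hSc : IsCompact S := by
    have h1 : IsClosed S := by
      apply IsClosed.inter (s₁ := {p : ℝ × ℝ | p.1 ∈ Icc 0 τ})
      · exact isClosed_Icc.preimage continuous_fst
      · exact isClosed_le (f := fun p : ℝ × ℝ => (1 + p.2 ^ 2) * Real.exp (c * p.1)) (by fun_prop)
          continuous_const
    refine ((isCompact_Icc (a := (0 : ℝ)) (b := τ)).prod (isCompact_Icc (a := -N) (b := N))).of_isClosed_subset h1 ?_
    rintro ⟨s, y⟩ ⟨h1, h2⟩
    refine ⟨h1, abs_le.1 ?_⟩
    have h3 : 1 ≤ Real.exp (c * s) := Real.one_le_exp (mul_nonneg hc0 h1.1)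
    have h4 : 1 + y ^ 2 ≤ N := by
      simp only at h2
      nlinarith [sq_nonneg y]
    simp only
    nlinarith [sq_abs y, sq_nonneg (|y| - 1)]
  have hxS : (τ, x) ∈ S := ⟨⟨hτ.1, le_rfl⟩, le_rfl⟩
  obtain ⟨p, hpS, hpm⟩ := hSc.exists_isMaxOn ⟨_, hxS⟩
    (f := fun p : ℝ × ℝ => |Y p.1 p.2| * Real.exp (-(4 * M * p.1)))
    (by have : Continuous fun p : ℝ × ℝ => Y p.1 p.2 := hY
        fun_prop)
  set Z := |Y p.1 p.2| * Real.exp (-(4 * M * p.1)) with hZ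
  have hle : ∀ q ∈ S, |Y q.1 q.2| ≤ Z * Real.exp (4 * M * q.1) := fun q hq => by
    have h1 : |Y q.1 q.2| * Real.exp (-(4 * M * q.1)) ≤ Z := hpm hq
    rw [Real.exp_neg, ← div_eq_mul_inv, div_le_iff₀ (Real.exp_pos _)] at h1
    exact h1
  obtain ⟨t, y⟩ := p
  have ht : t ∈ Icc 0 T := ⟨hpS.1.1, hpS.1.2.trans hτ.2⟩
  simp only at hZ
  have hmem : ∀ s ∈ Icc 0 t, (s, X t y s) ∈ S ∧ (s, -X t y s) ∈ S := fun s hs => by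
    have h1 := hcone t ht s ⟨hs.1, hs.2.trans ht.2⟩ y
    have h2 : (1 + X t y s ^ 2) * Real.exp (c * s) ≤ N := by
      refine le_trans ?_ hpS.2
      refine (mul_le_mul_of_nonneg_right h1 (Real.exp_pos _).le).trans (le_of_eq ?_)
      rw [mul_assoc, ← Real.exp_add, abs_sub_comm, abs_of_nonneg (sub_nonneg.2 hs.2)]
      congr 2; ring
    exact ⟨⟨⟨hs.1, hs.2.trans hpS.1.2⟩, h2⟩, ⟨⟨hs.1, hs.2.trans hpS.1.2⟩, by simpa using h2⟩⟩
  have hXc := hX.continuous_curve t y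
  have hcl : Continuous fun s => M * (|Y s (X t y s)| + |Y s (-X t y s)|) := by
    have h1 : Continuous fun s => Y s (X t y s) := hY.comp (f := fun s => (s, X t y s)) (by fun_prop)
    have h2 : Continuous fun s => Y s (-X t y s) :=
      hY.comp (f := fun s => (s, -X t y s)) (by fun_prop)
    fun_prop
  have hint : (∫ s in (0 : ℝ)..t, M * (|Y s (X t y s)| + |Y s (-X t y s)|)) ≤
      ∫ s in (0 : ℝ)..t, Z / 2 * (Real.exp (4 * M * s) * (4 * M)) := by
    refine intervalIntegral.integral_mono_on ht.1 (hcl.intervalIntegrable _ _)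
      (Continuous.intervalIntegrable (by fun_prop) _ _) fun s hs => ?_
    have h1 := hle _ (hmem s hs).1
    have h2 := hle _ (hmem s hs).2
    simp only at h1 h2
    nlinarith [mul_le_mul_of_nonneg_left h1 hM, mul_le_mul_of_nonneg_left h2 hM]
  have hFTC : (∫ s in (0 : ℝ)..t, Z / 2 * (Real.exp (4 * M * s) * (4 * M))) =
      Z / 2 * (Real.exp (4 * M * t) - 1) := by
    rw [intervalIntegral.integral_const_mul, intervalIntegral.integral_eq_sub_of_hasDerivAt
      (f := fun s => Real.exp (4 * M * s))
      (fun s _ => by simpa using ((hasDerivAt_id s).const_mul (4 * M)).exp)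
      (Continuous.intervalIntegrable (by fun_prop) _ _)]
    simp
  have h1 := h t hpS.1 y
  have hZ0 : 0 ≤ Z := by positivity
  have he := Real.exp_pos (4 * M * t)
  have he1 : 1 ≤ Real.exp (4 * M * t) := Real.one_le_exp (by have := ht.1; positivity)
  have hY' : |Y t y| = Z * Real.exp (4 * M * t) := by
    rw [hZ, mul_assoc, ← Real.exp_add]; simp
  have hZA : Z ≤ 2 * A := by
    have h2 : Z * Real.exp (4 * M * t) ≤ A + Z / 2 * (Real.exp (4 * M * t) - 1) := by linarith
    have h3 : Z / 2 * Real.exp (4 * M * t) ≤ A * Real.exp (4 * M * t) := by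
      nlinarith [mul_le_mul_of_nonneg_left he1 hA]
    have := le_of_mul_le_mul_right h3 he
    linarith
  refine (hle _ hxS).trans ?_
  gcongr

/-! ### Suprema over both sides -/

section SupNorm

variable {F : Type*} [NormedAddCommGroup F] {a b : ℝ}

/-- A bound has to be supplied, since the supremum of an unbounded set of reals is 0 by convention.
-/
theorem norm_le_supNorm {h : Side → ℝ → F} {K : ℝ} (hK : ∀ σ, ∀ r ∈ σ.interval a b, ‖h σ r‖ ≤ K)
    {σ : Side} {r : ℝ} (hr : r ∈ σ.interval a b) : ‖h σ r‖ ≤ supNorm a b h :=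
  le_csSup ⟨K, by rintro _ ⟨σ, r, hr, rfl⟩; exact hK σ r hr⟩ ⟨σ, r, hr, rfl⟩

theorem supNorm_le {h : Side → ℝ → F} {K : ℝ} (hK : ∀ σ, ∀ r ∈ σ.interval a b, ‖h σ r‖ ≤ K) :
    supNorm a b h ≤ K :=
  csSup_le ⟨_, Side.plus, b, mem_Ici.2 le_rfl, rfl⟩ (by rintro _ ⟨σ, r, hr, rfl⟩; exact hK σ r hr)

theorem supNorm_nonneg (h : Side → ℝ → F) : 0 ≤ supNorm a b h :=
  Real.sSup_nonneg (by rintro _ ⟨σ, r, -, rfl⟩; exact norm_nonneg _)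

/-- A supremum over uncountably many radii need not be continuous in time, but as a supremum of
continuous functions it is lower semicontinuous, hence measurable, and it is bounded. -/
theorem intervalIntegrable_supNorm {T K : ℝ} (hT : 0 ≤ T) {g : Side → ℝ × ℝ → F}
    (hg : ∀ σ, ContinuousOn (g σ) (slab a b T σ)) (hK : ∀ σ, ∀ p ∈ slab a b T σ, ‖g σ p‖ ≤ K)
    {t : ℝ} (ht : t ∈ Icc 0 T) :
    IntervalIntegrable (fun s => supNorm a b fun σ r => g σ (s, r)) volume 0 t := by
  have hct := continuous_clampTime T
  have hm : ∀ s, clampTime T s ∈ Icc 0 T := clampTime_mem hT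
  let S : ℝ → ℝ := fun s => ⨆ i : (σ : Side) × σ.interval a b, ‖g i.1 (clampTime T s, i.2)‖
  have hS : LowerSemicontinuous S := by
    refine lowerSemicontinuous_ciSup (fun s => ⟨K, ?_⟩) fun i => Continuous.lowerSemicontinuous ?_
    · rintro _ ⟨i, rfl⟩
      exact hK _ _ ⟨hm s, i.2.2⟩
    · exact ((hg i.1).comp_continuous (f := fun s => (clampTime T s, (i.2 : ℝ))) (by fun_prop)
        fun s => ⟨hm s, i.2.2⟩).norm
  have hb : ∀ s, ‖S s‖ ≤ K := fun s => by
    have : Nonempty ((σ : Side) × σ.interval a b) := ⟨Side.plus, b, mem_Ici.2 le_rfl⟩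
    rw [Real.norm_of_nonneg (Real.iSup_nonneg fun _ => norm_nonneg _)]
    exact ciSup_le fun i => hK _ _ ⟨hm s, i.2.2⟩
  have h1 : IntervalIntegrable S volume 0 t :=
    (intervalIntegrable_const (c := K)).mono_fun hS.measurable.aestronglyMeasurable
      (ae_of_all _ fun s => (hb s).trans (le_abs_self K))
  refine h1.congr ?_
  intro s hs
  rw [uIoc_of_le ht.1] at hs
  have hs' : s ∈ Icc 0 T := ⟨hs.1.le, hs.2.trans ht.2⟩
  simp only [S, supNorm, clampTime_of_mem hs', iSup]
  congr 1
  ext y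
  constructor
  · rintro ⟨i, rfl⟩; exact ⟨i.1, i.2, i.2.2, rfl⟩
  · rintro ⟨σ, r, hr, rfl⟩; exact ⟨⟨σ, r, hr⟩, rfl⟩

end SupNorm

end VortexSheet

namespace VortexSheet
open Filter Topology MeasureTheory

/-! ### Continuously differentiable functions on one side -/

/-- `g` is `C¹` on `S` up to the boundary, with partial derivatives `gt` and `gr`. -/
structure HasPartials (S : Set (ℝ × ℝ)) (g gt gr : ℝ × ℝ → ℝ) : Prop where
  hasFDerivWithinAt : ∀ p ∈ S, HasFDerivWithinAt g
    (gt p • ContinuousLinearMap.fst ℝ ℝ ℝ + gr p • ContinuousLinearMap.snd ℝ ℝ ℝ) S p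
  continuousOn_dt : ContinuousOn gt S
  continuousOn_dr : ContinuousOn gr S

namespace HasPartials

variable {S : Set (ℝ × ℝ)} {g gt gr h ht hr : ℝ × ℝ → ℝ}

theorem continuousOn (hg : HasPartials S g gt gr) : ContinuousOn g S :=
  fun p hp => (hg.hasFDerivWithinAt p hp).continuousWithinAt

theorem congr (hg : HasPartials S g gt gr) {g' gt' gr' : ℝ × ℝ → ℝ} (h : ∀ p ∈ S, g' p = g p)
    (h1 : ∀ p ∈ S, gt' p = gt p) (h2 : ∀ p ∈ S, gr' p = gr p) : HasPartials S g' gt' gr' :=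
  ⟨fun p hp => by
    rw [h1 p hp, h2 p hp]
    exact (hg.hasFDerivWithinAt p hp).congr h (h p hp),
    hg.continuousOn_dt.congr h1, hg.continuousOn_dr.congr h2⟩

theorem const (c : ℝ) : HasPartials S (fun _ => c) (fun _ => 0) (fun _ => 0) :=
  ⟨fun p _ => (hasFDerivWithinAt_const c p S).congr_fderiv (by ext <;> simp), continuousOn_const,
    continuousOn_const⟩

theorem snd : HasPartials S (fun p => p.2) (fun _ => 0) (fun _ => 1) :=
  ⟨fun p _ => hasFDerivWithinAt_snd.congr_fderiv (by ext <;> simp), continuousOn_const,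
    continuousOn_const⟩

theorem add (hg : HasPartials S g gt gr) (hh : HasPartials S h ht hr) :
    HasPartials S (fun p => g p + h p) (fun p => gt p + ht p) (fun p => gr p + hr p) :=
  ⟨fun p hp => ((hg.hasFDerivWithinAt p hp).fun_add (hh.hasFDerivWithinAt p hp)).congr_fderiv
    (by ext <;> simp), hg.continuousOn_dt.add hh.continuousOn_dt,
    hg.continuousOn_dr.add hh.continuousOn_dr⟩

theorem neg (hg : HasPartials S g gt gr) :
    HasPartials S (fun p => -g p) (fun p => -gt p) (fun p => -gr p) :=
  ⟨fun p hp => (hg.hasFDerivWithinAt p hp).fun_neg.congr_fderiv (by ext <;> simp),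
    hg.continuousOn_dt.neg, hg.continuousOn_dr.neg⟩

theorem sub (hg : HasPartials S g gt gr) (hh : HasPartials S h ht hr) :
    HasPartials S (fun p => g p - h p) (fun p => gt p - ht p) (fun p => gr p - hr p) :=
  (hg.add hh.neg).congr (fun _ _ => sub_eq_add_neg _ _) (fun _ _ => sub_eq_add_neg _ _)
    fun _ _ => sub_eq_add_neg _ _

theorem mul (hg : HasPartials S g gt gr) (hh : HasPartials S h ht hr) :
    HasPartials S (fun p => g p * h p) (fun p => gt p * h p + g p * ht p)
      (fun p => gr p * h p + g p * hr p) :=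
  ⟨fun p hp => ((hg.hasFDerivWithinAt p hp).fun_mul (hh.hasFDerivWithinAt p hp)).congr_fderiv
    (by ext <;> simp <;> ring),
    (hg.continuousOn_dt.mul hh.continuousOn).add (hg.continuousOn.mul hh.continuousOn_dt),
    (hg.continuousOn_dr.mul hh.continuousOn).add (hg.continuousOn.mul hh.continuousOn_dr)⟩

theorem comp (hg : HasPartials S g gt gr) {I : Set ℝ} (hI : ∀ p ∈ S, g p ∈ I) {k k' : ℝ → ℝ}
    (hk : ∀ x ∈ I, HasDerivAt k (k' x) x) (hk' : ContinuousOn k' I) :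
    HasPartials S (fun p => k (g p)) (fun p => k' (g p) * gt p) (fun p => k' (g p) * gr p) :=
  ⟨fun p hp => ((hk _ (hI p hp)).comp_hasFDerivWithinAt p
    (hg.hasFDerivWithinAt p hp)).congr_fderiv (by ext <;> simp),
    (hk'.comp hg.continuousOn hI).mul hg.continuousOn_dt,
    (hk'.comp hg.continuousOn hI).mul hg.continuousOn_dr⟩

theorem exp (hg : HasPartials S g gt gr) :
    HasPartials S (fun p => Real.exp (g p)) (fun p => Real.exp (g p) * gt p)
      (fun p => Real.exp (g p) * gr p) :=
  hg.comp (I := univ) (fun _ _ => mem_univ _) (fun x _ => Real.hasDerivAt_exp x)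
    Real.continuous_exp.continuousOn

theorem inv (hg : HasPartials S g gt gr) (h0 : ∀ p ∈ S, g p ≠ 0) :
    HasPartials S (fun p => (g p)⁻¹) (fun p => -(g p ^ 2)⁻¹ * gt p)
      (fun p => -(g p ^ 2)⁻¹ * gr p) :=
  hg.comp (I := {0}ᶜ) h0 (fun _ hx => hasDerivAt_inv hx)
    (((continuousOn_id.pow 2).inv₀ fun _ hx => pow_ne_zero 2 hx).neg)

theorem of_contDiffOn (hS : UniqueDiffOn ℝ S) (hg : ContDiffOn ℝ 1 g S) :
    HasPartials S g (dt S g) (dr S g) := by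
  have hd := hg.differentiableOn (by norm_num)
  have hc : ContinuousOn (fderivWithin ℝ g S) S := hg.continuousOn_fderivWithin hS (by norm_num)
  refine ⟨fun p hp => (hd p hp).hasFDerivWithinAt.congr_fderiv ?_,
    hc.clm_apply continuousOn_const, hc.clm_apply continuousOn_const⟩
  ext <;> simp [dt, dr]

theorem contDiffOn (hg : HasPartials S g gt gr) (hS : UniqueDiffOn ℝ S) : ContDiffOn ℝ 1 g S := by
  rw [show (1 : WithTop ℕ∞) = 0 + 1 by norm_num, contDiffOn_succ_iff_fderivWithin hS]
  refine ⟨fun p hp => (hg.hasFDerivWithinAt p hp).differentiableWithinAt, by simp, ?_⟩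
  rw [contDiffOn_zero]
  have h1 := hg.continuousOn_dt
  have h2 := hg.continuousOn_dr
  exact ContinuousOn.congr (f := fun p => gt p • ContinuousLinearMap.fst ℝ ℝ ℝ +
    gr p • ContinuousLinearMap.snd ℝ ℝ ℝ) (by fun_prop)
    fun p hp => (hg.hasFDerivWithinAt p hp).fderivWithin (hS p hp)

theorem dt_eq (hg : HasPartials S g gt gr) (hS : UniqueDiffOn ℝ S) {p : ℝ × ℝ} (hp : p ∈ S) :
    dt S g p = gt p := by
  rw [dt, (hg.hasFDerivWithinAt p hp).fderivWithin (hS p hp)]; simp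

theorem dr_eq (hg : HasPartials S g gt gr) (hS : UniqueDiffOn ℝ S) {p : ℝ × ℝ} (hp : p ∈ S) :
    dr S g p = gr p := by
  rw [dr, (hg.hasFDerivWithinAt p hp).fderivWithin (hS p hp)]; simp

theorem hasFDerivAt (hg : HasPartials S g gt gr) {p : ℝ × ℝ} (hp : S ∈ 𝓝 p) :
    HasFDerivAt g (gt p • ContinuousLinearMap.fst ℝ ℝ ℝ + gr p • ContinuousLinearMap.snd ℝ ℝ ℝ) p :=
  (hg.hasFDerivWithinAt p (mem_of_mem_nhds hp)).hasFDerivAt hp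

theorem hasDerivWithinAt_snd (hg : HasPartials S g gt gr) {I : Set ℝ} {t : ℝ}
    (hI : ∀ r ∈ I, (t, r) ∈ S) {r : ℝ} (hr' : r ∈ I) :
    HasDerivWithinAt (fun r => g (t, r)) (gr (t, r)) I r := by
  have h1 : HasDerivWithinAt (fun r : ℝ => (t, r)) (0, 1) I r :=
    (hasDerivWithinAt_const r I t).prodMk (hasDerivWithinAt_id r I)
  exact ((hg.hasFDerivWithinAt _ (hI r hr')).comp_hasDerivWithinAt r h1 hI).congr_deriv (by simp)

theorem hasDerivWithinAt_fst (hg : HasPartials S g gt gr) {I : Set ℝ} {r : ℝ}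
    (hI : ∀ t ∈ I, (t, r) ∈ S) {t : ℝ} (ht' : t ∈ I) :
    HasDerivWithinAt (fun t => g (t, r)) (gt (t, r)) I t := by
  have h1 : HasDerivWithinAt (fun t : ℝ => (t, r)) (1, 0) I t :=
    (hasDerivWithinAt_id t I).prodMk (hasDerivWithinAt_const t I r)
  exact ((hg.hasFDerivWithinAt _ (hI t ht')).comp_hasDerivWithinAt t h1 hI).congr_deriv (by simp)

theorem of_fst {I : Set ℝ} (hI : ∀ p ∈ S, p.1 ∈ I) {k k' : ℝ → ℝ}
    (hk : ∀ t ∈ I, HasDerivWithinAt k (k' t) I t) (hk' : ContinuousOn k' I) :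
    HasPartials S (fun p => k p.1) (fun p => k' p.1) (fun _ => 0) :=
  ⟨fun p hp => ((hk _ (hI p hp)).comp_hasFDerivWithinAt p hasFDerivWithinAt_fst hI).congr_fderiv
    (by ext <;> simp), hk'.comp continuousOn_fst hI, continuousOn_const⟩

/-- A derivative that extends continuously to the boundary of a convex set is the one-sided
derivative there. Differentiability of the constructed solutions thus has to be checked only away
from the wall, the front and the ends of the time interval. -/
theorem of_interior (hconv : Convex ℝ S) (hcl : closure (interior S) = S) (hg : ContinuousOn g S)
    (h1 : ContinuousOn gt S) (h2 : ContinuousOn gr S)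
    (hd : ∀ p ∈ interior S, HasFDerivAt g
      (gt p • ContinuousLinearMap.fst ℝ ℝ ℝ + gr p • ContinuousLinearMap.snd ℝ ℝ ℝ) p) :
    HasPartials S g gt gr := by
  refine ⟨fun p hp => ?_, h1, h2⟩
  have hc : ContinuousOn (fun p => gt p • ContinuousLinearMap.fst ℝ ℝ ℝ +
    gr p • ContinuousLinearMap.snd ℝ ℝ ℝ) S := by fun_prop
  have := hasFDerivWithinAt_closure_of_tendsto_fderiv (f := g) (s := interior S) (x := p)
    (f' := gt p • ContinuousLinearMap.fst ℝ ℝ ℝ + gr p • ContinuousLinearMap.snd ℝ ℝ ℝ)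
    (fun q hq => (hd q hq).differentiableAt.differentiableWithinAt) hconv.interior isOpen_interior
    (fun q hq => (hg q (hcl ▸ hq)).mono interior_subset)
    (((hc p hp).tendsto.mono_left (nhdsWithin_mono p interior_subset)).congr' (by
      filter_upwards [self_mem_nhdsWithin] with q hq
      exact (hd q hq).fderiv.symm))
  rwa [hcl] at this

end HasPartials

/-! ### The two sides -/

section Slab

variable {a b T : ℝ} {σ : Side}

theorem Side.left_mem (hab : a ≤ b) : a ∈ Side.minus.interval a b := ⟨le_rfl, hab⟩

theorem Side.mem (hab : a ≤ b) : ∀ σ : Side, b ∈ σ.interval a b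
  | .minus => ⟨hab, le_rfl⟩
  | .plus => mem_Ici.2 le_rfl

theorem Side.convex_interval (a b : ℝ) : ∀ σ : Side, Convex ℝ (σ.interval a b)
  | .minus => convex_Icc a b
  | .plus => convex_Ici b

theorem Side.ge_of_mem (hab : a ≤ b) : ∀ {σ : Side} {r : ℝ}, r ∈ σ.interval a b → a ≤ r
  | .minus, _, h => h.1
  | .plus, _, h => hab.trans h

theorem Side.closure_interior (hab : a < b) : ∀ σ : Side,
    closure (interior (σ.interval a b)) = σ.interval a b
  | .minus => by simp [Side.interval, interior_Icc, closure_Ioo hab.ne]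
  | .plus => by simp [Side.interval]

theorem Side.uniqueDiffOn_interval (hab : a < b) (σ : Side) : UniqueDiffOn ℝ (σ.interval a b) :=
  uniqueDiffOn_convex (σ.convex_interval a b) (by
    cases σ
    · simp [Side.interval, interior_Icc, hab]
    · simp [Side.interval])

theorem convex_slab (a b T : ℝ) (σ : Side) : Convex ℝ (slab a b T σ) :=
  (convex_Icc 0 T).prod (σ.convex_interval a b)

theorem interior_slab (a b T : ℝ) (σ : Side) :
    interior (slab a b T σ) = Ioo 0 T ×ˢ interior (σ.interval a b) := by
  rw [slab, interior_prod_eq, interior_Icc]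

theorem closure_interior_slab (hab : a < b) (hT : 0 < T) (σ : Side) :
    closure (interior (slab a b T σ)) = slab a b T σ := by
  rw [interior_slab, closure_prod_eq, closure_Ioo hT.ne, σ.closure_interior hab, slab]

theorem uniqueDiffOn_slab (hab : a < b) (hT : 0 < T) (σ : Side) :
    UniqueDiffOn ℝ (slab a b T σ) :=
  (uniqueDiffOn_Icc hT).prod (σ.uniqueDiffOn_interval hab)

variable {F : Type*} [NormedAddCommGroup F] [NormedSpace ℝ F]

theorem dt_apply (hab : a < b) (hT : 0 < T) {g : ℝ × ℝ → State} {p : ℝ × ℝ}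
    (hp : p ∈ slab a b T σ) (hg : ContDiffOn ℝ 1 g (slab a b T σ)) (i : Fin 3) :
    dt (slab a b T σ) g p i = dt (slab a b T σ) (fun q => g q i) p := by
  have h := (hg.differentiableOn (by norm_num)) p hp
  rw [dt, dt, ((hasFDerivWithinAt_pi'.1 h.hasFDerivWithinAt) i).fderivWithin
    (uniqueDiffOn_slab hab hT σ p hp)]
  rfl

theorem dr_apply (hab : a < b) (hT : 0 < T) {g : ℝ × ℝ → State} {p : ℝ × ℝ}
    (hp : p ∈ slab a b T σ) (hg : ContDiffOn ℝ 1 g (slab a b T σ)) (i : Fin 3) :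
    dr (slab a b T σ) g p i = dr (slab a b T σ) (fun q => g q i) p := by
  have h := (hg.differentiableOn (by norm_num)) p hp
  rw [dr, dr, ((hasFDerivWithinAt_pi'.1 h.hasFDerivWithinAt) i).fderivWithin
    (uniqueDiffOn_slab hab hT σ p hp)]
  rfl

/-- The components of a `C¹` function have the components of its derivatives as partials. -/
theorem hasPartials_apply (hab : a < b) (hT : 0 < T) {g : ℝ × ℝ → State}
    (hg : ContDiffOn ℝ 1 g (slab a b T σ)) (i : Fin 3) :
    HasPartials (slab a b T σ) (fun p => g p i) (fun p => dt (slab a b T σ) g p i)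
      (fun p => dr (slab a b T σ) g p i) :=
  (HasPartials.of_contDiffOn (uniqueDiffOn_slab hab hT σ) (contDiffOn_pi.1 hg i)).congr
    (fun _ _ => rfl) (fun _ hp => dt_apply hab hT hp hg i) fun _ hp => dr_apply hab hT hp hg i

end Slab

end VortexSheet

namespace VortexSheet
open Filter Topology MeasureTheory

/-! ### Unfolding at the wall -/

/-- The positions of the wall and of the front after the unfolding. -/
def breaks (l : ℝ) : Set ℝ := {-l, 0, l}

theorem neg_mem_breaks {l x : ℝ} (hx : x ∈ breaks l) : -x ∈ breaks l := by
  rcases hx with rfl | rfl | rfl <;> simp [breaks]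

theorem isClosed_breaks (l : ℝ) : IsClosed (breaks l) := by
  unfold breaks; exact (Set.toFinite _).isClosed

theorem countable_breaks (l : ℝ) : (breaks l).Countable := by
  unfold breaks; exact (Set.toFinite _).countable

/-- The function on the line that is given by `p` where `x > 0` and by the reflection of `q` where
`x < 0`, at distance `|x|` from the wall. -/
noncomputable def unfolded (a b T : ℝ) (p q : Side → ℝ × ℝ → ℝ) (t x : ℝ) : ℝ :=
  if 0 < x then p (if x ≤ b - a then Side.minus else Side.plus) (clampTime T t, a + x)
  else if x < 0 then q (if -x ≤ b - a then Side.minus else Side.plus) (clampTime T t, a - x)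
  else (p Side.minus (clampTime T t, a) + q Side.minus (clampTime T t, a)) / 2

/-- The pair `p`, `q` is unfolded to a function without jumps. -/
structure Matching (a b T : ℝ) (p q : Side → ℝ × ℝ → ℝ) : Prop where
  wall : ∀ t ∈ Icc 0 T, p Side.minus (t, a) = q Side.minus (t, a)
  front_fst : ∀ t ∈ Icc 0 T, p Side.plus (t, b) = p Side.minus (t, b)
  front_snd : ∀ t ∈ Icc 0 T, q Side.plus (t, b) = q Side.minus (t, b)

section Unfolded

variable {a b T : ℝ} {p q pt pr qt qr : Side → ℝ × ℝ → ℝ}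

/-- The mean value taken at x = 0 makes reflection exchange the two functions without exception,
whether or not they agree at the wall. -/
theorem unfolded_neg (t x : ℝ) : unfolded a b T p q t (-x) = unfolded a b T q p t x := by
  unfold unfolded
  rcases lt_trichotomy x 0 with h | h | h
  · simp [h, not_lt.2 h.le, sub_eq_add_neg]
  · simp [h, add_comm]
  · simp [h, not_lt.2 h.le, sub_eq_add_neg]

theorem mem_interval_side {x : ℝ} (hx : 0 ≤ x) :
    a + x ∈ (if x ≤ b - a then Side.minus else Side.plus).interval a b := by
  split_ifs with h
  · exact ⟨by linarith, by linarith⟩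
  · exact mem_Ici.2 (by linarith)

theorem abs_unfolded_le (hab : a ≤ b) (hT : 0 ≤ T) {C : ℝ}
    (hp : ∀ σ, ∀ z ∈ slab a b T σ, |p σ z| ≤ C) (hq : ∀ σ, ∀ z ∈ slab a b T σ, |q σ z| ≤ C)
    (t x : ℝ) : |unfolded a b T p q t x| ≤ C := by
  have ht := clampTime_mem hT t
  unfold unfolded
  split_ifs with h1 h2 h3
  · exact hp _ _ ⟨ht, ⟨by linarith, by linarith⟩⟩
  · exact hp _ _ ⟨ht, mem_Ici.2 (by linarith)⟩
  · exact hq _ _ ⟨ht, ⟨by linarith, by linarith⟩⟩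
  · exact hq _ _ ⟨ht, mem_Ici.2 (by linarith)⟩
  · have h1 := abs_le.1 (hp .minus (clampTime T t, a) ⟨ht, Side.left_mem hab⟩)
    have h2 := abs_le.1 (hq .minus (clampTime T t, a) ⟨ht, Side.left_mem hab⟩)
    exact abs_le.2 ⟨by linarith, by linarith⟩

/-- Near a point of the right half line that is not a break the unfolded function is given by one
of the sides. -/
theorem unfolded_eventually (hab : a < b) {x : ℝ} (hx : x ∉ breaks (b - a)) (h0 : 0 < x) :
    ∃ σ : Side, a + x ∈ interior (σ.interval a b) ∧ ∀ᶠ y in 𝓝 x, a + y ∈ σ.interval a b ∧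
      ∀ (p q : Side → ℝ × ℝ → ℝ) (t : ℝ), unfolded a b T p q t y = p σ (clampTime T t, a + y) := by
  have hne : x ≠ b - a := fun h => hx (by simp [breaks, h])
  rcases lt_or_gt_of_ne hne with h | h
  · refine ⟨.minus, ?_, ?_⟩
    · simp only [Side.interval, interior_Icc]; exact ⟨by linarith, by linarith⟩
    · filter_upwards [Ioo_mem_nhds h0 h] with y hy
      refine ⟨⟨by linarith [hy.1], by linarith [hy.2]⟩, fun p q t => ?_⟩
      simp [unfolded, hy.1, hy.2.le]
  · refine ⟨.plus, ?_, ?_⟩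
    · simp only [Side.interval, interior_Ici]; exact mem_Ioi.2 (by linarith)
    · filter_upwards [Ioi_mem_nhds h] with y hy
      have hy' : b - a < y := hy
      refine ⟨mem_Ici.2 (by linarith), fun p q t => ?_⟩
      simp [unfolded, (by linarith : 0 < y), not_le.2 hy']

theorem unfolded_apply (hab : a ≤ b) (hm : Matching a b T p q) {σ : Side} {t r : ℝ}
    (ht : t ∈ Icc 0 T) (hr : r ∈ σ.interval a b) :
    unfolded a b T p q t (r - a) = p σ (t, r) ∧ unfolded a b T p q t (a - r) = q σ (t, r) := by
  have key : ∀ p q : Side → ℝ × ℝ → ℝ, Matching a b T p q →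
      unfolded a b T p q t (r - a) = p σ (t, r) := by
    intro p q hm
    rcases (Side.ge_of_mem hab hr).eq_or_lt with h | h
    · subst h
      have : p σ (t, a) = p .minus (t, a) := by
        cases σ
        · rfl
        · have h1 : a = b := le_antisymm hab hr
          rw [h1]; exact hm.front_fst t ht
      rw [this]
      simp [unfolded, clampTime_of_mem ht, ← hm.wall t ht]
    · simp only [unfolded, sub_pos.2 h, if_true, clampTime_of_mem ht, add_sub_cancel,
        sub_le_sub_iff_right]
      cases σ
      · rw [if_pos hr.2]
      · rcases (mem_Ici.1 hr).eq_or_lt with h1 | h1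
        · rw [if_pos h1.ge, ← h1, hm.front_fst t ht]
        · rw [if_neg (not_le.2 h1)]
  refine ⟨key p q hm, ?_⟩
  rw [← neg_sub r a, unfolded_neg]
  exact key q p ⟨fun t ht => (hm.wall t ht).symm, hm.front_snd, hm.front_fst⟩

theorem continuousOn_unfolded (hab : a < b) (hT : 0 ≤ T)
    (hp : ∀ σ, ContinuousOn (p σ) (slab a b T σ)) (hq : ∀ σ, ContinuousOn (q σ) (slab a b T σ)) :
    ContinuousOn (Function.uncurry (unfolded a b T p q)) (univ ×ˢ (breaks (b - a))ᶜ) := by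
  have key : ∀ p q : Side → ℝ × ℝ → ℝ, (∀ σ, ContinuousOn (p σ) (slab a b T σ)) → ∀ t x, 0 < x →
      x ∉ breaks (b - a) → ContinuousAt (Function.uncurry (unfolded a b T p q)) (t, x) := by
    intro p q hp t x h0 hx
    obtain ⟨σ, hσ, he⟩ := unfolded_eventually (T := T) hab hx h0
    have hct := continuous_clampTime T
    have h1 : ContinuousAt (fun z : ℝ × ℝ => p σ (clampTime T z.1, a + z.2)) (t, x) := by
      have h2 : ContinuousOn (fun z : ℝ × ℝ => p σ (clampTime T z.1, a + z.2))
          {z | a + z.2 ∈ σ.interval a b} :=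
        (hp σ).comp (f := fun z : ℝ × ℝ => (clampTime T z.1, a + z.2)) (by fun_prop)
          fun z hz => ⟨clampTime_mem hT _, hz⟩
      refine h2.continuousAt ?_
      have h3 : Continuous fun z : ℝ × ℝ => a + z.2 := by fun_prop
      exact h3.continuousAt.preimage_mem_nhds (mem_interior_iff_mem_nhds.1 hσ)
    refine h1.congr ?_
    have h2 : Tendsto (fun z : ℝ × ℝ => z.2) (𝓝 (t, x)) (𝓝 x) := continuous_snd.tendsto (t, x)
    filter_upwards [h2.eventually he] with z hz
    exact (hz.2 p q z.1).symm
  rintro ⟨t, x⟩ ⟨-, hx⟩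
  rcases lt_trichotomy x 0 with h | h | h
  · have h1 := key q p hq t (-x) (by linarith) fun h => hx (by simpa using neg_mem_breaks h)
    have h2 := h1.comp (x := ((t, x) : ℝ × ℝ)) (f := fun z : ℝ × ℝ => (z.1, -z.2))
      (Continuous.continuousAt (by fun_prop))
    refine (h2.congr (Eventually.of_forall fun z => ?_)).continuousWithinAt
    exact unfolded_neg _ _
  · exact absurd (by simp [breaks, h]) hx
  · exact (key p q hp t x h hx).continuousWithinAt

theorem continuous_unfolded (hab : a < b) (hT : 0 ≤ T) (hm : Matching a b T p q)
    (hp : ∀ σ, ContinuousOn (p σ) (slab a b T σ)) (hq : ∀ σ, ContinuousOn (q σ) (slab a b T σ)) :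
    Continuous (Function.uncurry (unfolded a b T p q)) := by
  have hct := continuous_clampTime T
  -- Each half is written as one globally continuous expression, constant for x ≤ 0, by truncating
  -- the radius. The unfolding is the sum of the two halves minus the common value at the wall.
  let J : (Side → ℝ × ℝ → ℝ) → ℝ → ℝ → ℝ := fun p t x =>
    p .minus (clampTime T t, max a (min (a + x) b)) + p .plus (clampTime T t, max (a + x) b) -
      p .plus (clampTime T t, b)
  have hJ : ∀ p : Side → ℝ × ℝ → ℝ, (∀ σ, ContinuousOn (p σ) (slab a b T σ)) →
      Continuous (Function.uncurry (J p)) := fun p hp => by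
    have h1 := (hp .minus).comp_continuous
      (f := fun z : ℝ × ℝ => (clampTime T z.1, max a (min (a + z.2) b))) (by fun_prop)
      fun z => ⟨clampTime_mem hT _, ⟨le_max_left _ _, max_le hab.le (min_le_right _ _)⟩⟩
    have h2 := (hp .plus).comp_continuous
      (f := fun z : ℝ × ℝ => (clampTime T z.1, max (a + z.2) b)) (by fun_prop)
      fun z => ⟨clampTime_mem hT _, mem_Ici.2 (le_max_right _ _)⟩
    have h3 := (hp .plus).comp_continuous
      (f := fun z : ℝ × ℝ => (clampTime T z.1, b)) (by fun_prop)
      fun z => ⟨clampTime_mem hT _, mem_Ici.2 le_rfl⟩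
    exact (h1.add h2).sub h3
  have hpos : ∀ p q : Side → ℝ × ℝ → ℝ, Matching a b T p q → ∀ t x, 0 < x →
      unfolded a b T p q t x = J p t x := by
    intro p q hm t x h
    have h2 := hm.front_fst _ (clampTime_mem hT t)
    simp only [unfolded, h, if_true, J]
    split_ifs with h1
    · rw [min_eq_left (by linarith), max_eq_right (by linarith), max_eq_right (by linarith)]; ring
    · rw [min_eq_right (by linarith), max_eq_right (by linarith), max_eq_left (by linarith), h2]
      ring
  have hneg : ∀ p : Side → ℝ × ℝ → ℝ, ∀ t x, x ≤ 0 → J p t x = p .minus (clampTime T t, a) := by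
    intro p t x h
    simp only [J]
    rw [min_eq_left (by linarith), max_eq_left (by linarith), max_eq_right (by linarith)]; ring
  have h1 := hJ p hp
  have h2 := (hJ q hq).comp (by fun_prop : Continuous fun z : ℝ × ℝ => (z.1, -z.2))
  have h3 : Continuous fun z : ℝ × ℝ => p .minus (clampTime T z.1, a) :=
    (hp .minus).comp_continuous (by fun_prop) fun z => ⟨clampTime_mem hT _, Side.left_mem hab.le⟩
  refine ((h1.add h2).sub h3).congr ?_
  rintro ⟨t, x⟩
  have hw := hm.wall _ (clampTime_mem hT t)
  change J p t x + J q t (-x) - p .minus (clampTime T t, a) = unfolded a b T p q t x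
  rcases lt_trichotomy x 0 with h | h | h
  · rw [hneg p t x h.le, ← hpos q p ⟨fun t ht => (hm.wall t ht).symm, hm.front_snd, hm.front_fst⟩
      t (-x) (by linarith), unfolded_neg]
    ring
  · rw [hneg p t x h.le, hneg q t (-x) (by linarith), ← hw]
    simp [unfolded, h, ← hw]
  · rw [hpos p q hm t x h, hneg q t (-x) (by linarith), hw]
    ring

/-- Reflection reverses the radial direction, hence the sign of `qr`. Only x > 0 has to be treated,
where the second function of a pair plays no role; x < 0 follows by reflection. -/
theorem hasDerivAt_unfolded (hab : a < b) {t : ℝ}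
    (hp : ∀ σ, ∀ r ∈ σ.interval a b,
      HasDerivWithinAt (fun r => p σ (clampTime T t, r)) (pr σ (clampTime T t, r))
        (σ.interval a b) r)
    (hq : ∀ σ, ∀ r ∈ σ.interval a b,
      HasDerivWithinAt (fun r => q σ (clampTime T t, r)) (qr σ (clampTime T t, r))
        (σ.interval a b) r) {x : ℝ} (hx : x ∉ breaks (b - a)) :
    HasDerivAt (unfolded a b T p q t) (unfolded a b T pr (fun σ z => -qr σ z) t x) x := by
  have key : ∀ p q pr q' : Side → ℝ × ℝ → ℝ, (∀ σ, ∀ r ∈ σ.interval a b,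
      HasDerivWithinAt (fun r => p σ (clampTime T t, r)) (pr σ (clampTime T t, r))
        (σ.interval a b) r) → ∀ x, 0 < x → x ∉ breaks (b - a) →
      HasDerivAt (unfolded a b T p q t) (unfolded a b T pr q' t x) x := by
    intro p q pr q' hp x h0 hx
    obtain ⟨σ, hσ, he⟩ := unfolded_eventually (T := T) hab hx h0
    have h1 := (hp σ _ (interior_subset hσ)).hasDerivAt (mem_interior_iff_mem_nhds.1 hσ)
    have h2 := h1.comp x ((hasDerivAt_id x).const_add a)
    rw [(he.self_of_nhds).2 pr q' t]
    refine (h2.congr_of_eventuallyEq ?_).congr_deriv (mul_one _)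
    filter_upwards [he] with y hy
    exact hy.2 p q t
  rcases lt_trichotomy x 0 with h | h | h
  · have h1 := key q p qr (fun σ z => -pr σ z) hq (-x) (by linarith)
      fun h => hx (by simpa using neg_mem_breaks h)
    have h2 := h1.comp x (hasDerivAt_neg x)
    refine (h2.congr_of_eventuallyEq (Eventually.of_forall fun y =>
      (unfolded_neg _ _).symm)).congr_deriv ?_
    rw [unfolded_neg]
    simp only [unfolded, not_lt.2 h.le, h, if_true, if_false]
    ring
  · exact absurd (by simp [breaks, h]) hx
  · exact key p q pr _ hp x h hx

theorem hasFDerivAt_unfolded (hab : a < b)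
    (hp : ∀ σ, HasPartials (slab a b T σ) (p σ) (pt σ) (pr σ))
    (hq : ∀ σ, HasPartials (slab a b T σ) (q σ) (qt σ) (qr σ)) {t x : ℝ} (ht : t ∈ Ioo 0 T)
    (hx : x ∉ breaks (b - a)) :
    HasFDerivAt (Function.uncurry (unfolded a b T p q))
      (unfolded a b T pt qt t x • ContinuousLinearMap.fst ℝ ℝ ℝ +
        unfolded a b T pr (fun σ z => -qr σ z) t x • ContinuousLinearMap.snd ℝ ℝ ℝ) (t, x) := by
  have ht' := Ioo_subset_Icc_self ht
  have key : ∀ p q pt pr q' q'' : Side → ℝ × ℝ → ℝ,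
      (∀ σ, HasPartials (slab a b T σ) (p σ) (pt σ) (pr σ)) → ∀ x, 0 < x → x ∉ breaks (b - a) →
      HasFDerivAt (Function.uncurry (unfolded a b T p q))
        (unfolded a b T pt q' t x • ContinuousLinearMap.fst ℝ ℝ ℝ +
          unfolded a b T pr q'' t x • ContinuousLinearMap.snd ℝ ℝ ℝ) (t, x) := by
    intro p q pt pr q' q'' hp x h0 hx
    obtain ⟨σ, hσ, he⟩ := unfolded_eventually (T := T) hab hx h0
    have hmem : slab a b T σ ∈ 𝓝 (t, a + x) := by
      rw [← mem_interior_iff_mem_nhds, interior_slab]; exact ⟨ht, hσ⟩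
    have h1 := (hp σ).hasFDerivAt hmem
    have h2 : HasFDerivAt (fun z : ℝ × ℝ => (z.1, a + z.2)) ((ContinuousLinearMap.fst ℝ ℝ ℝ).prod
        (ContinuousLinearMap.snd ℝ ℝ ℝ)) (t, x) :=
      hasFDerivAt_fst.prodMk (hasFDerivAt_snd.const_add a)
    have h3 := HasFDerivAt.comp (t, x) (f := fun z : ℝ × ℝ => (z.1, a + z.2)) h1 h2
    rw [(he.self_of_nhds).2 pt q' t, (he.self_of_nhds).2 pr q'' t, clampTime_of_mem ht']
    refine (h3.congr_of_eventuallyEq ?_).congr_fderiv (by ext <;> simp)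
    have h4 : Tendsto (fun z : ℝ × ℝ => z.2) (𝓝 (t, x)) (𝓝 x) := continuous_snd.tendsto (t, x)
    have h5 : Tendsto (fun z : ℝ × ℝ => z.1) (𝓝 (t, x)) (𝓝 t) := continuous_fst.tendsto (t, x)
    filter_upwards [h4.eventually he, h5.eventually (clampTime_eventuallyEq ht)] with z hz hz'
    simp only [Function.uncurry, Function.comp]
    rw [hz.2 p q z.1, hz', id]
  rcases lt_trichotomy x 0 with h | h | h
  · have h1 := key q p qt qr pt (fun σ z => -pr σ z) hq (-x) (by linarith)
      fun h => hx (by simpa using neg_mem_breaks h)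
    have h2 : HasFDerivAt (fun p : ℝ × ℝ => (p.1, -p.2)) ((ContinuousLinearMap.fst ℝ ℝ ℝ).prod
        (-ContinuousLinearMap.snd ℝ ℝ ℝ)) (t, x) := hasFDerivAt_fst.prodMk hasFDerivAt_snd.neg
    have h3 := HasFDerivAt.comp (t, x) (f := fun p : ℝ × ℝ => (p.1, -p.2)) h1 h2
    refine (h3.congr_of_eventuallyEq (Eventually.of_forall fun y =>
      (unfolded_neg _ _).symm)).congr_fderiv ?_
    rw [unfolded_neg, unfolded_neg]
    have : unfolded a b T pr (fun σ z => -qr σ z) t x =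
        -unfolded a b T (fun σ z => -pr σ z) qr t x := by
      simp only [unfolded, not_lt.2 h.le, h, if_true, if_false]
    rw [this]
    ext <;> simp
  · exact absurd (by simp [breaks, h]) hx
  · exact key p q pt pr _ _ hp x h hx

end Unfolded

end VortexSheet

/-! ### Acoustic coefficients and their unfolding -/

namespace VortexSheet
open Filter Topology MeasureTheory

theorem unfolded_of_interior {a b T : ℝ} (hab : a < b) {σ : Side} {t r : ℝ} (ht : t ∈ Icc 0 T)
    (hr : r ∈ interior (σ.interval a b)) :
    0 < r - a ∧ r - a ∉ breaks (b - a) ∧ ∀ p q : Side → ℝ × ℝ → ℝ,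
      unfolded a b T p q t (r - a) = p σ (t, r) ∧ unfolded a b T p q t (a - r) = q σ (t, r) := by
  have h0 : 0 < r - a ∧ r ≠ b := by
    cases σ
    · simp only [Side.interval, interior_Icc] at hr
      exact ⟨sub_pos.2 hr.1, hr.2.ne⟩
    · simp only [Side.interval, interior_Ici] at hr
      have : b < r := hr
      exact ⟨by linarith, this.ne'⟩
  have key : ∀ p q : Side → ℝ × ℝ → ℝ, unfolded a b T p q t (r - a) = p σ (t, r) := by
    intro p q
    simp only [unfolded, h0.1, if_true, clampTime_of_mem ht, add_sub_cancel, sub_le_sub_iff_right]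
    cases σ
    · rw [if_pos (interior_subset hr).2]
    · simp only [Side.interval, interior_Ici] at hr
      rw [if_neg (not_le.2 hr)]
  refine ⟨h0.1, ?_, fun p q => ⟨key p q, ?_⟩⟩
  · rintro (h | h | h)
    · linarith [h0.1]
    · linarith [h0.1]
    · exact h0.2 (by simpa using h)
  · rw [← neg_sub r a, unfolded_neg]; exact key q p

/-- The coefficients of an acoustic system: the transport speed, the sound speed, the logarithm
of the square root of the impedance, and their partial derivatives. -/
structure Acoustics where
  lam : Side → ℝ × ℝ → ℝ
  lamt : Side → ℝ × ℝ → ℝ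
  lamr : Side → ℝ × ℝ → ℝ
  kap : Side → ℝ × ℝ → ℝ
  kapt : Side → ℝ × ℝ → ℝ
  kapr : Side → ℝ × ℝ → ℝ
  th : Side → ℝ × ℝ → ℝ
  tht : Side → ℝ × ℝ → ℝ
  thr : Side → ℝ × ℝ → ℝ

/-- The wall and the front are characteristic for the transport, the coefficients of the acoustic
part are continuous across the front, and everything is bounded by `C`. -/
structure Acoustics.IsAdmissible (S : Acoustics) (a b T C : ℝ) : Prop where
  lt : a < b
  pos : 0 < T
  lam : ∀ σ, HasPartials (slab a b T σ) (S.lam σ) (S.lamt σ) (S.lamr σ)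
  kap : ∀ σ, HasPartials (slab a b T σ) (S.kap σ) (S.kapt σ) (S.kapr σ)
  th : ∀ σ, HasPartials (slab a b T σ) (S.th σ) (S.tht σ) (S.thr σ)
  lam_front : ∀ σ, ∀ t ∈ Icc 0 T, S.lam σ (t, b) = 0
  lam_wall : ∀ t ∈ Icc 0 T, S.lam .minus (t, a) = 0
  kap_pos : ∀ σ, ∀ z ∈ slab a b T σ, 0 < S.kap σ z
  kap_front : ∀ t ∈ Icc 0 T, S.kap .plus (t, b) = S.kap .minus (t, b)
  th_front : ∀ t ∈ Icc 0 T, S.th .plus (t, b) = S.th .minus (t, b)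
  kap_bound : ∀ σ, ∀ z ∈ slab a b T σ, |S.kap σ z| ≤ C
  kap_lower : ∀ σ, ∀ z ∈ slab a b T σ, 1 ≤ C * S.kap σ z
  kap_along : ∀ σ, ∀ z ∈ slab a b T σ, |S.kapt σ z + S.lam σ z * S.kapr σ z| ≤ C
  width_lower : 1 ≤ C * (b - a)
  lamr_bound : ∀ σ, ∀ z ∈ slab a b T σ, |S.lamr σ z| ≤ C
  kapr_bound : ∀ σ, ∀ z ∈ slab a b T σ, |S.kapr σ z| ≤ C
  th_bound : ∀ σ, ∀ z ∈ slab a b T σ, |S.th σ z| ≤ C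
  thr_bound : ∀ σ, ∀ z ∈ slab a b T σ, |S.thr σ z| ≤ C
  along_bound : ∀ σ, ∀ z ∈ slab a b T σ, |S.tht σ z + S.lam σ z * S.thr σ z| ≤ C

/-- `g` is continuous and bounded on both sides, with a radial derivative `gr` that is continuous
and bounded. -/
structure RadialC1 (a b T K : ℝ) (g gr : Side → ℝ × ℝ → ℝ) : Prop where
  continuousOn : ∀ σ, ContinuousOn (g σ) (slab a b T σ)
  continuousOn_dr : ∀ σ, ContinuousOn (gr σ) (slab a b T σ)
  hasDerivWithinAt : ∀ σ, ∀ t ∈ Icc 0 T, ∀ r ∈ σ.interval a b,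
    HasDerivWithinAt (fun r => g σ (t, r)) (gr σ (t, r)) (σ.interval a b) r
  bound : ∀ σ, ∀ z ∈ slab a b T σ, |g σ z| ≤ K
  bound_dr : ∀ σ, ∀ z ∈ slab a b T σ, |gr σ z| ≤ K

namespace Acoustics

variable {a b T C : ℝ} (S : Acoustics)

/-- The derivative of the impedance logarithm along the backward sound waves. -/
noncomputable def alongBack (σ : Side) (z : ℝ × ℝ) : ℝ :=
  S.tht σ z + S.lam σ z * S.thr σ z - S.kap σ z * S.thr σ z

/-- The derivative of the impedance logarithm along the forward sound waves. -/
noncomputable def alongForth (σ : Side) (z : ℝ × ℝ) : ℝ :=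
  S.tht σ z + S.lam σ z * S.thr σ z + S.kap σ z * S.thr σ z

variable (a b T)

/-- The speed of the unfolded sound waves. -/
noncomputable def speed : ℝ → ℝ → ℝ :=
  unfolded a b T (fun σ z => S.lam σ z - S.kap σ z) fun σ z => -(S.lam σ z + S.kap σ z)

/-- The derivative of the speed of the unfolded sound waves. -/
noncomputable def speedDeriv : ℝ → ℝ → ℝ :=
  unfolded a b T (fun σ z => S.lamr σ z - S.kapr σ z) fun σ z => S.lamr σ z + S.kapr σ z

/-- The unfolded impedance logarithm. -/
noncomputable def coeff : ℝ → ℝ → ℝ := unfolded a b T S.th S.th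

/-- The derivative of the unfolded impedance logarithm. -/
noncomputable def coeffDeriv : ℝ → ℝ → ℝ := unfolded a b T S.thr fun σ z => -S.thr σ z

/-- The derivative of the unfolded impedance logarithm along the unfolded sound waves. -/
noncomputable def coeffAlong : ℝ → ℝ → ℝ := unfolded a b T S.alongBack S.alongForth

variable {a b T S}

namespace IsAdmissible

variable (A : S.IsAdmissible a b T C)
include A

theorem nonneg : 0 ≤ C := (abs_nonneg _).trans
  (A.kap_bound .plus (0, b) ⟨⟨le_rfl, A.pos.le⟩, mem_Ici.2 le_rfl⟩)

theorem alongBack_bound (σ : Side) (z : ℝ × ℝ) (hz : z ∈ slab a b T σ) :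
    |S.alongBack σ z| ≤ C + C * C := by
  refine (abs_sub _ _).trans (add_le_add (A.along_bound σ z hz) ?_)
  rw [abs_mul]
  exact mul_le_mul (A.kap_bound σ z hz) (A.thr_bound σ z hz) (abs_nonneg _) A.nonneg

theorem alongForth_bound (σ : Side) (z : ℝ × ℝ) (hz : z ∈ slab a b T σ) :
    |S.alongForth σ z| ≤ C + C * C := by
  refine (abs_add_le _ _).trans (add_le_add (A.along_bound σ z hz) ?_)
  rw [abs_mul]
  exact mul_le_mul (A.kap_bound σ z hz) (A.thr_bound σ z hz) (abs_nonneg _) A.nonneg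

/-- Where the transport speed vanishes, both waves unfold to the speed -κ. This is why a wall and a
front that are characteristic for the transport leave no jump in the unfolded field. -/
theorem matching_speed : Matching a b T (fun σ z => S.lam σ z - S.kap σ z)
    fun σ z => -(S.lam σ z + S.kap σ z) :=
  ⟨fun t ht => by simp [A.lam_wall t ht],
    fun t ht => by simp [A.lam_front _ t ht, A.kap_front t ht],
    fun t ht => by simp [A.lam_front _ t ht, A.kap_front t ht]⟩

theorem matching_coeff : Matching a b T S.th S.th := ⟨fun _ _ => rfl, A.th_front, A.th_front⟩

theorem continuous_speed : Continuous (Function.uncurry (S.speed a b T)) :=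
  continuous_unfolded A.lt A.pos.le A.matching_speed
    (fun σ => (A.lam σ).continuousOn.sub (A.kap σ).continuousOn)
    fun σ => ((A.lam σ).continuousOn.add (A.kap σ).continuousOn).neg

theorem speedDeriv_bddContOff : BddContOff (breaks (b - a)) (2 * C) (S.speedDeriv a b T) :=
  ⟨continuousOn_unfolded A.lt A.pos.le
      (fun σ => (A.lam σ).continuousOn_dr.sub (A.kap σ).continuousOn_dr)
      fun σ => (A.lam σ).continuousOn_dr.add (A.kap σ).continuousOn_dr,
    abs_unfolded_le A.lt.le A.pos.le
      (fun σ z hz => (abs_sub _ _).trans (by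
        linarith [A.lamr_bound σ z hz, A.kapr_bound σ z hz]))
      fun σ z hz => (abs_add_le _ _).trans (by
        linarith [A.lamr_bound σ z hz, A.kapr_bound σ z hz])⟩

theorem hasDerivAt_speed (t : ℝ) {x : ℝ} (hx : x ∉ breaks (b - a)) :
    HasDerivAt (S.speed a b T t) (S.speedDeriv a b T t x) x := by
  have ht := clampTime_mem A.pos.le t
  have h := hasDerivAt_unfolded (T := T) (t := t) (p := fun σ z => S.lam σ z - S.kap σ z)
    (q := fun σ z => -(S.lam σ z + S.kap σ z)) (pr := fun σ z => S.lamr σ z - S.kapr σ z)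
    (qr := fun σ z => -(S.lamr σ z + S.kapr σ z)) A.lt
    (fun σ r hr => ((A.lam σ).sub (A.kap σ)).hasDerivWithinAt_snd (fun r hr => ⟨ht, hr⟩) hr)
    (fun σ r hr => ((A.lam σ).add (A.kap σ)).neg.hasDerivWithinAt_snd (fun r hr => ⟨ht, hr⟩) hr) hx
  simp only [neg_neg] at h
  exact h

theorem exists_charField :
    ∃ X, CharField T (2 * C) (breaks (b - a)) (S.speed a b T) (S.speedDeriv a b T) X := by
  have hC := A.nonneg
  have hlip : ∀ t x y, |S.speed a b T t x - S.speed a b T t y| ≤ 2 * C * |x - y| := fun t x y =>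
    abs_sub_le_of_hasDerivAt_off (countable_breaks (b - a)) (A.continuous_speed.comp (by fun_prop :
      Continuous fun x : ℝ => (t, x))) (fun x hx => A.hasDerivAt_speed t hx)
      (A.speedDeriv_bddContOff.intervalIntegrable_slice (isClosed_breaks _) (countable_breaks _) t)
      (A.speedDeriv_bddContOff.bound t) x y
  obtain ⟨X, hX⟩ := exists_isFlow A.pos (by positivity : (0 : ℝ) ≤ 2 * C) A.continuous_speed hlip
  refine ⟨X, A.pos, isClosed_breaks _, countable_breaks _, A.continuous_speed,
    fun t x hx => A.hasDerivAt_speed t hx, A.speedDeriv_bddContOff, hX, fun t ht x => ?_⟩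
  -- At every break the speed is -κ, which is not zero, so the curves cross the breaks transversally
  -- and `countable_meet` applies.
  have hne : ∀ e ∈ breaks (b - a), ∀ s, S.speed a b T s e ≠ 0 := by
    intro e he s
    have hs := clampTime_mem A.pos.le s
    have hk := A.kap_pos .minus (clampTime T s, b) ⟨hs, Side.mem A.lt.le _⟩
    have hka := A.kap_pos .minus (clampTime T s, a) ⟨hs, Side.left_mem A.lt.le⟩
    have hl := A.lam_front .minus _ hs
    have hla := A.lam_wall _ hs
    have hab := A.lt
    unfold Acoustics.speed unfolded
    rcases he with rfl | rfl | rfl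
    · simp only [neg_sub, sub_pos, sub_neg, hab, not_lt.2 hab.le, if_true, if_false, le_refl,
        sub_sub_cancel, hl]
      simp [hk.ne']
    · simp only [lt_irrefl, if_false, hla]
      intro h
      linarith
    · simp only [sub_pos, hab, if_true, le_refl, add_sub_cancel, hl]
      simp [hk.ne']
  refine Countable.mono (s₂ := ⋃ e ∈ breaks (b - a), {s | s ∈ Ioo 0 T ∧ X t x s = e}) ?_
    ((countable_breaks _).biUnion fun e he => hX.countable_meet ht x e (hne e he))
  rintro s ⟨hs, he⟩
  exact mem_biUnion he ⟨hs, rfl⟩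

theorem coeffDeriv_bddContOff : BddContOff (breaks (b - a)) C (S.coeffDeriv a b T) :=
  ⟨continuousOn_unfolded A.lt A.pos.le (fun σ => (A.th σ).continuousOn_dr)
      fun σ => (A.th σ).continuousOn_dr.neg,
    abs_unfolded_le A.lt.le A.pos.le A.thr_bound
      fun σ z hz => by rw [abs_neg]; exact A.thr_bound σ z hz⟩

theorem coeffAlong_bddContOff :
    BddContOff (breaks (b - a)) (C + C * C) (S.coeffAlong a b T) := by
  have h : ∀ σ, ContinuousOn (fun z => S.tht σ z + S.lam σ z * S.thr σ z) (slab a b T σ) :=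
    fun σ => (A.th σ).continuousOn_dt.add ((A.lam σ).continuousOn.mul (A.th σ).continuousOn_dr)
  have h' : ∀ σ, ContinuousOn (fun z => S.kap σ z * S.thr σ z) (slab a b T σ) :=
    fun σ => (A.kap σ).continuousOn.mul (A.th σ).continuousOn_dr
  exact ⟨continuousOn_unfolded A.lt A.pos.le (fun σ => (h σ).sub (h' σ))
      (fun σ => (h σ).add (h' σ)),
    abs_unfolded_le A.lt.le A.pos.le A.alongBack_bound A.alongForth_bound⟩

theorem coeff_pwC1 : PwC1 T (C + C * C) (breaks (b - a)) (S.speed a b T) (S.coeff a b T)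
    (S.coeffAlong a b T) (S.coeffDeriv a b T) := by
  have hC := A.nonneg
  refine ⟨continuous_unfolded A.lt A.pos.le A.matching_coeff (fun σ => (A.th σ).continuousOn)
      fun σ => (A.th σ).continuousOn, fun t ht x hx => ?_, fun t ht x hx => ?_,
    A.coeffAlong_bddContOff, A.coeffDeriv_bddContOff.mono (by nlinarith)⟩
  · have hm := clampTime_mem A.pos.le t
    exact hasDerivAt_unfolded A.lt
      (fun σ r hr => (A.th σ).hasDerivWithinAt_snd (fun r hr => ⟨hm, hr⟩) hr)
      (fun σ r hr => (A.th σ).hasDerivWithinAt_snd (fun r hr => ⟨hm, hr⟩) hr) hx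
  · refine (hasFDerivAt_unfolded A.lt A.th A.th ht hx).congr_fderiv ?_
    congr 2
    have h0 : x ≠ 0 := fun h => hx (by simp [breaks, h])
    unfold Acoustics.coeffAlong Acoustics.speed Acoustics.coeffDeriv unfolded Acoustics.alongBack
      Acoustics.alongForth
    rcases lt_or_gt_of_ne h0 with h | h
    · simp only [not_lt.2 h.le, h, if_true, if_false]; ring
    · simp only [h, if_true]; ring

omit A in
theorem coeffDeriv_neg (t x : ℝ) : S.coeffDeriv a b T t (-x) = -S.coeffDeriv a b T t x := by
  unfold Acoustics.coeffDeriv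
  rw [unfolded_neg]
  unfold unfolded
  split_ifs <;> ring

omit A in
theorem coeffAlong_neg (t x : ℝ) : S.coeffAlong a b T t (-x) = S.coeffAlong a b T t x -
    (S.speed a b T t x + S.speed a b T t (-x)) * S.coeffDeriv a b T t x := by
  unfold Acoustics.coeffDeriv Acoustics.coeffAlong Acoustics.speed
  rw [unfolded_neg, unfolded_neg]
  unfold unfolded Acoustics.alongBack Acoustics.alongForth
  split_ifs <;> ring

/-- The transport speed, for which no bound is assumed on the outer side, cancels in the sum and
leaves -2κ. -/
theorem speed_add_bound (t x : ℝ) : |S.speed a b T t x + S.speed a b T t (-x)| ≤ 2 * C := by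
  have h : S.speed a b T t x + S.speed a b T t (-x) =
      unfolded a b T (fun σ z => -2 * S.kap σ z) (fun σ z => -2 * S.kap σ z) t x := by
    unfold Acoustics.speed
    rw [unfolded_neg]
    unfold unfolded
    split_ifs <;> ring
  have hb : ∀ σ, ∀ z ∈ slab a b T σ, |-2 * S.kap σ z| ≤ 2 * C := fun σ z hz => by
    rw [abs_mul]; simp only [abs_neg, Nat.abs_ofNat]; linarith [A.kap_bound σ z hz]
  rw [h]
  exact abs_unfolded_le A.lt.le A.pos.le hb hb t x

end IsAdmissible
end Acoustics

end VortexSheet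

/-! ### Supremum bound for Riemann invariants -/

namespace VortexSheet
open Filter Topology MeasureTheory

theorem abs_unfolded_le_of_slice {a b T : ℝ} {p q : Side → ℝ × ℝ → ℝ} (hab : a ≤ b) {C t : ℝ}
    (ht : t ∈ Icc 0 T) (hp : ∀ σ, ∀ r ∈ σ.interval a b, |p σ (t, r)| ≤ C)
    (hq : ∀ σ, ∀ r ∈ σ.interval a b, |q σ (t, r)| ≤ C) (x : ℝ) :
    |unfolded a b T p q t x| ≤ C := by
  have h := abs_unfolded_le (T := T) (p := fun σ z => p σ (t, z.2)) (q := fun σ z => q σ (t, z.2))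
    hab (ht.1.trans ht.2) (fun σ z hz => hp σ z.2 hz.2) (fun σ z hz => hq σ z.2 hz.2) t x
  simpa only [unfolded, clampTime_of_mem ht] using h

/-- The source bound φ is only integrable in time. Replacing its integral up to t by the one up to τ
turns it into a constant, and the comparison on cones applies. -/
theorem CharField.abs_le_of_curve_integral {T L : ℝ} {E : Set ℝ} {μ μx : ℝ → ℝ → ℝ}
    {X : ℝ → ℝ → ℝ → ℝ} (F : CharField T L E μ μx X) {Z : ℝ → ℝ → ℝ}
    (hZ : Continuous (Function.uncurry Z)) {M A₀ τ : ℝ} (hM : 0 ≤ M) (hτ : τ ∈ Icc 0 T)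
    {φ : ℝ → ℝ} (hφ : IntervalIntegrable φ volume 0 τ) (hφ0 : ∀ s ∈ Icc 0 τ, 0 ≤ φ s)
    (h : ∀ t ∈ Icc 0 τ, ∀ x, |Z t x| ≤ A₀ + ∫ s in (0 : ℝ)..t, (φ s + M * |Z s (-X t x s)|))
    (x : ℝ) : |Z τ x| ≤ 2 * (A₀ + ∫ s in (0 : ℝ)..τ, φ s) * Real.exp (4 * M * τ) := by
  refine F.flow.abs_le_of_integral_inequality F.continuous F.lipschitz hZ hM hτ
    (fun t ht x => (h t ht x).trans ?_) x
  have hXc := F.flow.continuous_curve t x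
  have h1 : Continuous fun s => Z s (X t x s) := hZ.comp (f := fun s => (s, X t x s)) (by fun_prop)
  have h2 : Continuous fun s => Z s (-X t x s) :=
    hZ.comp (f := fun s => (s, -X t x s)) (by fun_prop)
  have h3 : IntervalIntegrable φ volume 0 t :=
    hφ.mono_set (by rw [uIcc_of_le ht.1, uIcc_of_le hτ.1]; exact Icc_subset_Icc_right ht.2)
  have h4 : (∫ s in (0 : ℝ)..t, φ s) ≤ ∫ s in (0 : ℝ)..τ, φ s := by
    refine intervalIntegral.integral_mono_interval le_rfl ht.1 ht.2 ?_ hφ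
    filter_upwards [ae_restrict_mem measurableSet_Ioc] with s hs
    exact hφ0 s (Ioc_subset_Icc_self hs)
  rw [intervalIntegral.integral_add h3 (Continuous.intervalIntegrable (by fun_prop) _ _)]
  have h5 : (∫ s in (0 : ℝ)..t, M * |Z s (-X t x s)|) ≤
      ∫ s in (0 : ℝ)..t, M * (|Z s (X t x s)| + |Z s (-X t x s)|) :=
    intervalIntegral.integral_mono_on ht.1 (Continuous.intervalIntegrable (by fun_prop) _ _)
      (Continuous.intervalIntegrable (by fun_prop) _ _) fun s _ =>
        mul_le_mul_of_nonneg_left (le_add_of_nonneg_left (abs_nonneg _)) hM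
  linarith

namespace Acoustics.IsAdmissible

variable {a b T C : ℝ} {S : Acoustics} {X : ℝ → ℝ → ℝ → ℝ}

section Pair

variable {p pt pr q qt qr gp gq : Side → ℝ × ℝ → ℝ}

/-- The unfolded Riemann invariants satisfy an integral equation along the sound waves. -/
theorem unfolded_eq_integral (A : S.IsAdmissible a b T C)
    (F : CharField T (2 * C) (breaks (b - a)) (S.speed a b T) (S.speedDeriv a b T) X)
    (hp : ∀ σ, HasPartials (slab a b T σ) (p σ) (pt σ) (pr σ))
    (hq : ∀ σ, HasPartials (slab a b T σ) (q σ) (qt σ) (qr σ)) (hm : Matching a b T p q)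
    (hep : ∀ σ, ∀ z ∈ slab a b T σ,
      pt σ z + (S.lam σ z - S.kap σ z) * pr σ z = gp σ z - S.alongBack σ z * q σ z)
    (heq : ∀ σ, ∀ z ∈ slab a b T σ,
      qt σ z + (S.lam σ z + S.kap σ z) * qr σ z = gq σ z - S.alongForth σ z * p σ z)
    {K : ℝ} (hgp : ∀ σ, ContinuousOn (gp σ) (slab a b T σ))
    (hgq : ∀ σ, ContinuousOn (gq σ) (slab a b T σ))
    (hgpb : ∀ σ, ∀ z ∈ slab a b T σ, |gp σ z| ≤ K) (hgqb : ∀ σ, ∀ z ∈ slab a b T σ, |gq σ z| ≤ K)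
    {t : ℝ} (ht : t ∈ Icc 0 T) (x : ℝ) :
    unfolded a b T p q t x = unfolded a b T p q 0 (X t x 0) +
      ∫ s in (0 : ℝ)..t, (unfolded a b T gp gq s (X t x s) -
        S.coeffAlong a b T s (X t x s) * unfolded a b T p q s (-X t x s)) := by
  have h0 : (0 : ℝ) ∈ Icc 0 T := ⟨le_rfl, A.pos.le⟩
  set Y := unfolded a b T p q with hYdef
  have hY : Continuous (Function.uncurry Y) := continuous_unfolded A.lt A.pos.le hm
    (fun σ => (hp σ).continuousOn) fun σ => (hq σ).continuousOn
  have hXc := F.flow.continuous_curve t x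
  have hY1 : Continuous fun s => Y s (X t x s) := hY.comp (f := fun s => (s, X t x s)) (by fun_prop)
  have hY2 : Continuous fun s => Y s (-X t x s) :=
    hY.comp (f := fun s => (s, -X t x s)) (by fun_prop)
  have hG : BddContOff (breaks (b - a)) K (unfolded a b T gp gq) :=
    ⟨continuousOn_unfolded A.lt A.pos.le hgp hgq, abs_unfolded_le A.lt.le A.pos.le hgpb hgqb⟩
  have hmt := F.meet t ht x
  have hint : IntervalIntegrable (fun s => unfolded a b T gp gq s (X t x s) -
      S.coeffAlong a b T s (X t x s) * Y s (-X t x s)) volume 0 t :=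
    (hG.intervalIntegrable_curve hXc hmt h0 ht).sub
      ((A.coeffAlong_bddContOff.intervalIntegrable_curve hXc hmt h0 ht).mul_continuousOn
        hY2.continuousOn)
  -- The invariant is continuous along the curve and differentiable except at the countably many
  -- crossings of the breaks, which suffices for the fundamental theorem of calculus.
  rw [integral_eq_of_hasDerivAt_off_countable (fun s => Y s (X t x s)) _ hmt hY1.continuousOn
    (fun s hs => ?_) hint, F.flow.initial t ht]
  · ring
  · rw [min_eq_left ht.1, max_eq_right ht.1] at hs
    have hs' : s ∈ Ioo 0 T := ⟨hs.1.1, hs.1.2.trans_le ht.2⟩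
    have hsm := Ioo_subset_Icc_self hs'
    have hxE : X t x s ∉ breaks (b - a) := fun h => hs.2 ⟨hs', h⟩
    have h1 := (hasDerivAt_id s).prodMk (F.flow.hasDerivAt t ht x s hs')
    have h2 := (hasFDerivAt_unfolded A.lt hp hq hs' hxE).comp_hasDerivAt s h1
    refine h2.congr_deriv ?_
    generalize hy : X t x s = y at *
    have h3 : Y s (-y) = unfolded a b T q p s y := unfolded_neg s y
    have hy0 : y ≠ 0 := fun h => hxE (by simp [breaks, h])
    simp only [add_apply, FunLike.coe_smul, Pi.smul_apply, ContinuousLinearMap.coe_fst',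
      ContinuousLinearMap.coe_snd', smul_eq_mul, mul_one]
    rw [h3]
    unfold Acoustics.coeffAlong Acoustics.speed unfolded
    rw [clampTime_of_mem hsm]
    rcases lt_or_gt_of_ne hy0 with h | h
    · simp only [not_lt.2 h.le, h, if_true, if_false]
      have hz : (s, a - y) ∈ slab a b T (if -y ≤ b - a then Side.minus else Side.plus) :=
        ⟨hsm, by rw [sub_eq_add_neg]; exact mem_interval_side (by linarith)⟩
      linear_combination heq _ _ hz
    · simp only [h, if_true]
      have hz : (s, a + y) ∈ slab a b T (if y ≤ b - a then Side.minus else Side.plus) :=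
        ⟨hsm, mem_interval_side h.le⟩
      linear_combination hep _ _ hz

/-- The Riemann invariants are bounded by their initial values and the sources. -/
theorem abs_le_of_pair (A : S.IsAdmissible a b T C)
    (hp : ∀ σ, HasPartials (slab a b T σ) (p σ) (pt σ) (pr σ))
    (hq : ∀ σ, HasPartials (slab a b T σ) (q σ) (qt σ) (qr σ)) (hm : Matching a b T p q)
    (hep : ∀ σ, ∀ z ∈ slab a b T σ,
      pt σ z + (S.lam σ z - S.kap σ z) * pr σ z = gp σ z - S.alongBack σ z * q σ z)
    (heq : ∀ σ, ∀ z ∈ slab a b T σ,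
      qt σ z + (S.lam σ z + S.kap σ z) * qr σ z = gq σ z - S.alongForth σ z * p σ z)
    {K : ℝ} (hgp : ∀ σ, ContinuousOn (gp σ) (slab a b T σ))
    (hgq : ∀ σ, ContinuousOn (gq σ) (slab a b T σ))
    (hgpb : ∀ σ, ∀ z ∈ slab a b T σ, |gp σ z| ≤ K) (hgqb : ∀ σ, ∀ z ∈ slab a b T σ, |gq σ z| ≤ K)
    {A₀ : ℝ} (hp0 : ∀ σ, ∀ r ∈ σ.interval a b, |p σ (0, r)| ≤ A₀)
    (hq0 : ∀ σ, ∀ r ∈ σ.interval a b, |q σ (0, r)| ≤ A₀)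
    {τ : ℝ} (hτ : τ ∈ Icc 0 T) {φ : ℝ → ℝ} (hφ : IntervalIntegrable φ volume 0 τ)
    (hgpφ : ∀ σ, ∀ s ∈ Icc 0 τ, ∀ r ∈ σ.interval a b, |gp σ (s, r)| ≤ φ s)
    (hgqφ : ∀ σ, ∀ s ∈ Icc 0 τ, ∀ r ∈ σ.interval a b, |gq σ (s, r)| ≤ φ s)
    {σ : Side} {r : ℝ} (hr : r ∈ σ.interval a b) :
    |p σ (τ, r)| ≤ 2 * (A₀ + ∫ s in (0 : ℝ)..τ, φ s) * Real.exp (4 * (C + C * C) * τ) ∧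
    |q σ (τ, r)| ≤ 2 * (A₀ + ∫ s in (0 : ℝ)..τ, φ s) * Real.exp (4 * (C + C * C) * τ) := by
  obtain ⟨X, F⟩ := A.exists_charField
  have hC := A.nonneg
  have h0 : (0 : ℝ) ∈ Icc 0 T := ⟨le_rfl, A.pos.le⟩
  have hY : Continuous (Function.uncurry (unfolded a b T p q)) :=
    continuous_unfolded A.lt A.pos.le hm (fun σ => (hp σ).continuousOn) fun σ => (hq σ).continuousOn
  have key := F.abs_le_of_curve_integral hY (M := C + C * C) (A₀ := A₀) (by positivity) hτ hφ
    (fun s hs => (abs_nonneg _).trans (hgpφ .plus s hs b (mem_Ici.2 le_rfl))) fun t ht x => by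
      have ht' : t ∈ Icc 0 T := ⟨ht.1, ht.2.trans hτ.2⟩
      have hXc := F.flow.continuous_curve t x
      have hY2 : Continuous fun s => unfolded a b T p q s (-X t x s) :=
        hY.comp (f := fun s => (s, -X t x s)) (by fun_prop)
      have hφt : IntervalIntegrable φ volume 0 t :=
        hφ.mono_set (by rw [uIcc_of_le ht.1, uIcc_of_le hτ.1]; exact Icc_subset_Icc_right ht.2)
      rw [A.unfolded_eq_integral F hp hq hm hep heq hgp hgq hgpb hgqb ht' x]
      refine (abs_add_le _ _).trans (add_le_add
        (abs_unfolded_le_of_slice A.lt.le h0 hp0 hq0 _) ?_)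
      have hc : Continuous fun s => (C + C * C) * |unfolded a b T p q s (-X t x s)| := by fun_prop
      rw [← Real.norm_eq_abs]
      refine intervalIntegral.norm_integral_le_of_norm_le ht.1 (ae_of_all _ fun s hs => ?_)
        (hφt.add (hc.intervalIntegrable _ _))
      have hs' : s ∈ Icc 0 τ := ⟨hs.1.le, hs.2.trans ht.2⟩
      rw [Real.norm_eq_abs]
      refine (abs_sub _ _).trans (add_le_add (abs_unfolded_le_of_slice A.lt.le
        ⟨hs'.1, hs'.2.trans hτ.2⟩ (fun σ => hgpφ σ s hs') (fun σ => hgqφ σ s hs') _) ?_)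
      rw [abs_mul]
      exact mul_le_mul_of_nonneg_right (A.coeffAlong_bddContOff.bound _ _) (abs_nonneg _)
  have h1 := unfolded_apply A.lt.le hm hτ hr
  exact ⟨h1.1 ▸ key (r - a), h1.2 ▸ key (a - r)⟩

end Pair

end Acoustics.IsAdmissible

end VortexSheet

/-! ### Existence of Riemann invariants and the bound for their derivatives -/

namespace VortexSheet
open Filter Topology MeasureTheory

/-- Riemann invariants `p`, `q` of the acoustic system with sources `gp`, `gq` and initial values
`P`, `Q`. -/
structure IsRiemannPair (S : Acoustics) (a b T : ℝ) (gp gq : Side → ℝ × ℝ → ℝ) (P Q : Side → ℝ → ℝ)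
    (p pt pr q qt qr : Side → ℝ × ℝ → ℝ) : Prop where
  fst : ∀ σ, HasPartials (slab a b T σ) (p σ) (pt σ) (pr σ)
  snd : ∀ σ, HasPartials (slab a b T σ) (q σ) (qt σ) (qr σ)
  matching : Matching a b T p q
  equation_fst : ∀ σ, ∀ z ∈ slab a b T σ,
    pt σ z + (S.lam σ z - S.kap σ z) * pr σ z = gp σ z - S.alongBack σ z * q σ z
  equation_snd : ∀ σ, ∀ z ∈ slab a b T σ,
    qt σ z + (S.lam σ z + S.kap σ z) * qr σ z = gq σ z - S.alongForth σ z * p σ z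
  initial_fst : ∀ σ, ∀ r ∈ σ.interval a b, p σ (0, r) = P σ r
  initial_snd : ∀ σ, ∀ r ∈ σ.interval a b, q σ (0, r) = Q σ r

namespace Acoustics.IsAdmissible

variable {a b T C K : ℝ} {S : Acoustics} {X : ℝ → ℝ → ℝ → ℝ}
  {gp gpr gq gqr : Side → ℝ × ℝ → ℝ} {P P' Q Q' : Side → ℝ → ℝ}

/-- The derivatives of the initial values of the Riemann invariants after the unfolding. -/
noncomputable def initDensity (S : Acoustics) (P' Q : Side → ℝ → ℝ) (σ : Side) (z : ℝ × ℝ) : ℝ :=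
  P' σ z.2 + S.thr σ (0, z.2) * Q σ z.2

/-- The hypothesis `hV` carries the compatibility of order one: it makes the unfolded initial
density continuous at the wall and at the front, although the derivatives of the initial values may
jump there. -/
theorem reflectedData (A : S.IsAdmissible a b T C)
    (F : CharField T (2 * C) (breaks (b - a)) (S.speed a b T) (S.speedDeriv a b T) X)
    (hgp : RadialC1 a b T K gp gpr) (hgq : RadialC1 a b T K gq gqr) (hg : Matching a b T gp gq)
    (hP : RadialC1 a b T K (fun σ z => P σ z.2) fun σ z => P' σ z.2)
    (hQ : RadialC1 a b T K (fun σ z => Q σ z.2) fun σ z => Q' σ z.2)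
    (hPQ : Matching a b T (fun σ z => P σ z.2) fun σ z => Q σ z.2)
    (hV : Matching a b T (initDensity S P' Q) fun σ z => -initDensity S Q' P σ z) :
    ReflectedData T (2 * C) (3 * C + C * C + K + C * K) (breaks (b - a)) (S.speed a b T)
      (S.speedDeriv a b T) X (S.coeff a b T) (S.coeffAlong a b T) (S.coeffDeriv a b T)
      (unfolded a b T gp gq) (unfolded a b T gpr fun σ z => -gqr σ z)
      (unfolded a b T (fun σ z => P σ z.2) (fun σ z => Q σ z.2) 0)
      (unfolded a b T (fun σ z => P' σ z.2) (fun σ z => -Q' σ z.2) 0)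
      (unfolded a b T (initDensity S P' Q) (fun σ z => -initDensity S Q' P σ z) 0) := by
  have hC := A.nonneg
  have h0 : (0 : ℝ) ∈ Icc 0 T := ⟨le_rfl, A.pos.le⟩
  have hK : 0 ≤ K := (abs_nonneg _).trans (hgp.bound .plus (0, b) ⟨h0, mem_Ici.2 le_rfl⟩)
  have hCC : 0 ≤ C * C := by positivity
  have hCK : 0 ≤ C * K := by positivity
  have hz : ∀ {z : ℝ × ℝ} {σ : Side}, z ∈ slab a b T σ → ((0 : ℝ), z.2) ∈ slab a b T σ :=
    fun h => ⟨h0, h.2⟩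
  have hthr0 : ∀ σ, ContinuousOn (fun z : ℝ × ℝ => S.thr σ (0, z.2)) (slab a b T σ) := fun σ =>
    (A.th σ).continuousOn_dr.comp (by fun_prop) fun z hz' => hz hz'
  have hcp : ∀ σ, ContinuousOn (initDensity S P' Q σ) (slab a b T σ) := fun σ =>
    (hP.continuousOn_dr σ).add ((hthr0 σ).mul (hQ.continuousOn σ))
  have hcq : ∀ σ, ContinuousOn (initDensity S Q' P σ) (slab a b T σ) := fun σ =>
    (hQ.continuousOn_dr σ).add ((hthr0 σ).mul (hP.continuousOn σ))
  have hb : ∀ σ, ∀ z ∈ slab a b T σ, ∀ x y : ℝ, |x| ≤ K → |y| ≤ K →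
      |x + S.thr σ (0, z.2) * y| ≤ K + C * K := fun σ z hz' x y hx hy => by
    refine (abs_add_le _ _).trans (add_le_add hx ?_)
    rw [abs_mul]
    exact mul_le_mul (A.thr_bound σ _ (hz hz')) hy (abs_nonneg _) hC
  have hbp : ∀ σ, ∀ z ∈ slab a b T σ, |initDensity S P' Q σ z| ≤ K + C * K := fun σ z hz' =>
    hb σ z hz' _ _ (hP.bound_dr σ z hz') (hQ.bound σ z hz')
  have hbq : ∀ σ, ∀ z ∈ slab a b T σ, |-initDensity S Q' P σ z| ≤ K + C * K := fun σ z hz' => by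
    rw [abs_neg]; exact hb σ z hz' _ _ (hQ.bound_dr σ z hz') (hP.bound σ z hz')
  have hx0 : Continuous fun x : ℝ => ((0 : ℝ), x) := by fun_prop
  have hdP := A.coeff_pwC1
  refine
    { field := F
      symm := fun _ => neg_mem_breaks
      coeff := ⟨hdP.continuous, hdP.hasDerivAt, hdP.hasFDerivAt, hdP.along.mono (by linarith),
        hdP.deriv_x.mono (by linarith)⟩
      coeff_bound := fun t x =>
        (abs_unfolded_le A.lt.le A.pos.le A.th_bound A.th_bound t x).trans (by linarith)
      coeff_x_neg := coeffDeriv_neg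
      coeff_along_neg := coeffAlong_neg
      sum_bound := fun t x => (A.speed_add_bound t x).trans (by linarith)
      source := continuous_unfolded A.lt A.pos.le hg hgp.continuousOn hgq.continuousOn
      source_bound := fun t x =>
        (abs_unfolded_le A.lt.le A.pos.le hgp.bound hgq.bound t x).trans (by linarith)
      source_deriv := fun t _ x hx => hasDerivAt_unfolded A.lt
        (fun σ => hgp.hasDerivWithinAt σ _ (clampTime_mem A.pos.le t))
        (fun σ => hgq.hasDerivWithinAt σ _ (clampTime_mem A.pos.le t)) hx
      source_x := BddContOff.mono (C := K) ⟨continuousOn_unfolded A.lt A.pos.le hgp.continuousOn_dr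
        fun σ => (hgq.continuousOn_dr σ).neg, abs_unfolded_le A.lt.le A.pos.le hgp.bound_dr
          fun σ z hz' => by rw [abs_neg]; exact hgq.bound_dr σ z hz'⟩ (by linarith)
      init := (continuous_unfolded A.lt A.pos.le hPQ hP.continuousOn hQ.continuousOn).comp hx0
      init_bound := fun x =>
        (abs_unfolded_le A.lt.le A.pos.le hP.bound hQ.bound 0 x).trans (by linarith)
      init_deriv := fun x hx => hasDerivAt_unfolded A.lt
        (fun σ => hP.hasDerivWithinAt σ _ (clampTime_mem A.pos.le 0))
        (fun σ => hQ.hasDerivWithinAt σ _ (clampTime_mem A.pos.le 0)) hx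
      init_density := (continuous_unfolded A.lt A.pos.le hV hcp fun σ => (hcq σ).neg).comp hx0
      init_density_bound := fun x =>
        (abs_unfolded_le A.lt.le A.pos.le hbp hbq 0 x).trans (by linarith)
      init_eq := fun x hx => ?_ }
  have hne : x ≠ 0 := fun h => hx (by simp [breaks, h])
  rw [unfolded_neg]
  unfold Acoustics.coeffDeriv unfolded initDensity
  rw [clampTime_of_mem h0]
  rcases lt_or_gt_of_ne hne with h | h
  · simp only [not_lt.2 h.le, h, if_true, if_false]; ring
  · simp only [h, if_true]

/-- Grönwall's inequality for the equation of the density alone. Neither the undifferentiated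
invariants nor second derivatives enter, and the factor exp(2CT) bounds the derivative of the flow.
-/
theorem abs_density_le (A : S.IsAdmissible a b T C)
    (F : CharField T (2 * C) (breaks (b - a)) (S.speed a b T) (S.speedDeriv a b T) X)
    {Y V : ℝ → ℝ → ℝ} (hY : IsReflectedSolution T (breaks (b - a)) (S.speed a b T)
      (S.speedDeriv a b T) X (S.coeffAlong a b T) (S.coeffDeriv a b T)
      (unfolded a b T gp gq) (unfolded a b T gpr fun σ z => -gqr σ z)
      (unfolded a b T (fun σ z => P σ z.2) (fun σ z => Q σ z.2) 0)
      (unfolded a b T (initDensity S P' Q) (fun σ z => -initDensity S Q' P σ z) 0) Y V)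
    (hg : Matching a b T gp gq) {τ A₁ : ℝ} (hτ : τ ∈ Icc 0 T) {ψ : ℝ → ℝ} (hψ : IntervalIntegrable ψ volume 0 τ)
    (hp0 : ∀ σ, ∀ r ∈ σ.interval a b, |P' σ r + S.thr σ (0, r) * Q σ r| ≤ A₁)
    (hq0 : ∀ σ, ∀ r ∈ σ.interval a b, |Q' σ r + S.thr σ (0, r) * P σ r| ≤ A₁)
    (hp : ∀ σ, ∀ s ∈ Icc 0 τ, ∀ r ∈ σ.interval a b,
      |gpr σ (s, r) + S.thr σ (s, r) * gq σ (s, r)| ≤ ψ s)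
    (hq : ∀ σ, ∀ s ∈ Icc 0 τ, ∀ r ∈ σ.interval a b,
      |gqr σ (s, r) + S.thr σ (s, r) * gp σ (s, r)| ≤ ψ s) (x : ℝ) :
    |V τ x| ≤ 2 * (Real.exp (2 * C * T) * (A₁ + ∫ s in (0 : ℝ)..τ, ψ s)) *
      Real.exp (4 * (Real.exp (2 * C * T) * (C + C * C)) * τ) := by
  have hC := A.nonneg
  have h0 : (0 : ℝ) ∈ Icc 0 T := ⟨le_rfl, A.pos.le⟩
  set J := Real.exp (2 * C * T) with hJ
  have hJ0 : 0 < J := Real.exp_pos _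
  have hVc := hY.continuous_density
  have hψ0 : ∀ s ∈ Icc 0 τ, 0 ≤ ψ s := fun s hs =>
    (abs_nonneg _).trans (hp .plus s hs b (mem_Ici.2 le_rfl))
  rw [mul_add, ← intervalIntegral.integral_const_mul]
  refine F.abs_le_of_curve_integral hVc (by positivity) hτ (hψ.const_mul J)
    (fun s hs => mul_nonneg hJ0.le (hψ0 s hs)) (fun t ht x => ?_) x
  have ht' : t ∈ Icc 0 T := ⟨ht.1, ht.2.trans hτ.2⟩
  have hXc := F.flow.continuous_curve t x
  have hV2 : Continuous fun s => V s (-X t x s) :=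
    hVc.comp (f := fun s => (s, -X t x s)) (by fun_prop)
  have hψt : IntervalIntegrable ψ volume 0 t :=
    hψ.mono_set (by rw [uIcc_of_le ht.1, uIcc_of_le hτ.1]; exact Icc_subset_Icc_right ht.2)
  rw [hY.density_eq t x, transportedDensity, clampTime_of_mem ht']
  refine (abs_add_le _ _).trans (add_le_add ?_ ?_)
  · rw [abs_mul]
    refine mul_le_mul (F.flowDeriv_le ht' h0 x) ?_ (abs_nonneg _) hJ0.le
    exact abs_unfolded_le_of_slice A.lt.le h0 hp0
      (fun σ r hr => by rw [abs_neg]; exact hq0 σ r hr) _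
  · have hc : Continuous fun s => J * (C + C * C) * |V s (-X t x s)| := by fun_prop
    rw [← Real.norm_eq_abs]
    refine intervalIntegral.norm_integral_le_of_norm_le ht.1 (ae_of_all _ fun s hs => ?_)
      ((hψt.const_mul J).add (hc.intervalIntegrable _ _))
    have hs' : s ∈ Icc 0 τ := ⟨hs.1.le, hs.2.trans ht.2⟩
    have hsT : s ∈ Icc 0 T := ⟨hs'.1, hs'.2.trans hτ.2⟩
    rw [Real.norm_eq_abs, abs_mul, mul_assoc, ← mul_add]
    refine mul_le_mul (F.flowDeriv_le ht' hsT x) ?_ (abs_nonneg _) hJ0.le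
    refine (abs_add_le _ _).trans (add_le_add ?_ ?_)
    · have h1 := abs_unfolded_le_of_slice (T := T)
        (p := fun σ z => gpr σ z + S.thr σ z * gq σ z)
        (q := fun σ z => -(gqr σ z + S.thr σ z * gp σ z)) A.lt.le hsT (fun σ => hp σ s hs')
        (fun σ r hr => by rw [abs_neg]; exact hq σ s hs' r hr) (X t x s)
      refine le_trans (le_of_eq ?_) h1
      congr 1
      rw [unfolded_neg]
      unfold Acoustics.coeffDeriv unfolded
      have hw := hg.wall _ (clampTime_mem A.pos.le s)
      beta_reduce
      split_ifs
      · ring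
      · ring
      · ring
      · ring
      -- At x = 0, where the unfolding takes the mean, the identity needs the two sources to agree
      -- at the wall.
      · rw [hw]; ring
    · rw [abs_mul]
      exact mul_le_mul_of_nonneg_right (A.coeffAlong_bddContOff.bound _ _) (abs_nonneg _)

/-- Existence of Riemann invariants, with a bound for their derivatives. -/
theorem exists_isRiemannPair (A : S.IsAdmissible a b T C)
    (hgp : RadialC1 a b T K gp gpr) (hgq : RadialC1 a b T K gq gqr) (hg : Matching a b T gp gq)
    (hP : RadialC1 a b T K (fun σ z => P σ z.2) fun σ z => P' σ z.2)
    (hQ : RadialC1 a b T K (fun σ z => Q σ z.2) fun σ z => Q' σ z.2)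
    (hPQ : Matching a b T (fun σ z => P σ z.2) fun σ z => Q σ z.2)
    (hV : Matching a b T (initDensity S P' Q) fun σ z => -initDensity S Q' P σ z) :
    ∃ p pt pr q qt qr, IsRiemannPair S a b T gp gq P Q p pt pr q qt qr ∧
      ∀ τ ∈ Icc 0 T, ∀ (A₁ : ℝ) (ψ : ℝ → ℝ), IntervalIntegrable ψ volume 0 τ →
      (∀ σ, ∀ r ∈ σ.interval a b, |P' σ r + S.thr σ (0, r) * Q σ r| ≤ A₁) →
      (∀ σ, ∀ r ∈ σ.interval a b, |Q' σ r + S.thr σ (0, r) * P σ r| ≤ A₁) →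
      (∀ σ, ∀ s ∈ Icc 0 τ, ∀ r ∈ σ.interval a b,
        |gpr σ (s, r) + S.thr σ (s, r) * gq σ (s, r)| ≤ ψ s) →
      (∀ σ, ∀ s ∈ Icc 0 τ, ∀ r ∈ σ.interval a b,
        |gqr σ (s, r) + S.thr σ (s, r) * gp σ (s, r)| ≤ ψ s) →
      ∀ σ, ∀ r ∈ σ.interval a b,
        |pr σ (τ, r) + S.thr σ (τ, r) * q σ (τ, r)| ≤
          2 * (Real.exp (2 * C * T) * (A₁ + ∫ s in (0 : ℝ)..τ, ψ s)) *
            Real.exp (4 * (Real.exp (2 * C * T) * (C + C * C)) * τ) ∧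
        |qr σ (τ, r) + S.thr σ (τ, r) * p σ (τ, r)| ≤
          2 * (Real.exp (2 * C * T) * (A₁ + ∫ s in (0 : ℝ)..τ, ψ s)) *
            Real.exp (4 * (Real.exp (2 * C * T) * (C + C * C)) * τ) := by
  obtain ⟨X, F⟩ := A.exists_charField
  obtain ⟨Y, V, hY⟩ := (A.reflectedData F hgp hgq hg hP hQ hPQ hV).exists_solution
  have h0 : (0 : ℝ) ∈ Icc 0 T := ⟨le_rfl, A.pos.le⟩
  have hYc := hY.continuous
  have hVc := hY.continuous_density
  -- The same formula serves on both sides, so continuity at the front and equality at the wall hold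
  -- by construction.
  let p : Side → ℝ × ℝ → ℝ := fun _ z => Y z.1 (z.2 - a)
  let q : Side → ℝ × ℝ → ℝ := fun _ z => Y z.1 (a - z.2)
  let pr : Side → ℝ × ℝ → ℝ := fun σ z => V z.1 (z.2 - a) - S.thr σ z * q σ z
  let qr : Side → ℝ × ℝ → ℝ := fun σ z => -V z.1 (a - z.2) - S.thr σ z * p σ z
  -- The time derivatives are read off from the equations. They are continuous up to the boundary,
  -- so `HasPartials.of_interior` reduces their identification to interior points.
  let pt : Side → ℝ × ℝ → ℝ := fun σ z =>
    gp σ z - S.alongBack σ z * q σ z - (S.lam σ z - S.kap σ z) * pr σ z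
  let qt : Side → ℝ × ℝ → ℝ := fun σ z =>
    gq σ z - S.alongForth σ z * p σ z - (S.lam σ z + S.kap σ z) * qr σ z
  have hYp : Continuous fun z : ℝ × ℝ => Y z.1 (z.2 - a) :=
    hYc.comp (f := fun z : ℝ × ℝ => (z.1, z.2 - a)) (by fun_prop)
  have hYq : Continuous fun z : ℝ × ℝ => Y z.1 (a - z.2) :=
    hYc.comp (f := fun z : ℝ × ℝ => (z.1, a - z.2)) (by fun_prop)
  have hVp : Continuous fun z : ℝ × ℝ => V z.1 (z.2 - a) :=
    hVc.comp (f := fun z : ℝ × ℝ => (z.1, z.2 - a)) (by fun_prop)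
  have hVq : Continuous fun z : ℝ × ℝ => V z.1 (a - z.2) :=
    hVc.comp (f := fun z : ℝ × ℝ => (z.1, a - z.2)) (by fun_prop)
  have hthr : ∀ σ, ContinuousOn (S.thr σ) (slab a b T σ) := fun σ => (A.th σ).continuousOn_dr
  have htht : ∀ σ, ContinuousOn (S.tht σ) (slab a b T σ) := fun σ => (A.th σ).continuousOn_dt
  have hlam : ∀ σ, ContinuousOn (S.lam σ) (slab a b T σ) := fun σ => (A.lam σ).continuousOn
  have hkap : ∀ σ, ContinuousOn (S.kap σ) (slab a b T σ) := fun σ => (A.kap σ).continuousOn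
  have hprc : ∀ σ, ContinuousOn (pr σ) (slab a b T σ) := fun σ =>
    hVp.continuousOn.sub ((hthr σ).mul hYq.continuousOn)
  have hqrc : ∀ σ, ContinuousOn (qr σ) (slab a b T σ) := fun σ =>
    hVq.continuousOn.neg.sub ((hthr σ).mul hYp.continuousOn)
  have hback : ∀ σ, ContinuousOn (S.alongBack σ) (slab a b T σ) := fun σ =>
    ((htht σ).add ((hlam σ).mul (hthr σ))).sub ((hkap σ).mul (hthr σ))
  have hforth : ∀ σ, ContinuousOn (S.alongForth σ) (slab a b T σ) := fun σ =>
    ((htht σ).add ((hlam σ).mul (hthr σ))).add ((hkap σ).mul (hthr σ))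
  have hptc : ∀ σ, ContinuousOn (pt σ) (slab a b T σ) := fun σ =>
    ((hgp.continuousOn σ).sub ((hback σ).mul hYq.continuousOn)).sub
      (((hlam σ).sub (hkap σ)).mul (hprc σ))
  have hqtc : ∀ σ, ContinuousOn (qt σ) (slab a b T σ) := fun σ =>
    ((hgq.continuousOn σ).sub ((hforth σ).mul hYp.continuousOn)).sub
      (((hlam σ).add (hkap σ)).mul (hqrc σ))
  have hpP : ∀ σ, HasPartials (slab a b T σ) (p σ) (pt σ) (pr σ) := fun σ => by
    refine HasPartials.of_interior (convex_slab a b T σ) (closure_interior_slab A.lt A.pos σ)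
      hYp.continuousOn (hptc σ) (hprc σ) ?_
    rintro ⟨t, r⟩ hz
    rw [interior_slab] at hz
    obtain ⟨-, hb, hu⟩ := unfolded_of_interior A.lt (Ioo_subset_Icc_self hz.1) hz.2
    have h2 : HasFDerivAt (fun z : ℝ × ℝ => (z.1, z.2 - a)) ((ContinuousLinearMap.fst ℝ ℝ ℝ).prod
        (ContinuousLinearMap.snd ℝ ℝ ℝ)) (t, r) :=
      hasFDerivAt_fst.prodMk (hasFDerivAt_snd.sub_const a)
    have h3 := HasFDerivAt.comp (t, r) (f := fun z : ℝ × ℝ => (z.1, z.2 - a))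
      (hY.hasFDerivAt t hz.1 _ hb) h2
    refine h3.congr_fderiv ?_
    simp only [Acoustics.coeffAlong, Acoustics.coeffDeriv, Acoustics.speed, (hu _ _).1, neg_sub]
    simp only [pt, pr, q]
    ext <;> simp
  have hqP : ∀ σ, HasPartials (slab a b T σ) (q σ) (qt σ) (qr σ) := fun σ => by
    refine HasPartials.of_interior (convex_slab a b T σ) (closure_interior_slab A.lt A.pos σ)
      hYq.continuousOn (hqtc σ) (hqrc σ) ?_
    rintro ⟨t, r⟩ hz
    rw [interior_slab] at hz
    obtain ⟨-, hb, hu⟩ := unfolded_of_interior A.lt (Ioo_subset_Icc_self hz.1) hz.2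
    have hb' : a - r ∉ breaks (b - a) := fun h => hb (by simpa using neg_mem_breaks h)
    have h2 : HasFDerivAt (fun z : ℝ × ℝ => (z.1, a - z.2)) ((ContinuousLinearMap.fst ℝ ℝ ℝ).prod
        (-ContinuousLinearMap.snd ℝ ℝ ℝ)) (t, r) :=
      hasFDerivAt_fst.prodMk (hasFDerivAt_snd.const_sub a)
    have h3 := HasFDerivAt.comp (t, r) (f := fun z : ℝ × ℝ => (z.1, a - z.2))
      (hY.hasFDerivAt t hz.1 _ hb') h2
    refine h3.congr_fderiv ?_
    simp only [Acoustics.coeffAlong, Acoustics.coeffDeriv, Acoustics.speed, (hu _ _).2, neg_sub]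
    simp only [qt, qr, p]
    ext <;> simp <;> ring
  refine ⟨p, pt, pr, q, qt, qr, ⟨hpP, hqP, ⟨fun t _ => by simp [p, q], fun _ _ => rfl,
    fun _ _ => rfl⟩, fun σ z _ => by simp only [pt]; ring, fun σ z _ => by simp only [qt]; ring,
    fun σ r hr => ?_, fun σ r hr => ?_⟩, ?_⟩
  · change Y 0 (r - a) = _
    rw [hY.eq_transported, transported, clampTime_of_mem h0, F.flow.initial 0 h0,
      intervalIntegral.integral_same, add_zero]
    exact (unfolded_apply A.lt.le hPQ h0 hr).1
  · change Y 0 (a - r) = _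
    rw [hY.eq_transported, transported, clampTime_of_mem h0, F.flow.initial 0 h0,
      intervalIntegral.integral_same, add_zero]
    exact (unfolded_apply A.lt.le hPQ h0 hr).2
  · intro τ hτ A₁ ψ hψ h1 h2 h3 h4 σ r hr
    have key := A.abs_density_le F hY hg hτ hψ h1 h2 h3 h4
    refine ⟨?_, ?_⟩
    · simpa only [pr, sub_add_cancel] using key (r - a)
    · simpa only [qr, sub_add_cancel, abs_neg] using key (a - r)

end Acoustics.IsAdmissible

end VortexSheet

namespace VortexSheet
open Filter Topology MeasureTheory

/-! ### Radial calculus -/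

namespace RadialC1

variable {a b T K K' : ℝ} {g gr h hr : Side → ℝ × ℝ → ℝ}

theorem mono (hg : RadialC1 a b T K g gr) (h : K ≤ K') : RadialC1 a b T K' g gr :=
  ⟨hg.continuousOn, hg.continuousOn_dr, hg.hasDerivWithinAt,
    fun σ z hz => (hg.bound σ z hz).trans h, fun σ z hz => (hg.bound_dr σ z hz).trans h⟩

theorem add (hg : RadialC1 a b T K g gr) (hh : RadialC1 a b T K' h hr) :
    RadialC1 a b T (K + K') (fun σ z => g σ z + h σ z) fun σ z => gr σ z + hr σ z :=
  ⟨fun σ => (hg.continuousOn σ).add (hh.continuousOn σ),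
    fun σ => (hg.continuousOn_dr σ).add (hh.continuousOn_dr σ),
    fun σ t ht r hr => (hg.hasDerivWithinAt σ t ht r hr).add (hh.hasDerivWithinAt σ t ht r hr),
    fun σ z hz => (abs_add_le _ _).trans (add_le_add (hg.bound σ z hz) (hh.bound σ z hz)),
    fun σ z hz => (abs_add_le _ _).trans (add_le_add (hg.bound_dr σ z hz) (hh.bound_dr σ z hz))⟩

theorem mul (hg : RadialC1 a b T K g gr) (hh : RadialC1 a b T K' h hr) :
    RadialC1 a b T (2 * (K * K')) (fun σ z => g σ z * h σ z)
      fun σ z => gr σ z * h σ z + g σ z * hr σ z := by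
  have hm : ∀ {x y : ℝ}, |x| ≤ K → |y| ≤ K' → |x * y| ≤ K * K' := fun h1 h2 => by
    rw [abs_mul]
    exact mul_le_mul h1 h2 (abs_nonneg _) ((abs_nonneg _).trans h1)
  refine ⟨fun σ => (hg.continuousOn σ).mul (hh.continuousOn σ),
    fun σ => ((hg.continuousOn_dr σ).mul (hh.continuousOn σ)).add
      ((hg.continuousOn σ).mul (hh.continuousOn_dr σ)),
    fun σ t ht r hr => (hg.hasDerivWithinAt σ t ht r hr).mul (hh.hasDerivWithinAt σ t ht r hr),
    fun σ z hz => ?_, fun σ z hz => (abs_add_le _ _).trans ?_⟩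
  · have h1 := hm (hg.bound σ z hz) (hh.bound σ z hz)
    linarith [(abs_nonneg _).trans h1]
  · linarith [hm (hg.bound_dr σ z hz) (hh.bound σ z hz), hm (hg.bound σ z hz) (hh.bound_dr σ z hz)]

theorem congr (hg : RadialC1 a b T K g gr) {g' gr' : Side → ℝ × ℝ → ℝ}
    (h1 : ∀ σ, ∀ z ∈ slab a b T σ, g' σ z = g σ z)
    (h2 : ∀ σ, ∀ z ∈ slab a b T σ, gr' σ z = gr σ z) : RadialC1 a b T K g' gr' :=
  ⟨fun σ => (hg.continuousOn σ).congr (h1 σ), fun σ => (hg.continuousOn_dr σ).congr (h2 σ),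
    fun σ t ht r hr => by
      rw [h2 σ _ ⟨ht, hr⟩]
      exact (hg.hasDerivWithinAt σ t ht r hr).congr (fun y hy => h1 σ _ ⟨ht, hy⟩) (h1 σ _ ⟨ht, hr⟩),
    fun σ z hz => by rw [h1 σ z hz]; exact hg.bound σ z hz,
    fun σ z hz => by rw [h2 σ z hz]; exact hg.bound_dr σ z hz⟩

theorem const (c : ℝ) : RadialC1 a b T |c| (fun _ _ => c) fun _ _ => 0 :=
  ⟨fun _ => continuousOn_const, fun _ => continuousOn_const,
    fun _ _ _ _ _ => hasDerivWithinAt_const _ _ _, fun _ _ _ => le_rfl, fun _ _ _ => by simp⟩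

/-- The initial values of a function, as a function that does not depend on time. -/
theorem at_zero (hT : 0 ≤ T) (hg : RadialC1 a b T K g gr) :
    RadialC1 a b T K (fun σ z => g σ (0, z.2)) fun σ z => gr σ (0, z.2) := by
  have h0 : (0 : ℝ) ∈ Icc 0 T := ⟨le_rfl, hT⟩
  have hz : ∀ {z : ℝ × ℝ} {σ : Side}, z ∈ slab a b T σ → ((0 : ℝ), z.2) ∈ slab a b T σ :=
    fun h => ⟨h0, h.2⟩
  exact ⟨fun σ => (hg.continuousOn σ).comp (f := fun z : ℝ × ℝ => ((0 : ℝ), z.2)) (by fun_prop)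
      fun z h => hz h,
    fun σ => (hg.continuousOn_dr σ).comp (f := fun z : ℝ × ℝ => ((0 : ℝ), z.2)) (by fun_prop)
      fun z h => hz h,
    fun σ t _ r hr => hg.hasDerivWithinAt σ 0 h0 r hr, fun σ z h => hg.bound σ _ (hz h),
    fun σ z h => hg.bound_dr σ _ (hz h)⟩

end RadialC1

theorem HasPartials.radialC1 {a b T K : ℝ} {g gt gr : Side → ℝ × ℝ → ℝ}
    (hg : ∀ σ, HasPartials (slab a b T σ) (g σ) (gt σ) (gr σ))
    (hb : ∀ σ, ∀ z ∈ slab a b T σ, |g σ z| ≤ K) (hbr : ∀ σ, ∀ z ∈ slab a b T σ, |gr σ z| ≤ K) :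
    RadialC1 a b T K g gr :=
  ⟨fun σ => (hg σ).continuousOn, fun σ => (hg σ).continuousOn_dr,
    fun σ _ ht _ hr => (hg σ).hasDerivWithinAt_snd (fun _ hr => ⟨ht, hr⟩) hr, hb, hbr⟩

/-! ### Radial primitives -/

theorem continuousOn_integral_slab {a b T : ℝ} (hab : a ≤ b) (hT : 0 ≤ T) {w : ℝ × ℝ → ℝ}
    (hw : ContinuousOn w (slab a b T .minus)) :
    ContinuousOn (fun z => ∫ y in a..z.2, w (z.1, y)) (slab a b T .minus) := by
  have hct := continuous_clampTime T
  have h1 : Continuous fun z : ℝ × ℝ => w (clampTime T z.1, max a (min z.2 b)) :=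
    hw.comp_continuous (by fun_prop)
      fun z => ⟨clampTime_mem hT _, ⟨le_max_left _ _, max_le hab (min_le_right _ _)⟩⟩
  have h2 : Continuous fun z : ℝ × ℝ => ∫ y in a..z.2, w (clampTime T z.1, max a (min y b)) := by
    refine intervalIntegral.continuous_parametric_intervalIntegral_of_continuous
      (f := fun (z : ℝ × ℝ) y => w (clampTime T z.1, max a (min y b))) ?_ (by fun_prop)
    exact h1.comp (f := fun q : (ℝ × ℝ) × ℝ => (q.1.1, q.2)) (by fun_prop)
  refine h2.continuousOn.congr fun z hz => ?_
  apply intervalIntegral.integral_congr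
  intro y hy
  rw [uIcc_of_le hz.2.1] at hy
  simp only
  rw [clampTime_of_mem hz.1, min_eq_left (hy.2.trans hz.2.2), max_eq_right hy.1]

/-- For fixed r the time derivative passes under the integral. Combined with the continuous radial
derivative, `hasFDerivAt_of_curve` along the constant curve gives joint differentiability in the
interior. -/
theorem HasPartials.integral {a b T : ℝ} (hab : a < b) (hT : 0 < T) {w wt wr : ℝ × ℝ → ℝ}
    (hw : HasPartials (slab a b T .minus) w wt wr) :
    HasPartials (slab a b T .minus) (fun z => ∫ y in a..z.2, w (z.1, y))
      (fun z => ∫ y in a..z.2, wt (z.1, y)) w := by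
  refine HasPartials.of_interior (convex_slab a b T _) (closure_interior_slab hab hT _)
    (continuousOn_integral_slab hab.le hT.le hw.continuousOn)
    (continuousOn_integral_slab hab.le hT.le hw.continuousOn_dt) hw.continuousOn ?_
  rintro ⟨t, r⟩ hz
  rw [interior_slab, Side.interval, interior_Icc] at hz
  obtain ⟨ht, hr⟩ : t ∈ Ioo 0 T ∧ r ∈ Ioo a b := hz
  have hmem : ∀ {s y : ℝ}, s ∈ Icc 0 T → y ∈ Icc a b → (s, y) ∈ slab a b T .minus :=
    fun hs hy => ⟨hs, hy⟩
  have hslice : ∀ {k : ℝ × ℝ → ℝ}, ContinuousOn k (slab a b T .minus) → ∀ s ∈ Icc 0 T,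
      ContinuousOn (fun y => k (s, y)) (Icc a b) := fun hk s hs =>
    hk.comp (by fun_prop) fun y hy => hmem hs hy
  have hsub : uIcc a r ⊆ Icc a b := by
    rw [uIcc_of_le hr.1.le]; exact Icc_subset_Icc_right hr.2.le
  obtain ⟨B, hB⟩ : ∃ B, ∀ z ∈ slab a b T .minus, ‖wt z‖ ≤ B :=
    (isCompact_Icc.prod isCompact_Icc).exists_bound_of_continuousOn hw.continuousOn_dt
  have hdt : HasDerivAt (fun s => ∫ y in a..r, w (s, y)) (∫ y in a..r, wt (t, y)) t := by
    have hnb : Ioo 0 T ∈ 𝓝 t := Ioo_mem_nhds ht.1 ht.2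
    refine (intervalIntegral.hasDerivAt_integral_of_dominated_loc_of_deriv_le
      (F := fun s y => w (s, y)) (F' := fun s y => wt (s, y)) (bound := fun _ => B) hnb
      ?_ ?_ ?_ ?_ ?_ ?_).2
    · filter_upwards [hnb] with s hs
      exact ((hslice hw.continuousOn s (Ioo_subset_Icc_self hs)).mono
        (uIoc_subset_uIcc.trans hsub)).aestronglyMeasurable measurableSet_uIoc
    · exact ((hslice hw.continuousOn t (Ioo_subset_Icc_self ht)).mono hsub).intervalIntegrable
    · exact ((hslice hw.continuousOn_dt t (Ioo_subset_Icc_self ht)).mono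
        (uIoc_subset_uIcc.trans hsub)).aestronglyMeasurable measurableSet_uIoc
    · exact ae_of_all _ fun y hy s hs =>
        hB _ (hmem (Ioo_subset_Icc_self hs) (hsub (uIoc_subset_uIcc hy)))
    · exact intervalIntegrable_const
    · refine ae_of_all _ fun y hy s hs => ?_
      exact (hw.hasDerivWithinAt_fst (I := Icc 0 T)
        (fun s hs => hmem hs (hsub (uIoc_subset_uIcc hy))) (Ioo_subset_Icc_self hs)).hasDerivAt
          (Icc_mem_nhds hs.1 hs.2)
  have hopen : IsOpen (Ioo 0 T ×ˢ Ioo a b) := isOpen_Ioo.prod isOpen_Ioo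
  have hpt : (t, r) ∈ Ioo 0 T ×ˢ Ioo a b := ⟨ht, hr⟩
  refine (hasFDerivAt_of_curve (g := fun s r => ∫ y in a..r, w (s, y))
    (gx := fun s r => w (s, r)) (ξ := fun _ => r) (m := 0) (hasDerivAt_const t r) rfl hdt
    ?_ ?_).congr_fderiv (by simp)
  · filter_upwards [hopen.mem_nhds hpt] with z hz
    have hs := hslice hw.continuousOn z.1 (Ioo_subset_Icc_self hz.1)
    have hnb : Icc a b ∈ 𝓝 z.2 := Icc_mem_nhds hz.2.1 hz.2.2
    refine intervalIntegral.integral_hasDerivAt_right ((hs.mono ?_).intervalIntegrable) ?_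
      (hs.continuousAt hnb)
    · rw [uIcc_of_le hz.2.1.le]; exact Icc_subset_Icc_right hz.2.2.le
    · exact (hs.mono Ioo_subset_Icc_self).stronglyMeasurableAtFilter isOpen_Ioo _ hz.2
  · exact hw.continuousOn.continuousAt (mem_of_superset (hopen.mem_nhds hpt)
      fun z hz => hmem (Ioo_subset_Icc_self hz.1) (Ioo_subset_Icc_self hz.2))

end VortexSheet

namespace VortexSheet
open Filter Topology MeasureTheory

/-! ### Acoustic systems and their Riemann invariants -/

/-- `w1`, `w2` solve the acoustic system with sources `f1`, `f2` and initial values `h1`, `h2`;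
they are continuous across the front, and `w2` vanishes at the wall. -/
structure IsAcousticSolution (S : Acoustics) (a b T : ℝ) (f1 f2 : Side → ℝ × ℝ → ℝ)
    (h1 h2 : Side → ℝ → ℝ) (w1 w1t w1r w2 w2t w2r : Side → ℝ × ℝ → ℝ) : Prop where
  fst : ∀ σ, HasPartials (slab a b T σ) (w1 σ) (w1t σ) (w1r σ)
  snd : ∀ σ, HasPartials (slab a b T σ) (w2 σ) (w2t σ) (w2r σ)
  equation_fst : ∀ σ, ∀ z ∈ slab a b T σ, w1t σ z + S.lam σ z * w1r σ z +
    S.kap σ z * Real.exp (S.th σ z) ^ 2 * w2r σ z = f1 σ z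
  equation_snd : ∀ σ, ∀ z ∈ slab a b T σ, w2t σ z + S.lam σ z * w2r σ z +
    S.kap σ z * Real.exp (-S.th σ z) ^ 2 * w1r σ z = f2 σ z
  front_fst : ∀ t ∈ Icc 0 T, w1 .plus (t, b) = w1 .minus (t, b)
  front_snd : ∀ t ∈ Icc 0 T, w2 .plus (t, b) = w2 .minus (t, b)
  wall : ∀ t ∈ Icc 0 T, w2 .minus (t, a) = 0
  initial_fst : ∀ σ, ∀ r ∈ σ.interval a b, w1 σ (0, r) = h1 σ r
  initial_snd : ∀ σ, ∀ r ∈ σ.interval a b, w2 σ (0, r) = h2 σ r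

namespace Acoustics

/-- The Riemann invariant of the backward sound waves. -/
noncomputable def back (S : Acoustics) (u1 u2 : Side → ℝ × ℝ → ℝ) (σ : Side) (z : ℝ × ℝ) : ℝ :=
  (u1 σ z * Real.exp (-S.th σ z) - Real.exp (S.th σ z) * u2 σ z) / 2

/-- The Riemann invariant of the forward sound waves. -/
noncomputable def forth (S : Acoustics) (u1 u2 : Side → ℝ × ℝ → ℝ) (σ : Side) (z : ℝ × ℝ) : ℝ :=
  (u1 σ z * Real.exp (-S.th σ z) + Real.exp (S.th σ z) * u2 σ z) / 2

theorem exp_mul_exp_neg (x : ℝ) : Real.exp x * Real.exp (-x) = 1 := by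
  rw [← Real.exp_add, add_neg_cancel, Real.exp_zero]

namespace IsAdmissible

variable {a b T C K : ℝ} {S : Acoustics} {u1 u1t u1r u2 u2t u2r : Side → ℝ × ℝ → ℝ}

theorem exp_bounds (A : S.IsAdmissible a b T C) {σ : Side} {z : ℝ × ℝ} (hz : z ∈ slab a b T σ) :
    Real.exp (S.th σ z) ≤ Real.exp C ∧ Real.exp (-S.th σ z) ≤ Real.exp C := by
  have := abs_le.1 (A.th_bound σ z hz)
  exact ⟨Real.exp_le_exp.2 this.2, Real.exp_le_exp.2 (by linarith)⟩

theorem abs_back_forth_le (A : S.IsAdmissible a b T C) {σ : Side} {z : ℝ × ℝ}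
    (hz : z ∈ slab a b T σ) {k : ℝ} (h1 : |u1 σ z| ≤ k) (h2 : |u2 σ z| ≤ k) :
    |S.back u1 u2 σ z| ≤ Real.exp C * k ∧ |S.forth u1 u2 σ z| ≤ Real.exp C * k := by
  obtain ⟨he, he'⟩ := A.exp_bounds hz
  have hk : 0 ≤ k := (abs_nonneg _).trans h1
  have h3 : |u1 σ z * Real.exp (-S.th σ z)| ≤ Real.exp C * k := by
    rw [abs_mul, abs_of_pos (Real.exp_pos _), mul_comm]
    exact mul_le_mul he' h1 (abs_nonneg _) (Real.exp_pos _).le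
  have h4 : |Real.exp (S.th σ z) * u2 σ z| ≤ Real.exp C * k := by
    rw [abs_mul, abs_of_pos (Real.exp_pos _)]
    exact mul_le_mul he h2 (abs_nonneg _) (Real.exp_pos _).le
  unfold Acoustics.back Acoustics.forth
  constructor <;> rw [abs_div, abs_two, div_le_iff₀ two_pos]
  · exact (abs_sub _ _).trans (by linarith)
  · exact (abs_add_le _ _).trans (by linarith)

theorem abs_le_of_back_forth (A : S.IsAdmissible a b T C) {σ : Side} {z : ℝ × ℝ}
    (hz : z ∈ slab a b T σ) {p q k : ℝ} (h1 : |p| ≤ k) (h2 : |q| ≤ k) :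
    |Real.exp (S.th σ z) * (p + q)| ≤ 2 * Real.exp C * k ∧
      |Real.exp (-S.th σ z) * (q - p)| ≤ 2 * Real.exp C * k := by
  obtain ⟨he, he'⟩ := A.exp_bounds hz
  have hk : 0 ≤ k := (abs_nonneg _).trans h1
  rw [mul_comm 2, mul_assoc, abs_mul, abs_mul, abs_of_pos (Real.exp_pos _),
    abs_of_pos (Real.exp_pos _)]
  exact ⟨mul_le_mul he ((abs_add_le _ _).trans (by linarith)) (abs_nonneg _) (Real.exp_pos _).le,
    mul_le_mul he' ((abs_sub _ _).trans (by linarith)) (abs_nonneg _) (Real.exp_pos _).le⟩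

theorem continuousOn_back_forth (A : S.IsAdmissible a b T C)
    (h1 : ∀ σ, ContinuousOn (u1 σ) (slab a b T σ)) (h2 : ∀ σ, ContinuousOn (u2 σ) (slab a b T σ))
    (σ : Side) : ContinuousOn (S.back u1 u2 σ) (slab a b T σ) ∧
      ContinuousOn (S.forth u1 u2 σ) (slab a b T σ) := by
  have h3 := (A.th σ).continuousOn
  have h4 : ContinuousOn (fun z => u1 σ z * Real.exp (-S.th σ z)) (slab a b T σ) :=
    (h1 σ).mul h3.neg.rexp
  have h5 : ContinuousOn (fun z => Real.exp (S.th σ z) * u2 σ z) (slab a b T σ) :=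
    h3.rexp.mul (h2 σ)
  exact ⟨(h4.sub h5).div_const 2, (h4.add h5).div_const 2⟩

/-- Differentiating the weights e^{±θ} exchanges the two invariants; this is the only source of
their coupling. -/
theorem back_forth_hasPartials (A : S.IsAdmissible a b T C)
    (h1 : ∀ σ, HasPartials (slab a b T σ) (u1 σ) (u1t σ) (u1r σ))
    (h2 : ∀ σ, HasPartials (slab a b T σ) (u2 σ) (u2t σ) (u2r σ)) (σ : Side) :
    HasPartials (slab a b T σ) (S.back u1 u2 σ)
      (fun z => S.back u1t u2t σ z - S.tht σ z * S.forth u1 u2 σ z)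
      (fun z => S.back u1r u2r σ z - S.thr σ z * S.forth u1 u2 σ z) ∧
    HasPartials (slab a b T σ) (S.forth u1 u2 σ)
      (fun z => S.forth u1t u2t σ z - S.tht σ z * S.back u1 u2 σ z)
      (fun z => S.forth u1r u2r σ z - S.thr σ z * S.back u1 u2 σ z) := by
  have h3 := (h1 σ).mul (A.th σ).neg.exp
  have h4 := (A.th σ).exp.mul (h2 σ)
  have hc := HasPartials.const (S := slab a b T σ) (1 / 2)
  unfold Acoustics.back Acoustics.forth
  refine ⟨((h3.sub h4).mul hc).congr ?_ ?_ ?_, ((h3.add h4).mul hc).congr ?_ ?_ ?_⟩ <;>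
  · intro z _; ring

theorem back_forth_radialC1 (A : S.IsAdmissible a b T C) (h1 : RadialC1 a b T K u1 u1r)
    (h2 : RadialC1 a b T K u2 u2r) : ∃ K', RadialC1 a b T K' (S.back u1 u2)
      (fun σ z => S.back u1r u2r σ z - S.thr σ z * S.forth u1 u2 σ z) ∧
    RadialC1 a b T K' (S.forth u1 u2)
      (fun σ z => S.forth u1r u2r σ z - S.thr σ z * S.back u1 u2 σ z) := by
  have hC := A.nonneg
  have hb : ∀ σ, ∀ z ∈ slab a b T σ, ∀ x y : ℝ, |x| ≤ Real.exp C → |y| ≤ C →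
      |x| ≤ Real.exp C * (1 + C) ∧ |x * y| ≤ Real.exp C * (1 + C) := fun σ z _ x y hx hy => by
    have he := Real.exp_pos C
    refine ⟨by nlinarith, ?_⟩
    rw [abs_mul]
    exact mul_le_mul hx (by linarith) (abs_nonneg _) he.le
  have he : RadialC1 a b T (Real.exp C * (1 + C)) (fun σ z => Real.exp (S.th σ z))
      fun σ z => Real.exp (S.th σ z) * S.thr σ z :=
    HasPartials.radialC1 (fun σ => (A.th σ).exp)
      (fun σ z hz => (hb σ z hz _ (S.thr σ z) (by
        rw [abs_of_pos (Real.exp_pos _)]; exact (A.exp_bounds hz).1) (A.thr_bound σ z hz)).1)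
      fun σ z hz => (hb σ z hz _ (S.thr σ z) (by
        rw [abs_of_pos (Real.exp_pos _)]; exact (A.exp_bounds hz).1) (A.thr_bound σ z hz)).2
  have he' : RadialC1 a b T (Real.exp C * (1 + C)) (fun σ z => Real.exp (-S.th σ z))
      fun σ z => Real.exp (-S.th σ z) * -S.thr σ z :=
    HasPartials.radialC1 (fun σ => (A.th σ).neg.exp)
      (fun σ z hz => (hb σ z hz _ (-S.thr σ z) (by
        rw [abs_of_pos (Real.exp_pos _)]; exact (A.exp_bounds hz).2)
          (by rw [abs_neg]; exact A.thr_bound σ z hz)).1)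
      fun σ z hz => (hb σ z hz _ (-S.thr σ z) (by
        rw [abs_of_pos (Real.exp_pos _)]; exact (A.exp_bounds hz).2)
          (by rw [abs_neg]; exact A.thr_bound σ z hz)).2
  have h3 := (h1.mul he').mul (RadialC1.const (1 / 2))
  have h4 := (he.mul h2).mul (RadialC1.const (1 / 2))
  have h5 := (he.mul h2).mul (RadialC1.const (-(1 / 2)))
  unfold Acoustics.back Acoustics.forth
  refine ⟨_, ((h3.add h5).congr ?_ ?_).mono (le_max_left _ _),
    ((h3.add h4).congr ?_ ?_).mono (le_max_right _ _)⟩ <;>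
  · intro σ z _; ring

/-- The invariants differ by e^{θ}u₂, so the wall condition u₂ = 0 is their equality there; at the
front θ is continuous and the weights do not jump. -/
theorem matching_back_forth (A : S.IsAdmissible a b T C)
    (h1 : ∀ t ∈ Icc 0 T, u1 .plus (t, b) = u1 .minus (t, b))
    (h2 : ∀ t ∈ Icc 0 T, u2 .plus (t, b) = u2 .minus (t, b))
    (h3 : ∀ t ∈ Icc 0 T, u2 .minus (t, a) = 0) : Matching a b T (S.back u1 u2) (S.forth u1 u2) :=
  ⟨fun t ht => by simp [Acoustics.back, Acoustics.forth, h3 t ht],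
    fun t ht => by simp only [Acoustics.back, h1 t ht, h2 t ht, A.th_front t ht],
    fun t ht => by simp only [Acoustics.forth, h1 t ht, h2 t ht, A.th_front t ht]⟩

end IsAdmissible

end Acoustics

namespace IsAcousticSolution

open Acoustics

variable {a b T C K : ℝ} {S : Acoustics} {f1 f2 : Side → ℝ × ℝ → ℝ} {h1 h2 : Side → ℝ → ℝ}
  {w1 w1t w1r w2 w2t w2r : Side → ℝ × ℝ → ℝ}

/-- The solution is bounded by its initial values and the sources. -/
theorem abs_le (A : S.IsAdmissible a b T C)
    (hw : IsAcousticSolution S a b T f1 f2 h1 h2 w1 w1t w1r w2 w2t w2r)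
    (hf1 : ∀ σ, ContinuousOn (f1 σ) (slab a b T σ)) (hf2 : ∀ σ, ContinuousOn (f2 σ) (slab a b T σ))
    (hf1b : ∀ σ, ∀ z ∈ slab a b T σ, |f1 σ z| ≤ K) (hf2b : ∀ σ, ∀ z ∈ slab a b T σ, |f2 σ z| ≤ K)
    {A₀ : ℝ} (hh1 : ∀ σ, ∀ r ∈ σ.interval a b, |h1 σ r| ≤ A₀)
    (hh2 : ∀ σ, ∀ r ∈ σ.interval a b, |h2 σ r| ≤ A₀)
    {τ : ℝ} (hτ : τ ∈ Icc 0 T) {φ : ℝ → ℝ} (hφ : IntervalIntegrable φ volume 0 τ)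
    (hf1φ : ∀ σ, ∀ s ∈ Icc 0 τ, ∀ r ∈ σ.interval a b, |f1 σ (s, r)| ≤ φ s)
    (hf2φ : ∀ σ, ∀ s ∈ Icc 0 τ, ∀ r ∈ σ.interval a b, |f2 σ (s, r)| ≤ φ s)
    {σ : Side} {r : ℝ} (hr : r ∈ σ.interval a b) :
    |w1 σ (τ, r)| ≤ 2 * Real.exp C * (2 * (Real.exp C * (A₀ + ∫ s in (0 : ℝ)..τ, φ s)) *
      Real.exp (4 * (C + C * C) * τ)) ∧
    |w2 σ (τ, r)| ≤ 2 * Real.exp C * (2 * (Real.exp C * (A₀ + ∫ s in (0 : ℝ)..τ, φ s)) *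
      Real.exp (4 * (C + C * C) * τ)) := by
  have h0 : (0 : ℝ) ∈ Icc 0 T := ⟨le_rfl, A.pos.le⟩
  have hP := A.back_forth_hasPartials hw.fst hw.snd
  have hc := A.continuousOn_back_forth hf1 hf2
  have key := A.abs_le_of_pair (gp := S.back f1 f2) (gq := S.forth f1 f2) (K := Real.exp C * K)
    (A₀ := Real.exp C * A₀) (φ := fun s => Real.exp C * φ s) (fun σ => (hP σ).1) (fun σ => (hP σ).2)
    (A.matching_back_forth hw.front_fst hw.front_snd hw.wall) (fun σ z hz => by
      have hee := exp_mul_exp_neg (S.th σ z)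
      simp only [Acoustics.back, Acoustics.forth, Acoustics.alongBack]
      linear_combination Real.exp (-S.th σ z) / 2 * hw.equation_fst σ z hz -
        Real.exp (S.th σ z) / 2 * hw.equation_snd σ z hz + S.kap σ z / 2 *
          (Real.exp (-S.th σ z) * w1r σ z - Real.exp (S.th σ z) * w2r σ z) * hee)
    (fun σ z hz => by
      have hee := exp_mul_exp_neg (S.th σ z)
      simp only [Acoustics.back, Acoustics.forth, Acoustics.alongForth]
      linear_combination Real.exp (-S.th σ z) / 2 * hw.equation_fst σ z hz +
        Real.exp (S.th σ z) / 2 * hw.equation_snd σ z hz - S.kap σ z / 2 *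
          (Real.exp (-S.th σ z) * w1r σ z + Real.exp (S.th σ z) * w2r σ z) * hee)
    (fun σ => (hc σ).1) (fun σ => (hc σ).2)
    (fun σ z hz => (A.abs_back_forth_le hz (hf1b σ z hz) (hf2b σ z hz)).1)
    (fun σ z hz => (A.abs_back_forth_le hz (hf1b σ z hz) (hf2b σ z hz)).2)
    (fun σ r hr => (A.abs_back_forth_le ⟨h0, hr⟩ (by rw [hw.initial_fst σ r hr]; exact hh1 σ r hr)
      (by rw [hw.initial_snd σ r hr]; exact hh2 σ r hr)).1)
    (fun σ r hr => (A.abs_back_forth_le ⟨h0, hr⟩ (by rw [hw.initial_fst σ r hr]; exact hh1 σ r hr)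
      (by rw [hw.initial_snd σ r hr]; exact hh2 σ r hr)).2)
    hτ (hφ.const_mul _)
    (fun σ s hs r hr => (A.abs_back_forth_le ⟨⟨hs.1, hs.2.trans hτ.2⟩, hr⟩ (hf1φ σ s hs r hr)
      (hf2φ σ s hs r hr)).1)
    (fun σ s hs r hr => (A.abs_back_forth_le ⟨⟨hs.1, hs.2.trans hτ.2⟩, hr⟩ (hf1φ σ s hs r hr)
      (hf2φ σ s hs r hr)).2) hr
  rw [intervalIntegral.integral_const_mul, ← mul_add] at key
  have h3 := A.abs_le_of_back_forth (σ := σ) (z := (τ, r)) ⟨hτ, hr⟩ key.1 key.2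
  have hee := exp_mul_exp_neg (S.th σ (τ, r))
  refine ⟨le_of_eq_of_le (congrArg _ ?_) h3.1, le_of_eq_of_le (congrArg _ ?_) h3.2⟩
  · simp only [Acoustics.back, Acoustics.forth]
    linear_combination -w1 σ (τ, r) * hee
  · simp only [Acoustics.back, Acoustics.forth]
    linear_combination -w2 σ (τ, r) * hee

end IsAcousticSolution

open Acoustics Acoustics.IsAdmissible in
/-- Existence of solutions for sources without jumps, with a bound for the radial derivatives. -/
theorem Acoustics.IsAdmissible.exists_isAcousticSolution {a b T C K : ℝ} {S : Acoustics}
    {f1 f1r f2 f2r : Side → ℝ × ℝ → ℝ} {h1 h1' h2 h2' : Side → ℝ → ℝ} (A : S.IsAdmissible a b T C)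
    (hf1 : RadialC1 a b T K f1 f1r) (hf2 : RadialC1 a b T K f2 f2r)
    (hf1b : ∀ t ∈ Icc 0 T, f1 .plus (t, b) = f1 .minus (t, b))
    (hf2b : ∀ t ∈ Icc 0 T, f2 .plus (t, b) = f2 .minus (t, b))
    (hf2a : ∀ t ∈ Icc 0 T, f2 .minus (t, a) = 0)
    (hh1 : RadialC1 a b T K (fun σ z => h1 σ z.2) fun σ z => h1' σ z.2)
    (hh2 : RadialC1 a b T K (fun σ z => h2 σ z.2) fun σ z => h2' σ z.2)
    (hh1b : h1 .plus b = h1 .minus b) (hh2b : h2 .plus b = h2 .minus b) (hh2a : h2 .minus a = 0)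
    (hh1b' : h1' .plus b = h1' .minus b) (hh2b' : h2' .plus b = h2' .minus b)
    (hh1a' : h1' .minus a = 0) :
    ∃ w1 w1t w1r w2 w2t w2r, IsAcousticSolution S a b T f1 f2 h1 h2 w1 w1t w1r w2 w2t w2r ∧
      ∀ τ ∈ Icc 0 T, ∀ (A₁ : ℝ) (ψ : ℝ → ℝ), IntervalIntegrable ψ volume 0 τ →
      (∀ σ, ∀ r ∈ σ.interval a b, |h1' σ r| ≤ A₁) → (∀ σ, ∀ r ∈ σ.interval a b, |h2' σ r| ≤ A₁) →
      (∀ σ, ∀ s ∈ Icc 0 τ, ∀ r ∈ σ.interval a b, |f1r σ (s, r)| ≤ ψ s) →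
      (∀ σ, ∀ s ∈ Icc 0 τ, ∀ r ∈ σ.interval a b, |f2r σ (s, r)| ≤ ψ s) →
      ∀ σ, ∀ r ∈ σ.interval a b,
        |w1r σ (τ, r)| ≤ 2 * Real.exp C * (2 * (Real.exp (2 * C * T) *
          (Real.exp C * (A₁ + ∫ s in (0 : ℝ)..τ, ψ s))) *
            Real.exp (4 * (Real.exp (2 * C * T) * (C + C * C)) * τ)) ∧
        |w2r σ (τ, r)| ≤ 2 * Real.exp C * (2 * (Real.exp (2 * C * T) *
          (Real.exp C * (A₁ + ∫ s in (0 : ℝ)..τ, ψ s))) *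
            Real.exp (4 * (Real.exp (2 * C * T) * (C + C * C)) * τ)) := by
  have h0 : (0 : ℝ) ∈ Icc 0 T := ⟨le_rfl, A.pos.le⟩
  obtain ⟨K1, hg1, hg2⟩ := A.back_forth_radialC1 hf1 hf2
  obtain ⟨K2, hi1, hi2⟩ := A.back_forth_radialC1 hh1 hh2
  replace hi1 := hi1.at_zero A.pos.le
  replace hi2 := hi2.at_zero A.pos.le
  let u1 : Side → ℝ × ℝ → ℝ := fun σ z => h1 σ z.2
  let u2 : Side → ℝ × ℝ → ℝ := fun σ z => h2 σ z.2
  let u1' : Side → ℝ × ℝ → ℝ := fun σ z => h1' σ z.2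
  let u2' : Side → ℝ × ℝ → ℝ := fun σ z => h2' σ z.2
  let P : Side → ℝ → ℝ := fun σ r => S.back u1 u2 σ (0, r)
  let Q : Side → ℝ → ℝ := fun σ r => S.forth u1 u2 σ (0, r)
  let P' : Side → ℝ → ℝ := fun σ r =>
    S.back u1' u2' σ (0, r) - S.thr σ (0, r) * S.forth u1 u2 σ (0, r)
  let Q' : Side → ℝ → ℝ := fun σ r =>
    S.forth u1' u2' σ (0, r) - S.thr σ (0, r) * S.back u1 u2 σ (0, r)
  -- The initial densities are the Riemann invariants of the initial radial derivatives. Their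
  -- matching at the front and at the wall therefore follows from the conditions on `h1'` and `h2'`;
  -- at the wall `h1'` = 0 is what gives the opposite sign.
  have hPV : ∀ σ r, P' σ r + S.thr σ (0, r) * Q σ r = S.back u1' u2' σ (0, r) :=
    fun σ r => by simp only [P', Q]; ring
  have hQV : ∀ σ r, Q' σ r + S.thr σ (0, r) * P σ r = S.forth u1' u2' σ (0, r) :=
    fun σ r => by simp only [Q', P]; ring
  have hb := A.matching_back_forth (u1 := u1) (u2 := u2) (fun _ _ => hh1b) (fun _ _ => hh2b)
    fun _ _ => hh2a
  have hthb := A.th_front 0 h0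
  obtain ⟨p, pt, pr, q, qt, qr, hpq, hest⟩ := A.exists_isRiemannPair (P := P) (P' := P') (Q := Q)
    (Q' := Q') (hg1.mono (le_max_left K1 K2)) (hg2.mono (le_max_left K1 K2))
    (A.matching_back_forth hf1b hf2b hf2a) (hi1.mono (le_max_right K1 K2))
    (hi2.mono (le_max_right K1 K2))
    ⟨fun _ _ => hb.wall 0 h0, fun _ _ => hb.front_fst 0 h0, fun _ _ => hb.front_snd 0 h0⟩
    ⟨fun t _ => by
        change P' .minus a + S.thr .minus (0, a) * Q .minus a =
          -(Q' .minus a + S.thr .minus (0, a) * P .minus a)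
        rw [hPV, hQV]
        simp [Acoustics.back, Acoustics.forth, u1', u2', hh1a', neg_div],
      fun t _ => by
        change P' .plus b + S.thr .plus (0, b) * Q .plus b =
          P' .minus b + S.thr .minus (0, b) * Q .minus b
        rw [hPV, hPV]
        simp only [Acoustics.back, u1', u2', hh1b', hh2b', hthb],
      fun t _ => by
        change -(Q' .plus b + S.thr .plus (0, b) * P .plus b) =
          -(Q' .minus b + S.thr .minus (0, b) * P .minus b)
        rw [hQV, hQV]
        simp only [Acoustics.forth, u1', u2', hh1b', hh2b', hthb]⟩
  have hsum : ∀ σ, HasPartials (slab a b T σ) (fun z => Real.exp (S.th σ z) * (p σ z + q σ z))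
      (fun z => Real.exp (S.th σ z) * (S.tht σ z * (p σ z + q σ z) + (pt σ z + qt σ z)))
      (fun z => Real.exp (S.th σ z) * ((pr σ z + S.thr σ z * q σ z) +
        (qr σ z + S.thr σ z * p σ z))) := fun σ =>
    ((A.th σ).exp.mul ((hpq.fst σ).add (hpq.snd σ))).congr (fun _ _ => rfl)
      (fun _ _ => by ring) fun _ _ => by ring
  have hdiff : ∀ σ, HasPartials (slab a b T σ) (fun z => Real.exp (-S.th σ z) * (q σ z - p σ z))
      (fun z => Real.exp (-S.th σ z) * (qt σ z - pt σ z - S.tht σ z * (q σ z - p σ z)))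
      (fun z => Real.exp (-S.th σ z) * ((qr σ z + S.thr σ z * p σ z) -
        (pr σ z + S.thr σ z * q σ z))) := fun σ =>
    ((A.th σ).neg.exp.mul ((hpq.snd σ).sub (hpq.fst σ))).congr (fun _ _ => rfl)
      (fun _ _ => by ring) fun _ _ => by ring
  refine ⟨_, _, _, _, _, _, ⟨hsum, hdiff, fun σ z hz => ?_, fun σ z hz => ?_, fun t ht => ?_,
    fun t ht => ?_, fun t ht => ?_, fun σ r hr => ?_, fun σ r hr => ?_⟩,
    fun τ hτ A₁ ψ hψ k1 k2 k3 k4 σ r hr => ?_⟩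
  · have hee := exp_mul_exp_neg (S.th σ z)
    have e1 := hpq.equation_fst σ z hz
    have e2 := hpq.equation_snd σ z hz
    simp only [Acoustics.back, Acoustics.forth, Acoustics.alongBack, Acoustics.alongForth] at e1 e2
    linear_combination Real.exp (S.th σ z) * e1 + Real.exp (S.th σ z) * e2 +
      (f1 σ z + S.kap σ z * Real.exp (S.th σ z) *
        (qr σ z - pr σ z + S.thr σ z * (p σ z - q σ z))) * hee
  · have hee := exp_mul_exp_neg (S.th σ z)
    have e1 := hpq.equation_fst σ z hz
    have e2 := hpq.equation_snd σ z hz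
    simp only [Acoustics.back, Acoustics.forth, Acoustics.alongBack, Acoustics.alongForth] at e1 e2
    linear_combination Real.exp (-S.th σ z) * e2 - Real.exp (-S.th σ z) * e1 +
      (f2 σ z + S.kap σ z * Real.exp (-S.th σ z) *
        (pr σ z + qr σ z + S.thr σ z * (p σ z + q σ z))) * hee
  · simp only [hpq.matching.front_fst t ht, hpq.matching.front_snd t ht, A.th_front t ht]
  · simp only [hpq.matching.front_fst t ht, hpq.matching.front_snd t ht, A.th_front t ht]
  · simp only [hpq.matching.wall t ht, sub_self, mul_zero]
  · simp only [hpq.initial_fst σ r hr, hpq.initial_snd σ r hr, P, Q, Acoustics.back,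
      Acoustics.forth, u1, u2]
    linear_combination h1 σ r * exp_mul_exp_neg (S.th σ (0, r))
  · simp only [hpq.initial_fst σ r hr, hpq.initial_snd σ r hr, P, Q, Acoustics.back,
      Acoustics.forth, u1, u2]
    linear_combination h2 σ r * exp_mul_exp_neg (S.th σ (0, r))
  · have hmem : ∀ {s}, s ∈ Icc 0 τ → s ∈ Icc 0 T := fun hs => ⟨hs.1, hs.2.trans hτ.2⟩
    have key := hest τ hτ (Real.exp C * A₁) (fun s => Real.exp C * ψ s) (hψ.const_mul _)
      (fun σ r hr => by
        rw [hPV]; exact (A.abs_back_forth_le ⟨h0, hr⟩ (k1 σ r hr) (k2 σ r hr)).1)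
      (fun σ r hr => by
        rw [hQV]; exact (A.abs_back_forth_le ⟨h0, hr⟩ (k1 σ r hr) (k2 σ r hr)).2)
      (fun σ s hs r hr => by
        rw [sub_add_cancel]
        exact (A.abs_back_forth_le ⟨hmem hs, hr⟩ (k3 σ s hs r hr) (k4 σ s hs r hr)).1)
      (fun σ s hs r hr => by
        rw [sub_add_cancel]
        exact (A.abs_back_forth_le ⟨hmem hs, hr⟩ (k3 σ s hs r hr) (k4 σ s hs r hr)).2) σ r hr
    rw [intervalIntegral.integral_const_mul, ← mul_add] at key
    exact A.abs_le_of_back_forth (σ := σ) (z := (τ, r)) ⟨hτ, hr⟩ key.1 key.2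

end VortexSheet

namespace VortexSheet
open Filter Topology MeasureTheory

/-! ### Removal of the jumps of the sources -/

/-- The function that interpolates linearly, on the inner side, between `0` at the wall and the
trace of `f` at the front, and equals `f` on the outer side. -/
noncomputable def interpolated (a b : ℝ) (f : Side → ℝ × ℝ → ℝ) : Side → ℝ × ℝ → ℝ
  | .minus, z => (z.2 - a) / (b - a) * f .plus (z.1, b)
  | .plus, z => f .plus z

/-- The radial derivative of the interpolated function. -/
noncomputable def interpolatedDeriv (a b : ℝ) (f fr : Side → ℝ × ℝ → ℝ) : Side → ℝ × ℝ → ℝ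
  | .minus, z => 1 / (b - a) * f .plus (z.1, b)
  | .plus, z => fr .plus z

theorem hasPartials_ramp {S : Set (ℝ × ℝ)} (a b : ℝ) :
    HasPartials S (fun z => (z.2 - a) / (b - a)) (fun _ => 0) (fun _ => 1 / (b - a)) :=
  ((HasPartials.snd.sub (HasPartials.const a)).mul (HasPartials.const (1 / (b - a)))).congr
    (fun _ _ => by ring) (fun _ _ => by ring) fun _ _ => by ring

theorem ramp_mem {a b r : ℝ} (hab : a < b) (hr : r ∈ Icc a b) : |(r - a) / (b - a)| ≤ 1 := by
  rw [abs_of_nonneg (div_nonneg (sub_nonneg.2 hr.1) (sub_nonneg.2 hab.le)),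
    div_le_one (sub_pos.2 hab)]
  linarith [hr.2]

namespace Acoustics.IsAdmissible

variable {a b T C K : ℝ} {S : Acoustics} {f ft fr : Side → ℝ × ℝ → ℝ}

theorem trace_hasPartials (A : S.IsAdmissible a b T C)
    (hf : ∀ σ, HasPartials (slab a b T σ) (f σ) (ft σ) (fr σ)) (σ σ' : Side) :
    HasPartials (slab a b T σ) (fun z => f σ' (z.1, b)) (fun z => ft σ' (z.1, b)) fun _ => 0 := by
  have hm : ∀ t ∈ Icc 0 T, (t, b) ∈ slab a b T σ' := fun t ht => ⟨ht, σ'.mem A.lt.le⟩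
  exact HasPartials.of_fst (fun p hp => hp.1)
    (fun t ht => (hf σ').hasDerivWithinAt_fst (I := Icc 0 T) hm ht)
    ((hf σ').continuousOn_dt.comp (by fun_prop) hm)

theorem interpolated_radialC1 (A : S.IsAdmissible a b T C)
    (hf : ∀ σ, HasPartials (slab a b T σ) (f σ) (ft σ) (fr σ))
    (hb : ∀ σ, ∀ z ∈ slab a b T σ, |f σ z| ≤ K) (hbr : ∀ σ, ∀ z ∈ slab a b T σ, |fr σ z| ≤ K) :
    RadialC1 a b T ((1 + C) * K) (interpolated a b f) (interpolatedDeriv a b f fr) := by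
  have hC := A.nonneg
  have hK : 0 ≤ K := (abs_nonneg _).trans
    (hb .plus (0, b) ⟨⟨le_rfl, A.pos.le⟩, mem_Ici.2 le_rfl⟩)
  have hw : |1 / (b - a)| ≤ C := by
    have := sub_pos.2 A.lt
    rw [abs_of_pos (by positivity), div_le_iff₀ this]; exact A.width_lower
  have h1 := (hasPartials_ramp (S := slab a b T .minus) a b).mul (A.trace_hasPartials hf .minus .plus)
  have hx : ∀ x : ℝ, |x| ≤ K → |x| ≤ (1 + C) * K := fun x h => by nlinarith
  refine HasPartials.radialC1 (gt := fun σ z => match σ with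
    | .minus => (z.2 - a) / (b - a) * ft .plus (z.1, b)
    | .plus => ft .plus z) ?_ ?_ ?_
  · rintro (_ | _)
    · exact h1.congr (fun _ _ => rfl) (fun _ _ => by ring)
        fun _ _ => by simp only [interpolatedDeriv]; ring
    · exact hf .plus
  · rintro (_ | _) z hz
    · simp only [interpolated, abs_mul]
      have h2 := hb .plus (z.1, b) ⟨hz.1, mem_Ici.2 le_rfl⟩
      have h3 := ramp_mem A.lt hz.2
      nlinarith [abs_nonneg (f .plus (z.1, b)), abs_nonneg ((z.2 - a) / (b - a))]
    · exact hx _ (hb .plus z hz)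
  · rintro (_ | _) z hz
    · simp only [interpolatedDeriv, abs_mul]
      have h2 := hb .plus (z.1, b) ⟨hz.1, mem_Ici.2 le_rfl⟩
      nlinarith [mul_le_mul hw h2 (abs_nonneg _) hC]
    · exact hx _ (hbr .plus z hz)

/-- The transport speed vanishes at the wall and has bounded radial derivative. The factor b - a
cancels the slope of the ramp in `exists_lift`. -/
theorem abs_lam_minus_le (A : S.IsAdmissible a b T C) {z : ℝ × ℝ} (hz : z ∈ slab a b T .minus) :
    |S.lam .minus z| ≤ C * (b - a) := by
  have h := Convex.norm_image_sub_le_of_norm_hasDerivWithin_le (s := Icc a b) (C := C)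
    (f := fun r => S.lam .minus (z.1, r)) (f' := fun r => S.lamr .minus (z.1, r)) (x := a) (y := z.2)
    (fun r hr => (A.lam .minus).hasDerivWithinAt_snd (fun r hr => ⟨hz.1, hr⟩) hr)
    (fun r hr => A.lamr_bound .minus _ ⟨hz.1, hr⟩) (convex_Icc a b) ⟨le_rfl, A.lt.le⟩ hz.2
  simp only [A.lam_wall z.1 hz.1, sub_zero, Real.norm_eq_abs] at h
  rw [abs_of_nonneg (sub_nonneg.2 hz.2.1)] at h
  exact h.trans (mul_le_mul_of_nonneg_left (sub_le_sub_right hz.2.2 a) A.nonneg)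

/-- A function whose radial derivative is `k` times the difference between the source and the
interpolated source. -/
theorem exists_lift (A : S.IsAdmissible a b T C) {B : ℝ} {k kt kr : ℝ × ℝ → ℝ}
    (hk : HasPartials (slab a b T .minus) k kt kr) (hkb : ∀ z ∈ slab a b T .minus, |k z| ≤ B)
    (hkD : ∀ z ∈ slab a b T .minus, |kt z + S.lam .minus z * kr z| ≤ B)
    (hf : ∀ σ, HasPartials (slab a b T σ) (f σ) (ft σ) (fr σ)) :
    ∃ W Wt Wr Zr : Side → ℝ × ℝ → ℝ,
      (∀ σ, HasPartials (slab a b T σ) (W σ) (Wt σ) (Wr σ)) ∧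
      (∀ t, W .plus (t, b) = W .minus (t, b)) ∧ (∀ t, W .minus (t, a) = 0) ∧
      (∀ z, Wr .minus z = k z * (f .minus z - interpolated a b f .minus z)) ∧
      (∀ z, Wr .plus z = 0) ∧ (∃ K', RadialC1 a b T K' W Wr) ∧
      (∃ K', RadialC1 a b T K' (fun σ z => Wt σ z + S.lam σ z * Wr σ z) Zr) ∧
      (∀ t ∈ Icc 0 T, Wt .plus (t, b) + S.lam .plus (t, b) * Wr .plus (t, b) =
        Wt .minus (t, b) + S.lam .minus (t, b) * Wr .minus (t, b)) ∧
      (∀ t ∈ Icc 0 T, Wt .minus (t, a) + S.lam .minus (t, a) * Wr .minus (t, a) = 0) ∧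
      ∀ t ∈ Icc 0 T, ∀ ψ, (∀ σ, ∀ r ∈ σ.interval a b, |f σ (t, r)| ≤ ψ) →
        (∀ σ, ∀ r ∈ σ.interval a b, |Wr σ (t, r)| ≤ 2 * B * ψ) ∧
        ((∀ σ, ∀ r ∈ σ.interval a b, |ft σ (t, r) + S.lam σ (t, r) * fr σ (t, r)| ≤ ψ) →
          ∀ σ, ∀ r ∈ σ.interval a b, |Zr σ (t, r)| ≤ B * (4 + 3 * C) * ψ) := by
  have hC := A.nonneg
  have hba := sub_pos.2 A.lt
  have hB : 0 ≤ B := (abs_nonneg _).trans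
    (hkb (0, a) ⟨⟨le_rfl, A.pos.le⟩, Side.left_mem A.lt.le⟩)
  have hF := (hasPartials_ramp (S := slab a b T .minus) a b).mul (A.trace_hasPartials hf .minus .plus)
  have hd := (hf .minus).sub hF
  have hω := hk.mul hd
  set ω : ℝ × ℝ → ℝ := fun z => k z * (f .minus z - (z.2 - a) / (b - a) * f .plus (z.1, b)) with hωdef
  set ωt : ℝ × ℝ → ℝ := _ with hωt
  set ωr : ℝ × ℝ → ℝ := _ with hωr
  change HasPartials _ ω ωt ωr at hω
  have hI := hω.integral A.lt A.pos
  have hbm : ∀ t ∈ Icc 0 T, (t, b) ∈ slab a b T .minus := fun t ht => ⟨ht, Side.mem A.lt.le _⟩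
  have hIb : HasPartials (slab a b T .plus) (fun z => ∫ y in a..b, ω (z.1, y))
      (fun z => ∫ y in a..b, ωt (z.1, y)) fun _ => 0 :=
    HasPartials.of_fst (fun p hp => hp.1)
      (fun t ht => hI.hasDerivWithinAt_fst (I := Icc 0 T) hbm ht)
      (hI.continuousOn_dt.comp (f := fun t : ℝ => (t, b)) (by fun_prop) hbm)
  -- The primitive starts at the wall, so it vanishes there, and it is continued by its value at the
  -- front, so it is constant in r on the outer side.
  let W : Side → ℝ × ℝ → ℝ := fun σ z => match σ with
    | .minus => ∫ y in a..z.2, ω (z.1, y)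
    | .plus => ∫ y in a..b, ω (z.1, y)
  let Wt : Side → ℝ × ℝ → ℝ := fun σ z => match σ with
    | .minus => ∫ y in a..z.2, ωt (z.1, y)
    | .plus => ∫ y in a..b, ωt (z.1, y)
  let Wr : Side → ℝ × ℝ → ℝ := fun σ z => match σ with
    | .minus => ω z
    | .plus => 0
  -- The lift contributes W_t + λW_r to the sources. Its radial derivative exists because the time
  -- derivative of the primitive is itself a primitive, with integrand `ωt`.
  let Zr : Side → ℝ × ℝ → ℝ := fun σ z => match σ with
    | .minus => ωt z + (S.lamr .minus z * ω z + S.lam .minus z * ωr z)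
    | .plus => 0
  have hZm : ContinuousOn (fun z => Wt .minus z + S.lam .minus z * Wr .minus z) (slab a b T .minus) :=
    hI.continuousOn_dt.add ((A.lam .minus).continuousOn.mul hω.continuousOn)
  have hZrm : ContinuousOn (Zr .minus) (slab a b T .minus) :=
    hω.continuousOn_dt.add (((A.lam .minus).continuousOn_dr.mul hω.continuousOn).add
      ((A.lam .minus).continuousOn.mul hω.continuousOn_dr))
  have hcomp : IsCompact (slab a b T .minus) := isCompact_Icc.prod isCompact_Icc
  obtain ⟨K1, hK1⟩ := hcomp.exists_bound_of_continuousOn hZm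
  obtain ⟨K2, hK2⟩ := hcomp.exists_bound_of_continuousOn hZrm
  have hK1n : 0 ≤ K1 := (norm_nonneg _).trans
    (hK1 (0, a) ⟨⟨le_rfl, A.pos.le⟩, Side.left_mem A.lt.le⟩)
  obtain ⟨K3, hK3⟩ := hcomp.exists_bound_of_continuousOn hI.continuousOn
  obtain ⟨K4, hK4⟩ := hcomp.exists_bound_of_continuousOn hω.continuousOn
  have hK3n : 0 ≤ K3 := (norm_nonneg _).trans
    (hK3 (0, a) ⟨⟨le_rfl, A.pos.le⟩, Side.left_mem A.lt.le⟩)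
  have hlamb := A.lam_front
  refine ⟨W, Wt, Wr, Zr, ?_, fun t => rfl, fun t => intervalIntegral.integral_same, fun z => rfl,
    fun z => rfl, ⟨max K3 K4, HasPartials.radialC1 (gt := Wt) ?_ ?_ ?_⟩, ⟨max K1 K2, ?_, ?_, ?_, ?_, ?_⟩, fun t ht => ?_, fun t ht => ?_,
    fun t ht ψ h1 => ?_⟩
  · rintro (_ | _)
    exacts [hI, hIb]
  · rintro (_ | _)
    exacts [hI, hIb]
  · rintro (_ | _) z hz
    · exact (hK3 z hz).trans (le_max_left _ _)
    · exact (hK3 (z.1, b) (hbm _ hz.1)).trans (le_max_left _ _)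
  · rintro (_ | _) z hz
    · exact (hK4 z hz).trans (le_max_right _ _)
    · simp only [Wr, abs_zero]
      exact hK3n.trans (le_max_left _ _)
  · rintro (_ | _)
    · exact hZm
    · exact hIb.continuousOn_dt.add ((A.lam .plus).continuousOn.mul continuousOn_const)
  · rintro (_ | _)
    exacts [hZrm, continuousOn_const]
  · rintro (_ | _) t ht r hr
    · have hc : ContinuousOn (fun y => ωt (t, y)) (Icc a b) :=
        hω.continuousOn_dt.comp (by fun_prop) fun y hy => ⟨ht, hy⟩
      have : Fact (r ∈ Icc a b) := ⟨hr⟩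
      have h3 : HasDerivWithinAt (fun r => ∫ y in a..r, ωt (t, y)) (ωt (t, r)) (Icc a b) r :=
        intervalIntegral.integral_hasDerivWithinAt_right
          ((hc.mono (by rw [uIcc_of_le hr.1]; exact Icc_subset_Icc_right hr.2)).intervalIntegrable)
          (hc.stronglyMeasurableAtFilter_nhdsWithin measurableSet_Icc r) (hc r hr)
      exact h3.add (((A.lam .minus).hasDerivWithinAt_snd (fun r hr => ⟨ht, hr⟩) hr).mul
        (hω.hasDerivWithinAt_snd (fun r hr => ⟨ht, hr⟩) hr))
    · simp only [Wt, Wr, Zr, mul_zero]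
      exact hasDerivWithinAt_const _ _ _
  · rintro (_ | _) z hz
    · exact (hK1 z hz).trans (le_max_left _ _)
    · have h3 := hK1 (z.1, b) (hbm _ hz.1)
      simp only [Wt, Wr, hlamb .minus z.1 hz.1, zero_mul, add_zero, mul_zero] at h3 ⊢
      exact h3.trans (le_max_left _ _)
  · rintro (_ | _) z hz
    · exact (hK2 z hz).trans (le_max_right _ _)
    · simp only [Zr, abs_zero]
      exact hK1n.trans (le_max_left _ _)
  · simp only [Wt, Wr, hlamb _ t ht, zero_mul]
  · simp only [Wt, Wr, A.lam_wall t ht, zero_mul, intervalIntegral.integral_same, add_zero]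
  · have hψ : 0 ≤ ψ := (abs_nonneg _).trans (h1 .plus b (mem_Ici.2 le_rfl))
    have hfb := h1 .plus b (mem_Ici.2 le_rfl)
    have hmul : ∀ {x y A B : ℝ}, |x| ≤ A → |y| ≤ B → |x * y| ≤ A * B := fun h1 h2 => by
      rw [abs_mul]; exact mul_le_mul h1 h2 (abs_nonneg _) ((abs_nonneg _).trans h1)
    have hdb : ∀ r ∈ Icc a b, |f .minus (t, r) - (r - a) / (b - a) * f .plus (t, b)| ≤ 2 * ψ :=
      fun r hr => (abs_sub _ _).trans (by
        linarith [h1 .minus r hr, hmul (ramp_mem A.lt hr) hfb])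
    have hωb : ∀ r ∈ Icc a b, |ω (t, r)| ≤ B * (2 * ψ) := fun r hr =>
      hmul (hkb _ ⟨ht, hr⟩) (hdb r hr)
    refine ⟨?_, fun h2 => ?_⟩
    · rintro (_ | _) r hr
      · exact (hωb r hr).trans (le_of_eq (by ring))
      · simp only [Wr, abs_zero]; positivity
    · rintro (_ | _) r hr
      · have hm : (t, r) ∈ slab a b T .minus := ⟨ht, hr⟩
        have e1 := hmul (hkD _ hm) (hdb r hr)
        have e2 := h2 .plus b (mem_Ici.2 le_rfl)
        rw [hlamb _ t ht, zero_mul, add_zero] at e2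
        have e3 := hmul (ramp_mem A.lt hr) e2
        have e4 : |S.lam .minus (t, r) / (b - a)| ≤ C := by
          rw [abs_div, abs_of_pos hba, div_le_iff₀ hba]; exact A.abs_lam_minus_le hm
        have e5 := hmul e4 hfb
        have e6 := hmul (A.lamr_bound _ _ hm) (hωb r hr)
        have e7 := h2 .minus r hr
        have e8 : |(ft .minus (t, r) + S.lam .minus (t, r) * fr .minus (t, r)) -
            (r - a) / (b - a) * ft .plus (t, b) - S.lam .minus (t, r) / (b - a) * f .plus (t, b)| ≤
            ψ + 1 * ψ + C * ψ :=
          (abs_sub _ _).trans (add_le_add ((abs_sub _ _).trans (add_le_add e7 e3)) e5)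
        have e9 := hmul (hkb _ hm) e8
        -- By the product rule the time and radial derivatives combine into derivatives along λ of
        -- the coefficient and of `f`, and at the front, where λ = 0, into the time derivative of
        -- the trace. These are the quantities bounded by the hypotheses.
        have e : Zr .minus (t, r) = (kt (t, r) + S.lam .minus (t, r) * kr (t, r)) *
            (f .minus (t, r) - (r - a) / (b - a) * f .plus (t, b)) +
            k (t, r) * ((ft .minus (t, r) + S.lam .minus (t, r) * fr .minus (t, r)) -
              (r - a) / (b - a) * ft .plus (t, b) - S.lam .minus (t, r) / (b - a) * f .plus (t, b)) +
            S.lamr .minus (t, r) * ω (t, r) := by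
          simp only [Zr, hωt, hωr]
          ring
        rw [e]
        refine (abs_add_le _ _).trans ((add_le_add ((abs_add_le _ _).trans (add_le_add e1 e9))
          e6).trans (le_of_eq (by ring)))
      · simp only [Zr, abs_zero]; positivity

end Acoustics.IsAdmissible

end VortexSheet

/-! ### Acoustic systems whose sources jump at the front -/

namespace VortexSheet
open Filter Topology MeasureTheory

namespace Acoustics.IsAdmissible

variable {a b T C K : ℝ} {S : Acoustics}

/-- With D = ∂_t + λ∂_r the coefficient k = e^{2θ}/κ satisfies Dk = k(2Dθ - Dκ/κ). Both k and Dk are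
bounded through 1/κ ≤ C, and one constant is taken for both. -/
theorem exists_lift_coeff (A : S.IsAdmissible a b T C) {θ θt θr : ℝ × ℝ → ℝ}
    (hθ : HasPartials (slab a b T .minus) θ θt θr) (hb : ∀ z ∈ slab a b T .minus, |θ z| ≤ C)
    (hD : ∀ z ∈ slab a b T .minus, |θt z + S.lam .minus z * θr z| ≤ C) :
    ∃ kt kr, HasPartials (slab a b T .minus)
        (fun z => Real.exp (θ z) ^ 2 * (S.kap .minus z)⁻¹) kt kr ∧
      (∀ z ∈ slab a b T .minus, |Real.exp (θ z) ^ 2 * (S.kap .minus z)⁻¹| ≤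
        Real.exp C ^ 2 * C * (1 + 2 * C + C * C)) ∧
      ∀ z ∈ slab a b T .minus, |kt z + S.lam .minus z * kr z| ≤
        Real.exp C ^ 2 * C * (1 + 2 * C + C * C) := by
  have hC := A.nonneg
  have h1 := (hθ.exp.mul hθ.exp).mul ((A.kap .minus).inv fun z hz => (A.kap_pos .minus z hz).ne')
  have hk : ∀ z ∈ slab a b T .minus, |(S.kap .minus z)⁻¹| ≤ C := fun z hz => by
    have h2 := A.kap_pos .minus z hz
    rw [abs_of_pos (inv_pos.2 h2), inv_le_iff_one_le_mul₀ h2]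
    exact A.kap_lower .minus z hz
  have hm : ∀ z ∈ slab a b T .minus, |Real.exp (θ z) ^ 2 * (S.kap .minus z)⁻¹| ≤
      Real.exp C ^ 2 * C := fun z hz => by
    rw [abs_mul, abs_of_pos (by positivity : 0 < Real.exp (θ z) ^ 2)]
    have h3 : Real.exp (θ z) ≤ Real.exp C := Real.exp_le_exp.2 (abs_le.1 (hb z hz)).2
    exact mul_le_mul (pow_le_pow_left₀ (Real.exp_pos _).le h3 2) (hk z hz) (abs_nonneg _)
      (by positivity)
  refine ⟨_, _, h1.congr (fun _ _ => by ring) (fun _ _ => rfl) (fun _ _ => rfl), fun z hz => ?_,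
    fun z hz => ?_⟩
  · exact (hm z hz).trans (le_mul_of_one_le_right (by positivity) (by nlinarith))
  · have h2 := A.kap_pos .minus z hz
    have h3 : |2 * (θt z + S.lam .minus z * θr z) - (S.kap .minus z)⁻¹ *
        (S.kapt .minus z + S.lam .minus z * S.kapr .minus z)| ≤ 2 * C + C * C := by
      refine (abs_sub _ _).trans (add_le_add ?_ ?_)
      · rw [abs_mul, abs_two]; linarith [hD z hz]
      · rw [abs_mul]
        exact mul_le_mul (hk z hz) (A.kap_along .minus z hz) (abs_nonneg _) hC
    have h4 := mul_le_mul (hm z hz) h3 (abs_nonneg _) (by positivity)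
    rw [← abs_mul] at h4
    refine le_trans (le_of_eq_of_le (congrArg _ ?_) h4) ?_
    · field_simp
      ring
    · have : 0 ≤ Real.exp C ^ 2 * C := by positivity
      nlinarith

end Acoustics.IsAdmissible

/-- Translates a compatibility condition of order one, which compares the prescribed time
derivatives, into the statement that the radial derivative no longer jumps after subtraction of the
lift. -/
theorem eq_sub_of_mul_exp {κ e e' g g' x x' : ℝ} (hκ : κ ≠ 0) (hee : e * e' = 1)
    (h : g - κ * e' ^ 2 * x = g' - κ * e' ^ 2 * x') : x = x' - e ^ 2 * κ⁻¹ * (g' - g) := by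
  have h1 : κ * κ⁻¹ = 1 := mul_inv_cancel₀ hκ
  have h2 : e ^ 2 * κ⁻¹ * (κ * e' ^ 2) = 1 := by
    linear_combination e ^ 2 * e' ^ 2 * h1 + (e * e' + 1) * hee
  linear_combination -(e ^ 2 * κ⁻¹) * h - (x - x') * h2

theorem mul_exp_cancel {κ e e' x : ℝ} (hκ : κ ≠ 0) (hee : e * e' = 1) :
    κ * e ^ 2 * (e' ^ 2 * κ⁻¹ * x) = x := by
  have h1 : κ * κ⁻¹ = 1 := mul_inv_cancel₀ hκ
  linear_combination e ^ 2 * e' ^ 2 * x * h1 + x * (e * e' + 1) * hee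

/-- All exponential growth is estimated at the final time T₀, which makes the constant independent
of T and τ. -/
theorem growth_le {C T T₀ τ X Y : ℝ} (hC : 0 ≤ C) (hτ : τ ∈ Icc 0 T) (hT : T ≤ T₀) (hXY : X ≤ Y)
    (hY : 0 ≤ Y) :
    2 * Real.exp C * (2 * (Real.exp (2 * C * T) * (Real.exp C * X)) *
      Real.exp (4 * (Real.exp (2 * C * T) * (C + C * C)) * τ)) ≤
    2 * Real.exp C * (2 * (Real.exp (2 * C * T₀) * Real.exp C) *
      Real.exp (4 * (Real.exp (2 * C * T₀) * (C + C * C)) * T₀)) * Y := by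
  have e1 : Real.exp (2 * C * T) ≤ Real.exp (2 * C * T₀) :=
    Real.exp_le_exp.2 (mul_le_mul_of_nonneg_left hT (by positivity))
  have e2 : Real.exp (4 * (Real.exp (2 * C * T) * (C + C * C)) * τ) ≤
      Real.exp (4 * (Real.exp (2 * C * T₀) * (C + C * C)) * T₀) :=
    Real.exp_le_exp.2 (mul_le_mul (by gcongr) (hτ.2.trans hT) hτ.1 (by positivity))
  rw [show 2 * Real.exp C * (2 * (Real.exp (2 * C * T₀) * Real.exp C) *
      Real.exp (4 * (Real.exp (2 * C * T₀) * (C + C * C)) * T₀)) * Y = 2 * Real.exp C * (2 *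
      (Real.exp (2 * C * T₀) * (Real.exp C * Y)) *
      Real.exp (4 * (Real.exp (2 * C * T₀) * (C + C * C)) * T₀)) by ring]
  refine le_trans (b := 2 * Real.exp C * (2 * (Real.exp (2 * C * T) * (Real.exp C * Y)) *
      Real.exp (4 * (Real.exp (2 * C * T) * (C + C * C)) * τ))) ?_ ?_
  · gcongr
  · gcongr

/-- Existence for the acoustic system, with a bound for the radial derivatives. -/
theorem exists_isAcousticSolution_of_compatible (C T₀ : ℝ) (hC : 0 ≤ C) :
    ∃ N, 0 ≤ N ∧ ∀ {a b T K : ℝ} {S : Acoustics} {f1 f1t f1r f2 f2t f2r : Side → ℝ × ℝ → ℝ}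
      {h1 h1' h2 h2' : Side → ℝ → ℝ}, S.IsAdmissible a b T C → T ≤ T₀ →
      (∀ σ, HasPartials (slab a b T σ) (f1 σ) (f1t σ) (f1r σ)) →
      (∀ σ, HasPartials (slab a b T σ) (f2 σ) (f2t σ) (f2r σ)) →
      (∀ σ, ∀ z ∈ slab a b T σ, |f1 σ z| ≤ K) → (∀ σ, ∀ z ∈ slab a b T σ, |f1r σ z| ≤ K) →
      (∀ σ, ∀ z ∈ slab a b T σ, |f2 σ z| ≤ K) → (∀ σ, ∀ z ∈ slab a b T σ, |f2r σ z| ≤ K) →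
      RadialC1 a b T K (fun σ z => h1 σ z.2) (fun σ z => h1' σ z.2) →
      RadialC1 a b T K (fun σ z => h2 σ z.2) (fun σ z => h2' σ z.2) →
      h1 .plus b = h1 .minus b → h2 .plus b = h2 .minus b → h2 .minus a = 0 →
      (f1 .plus (0, b) - S.kap .minus (0, b) * Real.exp (S.th .minus (0, b)) ^ 2 * h2' .plus b =
        f1 .minus (0, b) - S.kap .minus (0, b) * Real.exp (S.th .minus (0, b)) ^ 2 *
          h2' .minus b) →
      (f2 .plus (0, b) - S.kap .minus (0, b) * Real.exp (-S.th .minus (0, b)) ^ 2 * h1' .plus b =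
        f2 .minus (0, b) - S.kap .minus (0, b) * Real.exp (-S.th .minus (0, b)) ^ 2 *
          h1' .minus b) →
      (f2 .minus (0, a) - S.kap .minus (0, a) * Real.exp (-S.th .minus (0, a)) ^ 2 *
        h1' .minus a = 0) →
      ∃ w1 w1t w1r w2 w2t w2r, IsAcousticSolution S a b T f1 f2 h1 h2 w1 w1t w1r w2 w2t w2r ∧
        ∀ τ ∈ Icc 0 T, ∀ (A₁ : ℝ) (ψ : ℝ → ℝ), IntervalIntegrable ψ volume 0 τ →
        (∀ σ, ∀ r ∈ σ.interval a b, |h1' σ r| ≤ A₁) →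
        (∀ σ, ∀ r ∈ σ.interval a b, |h2' σ r| ≤ A₁) →
        (∀ s, s = 0 ∨ s = τ → ∀ σ, ∀ r ∈ σ.interval a b, |f1 σ (s, r)| ≤ A₁) →
        (∀ s, s = 0 ∨ s = τ → ∀ σ, ∀ r ∈ σ.interval a b, |f2 σ (s, r)| ≤ A₁) →
        (∀ s ∈ Icc 0 τ, ∀ σ, ∀ r ∈ σ.interval a b, |f1 σ (s, r)| ≤ ψ s ∧ |f1r σ (s, r)| ≤ ψ s ∧
          |f1t σ (s, r) + S.lam σ (s, r) * f1r σ (s, r)| ≤ ψ s) →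
        (∀ s ∈ Icc 0 τ, ∀ σ, ∀ r ∈ σ.interval a b, |f2 σ (s, r)| ≤ ψ s ∧ |f2r σ (s, r)| ≤ ψ s ∧
          |f2t σ (s, r) + S.lam σ (s, r) * f2r σ (s, r)| ≤ ψ s) →
        ∀ σ, ∀ r ∈ σ.interval a b, |w1r σ (τ, r)| ≤ N * (A₁ + ∫ s in (0 : ℝ)..τ, ψ s) ∧
          |w2r σ (τ, r)| ≤ N * (A₁ + ∫ s in (0 : ℝ)..τ, ψ s) := by
  -- `B` bounds the coefficients of the lifts, `D` is the growth factor of `growth_le`, and `N₁`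
  -- collects what the lifts add: 1 + 2B for the initial derivatives and (1 + C) + B(4 + 3C) for the
  -- radial derivatives of the sources.
  set B := Real.exp C ^ 2 * C * (1 + 2 * C + C * C) with hBdef
  have hB : 0 ≤ B := by positivity
  set D := 2 * Real.exp C * (2 * (Real.exp (2 * C * T₀) * Real.exp C) *
    Real.exp (4 * (Real.exp (2 * C * T₀) * (C + C * C)) * T₀)) with hDdef
  have hD : 0 ≤ D := by positivity
  set N₁ := (1 + 2 * B) + ((1 + C) + B * (4 + 3 * C)) with hN₁
  have hN₁0 : 0 ≤ N₁ := by positivity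
  clear_value D N₁ B
  refine ⟨D * N₁ + 2 * B, by positivity, ?_⟩
  intro a b T K S f1 f1t f1r f2 f2t f2r h1 h1' h2 h2' A hT hf1 hf2 hf1b hf1rb hf2b hf2rb
    hh1 hh2 hh1b hh2b hh2a c1 c2 c3
  have h0 : (0 : ℝ) ∈ Icc 0 T := ⟨le_rfl, A.pos.le⟩
  have hba := sub_pos.2 A.lt
  obtain ⟨k1t, k1r, hk1, hk1b, hk1D⟩ := A.exists_lift_coeff (A.th .minus) (A.th_bound .minus)
    (A.along_bound .minus)
  obtain ⟨k2t, k2r, hk2, hk2b, hk2D⟩ := A.exists_lift_coeff (A.th .minus).neg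
    (fun z hz => by rw [abs_neg]; exact A.th_bound .minus z hz)
    (fun z hz => by
      rw [mul_neg, ← neg_add, abs_neg]; exact A.along_bound .minus z hz)
  simp only [← hBdef] at hk1b hk1D hk2b hk2D
  -- The first lift is built from `f2` and the second from `f1`, because the radial derivative of
  -- each unknown enters the equation of the other with a factor that does not vanish. The lift
  -- absorbs the jump of the source at the front and its value at the wall.
  obtain ⟨W1, W1t, W1r, Z1r, hW1, hW1b, hW1a, hW1m, hW1p, ⟨L1, hW1R⟩, ⟨M1, hZ1R⟩, hZ1b, hZ1a,
    hW1e⟩ := A.exists_lift hk1 hk1b hk1D hf2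
  obtain ⟨W2, W2t, W2r, Z2r, hW2, hW2b, hW2a, hW2m, hW2p, ⟨L2, hW2R⟩, ⟨M2, hZ2R⟩, hZ2b, hZ2a,
    hW2e⟩ := A.exists_lift hk2 hk2b hk2D hf1
  have hsub : ∀ {g gr k kr : Side → ℝ × ℝ → ℝ} {K1 K2 : ℝ}, RadialC1 a b T K1 g gr →
      RadialC1 a b T K2 k kr → ∃ K3, RadialC1 a b T K3 (fun σ z => g σ z - k σ z)
        fun σ z => gr σ z - kr σ z := fun hg hk =>
    ⟨_, (hg.add (hk.mul (RadialC1.const (-1)))).congr (fun _ _ _ => by ring) fun _ _ _ => by ring⟩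
  obtain ⟨Q1, hF1⟩ := hsub (A.interpolated_radialC1 hf1 hf1b hf1rb) hZ1R
  obtain ⟨Q2, hF2⟩ := hsub (A.interpolated_radialC1 hf2 hf2b hf2rb) hZ2R
  obtain ⟨Q3, hH1⟩ := hsub hh1 (hW1R.at_zero A.pos.le)
  obtain ⟨Q4, hH2⟩ := hsub hh2 (hW2R.at_zero A.pos.le)
  obtain ⟨Q, q1, q2, q3, q4⟩ : ∃ Q, Q1 ≤ Q ∧ Q2 ≤ Q ∧ Q3 ≤ Q ∧ Q4 ≤ Q :=
    ⟨max (max Q1 Q2) (max Q3 Q4), (le_max_left _ _).trans (le_max_left _ _),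
      (le_max_right _ _).trans (le_max_left _ _), (le_max_left _ _).trans (le_max_right _ _),
      (le_max_right _ _).trans (le_max_right _ _)⟩
  have hone : (b - a) / (b - a) = 1 := div_self hba.ne'
  have hκb := A.kap_pos .minus (0, b) ⟨h0, Side.mem A.lt.le _⟩
  have hκa := A.kap_pos .minus (0, a) ⟨h0, Side.left_mem A.lt.le⟩
  have heeb := Acoustics.exp_mul_exp_neg (S.th .minus (0, b))
  have heea := Acoustics.exp_mul_exp_neg (S.th .minus (0, a))
  obtain ⟨v1, v1t, v1r, v2, v2t, v2r, hv, hve⟩ := A.exists_isAcousticSolution (K := Q)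
    (h1 := fun σ r => h1 σ r - W1 σ (0, r)) (h1' := fun σ r => h1' σ r - W1r σ (0, r))
    (h2 := fun σ r => h2 σ r - W2 σ (0, r)) (h2' := fun σ r => h2' σ r - W2r σ (0, r))
    (hF1.mono q1) (hF2.mono q2)
    (fun t ht => by simp only [interpolated, hZ1b t ht, hone, one_mul])
    (fun t ht => by simp only [interpolated, hZ2b t ht, hone, one_mul])
    (fun t ht => by simp only [interpolated, hZ2a t ht, sub_self, zero_div, zero_mul])
    (hH1.mono q3) (hH2.mono q4) (by rw [hh1b, hW1b]) (by rw [hh2b, hW2b])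
    (by rw [hh2a, hW2a, sub_self])
    (by
      simp only [hW1m, hW1p, interpolated, hone, one_mul, sub_zero]
      exact eq_sub_of_mul_exp hκb.ne' heeb c2)
    (by
      simp only [hW2m, hW2p, interpolated, hone, one_mul, sub_zero]
      exact eq_sub_of_mul_exp hκb.ne' ((mul_comm _ _).trans heeb) c1)
    (by
      simp only [hW1m, interpolated, sub_self, zero_div, zero_mul, sub_zero]
      -- The wall is treated like a front with zero data on its other side.
      have := eq_sub_of_mul_exp (g := 0) (x := 0) hκa.ne' heea
        ((by ring : _ = (0 : ℝ)).trans c3.symm)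
      rw [sub_zero] at this
      exact this.symm)
  refine ⟨_, _, _, _, _, _, ⟨fun σ => (hv.fst σ).add (hW1 σ), fun σ => (hv.snd σ).add (hW2 σ),
    ?_, ?_, fun t ht => ?_, fun t ht => ?_, fun t ht => ?_, fun σ r hr => ?_, fun σ r hr => ?_⟩,
    fun τ hτ A₁ ψ hψ k1 k2 k3 k4 k5 k6 σ r hr => ?_⟩
  · rintro (_ | _) z hz
    · have hκ := A.kap_pos .minus z hz
      have hee := Acoustics.exp_mul_exp_neg (S.th .minus z)
      have e1 := hv.equation_fst .minus z hz
      have e2 := hW2m z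
      have e3 := mul_exp_cancel (x := f1 .minus z - interpolated a b f1 .minus z) hκ.ne' hee
      rw [← e2] at e3
      linear_combination e1 + e3
    · have e1 := hv.equation_fst .plus z hz
      simp only [hW2p, hW1p, interpolated] at e1 ⊢
      linear_combination e1
  · rintro (_ | _) z hz
    · have hκ := A.kap_pos .minus z hz
      have hee := Acoustics.exp_mul_exp_neg (S.th .minus z)
      have e1 := hv.equation_snd .minus z hz
      have e2 := hW1m z
      have e3 := mul_exp_cancel (x := f2 .minus z - interpolated a b f2 .minus z) hκ.ne'
        ((mul_comm _ _).trans hee)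
      rw [← e2] at e3
      linear_combination e1 + e3
    · have e1 := hv.equation_snd .plus z hz
      simp only [hW2p, hW1p, interpolated] at e1 ⊢
      linear_combination e1
  · simp only [hv.front_fst t ht, hW1b]
  · simp only [hv.front_snd t ht, hW2b]
  · simp only [hv.wall t ht, hW2a, add_zero]
  · simp only [hv.initial_fst σ r hr, sub_add_cancel]
  · simp only [hv.initial_snd σ r hr, sub_add_cancel]
  · have hτ0 : ∀ {s}, s ∈ Icc 0 τ → s ∈ Icc 0 T := fun hs => ⟨hs.1, hs.2.trans hτ.2⟩
    have hA₁ : 0 ≤ A₁ := (abs_nonneg _).trans (k1 .plus b (mem_Ici.2 le_rfl))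
    have hψ0 : ∀ s ∈ Icc 0 τ, 0 ≤ ψ s := fun s hs =>
      (abs_nonneg _).trans (k5 s hs .plus b (mem_Ici.2 le_rfl)).1
    have hI : 0 ≤ ∫ s in (0 : ℝ)..τ, ψ s := intervalIntegral.integral_nonneg hτ.1 hψ0
    have hw : |1 / (b - a)| ≤ C := by
      rw [abs_of_pos (by positivity), div_le_iff₀ hba]; exact A.width_lower
    have hinterp : ∀ {f fr : Side → ℝ × ℝ → ℝ}, ∀ s ∈ Icc 0 τ,
        (∀ σ, ∀ r ∈ σ.interval a b, |f σ (s, r)| ≤ ψ s) →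
        (∀ σ, ∀ r ∈ σ.interval a b, |fr σ (s, r)| ≤ ψ s) →
        ∀ σ, ∀ r ∈ σ.interval a b, |interpolatedDeriv a b f fr σ (s, r)| ≤ (1 + C) * ψ s := by
      intro f fr s hs g1 g2
      have := hψ0 s hs
      rintro (_ | _) r hr
      · simp only [interpolatedDeriv, abs_mul]
        have h2 := g1 .plus b (mem_Ici.2 le_rfl)
        nlinarith [mul_le_mul hw h2 (abs_nonneg _) hC]
      · exact (g2 .plus r hr).trans (by nlinarith)
    -- The lifts enter at time 0 through the initial derivatives and at time τ when they are added
    -- back. This is why `A₁` must dominate the sources at both times.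
    have key := hve τ hτ ((1 + 2 * B) * A₁) (fun s => ((1 + C) + B * (4 + 3 * C)) * ψ s)
      (hψ.const_mul _)
      (fun σ r hr => (abs_sub _ _).trans (by
        linarith [k1 σ r hr, (hW1e 0 h0 A₁ (k4 0 (Or.inl rfl))).1 σ r hr]))
      (fun σ r hr => (abs_sub _ _).trans (by
        linarith [k2 σ r hr, (hW2e 0 h0 A₁ (k3 0 (Or.inl rfl))).1 σ r hr]))
      (fun σ s hs r hr => (abs_sub _ _).trans (by
        have e1 := hinterp (f := f1) (fr := f1r) s hs (fun σ r hr => (k5 s hs σ r hr).1)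
          (fun σ r hr => (k5 s hs σ r hr).2.1) σ r hr
        have e2 := (hW1e s (hτ0 hs) (ψ s) fun σ r hr => (k6 s hs σ r hr).1).2
          (fun σ r hr => (k6 s hs σ r hr).2.2) σ r hr
        linarith))
      (fun σ s hs r hr => (abs_sub _ _).trans (by
        have e1 := hinterp (f := f2) (fr := f2r) s hs (fun σ r hr => (k6 s hs σ r hr).1)
          (fun σ r hr => (k6 s hs σ r hr).2.1) σ r hr
        have e2 := (hW2e s (hτ0 hs) (ψ s) fun σ r hr => (k5 s hs σ r hr).1).2
          (fun σ r hr => (k5 s hs σ r hr).2.2) σ r hr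
        linarith)) σ r hr
    rw [intervalIntegral.integral_const_mul] at key
    have hX : (1 + 2 * B) * A₁ + ((1 + C) + B * (4 + 3 * C)) * (∫ s in (0 : ℝ)..τ, ψ s) ≤
        N₁ * (A₁ + ∫ s in (0 : ℝ)..τ, ψ s) := by
      rw [hN₁]
      have e1 : 0 ≤ (1 + 2 * B) * ∫ s in (0 : ℝ)..τ, ψ s := by positivity
      have e2 : 0 ≤ ((1 + C) + B * (4 + 3 * C)) * A₁ := by positivity
      linarith
    have hDb : 2 * Real.exp C * (2 * (Real.exp (2 * C * T) * (Real.exp C *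
        ((1 + 2 * B) * A₁ + ((1 + C) + B * (4 + 3 * C)) * (∫ s in (0 : ℝ)..τ, ψ s)))) *
        Real.exp (4 * (Real.exp (2 * C * T) * (C + C * C)) * τ)) ≤
        D * N₁ * (A₁ + ∫ s in (0 : ℝ)..τ, ψ s) := by
      rw [hDdef, mul_assoc _ N₁]
      exact growth_le hC hτ hT hX (mul_nonneg hN₁0 (add_nonneg hA₁ hI))
    have e4 : 0 ≤ 2 * B * ∫ s in (0 : ℝ)..τ, ψ s := by positivity
    refine ⟨(abs_add_le _ _).trans ?_, (abs_add_le _ _).trans ?_⟩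
    · linarith [key.1, (hW1e τ hτ A₁ (k4 τ (Or.inr rfl))).1 σ r hr]
    · linarith [key.2, (hW2e τ hτ A₁ (k3 τ (Or.inr rfl))).1 σ r hr]

end VortexSheet

namespace VortexSheet
open Filter Topology MeasureTheory

/-! ### Transport on one side -/

/-- The projection of the line onto the radial interval of a side. -/
noncomputable def Side.proj (a b : ℝ) : Side → ℝ → ℝ
  | .minus, y => max a (min y b)
  | .plus, y => max y b

theorem Side.proj_mem {a b : ℝ} (hab : a ≤ b) : ∀ (σ : Side) (y : ℝ), σ.proj a b y ∈ σ.interval a b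
  | .minus, _ => ⟨le_max_left _ _, max_le hab (min_le_right _ _)⟩
  | .plus, _ => mem_Ici.2 (le_max_right _ _)

theorem Side.proj_of_mem {a b : ℝ} : ∀ {σ : Side} {y : ℝ}, y ∈ σ.interval a b → σ.proj a b y = y
  | .minus, _, h => by simp only [Side.proj]; rw [min_eq_left h.2, max_eq_right h.1]
  | .plus, _, h => max_eq_left h

theorem Side.continuous_proj (a b : ℝ) : ∀ σ : Side, Continuous (σ.proj a b)
  | .minus => by unfold Side.proj; fun_prop
  | .plus => by unfold Side.proj; fun_prop

/-- The extension of a function on one side to the line that is linear beyond the end points. -/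
noncomputable def extended (a b T : ℝ) (σ : Side) (g gr : ℝ × ℝ → ℝ) (t y : ℝ) : ℝ :=
  g (clampTime T t, b) + ∫ z in b..y, gr (clampTime T t, σ.proj a b z)

section Extended

variable {a b T : ℝ} {σ : Side} {g gr : ℝ × ℝ → ℝ}

theorem continuous_comp_proj (hab : a ≤ b) (hT : 0 ≤ T) (hg : ContinuousOn g (slab a b T σ)) :
    Continuous fun z : ℝ × ℝ => g (clampTime T z.1, σ.proj a b z.2) := by
  have h1 := continuous_clampTime T
  have h2 := σ.continuous_proj a b
  exact hg.comp_continuous (by fun_prop) fun z => ⟨clampTime_mem hT _, σ.proj_mem hab _⟩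

theorem continuous_extended (hab : a ≤ b) (hT : 0 ≤ T) (hg : ContinuousOn g (slab a b T σ))
    (hgr : ContinuousOn gr (slab a b T σ)) :
    Continuous (Function.uncurry (extended a b T σ g gr)) := by
  have h1 := continuous_clampTime T
  have h2 : Continuous fun z : ℝ × ℝ => g (clampTime T z.1, b) :=
    hg.comp_continuous (by fun_prop) fun z => ⟨clampTime_mem hT _, σ.mem hab⟩
  refine h2.add (intervalIntegral.continuous_parametric_intervalIntegral_of_continuous
    (f := fun (z : ℝ × ℝ) y => gr (clampTime T z.1, σ.proj a b y)) ?_ continuous_snd)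
  exact (continuous_comp_proj hab hT hgr).comp (f := fun q : (ℝ × ℝ) × ℝ => (q.1.1, q.2))
    (by fun_prop)

theorem hasDerivAt_extended (hab : a ≤ b) (hT : 0 ≤ T) (hgr : ContinuousOn gr (slab a b T σ))
    (t y : ℝ) : HasDerivAt (extended a b T σ g gr t) (gr (clampTime T t, σ.proj a b y)) y := by
  have h1 : Continuous fun z : ℝ => gr (clampTime T t, σ.proj a b z) :=
    (continuous_comp_proj hab hT hgr).comp (f := fun z : ℝ => (t, z)) (by fun_prop)
  exact (h1.integral_hasStrictDerivAt b y).hasDerivAt.const_add _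

theorem extended_apply (hab : a ≤ b) (hT : 0 ≤ T) (hg : ContinuousOn g (slab a b T σ))
    (hgr : ContinuousOn gr (slab a b T σ))
    (hd : ∀ t ∈ Icc 0 T, ∀ r ∈ σ.interval a b,
      HasDerivWithinAt (fun r => g (t, r)) (gr (t, r)) (σ.interval a b) r)
    {t r : ℝ} (ht : t ∈ Icc 0 T) (hr : r ∈ σ.interval a b) :
    extended a b T σ g gr t r = g (t, r) := by
  have h1 : Continuous fun z : ℝ => gr (clampTime T t, σ.proj a b z) :=
    (continuous_comp_proj hab hT hgr).comp (f := fun z : ℝ => (t, z)) (by fun_prop)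
  have hsub : uIcc b r ⊆ σ.interval a b :=
    (σ.convex_interval a b).ordConnected.uIcc_subset (σ.mem hab) hr
  have h2 := intervalIntegral.integral_eq_sub_of_hasDeriv_right (a := b) (b := r)
    (f := fun r => g (t, r)) (f' := fun z => gr (clampTime T t, σ.proj a b z))
    ((hg.comp (by fun_prop) fun y hy => ⟨ht, hy⟩).mono hsub) (fun x hx => by
      have hxI := hsub (Ioo_subset_Icc_self hx)
      have h3 := hd t ht x hxI
      have h4 : HasDerivAt (fun r => g (t, r)) (gr (t, x)) x :=
        h3.hasDerivAt (mem_of_superset (Icc_mem_nhds hx.1 hx.2) hsub)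
      rw [clampTime_of_mem ht, Side.proj_of_mem hxI]
      exact h4.hasDerivWithinAt) (h1.intervalIntegrable _ _)
  rw [extended, h2, clampTime_of_mem ht]
  ring

end Extended

/-- A zero of the field is a stationary curve, and distinct curves do not meet. So a curve stays on
its side of the zero; the positive factor expresses this. -/
theorem CharField.sub_mul_nonneg {T L : ℝ} {E : Set ℝ} {μ μx : ℝ → ℝ → ℝ} {X : ℝ → ℝ → ℝ → ℝ}
    (F : CharField T L E μ μx X) {e : ℝ} (he : ∀ s ∈ Icc 0 T, μ s e = 0) {t s : ℝ}
    (ht : t ∈ Icc 0 T) (hs : s ∈ Icc 0 T) (y : ℝ) :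
    ∃ k, 0 < k ∧ X t y s - e = (y - e) * k := by
  have h1 := abs_sub_le_of_trajectories (T := T) F.lipschitz (x := X t e) (y := fun _ => e)
    (F.flow.continuous_curve t e).continuousOn continuousOn_const
    (F.flow.hasDerivAt t ht e) (fun s hs => by
      rw [he s (Ioo_subset_Icc_self hs)]; exact hasDerivAt_const _ _) hs ht
  rw [F.flow.initial t ht, sub_self, abs_zero, zero_mul] at h1
  have h2 : X t e s = e := sub_eq_zero.1 (abs_eq_zero.1 (le_antisymm h1 (abs_nonneg _)))
  rcases eq_or_ne y e with rfl | hne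
  · exact ⟨1, one_pos, by rw [h2]; ring⟩
  · have h3 := F.sub_eq_mul_exp ht hs hne
    rw [h2] at h3
    exact ⟨_, Real.exp_pos _, h3⟩

namespace Acoustics.IsAdmissible

variable {a b T C : ℝ} {S : Acoustics}

/-- The speed vanishes at the front, and at the wall on the inner side. The characteristics starting
on one side thus remain there, and the transport problem needs no boundary data. -/
theorem exists_charField_side (A : S.IsAdmissible a b T C) (σ : Side) :
    ∃ X, CharField T C ∅ (extended a b T σ (S.lam σ) (S.lamr σ))
        (fun t y => S.lamr σ (clampTime T t, σ.proj a b y)) X ∧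
      ∀ t ∈ Icc 0 T, ∀ r ∈ σ.interval a b, ∀ s ∈ Icc 0 T, X t r s ∈ σ.interval a b := by
  have hl := A.lam σ
  have hc := continuous_extended A.lt.le A.pos.le hl.continuousOn hl.continuousOn_dr
  have hd := fun t y => hasDerivAt_extended (g := S.lam σ) A.lt.le A.pos.le hl.continuousOn_dr t y
  have hb : BddContOff ∅ C fun t y => S.lamr σ (clampTime T t, σ.proj a b y) :=
    BddContOff.of_continuous (continuous_comp_proj A.lt.le A.pos.le hl.continuousOn_dr)
      fun t y => A.lamr_bound σ _ ⟨clampTime_mem A.pos.le _, σ.proj_mem A.lt.le _⟩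
  obtain ⟨X, hX⟩ := exists_isFlow A.pos A.nonneg hc fun t x y =>
    abs_sub_le_of_hasDerivAt_off countable_empty
      (hc.comp (by fun_prop : Continuous fun x : ℝ => (t, x))) (fun x _ => hd t x)
      (hb.intervalIntegrable_slice isClosed_empty countable_empty t) (hb.bound t) x y
  have F : CharField T C ∅ (extended a b T σ (S.lam σ) (S.lamr σ))
      (fun t y => S.lamr σ (clampTime T t, σ.proj a b y)) X :=
    ⟨A.pos, isClosed_empty, countable_empty, hc, fun t x _ => hd t x, hb, hX,
      fun t _ x => by simp⟩
  have hap : ∀ s ∈ Icc 0 T, ∀ r ∈ σ.interval a b,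
      extended a b T σ (S.lam σ) (S.lamr σ) s r = S.lam σ (s, r) := fun s hs r hr =>
    extended_apply A.lt.le A.pos.le hl.continuousOn hl.continuousOn_dr
      (fun t ht r hr => hl.hasDerivWithinAt_snd (fun r hr => ⟨ht, hr⟩) hr) hs hr
  refine ⟨X, F, fun t ht r hr s hs => ?_⟩
  obtain ⟨k, hk, h1⟩ := F.sub_mul_nonneg (e := b)
    (fun s hs => (hap s hs b (σ.mem A.lt.le)).trans (A.lam_front σ s hs)) ht hs r
  cases σ
  · obtain ⟨k', hk', h2⟩ := F.sub_mul_nonneg (e := a)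
      (fun s hs => (hap s hs a (Side.left_mem A.lt.le)).trans (A.lam_wall s hs)) ht hs r
    have h3 := mul_nonneg (sub_nonneg.2 hr.1) hk'.le
    have h4 := mul_nonneg (sub_nonneg.2 hr.2) hk.le
    exact ⟨by linarith, by linarith⟩
  · have h4 := mul_nonneg (sub_nonneg.2 (mem_Ici.1 hr)) hk.le
    exact mem_Ici.2 (by linarith)

/-- A transported function is bounded by its initial values and the source. -/
theorem abs_le_of_transport (A : S.IsAdmissible a b T C) {σ : Side} {h ht hr f : ℝ × ℝ → ℝ}
    (hh : HasPartials (slab a b T σ) h ht hr)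
    (heq : ∀ z ∈ slab a b T σ, ht z + S.lam σ z * hr z = f z) {A₀ : ℝ}
    (h0 : ∀ r ∈ σ.interval a b, |h (0, r)| ≤ A₀) {τ : ℝ} (hτ : τ ∈ Icc 0 T) {φ : ℝ → ℝ}
    (hφ : IntervalIntegrable φ volume 0 τ)
    (hf : ∀ s ∈ Icc 0 τ, ∀ r ∈ σ.interval a b, |f (s, r)| ≤ φ s) {r : ℝ}
    (hr : r ∈ σ.interval a b) : |h (τ, r)| ≤ A₀ + ∫ s in (0 : ℝ)..τ, φ s := by
  obtain ⟨X, F, hX⟩ := A.exists_charField_side σ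
  have hl := A.lam σ
  have hcf : ContinuousOn f (slab a b T σ) := ContinuousOn.congr
    (hh.continuousOn_dt.add (hl.continuousOn.mul hh.continuousOn_dr)) fun z hz => (heq z hz).symm
  have hsub : Icc 0 τ ⊆ Icc 0 T := Icc_subset_Icc_right hτ.2
  have hXc := F.flow.continuous_curve τ r
  have hmaps : ∀ s ∈ Icc 0 τ, (s, X τ r s) ∈ slab a b T σ := fun s hs =>
    ⟨hsub hs, hX τ hτ r hr s (hsub hs)⟩
  have hcurve : ∀ {g : ℝ × ℝ → ℝ}, ContinuousOn g (slab a b T σ) →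
      ContinuousOn (fun s => g (s, X τ r s)) (Icc 0 τ) := fun hg =>
    hg.comp (f := fun s => (s, X τ r s)) (by fun_prop) hmaps
  have h1 := intervalIntegral.integral_eq_sub_of_hasDeriv_right (a := 0) (b := τ)
    (f := fun s => h (s, X τ r s)) (f' := fun s => f (s, X τ r s))
    (by rw [uIcc_of_le hτ.1]; exact hcurve hh.continuousOn) (fun s hs => by
      rw [min_eq_left hτ.1, max_eq_right hτ.1] at hs
      have hsI := Ioo_subset_Icc_self hs
      have hsT : s ∈ Ioo 0 T := ⟨hs.1, hs.2.trans_le hτ.2⟩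
      have h2 := ((hasDerivAt_id s).prodMk (F.flow.hasDerivAt τ hτ r s hsT)).hasDerivWithinAt
        (s := Icc 0 τ)
      have h3 := (hh.hasFDerivWithinAt _ (hmaps s hsI)).comp_hasDerivWithinAt
        (f := fun s => (s, X τ r s)) s h2 hmaps
      have h4 := h3.hasDerivAt (Icc_mem_nhds hs.1 hs.2)
      refine (h4.congr_deriv ?_).hasDerivWithinAt
      rw [extended_apply A.lt.le A.pos.le hl.continuousOn hl.continuousOn_dr
        (fun t ht r hr => hl.hasDerivWithinAt_snd (fun r hr => ⟨ht, hr⟩) hr) (hsub hsI)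
        (hmaps s hsI).2, ← heq _ (hmaps s hsI)]
      simp only [add_apply, FunLike.coe_smul, Pi.smul_apply, ContinuousLinearMap.coe_fst',
        ContinuousLinearMap.coe_snd', smul_eq_mul]
      ring)
    (by rw [← uIcc_of_le hτ.1] at hcurve; exact (hcurve hcf).intervalIntegrable)
  rw [F.flow.initial τ hτ] at h1
  have h2 : |∫ s in (0 : ℝ)..τ, f (s, X τ r s)| ≤ ∫ s in (0 : ℝ)..τ, φ s := by
    rw [← Real.norm_eq_abs]
    refine intervalIntegral.norm_integral_le_of_norm_le hτ.1 (ae_of_all _ fun s hs => ?_) hφ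
    exact hf s (Ioc_subset_Icc_self hs) _ (hmaps s (Ioc_subset_Icc_self hs)).2
  have h3 : h (τ, r) = h (0, X τ r 0) + ∫ s in (0 : ℝ)..τ, f (s, X τ r s) := by linarith
  rw [h3]
  exact (abs_add_le _ _).trans (add_le_add (h0 _ (hmaps 0 ⟨le_rfl, hτ.1⟩).2) h2)

/-- Existence for the transport equation, with a bound for the radial derivative. -/
theorem exists_transport (A : S.IsAdmissible a b T C) (σ : Side) {f ft fr : ℝ × ℝ → ℝ} {k k' : ℝ → ℝ}
    {K : ℝ} (hf : HasPartials (slab a b T σ) f ft fr) (hfb : ∀ z ∈ slab a b T σ, |fr z| ≤ K)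
    (hk : ∀ r ∈ σ.interval a b, HasDerivWithinAt k (k' r) (σ.interval a b) r)
    (hk' : ContinuousOn k' (σ.interval a b)) :
    ∃ h ht hr, HasPartials (slab a b T σ) h ht hr ∧
      (∀ z ∈ slab a b T σ, ht z + S.lam σ z * hr z = f z) ∧
      (∀ r ∈ σ.interval a b, h (0, r) = k r) ∧
      ∀ τ ∈ Icc 0 T, ∀ (A₁ : ℝ) (ψ : ℝ → ℝ), IntervalIntegrable ψ volume 0 τ →
        (∀ r ∈ σ.interval a b, |k' r| ≤ A₁) →
        (∀ s ∈ Icc 0 τ, ∀ r ∈ σ.interval a b, |fr (s, r)| ≤ ψ s) →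
        ∀ r ∈ σ.interval a b,
          |hr (τ, r)| ≤ Real.exp (C * T) * (A₁ + ∫ s in (0 : ℝ)..τ, ψ s) := by
  obtain ⟨X, F, hX⟩ := A.exists_charField_side σ
  have hl := A.lam σ
  have h0 : (0 : ℝ) ∈ Icc 0 T := ⟨le_rfl, A.pos.le⟩
  have hlap : ∀ s ∈ Icc 0 T, ∀ r ∈ σ.interval a b,
      extended a b T σ (S.lam σ) (S.lamr σ) s r = S.lam σ (s, r) := fun s hs r hr =>
    extended_apply A.lt.le A.pos.le hl.continuousOn hl.continuousOn_dr
      (fun t ht r hr => hl.hasDerivWithinAt_snd (fun r hr => ⟨ht, hr⟩) hr) hs hr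
  have hfap : ∀ s ∈ Icc 0 T, ∀ r ∈ σ.interval a b, extended a b T σ f fr s r = f (s, r) :=
    fun s hs r hr => extended_apply A.lt.le A.pos.le hf.continuousOn hf.continuousOn_dr
      (fun t ht r hr => hf.hasDerivWithinAt_snd (fun r hr => ⟨ht, hr⟩) hr) hs hr
  have hkc : ContinuousOn (fun z : ℝ × ℝ => k z.2) (slab a b T σ) := fun z hz =>
    ((hk z.2 hz.2).continuousWithinAt).comp (t := σ.interval a b)
      continuous_snd.continuousWithinAt fun z hz => hz.2
  have hkc' : ContinuousOn (fun z : ℝ × ℝ => k' z.2) (slab a b T σ) :=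
    hk'.comp continuousOn_snd fun z hz => hz.2
  have hkap : ∀ s ∈ Icc 0 T, ∀ r ∈ σ.interval a b,
      extended a b T σ (fun z => k z.2) (fun z => k' z.2) s r = k r :=
    fun s hs r hr => extended_apply (g := fun z => k z.2) A.lt.le A.pos.le hkc hkc'
      (fun t _ r hr => hk r hr) hs hr
  let G := extended a b T σ f fr
  let Gx : ℝ → ℝ → ℝ := fun t y => fr (clampTime T t, σ.proj a b y)
  let Y₀ : ℝ → ℝ := extended a b T σ (fun z => k z.2) (fun z => k' z.2) 0
  let Y₀' : ℝ → ℝ := fun y => k' (σ.proj a b y)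
  have hG : Continuous (Function.uncurry G) :=
    continuous_extended A.lt.le A.pos.le hf.continuousOn hf.continuousOn_dr
  have hGd : ∀ t y, HasDerivAt (G t) (Gx t y) y := fun t y =>
    hasDerivAt_extended A.lt.le A.pos.le hf.continuousOn_dr t y
  have hGx : BddContOff ∅ K Gx :=
    BddContOff.of_continuous (continuous_comp_proj A.lt.le A.pos.le hf.continuousOn_dr)
      fun t y => hfb _ ⟨clampTime_mem A.pos.le _, σ.proj_mem A.lt.le _⟩
  have hY₀ : Continuous Y₀ := (continuous_extended A.lt.le A.pos.le hkc hkc').comp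
    (by fun_prop : Continuous fun x : ℝ => ((0 : ℝ), x))
  have hY₀d : ∀ y, HasDerivAt Y₀ (Y₀' y) y := fun y =>
    hasDerivAt_extended (g := fun z => k z.2) A.lt.le A.pos.le hkc' 0 y
  have hY₀' : Continuous Y₀' := hk'.comp_continuous (σ.continuous_proj a b) (σ.proj_mem A.lt.le)
  -- The regularity theory of the reflected problem is reused with zero coupling and no breaks.
  have hz : PwC1 T 0 ∅ (extended a b T σ (S.lam σ) (S.lamr σ)) (fun _ _ => 0) (fun _ _ => 0)
      fun _ _ => 0 := by
    have hb : BddContOff ∅ 0 fun _ _ : ℝ => (0 : ℝ) :=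
      BddContOff.of_continuous (by fun_prop) (by simp)
    refine ⟨by fun_prop, fun _ _ _ _ => hasDerivAt_const _ _, fun t _ x _ => ?_, hb, hb⟩
    exact (hasFDerivAt_const (0 : ℝ) ((t, x) : ℝ × ℝ)).congr_fderiv (by ext <;> simp)
  have hd : ∀ t ∈ Icc 0 T, ∀ x ∉ (∅ : Set ℝ), HasDerivAt
      (transported T X Y₀ (fun s y => G s y + -((0 : ℝ) * 0)) t)
      (transportedDensity T (fun t y => S.lamr σ (clampTime T t, σ.proj a b y)) X Y₀' Gx t x) x := by
    intro t ht x hx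
    have := F.hasDerivAt_transported hz hz (CW := 0) (by simp) hG (fun t _ x _ => hGd t x) hGx hY₀
      (fun x _ => hY₀d x) hY₀' (fun x _ => by simp) ht hx
    simpa only [mul_zero, sub_zero, add_zero] using this
  have hS : BddContOff ∅ 0 fun _ _ : ℝ => -((0 : ℝ) * 0) :=
    BddContOff.of_continuous (by fun_prop) (by simp)
  have hYc := F.continuous_transported hY₀ hG hS
  have hVc := F.continuous_transportedDensity hY₀' hGx
  have hFD := fun t ht x => F.hasFDerivAt_transported (Y₀ := Y₀) hG hS hd hVc.continuousOn
    (t := t) ht (x := x) (by simp)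
  set V := transportedDensity T (fun t y => S.lamr σ (clampTime T t, σ.proj a b y)) X Y₀' Gx with hV
  refine ⟨Function.uncurry (transported T X Y₀ fun s y => G s y + -((0 : ℝ) * 0)),
    fun z => f z - S.lam σ z * V z.1 z.2, Function.uncurry V, ?_, fun z _ => ?_, fun r hr => ?_, ?_⟩
  · refine HasPartials.of_interior (convex_slab a b T σ) (closure_interior_slab A.lt A.pos σ)
      hYc.continuousOn (hf.continuousOn.sub (hl.continuousOn.mul hVc.continuousOn))
      hVc.continuousOn ?_
    rintro ⟨t, r⟩ hz'
    have hm := interior_subset hz'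
    rw [interior_slab] at hz'
    refine (hFD t hz'.1 r).congr_fderiv ?_
    simp only [G, hfap t hm.1 r hm.2, hlap t hm.1 r hm.2]
    ext <;> simp [Function.uncurry]
  · simp only [Function.uncurry]; ring
  · simp only [Function.uncurry, transported, clampTime_of_mem h0, F.flow.initial 0 h0,
      intervalIntegral.integral_same, add_zero, Y₀, hkap 0 h0 r hr]
  · intro τ hτ A₁ ψ hψ k1 k2 r hr
    have e1 : ∀ s ∈ Icc 0 T, |flowDeriv (fun t y => S.lamr σ (clampTime T t, σ.proj a b y)) X τ r s| ≤
        Real.exp (C * T) := fun s hs => F.flowDeriv_le hτ hs r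
    have e0 := Real.exp_pos (C * T)
    simp only [Function.uncurry, hV, transportedDensity, clampTime_of_mem hτ]
    rw [mul_add, ← intervalIntegral.integral_const_mul]
    refine (abs_add_le _ _).trans (add_le_add ?_ ?_)
    · rw [abs_mul]
      exact mul_le_mul (e1 0 h0) (k1 _ (σ.proj_mem A.lt.le _)) (abs_nonneg _) e0.le
    · rw [← Real.norm_eq_abs]
      refine intervalIntegral.norm_integral_le_of_norm_le hτ.1 (ae_of_all _ fun s hs => ?_)
        (hψ.const_mul _)
      have hs' := Ioc_subset_Icc_self hs
      have hsT : s ∈ Icc 0 T := ⟨hs'.1, hs'.2.trans hτ.2⟩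
      rw [Real.norm_eq_abs, abs_mul]
      refine mul_le_mul (e1 s hsT) ?_ (abs_nonneg _) e0.le
      simp only [Gx, clampTime_of_mem hsT]
      exact k2 s hs' _ (σ.proj_mem A.lt.le _)

end Acoustics.IsAdmissible

end VortexSheet

namespace VortexSheet
open Filter Topology MeasureTheory

/-! ### The gas law -/

theorem soundSpeed_eq {γ ρ : ℝ} (hγ : 0 < γ) (hρ : 0 < ρ) :
    soundSpeed γ ρ = ρ ^ ((γ - 1) / 2) := by
  have h : HasDerivAt (pressure γ) (ρ ^ (γ - 1)) ρ :=
    ((Real.hasDerivAt_rpow_const (p := γ) (Or.inl hρ.ne')).div_const γ).congr_deriv (by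
      field_simp)
  rw [soundSpeed, h.deriv, Real.sqrt_eq_rpow, ← Real.rpow_mul hρ.le]
  congr 1; ring

theorem soundSpeed_pos {γ ρ : ℝ} (hγ : 0 < γ) (hρ : 0 < ρ) : 0 < soundSpeed γ ρ := by
  rw [soundSpeed_eq hγ hρ]; positivity

theorem soundSpeed_inv_eq {γ ρ : ℝ} (hγ : 0 < γ) (hρ : 0 < ρ) :
    (soundSpeed γ ρ)⁻¹ = ρ ^ (-((γ - 1) / 2)) := by
  rw [soundSpeed_eq hγ hρ, Real.rpow_neg hρ.le]

theorem hasDerivAt_soundSpeed {γ ρ : ℝ} (hγ : 0 < γ) (hρ : 0 < ρ) :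
    HasDerivAt (soundSpeed γ) ((γ - 1) / 2 * ρ ^ ((γ - 1) / 2 - 1)) ρ :=
  (Real.hasDerivAt_rpow_const (Or.inl hρ.ne')).congr_of_eventuallyEq (by
    filter_upwards [Ioi_mem_nhds hρ] with x hx using soundSpeed_eq hγ hx)

theorem hasDerivAt_soundSpeed_inv {γ ρ : ℝ} (hγ : 0 < γ) (hρ : 0 < ρ) :
    HasDerivAt (fun x => (soundSpeed γ x)⁻¹)
      (-((γ - 1) / 2) * ρ ^ (-((γ - 1) / 2) - 1)) ρ :=
  (Real.hasDerivAt_rpow_const (Or.inl hρ.ne')).congr_of_eventuallyEq (by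
    filter_upwards [Ioi_mem_nhds hρ] with x hx using soundSpeed_inv_eq hγ hx)

/-- Half the logarithm of `ρ / c`. -/
noncomputable def logImpedance (γ ρ : ℝ) : ℝ := (1 - (γ - 1) / 2) / 2 * Real.log ρ

/-- With this normalization κe^{2θ} = ρ/Φ_r and κe^{-2θ} = c²/(ρΦ_r), the off-diagonal entries of B.
-/
theorem exp_logImpedance_sq {γ ρ : ℝ} (hγ : 0 < γ) (hρ : 0 < ρ) :
    Real.exp (logImpedance γ ρ) ^ 2 = ρ / soundSpeed γ ρ := by
  rw [soundSpeed_eq hγ hρ, ← Real.exp_nat_mul, div_eq_mul_inv, ← Real.rpow_neg hρ.le]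
  nth_rewrite 2 [← Real.rpow_one ρ]
  rw [← Real.rpow_add hρ, Real.rpow_def_of_pos hρ, logImpedance]
  congr 1; push_cast; ring

theorem exp_neg_logImpedance_sq {γ ρ : ℝ} (hγ : 0 < γ) (hρ : 0 < ρ) :
    Real.exp (-logImpedance γ ρ) ^ 2 = soundSpeed γ ρ / ρ := by
  rw [Real.exp_neg, inv_pow, exp_logImpedance_sq hγ hρ, inv_div]

theorem hasDerivAt_logImpedance {γ ρ : ℝ} (hρ : 0 < ρ) :
    HasDerivAt (logImpedance γ) ((1 - (γ - 1) / 2) / 2 * ρ⁻¹) ρ :=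
  (Real.hasDerivAt_log hρ.ne').const_mul _

theorem exists_abs_le_on_Icc {k : ℝ → ℝ} {δ : ℝ} (K : ℝ) (hδ : 0 < δ)
    (hk : ContinuousOn k (Ioi 0)) : ∃ N, 0 ≤ N ∧ ∀ x ∈ Icc δ K, |k x| ≤ N := by
  obtain ⟨N, hN⟩ := isCompact_Icc.exists_bound_of_continuousOn
    (hk.mono fun x (hx : x ∈ Icc δ K) => hδ.trans_le hx.1)
  exact ⟨max N 0, le_max_right _ _, fun x hx => (hN x hx).trans (le_max_left _ _)⟩

theorem continuousOn_rpow_const_Ioi (e : ℝ) : ContinuousOn (fun x : ℝ => x ^ e) (Ioi 0) :=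
  continuousOn_id.rpow_const fun _ hx => Or.inl (ne_of_gt hx)

/-- A bound for the functions of the density that occur in the coefficients. -/
structure GasBound (γ δ K N : ℝ) : Prop where
  nonneg : 0 ≤ N
  speed : ∀ ρ ∈ Icc δ K, |soundSpeed γ ρ| ≤ N
  speed_inv : ∀ ρ ∈ Icc δ K, |(soundSpeed γ ρ)⁻¹| ≤ N
  speed_deriv : ∀ ρ ∈ Icc δ K, |(γ - 1) / 2 * ρ ^ ((γ - 1) / 2 - 1)| ≤ N
  speed_inv_deriv : ∀ ρ ∈ Icc δ K, |-((γ - 1) / 2) * ρ ^ (-((γ - 1) / 2) - 1)| ≤ N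
  inv_deriv : ∀ ρ ∈ Icc δ K, |-(ρ ^ 2)⁻¹| ≤ N
  impedance : ∀ ρ ∈ Icc δ K, |logImpedance γ ρ| ≤ N
  impedance_deriv : ∀ ρ ∈ Icc δ K, |(1 - (γ - 1) / 2) / 2 * ρ⁻¹| ≤ N

theorem exists_gasBound {γ δ : ℝ} (K : ℝ) (hγ : 0 < γ) (hδ : 0 < δ) :
    ∃ N, GasBound γ δ K N := by
  have hinv : ContinuousOn (fun x : ℝ => x⁻¹) (Ioi 0) :=
    continuousOn_id.inv₀ fun _ hx => ne_of_gt hx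
  have hinv2 : ContinuousOn (fun x : ℝ => -(x ^ 2)⁻¹) (Ioi 0) :=
    ((continuousOn_id.pow 2).inv₀ fun _ hx => pow_ne_zero 2 (ne_of_gt hx)).neg
  obtain ⟨N1, p1, h1⟩ := exists_abs_le_on_Icc K hδ
    (fun x hx => (hasDerivAt_soundSpeed hγ hx).continuousAt.continuousWithinAt)
  obtain ⟨N2, p2, h2⟩ := exists_abs_le_on_Icc K hδ
    (fun x hx => (hasDerivAt_soundSpeed_inv hγ hx).continuousAt.continuousWithinAt)
  obtain ⟨N4, p4, h4⟩ := exists_abs_le_on_Icc K hδ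
    ((continuousOn_rpow_const_Ioi ((γ - 1) / 2 - 1)).const_smul ((γ - 1) / 2))
  obtain ⟨N5, p5, h5⟩ := exists_abs_le_on_Icc K hδ
    ((continuousOn_rpow_const_Ioi (-((γ - 1) / 2) - 1)).const_smul (-((γ - 1) / 2)))
  obtain ⟨N6, p6, h6⟩ := exists_abs_le_on_Icc K hδ hinv2
  obtain ⟨N7, p7, h7⟩ := exists_abs_le_on_Icc K hδ
    (fun x hx => (hasDerivAt_logImpedance (γ := γ) hx).continuousAt.continuousWithinAt)
  obtain ⟨N8, p8, h8⟩ := exists_abs_le_on_Icc K hδ (hinv.const_smul ((1 - (γ - 1) / 2) / 2))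
  exact ⟨N1 + N2 + N4 + N5 + N6 + N7 + N8, by positivity,
    fun x hx => by linarith [h1 x hx], fun x hx => by linarith [h2 x hx],
    fun x hx => (h4 x hx).trans (by linarith),
    fun x hx => (h5 x hx).trans (by linarith), fun x hx => by linarith [h6 x hx],
    fun x hx => by linarith [h7 x hx], fun x hx => (h8 x hx).trans (by linarith)⟩

/-! ### The background -/

theorem HasPartials.dt_dr {S : Set (ℝ × ℝ)} {g gt gr : ℝ × ℝ → ℝ} (hg : HasPartials S g gt gr)
    (hS : UniqueDiffOn ℝ S) : HasPartials S g (dt S g) (dr S g) :=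
  hg.congr (fun _ _ => rfl) (fun _ hp => hg.dt_eq hS hp) fun _ hp => hg.dr_eq hS hp

theorem front_mem_slab {a b T : ℝ} (hab : a < b) {t : ℝ} (ht : t ∈ Icc 0 T) (σ : Side) :
    (t, b) ∈ slab a b T σ :=
  ⟨ht, Side.mem hab.le σ⟩

/-- The radial transport speed `(u - Φ_t) / Φ_r`. -/
noncomputable def transportSpeed (a b : ℝ) (U : Field) (σ : Side) (p : ℝ × ℝ) : ℝ :=
  (U σ p 1 - straightenT a b U p.1 p.2) * (straightenR a b U p.1)⁻¹

/-- The straightened sound speed `c / Φ_r`. -/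
noncomputable def straightSpeed (γ a b : ℝ) (U : Field) (σ : Side) (p : ℝ × ℝ) : ℝ :=
  soundSpeed γ (U σ p 0) * (straightenR a b U p.1)⁻¹

/-- The acoustic coefficients of a background state. -/
noncomputable def acoustics (γ a b T : ℝ) (U : Field) : Acoustics where
  lam := transportSpeed a b U
  lamt σ := dt (slab a b T σ) (transportSpeed a b U σ)
  lamr σ := dr (slab a b T σ) (transportSpeed a b U σ)
  kap := straightSpeed γ a b U
  kapt σ := dt (slab a b T σ) (straightSpeed γ a b U σ)
  kapr σ := dr (slab a b T σ) (straightSpeed γ a b U σ)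
  th σ p := logImpedance γ (U σ p 0)
  tht σ := dt (slab a b T σ) fun p => logImpedance γ (U σ p 0)
  thr σ := dr (slab a b T σ) fun p => logImpedance γ (U σ p 0)

section Gradient

variable {a b T : ℝ} {U : Field}

theorem dr_eq_grad (g : Field) (σ : Side) (p : ℝ × ℝ) (h : straightenR a b U p.1 ≠ 0) (i : Fin 3) :
    dr (slab a b T σ) (g σ) p i = straightenR a b U p.1 * (grad a b T U g σ p).2 i := by
  simp only [grad, Pi.smul_apply, smul_eq_mul]
  field_simp

/-- The derivative along λ is the material derivative in the original variables, with coefficients 1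
and u. It is bounded by the gradient even though λ and Φ_t separately may grow with r. -/
theorem along_eq_grad (g : Field) (σ : Side) (p : ℝ × ℝ) (i : Fin 3) :
    dt (slab a b T σ) (g σ) p i + transportSpeed a b U σ p * dr (slab a b T σ) (g σ) p i =
      (grad a b T U g σ p).1 i + U σ p 1 * (grad a b T U g σ p).2 i := by
  simp only [grad, Pi.smul_apply, smul_eq_mul, Pi.sub_apply, transportSpeed,
    div_eq_mul_inv]
  ring

theorem grad_fst_abs_le (g : Field) (σ : Side) (p : ℝ × ℝ) (i : Fin 3) :
    |(grad a b T U g σ p).1 i| ≤ ‖grad a b T U g σ p‖ :=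
  (norm_le_pi_norm (grad a b T U g σ p).1 i).trans (norm_fst_le _)

theorem grad_snd_abs_le (g : Field) (σ : Side) (p : ℝ × ℝ) (i : Fin 3) :
    |(grad a b T U g σ p).2 i| ≤ ‖grad a b T U g σ p‖ :=
  (norm_le_pi_norm (grad a b T U g σ p).2 i).trans (norm_snd_le _)

end Gradient

namespace IsBackground

variable {γ a b T T₀ K δ N : ℝ} {U : Field}

section

variable (hab : a < b) (hT : 0 < T) (hU : IsBackground a b T U K δ)
include hab hT hU

theorem hasPartials (σ : Side) (i : Fin 3) :
    HasPartials (slab a b T σ) (fun p => U σ p i) (fun p => dt (slab a b T σ) (U σ) p i)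
      (fun p => dr (slab a b T σ) (U σ) p i) :=
  hasPartials_apply hab hT (hU.boundedC1.contDiffOn σ) i

theorem continuousOn_trace : ContinuousOn (fun s => U .minus (s, b) 1) (Icc 0 T) :=
  fun _ hs => ((hU.hasPartials hab hT .minus 1).hasDerivWithinAt_fst
    (fun _ h => front_mem_slab hab h .minus) hs).continuousWithinAt

theorem hasPartials_straightenR (σ : Side) :
    HasPartials (slab a b T σ) (fun p => straightenR a b U p.1)
      (fun p => U .minus (p.1, b) 1 / (b - a)) (fun _ => 0) := by
  refine HasPartials.of_fst (k := straightenR a b U) (k' := fun t => U .minus (t, b) 1 / (b - a))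
    (I := Icc 0 T) (fun p hp => hp.1) (fun t ht => ?_)
    ((hU.continuousOn_trace hab hT).div_const _)
  have h := (hasDerivWithinAt_straighten_t a b T U (hU.continuousOn_trace hab hT) t (a + 1) ht
    ).sub_const a
  simp only [straighten, straightenT, add_sub_cancel_left, mul_one] at h
  exact h

theorem hasPartials_straightenT (σ : Side) :
    HasPartials (slab a b T σ) (fun p => straightenT a b U p.1 p.2)
      (fun p => dt (slab a b T .minus) (U .minus) (p.1, b) 1 * ((b - a)⁻¹ * (p.2 - a)))
      (fun p => U .minus (p.1, b) 1 / (b - a)) := by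
  have h1 : HasPartials (slab a b T σ) (fun p => U .minus (p.1, b) 1)
      (fun p => dt (slab a b T .minus) (U .minus) (p.1, b) 1) (fun _ => 0) :=
    HasPartials.of_fst (k := fun t => U .minus (t, b) 1)
      (k' := fun t => dt (slab a b T .minus) (U .minus) (t, b) 1) (I := Icc 0 T)
      (fun p hp => hp.1)
      (fun t ht => (hU.hasPartials hab hT .minus 1).hasDerivWithinAt_fst
        (fun _ h => front_mem_slab hab h .minus) ht)
      ((hU.hasPartials hab hT .minus 1).continuousOn_dt.comp (by fun_prop)
        fun _ h => front_mem_slab hab h .minus)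
  exact (h1.mul ((HasPartials.const (b - a)⁻¹).mul (HasPartials.snd.sub (.const a)))).congr
    (fun p _ => by rw [straightenT]; ring) (fun p _ => by ring) (fun p _ => by ring)

omit hT in
theorem straightenR_ge {t : ℝ} (ht : t ∈ Icc 0 T) : δ / (b - a) ≤ straightenR a b U t := by
  have := sub_pos.2 hab
  have := hU.front_away t ht
  unfold straightenR
  gcongr
  linarith

omit hab hT in
theorem abs_apply_le {σ : Side} {p : ℝ × ℝ} (hp : p ∈ slab a b T σ) (i : Fin 3) : |U σ p i| ≤ K :=
  (norm_le_pi_norm (U σ p) i).trans (hU.boundedC1.bound σ p hp)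

theorem bound_nonneg : 0 ≤ K :=
  (abs_nonneg _).trans (hU.abs_apply_le (front_mem_slab hab ⟨le_rfl, hT.le⟩ .minus) 0)

theorem straightenR_le (hT₀ : T ≤ T₀) {t : ℝ} (ht : t ∈ Icc 0 T) :
    straightenR a b U t ≤ (b - a + T₀ * K) / (b - a) := by
  have h0 := sub_pos.2 hab
  have hK := hU.bound_nonneg hab hT
  have h1 : ‖∫ s in (0 : ℝ)..t, U .minus (s, b) 1‖ ≤ K * |t - 0| :=
    intervalIntegral.norm_integral_le_of_norm_le_const fun s hs => by
      rw [uIoc_of_le ht.1] at hs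
      exact hU.abs_apply_le (front_mem_slab hab ⟨hs.1.le, hs.2.trans ht.2⟩ .minus) 1
  rw [sub_zero, abs_of_nonneg ht.1, Real.norm_eq_abs] at h1
  have h2 : K * t ≤ T₀ * K := by nlinarith [ht.2]
  unfold straightenR front
  gcongr
  linarith [le_abs_self (∫ s in (0 : ℝ)..t, U .minus (s, b) 1)]

variable (hδ : 0 < δ)
include hδ

omit hT in
theorem straightenR_pos {t : ℝ} (ht : t ∈ Icc 0 T) : 0 < straightenR a b U t :=
  (div_pos hδ (sub_pos.2 hab)).trans_le (hU.straightenR_ge hab ht)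

omit hab hT hδ in
theorem density_mem {σ : Side} {p : ℝ × ℝ} (hp : p ∈ slab a b T σ) : U σ p 0 ∈ Icc δ K :=
  ⟨hU.density σ p hp, (le_abs_self _).trans (hU.abs_apply_le hp 0)⟩

omit hab hT in
theorem density_pos {σ : Side} {p : ℝ × ℝ} (hp : p ∈ slab a b T σ) : 0 < U σ p 0 :=
  hδ.trans_le (hU.density σ p hp)

theorem hasPartials_straightenR_inv (σ : Side) :
    HasPartials (slab a b T σ) (fun p => (straightenR a b U p.1)⁻¹)
      (fun p => -(straightenR a b U p.1 ^ 2)⁻¹ * (U .minus (p.1, b) 1 / (b - a))) (fun _ => 0) :=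
  ((hU.hasPartials_straightenR hab hT σ).inv
    fun p hp => (hU.straightenR_pos hab hδ hp.1).ne').congr (fun _ _ => rfl)
    (fun _ _ => rfl) fun _ _ => by ring

theorem hasPartials_transportSpeed (σ : Side) :
    HasPartials (slab a b T σ) (transportSpeed a b U σ)
      (dt (slab a b T σ) (transportSpeed a b U σ))
      (fun p => (dr (slab a b T σ) (U σ) p 1 - U .minus (p.1, b) 1 / (b - a)) *
        (straightenR a b U p.1)⁻¹) := by
  have h := ((hU.hasPartials hab hT σ 1).sub (hU.hasPartials_straightenT hab hT σ)).mul
    (hU.hasPartials_straightenR_inv hab hT hδ σ)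
  exact h.congr (fun _ _ => rfl) (fun p hp => h.dt_eq (uniqueDiffOn_slab hab hT σ) hp)
    fun _ _ => by ring

theorem hasPartials_density_comp (σ : Side) {k k' : ℝ → ℝ}
    (hk : ∀ x, 0 < x → HasDerivAt k (k' x) x) (hk' : ContinuousOn k' (Ioi 0)) :
    HasPartials (slab a b T σ) (fun p => k (U σ p 0))
      (fun p => k' (U σ p 0) * dt (slab a b T σ) (U σ) p 0)
      (fun p => k' (U σ p 0) * dr (slab a b T σ) (U σ) p 0) :=
  (hU.hasPartials hab hT σ 0).comp (I := Ioi 0) (fun _ hp => hU.density_pos hδ hp)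
    (fun x hx => hk x hx) hk'

theorem hasPartials_soundSpeed (hγ : 0 < γ) (σ : Side) :
    HasPartials (slab a b T σ) (fun p => soundSpeed γ (U σ p 0))
      (fun p => (γ - 1) / 2 * U σ p 0 ^ ((γ - 1) / 2 - 1) * dt (slab a b T σ) (U σ) p 0)
      (fun p => (γ - 1) / 2 * U σ p 0 ^ ((γ - 1) / 2 - 1) * dr (slab a b T σ) (U σ) p 0) :=
  hU.hasPartials_density_comp hab hT hδ σ (fun _ hx => hasDerivAt_soundSpeed hγ hx)
    (continuousOn_const.mul (continuousOn_rpow_const_Ioi _))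

theorem hasPartials_straightSpeed (hγ : 0 < γ) (σ : Side) :
    HasPartials (slab a b T σ) (straightSpeed γ a b U σ)
      (fun p => (γ - 1) / 2 * U σ p 0 ^ ((γ - 1) / 2 - 1) * dt (slab a b T σ) (U σ) p 0 *
        (straightenR a b U p.1)⁻¹ - soundSpeed γ (U σ p 0) * ((straightenR a b U p.1)⁻¹ *
          (straightenR a b U p.1)⁻¹ * (U .minus (p.1, b) 1 / (b - a))))
      (fun p => (γ - 1) / 2 * U σ p 0 ^ ((γ - 1) / 2 - 1) * dr (slab a b T σ) (U σ) p 0 *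
        (straightenR a b U p.1)⁻¹) :=
  ((hU.hasPartials_soundSpeed hab hT hδ hγ σ).mul (hU.hasPartials_straightenR_inv hab hT hδ σ)
    ).congr (fun _ _ => rfl) (fun _ _ => by ring) (fun _ _ => by ring)

theorem hasPartials_logImpedance (γ : ℝ) (σ : Side) :
    HasPartials (slab a b T σ) (fun p => logImpedance γ (U σ p 0))
      (fun p => (1 - (γ - 1) / 2) / 2 * (U σ p 0)⁻¹ * dt (slab a b T σ) (U σ) p 0)
      (fun p => (1 - (γ - 1) / 2) / 2 * (U σ p 0)⁻¹ * dr (slab a b T σ) (U σ) p 0) :=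
  hU.hasPartials_density_comp hab hT hδ σ (fun _ hx => hasDerivAt_logImpedance hx)
    (continuousOn_const.mul (continuousOn_id.inv₀ fun _ hx => ne_of_gt hx))

end

end IsBackground

end VortexSheet

/-! ### Bounds for the coefficients and for m -/

namespace VortexSheet
open Filter Topology MeasureTheory

theorem abs_mul_le_mul {x y A B : ℝ} (hx : |x| ≤ A) (hy : |y| ≤ B) : |x * y| ≤ A * B := by
  rw [abs_mul]
  exact mul_le_mul hx hy (abs_nonneg _) ((abs_nonneg _).trans hx)

theorem abs_sub_le_add {x y A B : ℝ} (hx : |x| ≤ A) (hy : |y| ≤ B) : |x - y| ≤ A + B :=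
  (abs_sub x y).trans (add_le_add hx hy)

theorem abs_add_le_add {x y A B : ℝ} (hx : |x| ≤ A) (hy : |y| ≤ B) : |x + y| ≤ A + B :=
  (abs_add_le x y).trans (add_le_add hx hy)

/-- The inverse of `R` is an affine function of `1 / ρ` and `1 / c`. -/
theorem exists_matRInv_apply_eq {γ : ℝ} (hγ : 0 < γ) (i k : Fin 3) :
    ∃ α β η : ℝ, |α| ≤ 1 / 2 ∧ |β| ≤ 1 / 2 ∧ ∀ V : State, 0 < V 0 →
      matRInv γ V i k = α * (V 0)⁻¹ + β * (soundSpeed γ (V 0))⁻¹ + η := by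
  have key : ∀ α β η : ℝ, |α| ≤ 1 / 2 → |β| ≤ 1 / 2 →
      (∀ V : State, 0 < V 0 → 0 < soundSpeed γ (V 0) →
        matRInv γ V i k = α * (V 0)⁻¹ + β * (soundSpeed γ (V 0))⁻¹ + η) →
      ∃ α β η : ℝ, |α| ≤ 1 / 2 ∧ |β| ≤ 1 / 2 ∧ ∀ V : State, 0 < V 0 →
        matRInv γ V i k = α * (V 0)⁻¹ + β * (soundSpeed γ (V 0))⁻¹ + η :=
    fun α β η h1 h2 h => ⟨α, β, η, h1, h2, fun V hV => h V hV (soundSpeed_pos hγ hV)⟩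
  have hp : |(1 / 2 : ℝ)| ≤ 1 / 2 := by norm_num
  have hn : |(-(1 / 2) : ℝ)| ≤ 1 / 2 := by norm_num
  have h0 : |(0 : ℝ)| ≤ 1 / 2 := by norm_num
  fin_cases i <;> fin_cases k
  · exact key (1 / 2) 0 0 hp h0 fun V h h' => by simp [matRInv]; field_simp
  · exact key 0 (-(1 / 2)) 0 h0 hn fun V h h' => by simp [matRInv]; field_simp
  · exact key 0 0 0 h0 h0 fun V h h' => by simp [matRInv]
  · exact key 0 0 0 h0 h0 fun V h h' => by simp [matRInv]
  · exact key 0 0 0 h0 h0 fun V h h' => by simp [matRInv]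
  · exact key 0 0 1 h0 h0 fun V h h' => by simp [matRInv]; field_simp
  · exact key (1 / 2) 0 0 hp h0 fun V h h' => by simp [matRInv]; field_simp
  · exact key 0 (1 / 2) 0 h0 hp fun V h h' => by simp [matRInv]; field_simp
  · exact key 0 0 0 h0 h0 fun V h h' => by simp [matRInv]

theorem matLambda_eq (γ a b : ℝ) (U : Field) (σ : Side) (p : ℝ × ℝ) :
    matLambda γ a b U σ p = Matrix.diagonal fun i => transportSpeed a b U σ p +
      ![-1, 0, 1] i * straightSpeed γ a b U σ p := by
  unfold matLambda
  congr 1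
  ext i
  fin_cases i <;> simp [transportSpeed, straightSpeed] <;> ring

theorem abs_matR_apply_le {γ K N : ℝ} {V : State} (h0 : |V 0| ≤ K) (h1 : |soundSpeed γ (V 0)| ≤ N)
    (i j : Fin 3) : |matR γ V i j| ≤ K + N + 1 := by
  have hK := (abs_nonneg _).trans h0
  have hN := (abs_nonneg _).trans h1
  fin_cases i <;> fin_cases j <;> simp [matR] <;> linarith

namespace IsBackground

variable {γ a b T T₀ K δ N : ℝ} {U : Field} (hab : a < b) (hT : 0 < T)
  (hU : IsBackground a b T U K δ) (hδ : 0 < δ)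
include hab hT hU hδ

omit hT in
theorem abs_straightenR_inv_le {t : ℝ} (ht : t ∈ Icc 0 T) :
    |(straightenR a b U t)⁻¹| ≤ (b - a) / δ := by
  have h1 := hU.straightenR_ge hab ht
  have h2 := div_pos hδ (sub_pos.2 hab)
  rw [abs_of_pos (inv_pos.2 (h2.trans_le h1)), ← inv_div]
  exact inv_anti₀ h2 h1

theorem abs_dr_le_grad (hT₀ : T ≤ T₀) (g : Field) {σ : Side} {p : ℝ × ℝ}
    (hp : p ∈ slab a b T σ) (i : Fin 3) :
    |dr (slab a b T σ) (g σ) p i| ≤ (b - a + T₀ * K) / (b - a) * ‖grad a b T U g σ p‖ := by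
  have h0 := hU.straightenR_pos hab hδ hp.1
  rw [dr_eq_grad g σ p h0.ne' i]
  exact abs_mul_le_mul (by rw [abs_of_pos h0]; exact hU.straightenR_le hab hT hT₀ hp.1)
    (grad_snd_abs_le g σ p i)

omit hab hT hδ in
theorem abs_along_le_grad (g : Field) {σ : Side} {p : ℝ × ℝ} (hp : p ∈ slab a b T σ) (i : Fin 3) :
    |dt (slab a b T σ) (g σ) p i + transportSpeed a b U σ p * dr (slab a b T σ) (g σ) p i| ≤
      (1 + K) * ‖grad a b T U g σ p‖ := by
  rw [along_eq_grad, add_mul, one_mul]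
  exact abs_add_le_add (grad_fst_abs_le g σ p i)
    (abs_mul_le_mul (hU.abs_apply_le hp 1) (grad_snd_abs_le g σ p i))

theorem abs_dr_le (hT₀ : T ≤ T₀) {σ : Side} {p : ℝ × ℝ} (hp : p ∈ slab a b T σ) (i : Fin 3) :
    |dr (slab a b T σ) (U σ) p i| ≤ (b - a + T₀ * K) / (b - a) * K := by
  have h0 := (hU.straightenR_pos hab hδ hp.1).trans_le (hU.straightenR_le hab hT hT₀ hp.1)
  exact (hU.abs_dr_le_grad hab hT hδ hT₀ U hp i).trans
    (mul_le_mul_of_nonneg_left (hU.boundedC1.grad_bound σ p hp) h0.le)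

omit hδ in
theorem abs_along_le {σ : Side} {p : ℝ × ℝ} (hp : p ∈ slab a b T σ) (i : Fin 3) :
    |dt (slab a b T σ) (U σ) p i + transportSpeed a b U σ p * dr (slab a b T σ) (U σ) p i| ≤
      (1 + K) * K :=
  (hU.abs_along_le_grad U hp i).trans (mul_le_mul_of_nonneg_left
    (hU.boundedC1.grad_bound σ p hp) (by linarith [hU.bound_nonneg hab hT]))

omit hT in
theorem abs_straightSpeed_le (hN : GasBound γ δ K N) {σ : Side} {p : ℝ × ℝ}
    (hp : p ∈ slab a b T σ) : |straightSpeed γ a b U σ p| ≤ N * ((b - a) / δ) :=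
  abs_mul_le_mul (hN.speed _ (hU.density_mem hp))
    (hU.abs_straightenR_inv_le hab hδ hp.1)

/-- Each row of ∂_t R⁻¹ + Λ∂_r R⁻¹ is a derivative along λ plus 0 or ±κ times a radial derivative.
As R⁻¹ depends only on the density, both are controlled by the gradient of the background. -/
theorem abs_matM_le (hγ : 0 < γ) (hT₀ : T ≤ T₀) (hN : GasBound γ δ K N) {σ : Side} {p : ℝ × ℝ}
    (hp : p ∈ slab a b T σ) (i j : Fin 3) :
    |matM γ a b T U σ p i j| ≤ 3 * ((N * ((1 + K) * K) + N * ((b - a) / δ) *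
      (N * ((b - a + T₀ * K) / (b - a) * K))) * (K + N + 1)) := by
  have hS := uniqueDiffOn_slab hab hT σ
  set G := N * ((1 + K) * K) + N * ((b - a) / δ) * (N * ((b - a + T₀ * K) / (b - a) * K)) with hG
  have hterm : ∀ k, |dt (slab a b T σ) (fun q => matRInv γ (U σ q) i k) p +
      (transportSpeed a b U σ p + ![-1, 0, 1] i * straightSpeed γ a b U σ p) *
        dr (slab a b T σ) (fun q => matRInv γ (U σ q) i k) p| ≤ G := by
    intro k
    obtain ⟨α, β, η, hα, hβ, h⟩ := exists_matRInv_apply_eq hγ i k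
    have hd := (hU.hasPartials_density_comp hab hT hδ σ
      (k := fun x => α * x⁻¹ + β * (soundSpeed γ x)⁻¹ + η)
      (k' := fun x => α * -(x ^ 2)⁻¹ +
        β * (-((γ - 1) / 2) * x ^ (-((γ - 1) / 2) - 1)))
      (fun x hx => (((hasDerivAt_inv hx.ne').const_mul α).add
        ((hasDerivAt_soundSpeed_inv hγ hx).const_mul β)).add_const η)
      ((continuousOn_const.mul ((continuousOn_id.pow 2).inv₀
        fun _ hx => pow_ne_zero 2 (ne_of_gt hx)).neg).add
        (continuousOn_const.mul (continuousOn_const.mul (continuousOn_rpow_const_Ioi _))))).congr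
      (g' := fun q => matRInv γ (U σ q) i k) (fun q hq => h _ (hU.density_pos hδ hq))
      (fun _ _ => rfl) fun _ _ => rfl
    rw [hd.dt_eq hS hp, hd.dr_eq hS hp]
    have hρ := hU.density_mem hp
    have hk : |α * -(U σ p 0 ^ 2)⁻¹ +
        β * (-((γ - 1) / 2) * U σ p 0 ^ (-((γ - 1) / 2) - 1))| ≤ N :=
      (abs_add_le_add (abs_mul_le_mul hα (hN.inv_deriv _ hρ))
        (abs_mul_le_mul hβ (hN.speed_inv_deriv _ hρ))).trans (by linarith)
    have he : |(![-1, 0, 1] i : ℝ)| ≤ 1 := by fin_cases i <;> simp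
    have h1 := abs_mul_le_mul hk (hU.abs_along_le hab hT hp 0)
    have h2 := abs_mul_le_mul (abs_mul_le_mul he (hU.abs_straightSpeed_le hab hδ hN hp))
      (abs_mul_le_mul hk (hU.abs_dr_le hab hT hδ hT₀ hp 0))
    have h3 := abs_add_le_add h1 h2
    rw [one_mul] at h3
    refine le_of_eq_of_le (congrArg _ ?_) h3
    ring
  have hR := abs_matR_apply_le (hU.abs_apply_le hp 0)
    (hN.speed _ (hU.density_mem hp))
  have hM : matM γ a b T U σ p i j =
      ∑ k, (dt (slab a b T σ) (fun q => matRInv γ (U σ q) i k) p +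
      (transportSpeed a b U σ p + ![-1, 0, 1] i * straightSpeed γ a b U σ p) *
        dr (slab a b T σ) (fun q => matRInv γ (U σ q) i k) p) * matR γ (U σ p) k j := by
    rw [matM, matLambda_eq, Matrix.mul_apply]
    refine Finset.sum_congr rfl fun k _ => ?_
    rw [Matrix.add_apply, Matrix.diagonal_mul, Matrix.of_apply, Matrix.of_apply]
  rw [hM, Fin.sum_univ_three]
  have := abs_add_le_add (abs_add_le_add (abs_mul_le_mul (hterm 0) (hR 0 j))
    (abs_mul_le_mul (hterm 1) (hR 1 j))) (abs_mul_le_mul (hterm 2) (hR 2 j))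
  linarith

end IsBackground

/-- The lower bounds on density and front position and the gradient bound make all coefficients
uniformly controlled, before any particular T or U is chosen. -/
theorem exists_isAdmissible {γ a b T₀ K δ : ℝ} (hγ : 0 < γ) (hab : a < b) (hT₀ : 0 < T₀)
    (hK : 0 ≤ K) (hδ : 0 < δ) : ∃ C M : ℝ, 0 ≤ C ∧ 0 < M ∧ ∀ {T : ℝ} {U : Field}, 0 < T → T ≤ T₀ →
      IsBackground a b T U K δ → (acoustics γ a b T U).IsAdmissible a b T C ∧
      ∀ σ, ∀ p ∈ slab a b T σ, ∀ i j, |matM γ a b T U σ p i j| ≤ M := by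
  obtain ⟨N, hN⟩ := exists_gasBound K hγ hδ
  have hN0 := hN.nonneg
  have hba := sub_pos.2 hab
  -- `Q` bounds 1/Φ_r, `P` bounds Φ_r and `W` bounds the mixed derivative Φ_{tr}. Each c below
  -- bounds one coefficient, and C is the sum of all of them.
  set Q := (b - a) / δ with hQ
  set P := (b - a + T₀ * K) / (b - a) with hP
  set W := K / (b - a) with hW
  have hQ0 : 0 ≤ Q := by positivity
  have hP0 : 0 ≤ P := by positivity
  have hW0 : 0 ≤ W := by positivity
  set M₀ := 3 * ((N * ((1 + K) * K) + N * Q * (N * (P * K))) * (K + N + 1)) with hM₀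
  have hM0 : 0 ≤ M₀ := by positivity
  set c1 := N * Q
  set c2 := P * N
  set c3 := N * ((1 + K) * K) * Q + N * (Q * Q * W) with hc3
  set c4 := (b - a)⁻¹ with hc4
  set c5 := (P * K + W) * Q
  set c6 := N * (P * K) * Q
  set c7 := N * (P * K)
  set c8 := N * ((1 + K) * K)
  have p1 : 0 ≤ c1 := by positivity
  have p2 : 0 ≤ c2 := by positivity
  have p3 : 0 ≤ c3 := by positivity
  have p4 : 0 ≤ c4 := by positivity
  have p5 : 0 ≤ c5 := by positivity
  have p6 : 0 ≤ c6 := by positivity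
  have p7 : 0 ≤ c7 := by positivity
  have p8 : 0 ≤ c8 := by positivity
  obtain ⟨C, hC⟩ : ∃ C, C = N + (b - a) + c1 + c2 + c3 + c4 + c5 + c6 + c7 + c8 := ⟨_, rfl⟩
  have hC0 : 0 ≤ C := by linarith
  -- The summand 1 only makes M strictly positive.
  refine ⟨C, M₀ + 1, hC0, by linarith, fun {T U} hT hTT hU =>
    ⟨?_, fun σ p hp i j => (hU.abs_matM_le hab hT hδ hγ hTT hN hp i j).trans (by linarith)⟩⟩
  have hS := uniqueDiffOn_slab hab hT
  have hlam := hU.hasPartials_transportSpeed hab hT hδ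
  have hkap := hU.hasPartials_straightSpeed hab hT hδ hγ
  have hth := hU.hasPartials_logImpedance hab hT hδ γ
  have hmem : ∀ {σ p}, p ∈ slab a b T σ → U σ p 0 ∈ Icc δ K :=
    fun hp => hU.density_mem hp
  have hinv : ∀ {σ p}, p ∈ slab a b T σ → |(straightenR a b U p.1)⁻¹| ≤ Q :=
    fun hp => hU.abs_straightenR_inv_le hab hδ hp.1
  have hdr : ∀ {σ p}, p ∈ slab a b T σ → ∀ i, |dr (slab a b T σ) (U σ) p i| ≤ P * K :=
    fun hp i => hU.abs_dr_le hab hT hδ hTT hp i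
  have htr : ∀ {σ p}, p ∈ slab a b T σ → |U .minus (p.1, b) 1 / (b - a)| ≤ W := by
    intro σ p hp
    rw [abs_div, abs_of_pos hba]
    exact div_le_div_of_nonneg_right
      (hU.abs_apply_le (front_mem_slab hab hp.1 .minus) 1) hba.le
  exact {
    lt := hab
    pos := hT
    lam := fun σ => (hlam σ).dt_dr (hS σ)
    kap := fun σ => (hkap σ).dt_dr (hS σ)
    th := fun σ => (hth σ).dt_dr (hS σ)
    lam_front := fun σ t ht => by
      have h : U σ (t, b) 1 = U .minus (t, b) 1 := by
        cases σ
        · rfl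
        · exact hU.sheet_velocity t ht
      show transportSpeed a b U σ (t, b) = 0
      rw [transportSpeed, straightenT, h, div_mul_cancel₀ _ hba.ne', sub_self, zero_mul]
    lam_wall := fun t ht => by
      show transportSpeed a b U .minus (t, a) = 0
      simp [transportSpeed, straightenT, hU.wall t ht]
    kap_pos := fun σ p hp => mul_pos (soundSpeed_pos hγ (hU.density_pos hδ hp))
      (inv_pos.2 (hU.straightenR_pos hab hδ hp.1))
    kap_front := fun t ht => by
      show straightSpeed γ a b U .plus (t, b) = straightSpeed γ a b U .minus (t, b)
      simp only [straightSpeed, hU.sheet_density t ht]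
    th_front := fun t ht => by
      show logImpedance γ _ = logImpedance γ _
      rw [hU.sheet_density t ht]
    kap_bound := fun σ p hp => (hU.abs_straightSpeed_le hab hδ hN hp).trans (by
      show c1 ≤ C
      linarith)
    kap_lower := fun σ p hp => by
      have h1 := soundSpeed_pos hγ (hU.density_pos hδ hp)
      have h2 := hU.straightenR_pos hab hδ hp.1
      have h3 : straightenR a b U p.1 * (soundSpeed γ (U σ p 0))⁻¹ ≤ P * N :=
        mul_le_mul (hU.straightenR_le hab hT hTT hp.1)
          ((le_abs_self _).trans (hN.speed_inv _ (hmem hp))) (by positivity) hP0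
      have h4 : P * N ≤ C := by
        show c2 ≤ C
        linarith
      have h5 : 0 < straightSpeed γ a b U σ p := mul_pos h1 (inv_pos.2 h2)
      show 1 ≤ C * straightSpeed γ a b U σ p
      calc (1 : ℝ) = straightenR a b U p.1 * (soundSpeed γ (U σ p 0))⁻¹ *
            straightSpeed γ a b U σ p := by rw [straightSpeed]; field_simp
        _ ≤ C * straightSpeed γ a b U σ p :=
          mul_le_mul_of_nonneg_right (h3.trans h4) h5.le
    kap_along := fun σ p hp => by
      show |dt (slab a b T σ) (straightSpeed γ a b U σ) p + transportSpeed a b U σ p *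
        dr (slab a b T σ) (straightSpeed γ a b U σ) p| ≤ C
      rw [(hkap σ).dt_eq (hS σ) hp, (hkap σ).dr_eq (hS σ) hp]
      have h := abs_sub_le_add (abs_mul_le_mul (abs_mul_le_mul (hN.speed_deriv _ (hmem hp))
        (hU.abs_along_le hab hT hp 0)) (hinv hp)) (abs_mul_le_mul (hN.speed _ (hmem hp))
          (abs_mul_le_mul (abs_mul_le_mul (hinv hp) (hinv hp)) (htr hp)))
      refine le_of_eq_of_le (congrArg _ ?_) (h.trans (?_ : c3 ≤ C))
      · ring
      · linarith
    width_lower := by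
      have : c4 * (b - a) = 1 := inv_mul_cancel₀ hba.ne'
      nlinarith
    lamr_bound := fun σ p hp => by
      show |dr (slab a b T σ) (transportSpeed a b U σ) p| ≤ C
      rw [(hlam σ).dr_eq (hS σ) hp]
      refine (abs_mul_le_mul (abs_sub_le_add (hdr hp 1) (htr hp)) (hinv hp)).trans (?_ : c5 ≤ C)
      linarith
    kapr_bound := fun σ p hp => by
      show |dr (slab a b T σ) (straightSpeed γ a b U σ) p| ≤ C
      rw [(hkap σ).dr_eq (hS σ) hp]
      refine (abs_mul_le_mul (abs_mul_le_mul (hN.speed_deriv _ (hmem hp)) (hdr hp 0))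
        (hinv hp)).trans (?_ : c6 ≤ C)
      linarith
    th_bound := fun σ p hp => (hN.impedance _ (hmem hp)).trans (by linarith)
    thr_bound := fun σ p hp => by
      show |dr (slab a b T σ) (fun p => logImpedance γ (U σ p 0)) p| ≤ C
      rw [(hth σ).dr_eq (hS σ) hp]
      refine (abs_mul_le_mul (hN.impedance_deriv _ (hmem hp)) (hdr hp 0)).trans (?_ : c7 ≤ C)
      linarith
    along_bound := fun σ p hp => by
      show |dt (slab a b T σ) (fun p => logImpedance γ (U σ p 0)) p + transportSpeed a b U σ p *
        dr (slab a b T σ) (fun p => logImpedance γ (U σ p 0)) p| ≤ C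
      rw [(hth σ).dt_eq (hS σ) hp, (hth σ).dr_eq (hS σ) hp]
      have h := abs_mul_le_mul (hN.impedance_deriv _ (hmem hp)) (hU.abs_along_le hab hT hp 0)
      refine le_of_eq_of_le (congrArg _ ?_) (h.trans (?_ : c8 ≤ C))
      · ring
      · linarith }

end VortexSheet

/-! ### Reduction of the linearized problem and the supremum estimate -/

namespace VortexSheet
open Filter Topology MeasureTheory

namespace IsBackground

variable {γ a b T T₀ K δ C : ℝ} {U : Field} (hab : a < b) (hT : 0 < T)
  (hU : IsBackground a b T U K δ) (hδ : 0 < δ)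
include hab hT hU hδ

omit hT in
/-- The acoustic form of the first component of `B(U, φ) v`. -/
theorem matB_mulVec_fst (hγ : 0 < γ) {σ : Side} {p : ℝ × ℝ} (hp : p ∈ slab a b T σ) (v : State) :
    (matB γ a b U σ p).mulVec v 0 = (acoustics γ a b T U).lam σ p * v 0 +
      (acoustics γ a b T U).kap σ p * Real.exp ((acoustics γ a b T U).th σ p) ^ 2 * v 1 := by
  have h := soundSpeed_pos hγ (hU.density_pos hδ hp)
  have h' := hU.straightenR_pos hab hδ hp.1
  simp only [acoustics, exp_logImpedance_sq hγ (hU.density_pos hδ hp), transportSpeed,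
    straightSpeed]
  simp [matB, Matrix.mulVec, dotProduct, Fin.sum_univ_three]
  field_simp

omit hT in
/-- The acoustic form of the second component of `B(U, φ) v`. -/
theorem matB_mulVec_snd (hγ : 0 < γ) {σ : Side} {p : ℝ × ℝ} (hp : p ∈ slab a b T σ) (v : State) :
    (matB γ a b U σ p).mulVec v 1 = (acoustics γ a b T U).lam σ p * v 1 +
      (acoustics γ a b T U).kap σ p * Real.exp (-(acoustics γ a b T U).th σ p) ^ 2 * v 0 := by
  have h := soundSpeed_pos hγ (hU.density_pos hδ hp)
  have h' := hU.straightenR_pos hab hδ hp.1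
  simp only [acoustics, exp_neg_logImpedance_sq hγ (hU.density_pos hδ hp), transportSpeed,
    straightSpeed]
  simp [matB, Matrix.mulVec, dotProduct, Fin.sum_univ_three]
  field_simp
  ring

omit hab hT hδ hU in
/-- The third component of `B(U, φ) v`. -/
theorem matB_mulVec_trd (σ : Side) (p : ℝ × ℝ) (v : State) :
    (matB γ a b U σ p).mulVec v 2 = (acoustics γ a b T U).lam σ p * v 2 := by
  simp [acoustics, transportSpeed, matB, Matrix.mulVec, dotProduct, Fin.sum_univ_three]
  exact Or.inl (mul_comm _ _)

theorem continuousOn_grad {g : Field} {σ : Side} (hg : ContDiffOn ℝ 1 (g σ) (slab a b T σ)) :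
    ContinuousOn (grad a b T U g σ) (slab a b T σ) := by
  have h1 : ContinuousOn (fun p => dt (slab a b T σ) (g σ) p) (slab a b T σ) :=
    continuousOn_pi.2 fun i => (hasPartials_apply hab hT hg i).continuousOn_dt
  have h2 : ContinuousOn (fun p => dr (slab a b T σ) (g σ) p) (slab a b T σ) :=
    continuousOn_pi.2 fun i => (hasPartials_apply hab hT hg i).continuousOn_dr
  have h3 := (hU.hasPartials_straightenR hab hT σ).continuousOn
  have h4 := (hU.hasPartials_straightenT hab hT σ).continuousOn
  have h5 : ∀ p ∈ slab a b T σ, straightenR a b U p.1 ≠ 0 :=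
    fun p hp => (hU.straightenR_pos hab hδ hp.1).ne'
  exact (h1.sub ((h4.div h3 h5).smul h2)).prodMk ((continuousOn_const.div h3 h5).smul h2)

end IsBackground

section Solution

variable {γ a b T T₀ K δ C L : ℝ} {U f w : Field} {w₀ : InitialField}

namespace IsSolution

theorem isAcousticSolution (hγ : 0 < γ) (hab : a < b) (hT : 0 < T) (hU : IsBackground a b T U K δ)
    (hδ : 0 < δ) (hw : IsSolution γ a b T U f w₀ w) :
    IsAcousticSolution (acoustics γ a b T U) a b T (fun σ p => f σ p 0) (fun σ p => f σ p 1)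
      (fun σ r => w₀ σ r 0) (fun σ r => w₀ σ r 1) (fun σ p => w σ p 0)
      (fun σ p => dt (slab a b T σ) (w σ) p 0) (fun σ p => dr (slab a b T σ) (w σ) p 0)
      (fun σ p => w σ p 1) (fun σ p => dt (slab a b T σ) (w σ) p 1)
      (fun σ p => dr (slab a b T σ) (w σ) p 1) where
  fst σ := hasPartials_apply hab hT (hw.contDiffOn σ) 0
  snd σ := hasPartials_apply hab hT (hw.contDiffOn σ) 1
  equation_fst σ p hp := by
    have h := congrFun (hw.equation σ p hp) 0
    rw [Pi.add_apply, hU.matB_mulVec_fst hab hδ hγ hp, ← add_assoc] at h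
    exact h
  equation_snd σ p hp := by
    have h := congrFun (hw.equation σ p hp) 1
    rw [Pi.add_apply, hU.matB_mulVec_snd hab hδ hγ hp, ← add_assoc] at h
    exact h
  front_fst t ht := (hw.boundary t ht).sheet_fst
  front_snd t ht := (hw.boundary t ht).sheet_snd
  wall t ht := (hw.boundary t ht).wall
  initial_fst σ r hr := congrFun (hw.initial σ r hr) 0
  initial_snd σ r hr := congrFun (hw.initial σ r hr) 1

theorem transport (hw : IsSolution γ a b T U f w₀ w) {σ : Side} {p : ℝ × ℝ}
    (hp : p ∈ slab a b T σ) :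
    dt (slab a b T σ) (w σ) p 2 + (acoustics γ a b T U).lam σ p * dr (slab a b T σ) (w σ) p 2 =
      f σ p 2 := by
  have h := congrFun (hw.equation σ p hp) 2
  rwa [Pi.add_apply, IsBackground.matB_mulVec_trd (T := T)] at h

/-- The difference of two solutions solves the homogeneous problem. -/
theorem sub (hab : a < b) (hT : 0 < T) (hw : IsSolution γ a b T U f w₀ w) {w' : Field}
    (hw' : IsSolution γ a b T U f w₀ w') :
    IsSolution γ a b T U (fun _ _ => 0) (fun _ _ => 0) (fun σ p => w' σ p - w σ p) where
  contDiffOn σ := (hw'.contDiffOn σ).sub (hw.contDiffOn σ)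
  equation σ p hp := by
    have hu := uniqueDiffOn_slab hab hT σ p hp
    have h1 := ((hw'.contDiffOn σ).differentiableOn (by norm_num)) p hp
    have h2 := ((hw.contDiffOn σ).differentiableOn (by norm_num)) p hp
    have e1 := hw.equation σ p hp
    have e2 := hw'.equation σ p hp
    simp only [dt, dr] at e1 e2 ⊢
    rw [fderivWithin_fun_sub hu h1 h2, sub_apply,
      sub_apply, Matrix.mulVec_sub, ← sub_self (f σ p)]
    nth_rewrite 1 [← e2]
    rw [← e1]
    abel
  boundary t ht :=
    ⟨by simp [(hw.boundary t ht).sheet_fst, (hw'.boundary t ht).sheet_fst],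
      by simp [(hw.boundary t ht).sheet_snd, (hw'.boundary t ht).sheet_snd],
      by simp [(hw.boundary t ht).wall, (hw'.boundary t ht).wall]⟩
  initial σ r hr := by rw [hw.initial σ r hr, hw'.initial σ r hr, sub_self]

/-- The a priori estimate in the supremum norm. -/
theorem norm_le (hγ : 0 < γ) (hab : a < b) (hT : 0 < T) (hTT : T ≤ T₀)
    (hU : IsBackground a b T U K δ) (hδ : 0 < δ)
    (A : (acoustics γ a b T U).IsAdmissible a b T C) (hw : IsSolution γ a b T U f w₀ w)
    (hf : ∀ σ, ContinuousOn (f σ) (slab a b T σ)) (hfb : ∀ σ, ∀ p ∈ slab a b T σ, ‖f σ p‖ ≤ L)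
    (hw₀ : ∀ σ, ∀ r ∈ σ.interval a b, ‖w₀ σ r‖ ≤ L) {t : ℝ} (ht : t ∈ Icc 0 T) {σ : Side} {r : ℝ}
    (hr : r ∈ σ.interval a b) :
    ‖w σ (t, r)‖ ≤ (1 + 2 * Real.exp C * (2 * Real.exp C * Real.exp (4 * (C + C * C) * T₀))) *
      (supNorm a b w₀ + ∫ s in (0 : ℝ)..t, supNorm a b fun σ r => f σ (s, r)) := by
  have hC := A.nonneg
  set φ : ℝ → ℝ := fun s => supNorm a b fun σ r => f σ (s, r) with hφdef
  have hφ : IntervalIntegrable φ volume 0 t := intervalIntegrable_supNorm hT.le hf hfb ht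
  have hφ0 : 0 ≤ ∫ s in (0 : ℝ)..t, φ s :=
    intervalIntegral.integral_nonneg ht.1 fun s _ => supNorm_nonneg _
  have h0 : 0 ≤ supNorm a b w₀ := supNorm_nonneg _
  have hfφ : ∀ i, ∀ σ, ∀ s ∈ Icc 0 t, ∀ r ∈ σ.interval a b, |f σ (s, r) i| ≤ φ s :=
    fun i σ s hs r hr => (norm_le_pi_norm (f σ (s, r)) i).trans
      (norm_le_supNorm (fun σ r hr => hfb σ (s, r) ⟨⟨hs.1, hs.2.trans ht.2⟩, hr⟩) hr)
  have hw₀i : ∀ i, ∀ σ, ∀ r ∈ σ.interval a b, |w₀ σ r i| ≤ supNorm a b w₀ :=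
    fun i σ r hr => (norm_le_pi_norm (w₀ σ r) i).trans (norm_le_supNorm hw₀ hr)
  have hac := (hw.isAcousticSolution hγ hab hT hU hδ).abs_le (A := A)
    (fun σ => (continuous_apply 0).comp_continuousOn (hf σ))
    (fun σ => (continuous_apply 1).comp_continuousOn (hf σ))
    (fun σ p hp => (norm_le_pi_norm (f σ p) 0).trans (hfb σ p hp))
    (fun σ p hp => (norm_le_pi_norm (f σ p) 1).trans (hfb σ p hp)) (hw₀i 0) (hw₀i 1) ht hφ
    (hfφ 0) (hfφ 1) hr
  have htr := A.abs_le_of_transport (hasPartials_apply hab hT (hw.contDiffOn σ) 2)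
    (fun p hp => hw.transport hp)
    (fun r hr => by rw [hw.initial σ r hr]; exact hw₀i 2 σ r hr) ht hφ (hfφ 2 σ) hr
  set E := supNorm a b w₀ + ∫ s in (0 : ℝ)..t, φ s with hE
  have hE0 : 0 ≤ E := add_nonneg h0 hφ0
  have hexp : Real.exp (4 * (C + C * C) * t) ≤ Real.exp (4 * (C + C * C) * T₀) :=
    Real.exp_le_exp.2 (mul_le_mul_of_nonneg_left (ht.2.trans hTT) (by positivity))
  have hmul : 2 * Real.exp C * (2 * (Real.exp C * E) * Real.exp (4 * (C + C * C) * t)) ≤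
      (1 + 2 * Real.exp C * (2 * Real.exp C * Real.exp (4 * (C + C * C) * T₀))) * E := by
    have h1 : 2 * Real.exp C * (2 * (Real.exp C * E) * Real.exp (4 * (C + C * C) * t)) ≤
      2 * Real.exp C * (2 * (Real.exp C * E) * Real.exp (4 * (C + C * C) * T₀)) := by gcongr
    nlinarith
  -- The summand 1 in the constant serves the third component, which is transported without
  -- amplification.
  have hone : E ≤ (1 + 2 * Real.exp C * (2 * Real.exp C * Real.exp (4 * (C + C * C) * T₀))) * E :=
    le_mul_of_one_le_left hE0 (le_add_of_nonneg_right (by positivity))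
  refine (pi_norm_le_iff_of_nonneg (by positivity)).2 fun i => ?_
  fin_cases i
  · exact hac.1.trans hmul
  · exact hac.2.trans hmul
  · exact htr.trans hone

end IsSolution

end Solution

end VortexSheet

/-! ### Existence and the gradient estimate -/

namespace VortexSheet
open Filter Topology MeasureTheory

section Solution

variable {γ a b T T₀ K δ C L : ℝ} {U f w : Field} {w₀ : InitialField}

/-- The gradient of a solution is controlled by its radial derivative and the source. -/
theorem IsSolution.norm_grad_le (hγ : 0 < γ) (hab : a < b) (hT : 0 < T)
    (hU : IsBackground a b T U K δ) (hδ : 0 < δ)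
    (A : (acoustics γ a b T U).IsAdmissible a b T C) (hw : IsSolution γ a b T U f w₀ w)
    {σ : Side} {p : ℝ × ℝ} (hp : p ∈ slab a b T σ) {F B : ℝ} (hF : ‖f σ p‖ ≤ F)
    (hB : ∀ i, |dr (slab a b T σ) (w σ) p i| ≤ B) :
    ‖grad a b T U w σ p‖ ≤ F + (C * Real.exp C ^ 2 + (1 + K) * ((b - a) / δ)) * B := by
  have hC := A.nonneg
  have hK := hU.bound_nonneg hab hT
  have hB0 : 0 ≤ B := (abs_nonneg _).trans (hB 0)
  have hF0 : 0 ≤ F := (norm_nonneg _).trans hF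
  have hQ : 0 ≤ (b - a) / δ := div_nonneg (sub_pos.2 hab).le hδ.le
  obtain ⟨he, he'⟩ := A.exp_bounds hp
  have hfi : ∀ i, |f σ p i| ≤ F := fun i => (norm_le_pi_norm (f σ p) i).trans hF
  have h2 : ∀ i, |(grad a b T U w σ p).2 i| ≤ (b - a) / δ * B := fun i => by
    simp only [grad, Pi.smul_apply, smul_eq_mul, one_div]
    exact abs_mul_le_mul (hU.abs_straightenR_inv_le hab hδ hp.1) (hB i)
  have hac := hw.isAcousticSolution hγ hab hT hU hδ
  have hce : 0 ≤ C * Real.exp C ^ 2 * B := by positivity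
  -- The equation expresses the derivative along λ by the source and by radial derivatives
  -- multiplied by κe^{±2θ}. The possibly unbounded speed λ is contained in the left-hand side.
  have hmain : ∀ i, |dt (slab a b T σ) (w σ) p i +
      transportSpeed a b U σ p * dr (slab a b T σ) (w σ) p i| ≤ F + C * Real.exp C ^ 2 * B := by
    intro i
    have key : ∀ {x y g : ℝ} (j : Fin 3), x + (acoustics γ a b T U).kap σ p * y ^ 2 *
        dr (slab a b T σ) (w σ) p j = g → |g| ≤ F → 0 < y → y ≤ Real.exp C →
        |x| ≤ F + C * Real.exp C ^ 2 * B := by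
      intro x y g j hx hg hy hy'
      rw [eq_sub_of_add_eq hx]
      refine abs_sub_le_add hg (abs_mul_le_mul (abs_mul_le_mul (A.kap_bound σ p hp) ?_) (hB j))
      rw [abs_of_pos (by positivity)]
      gcongr
    fin_cases i
    · exact key 1 (hac.equation_fst σ p hp) (hfi 0) (Real.exp_pos _) he
    · exact key 0 (hac.equation_snd σ p hp) (hfi 1) (Real.exp_pos _) he'
    · refine (le_of_eq_of_le (congrArg _ (hw.transport hp)) (hfi 2)).trans ?_
      linarith
  have h1 : ∀ i, |(grad a b T U w σ p).1 i| ≤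
      F + C * Real.exp C ^ 2 * B + K * ((b - a) / δ * B) := fun i => by
    rw [eq_sub_of_add_eq (along_eq_grad w σ p i).symm]
    exact abs_sub_le_add (hmain i) (abs_mul_le_mul (hU.abs_apply_le hp 1) (h2 i))
  have hQB : 0 ≤ (b - a) / δ * B := by positivity
  have hKQB : 0 ≤ K * ((b - a) / δ * B) := by positivity
  refine norm_prod_le_iff.2 ⟨?_, ?_⟩
  · refine (pi_norm_le_iff_of_nonneg (by positivity)).2 fun i => (h1 i).trans ?_
    linarith
  · refine (pi_norm_le_iff_of_nonneg (by positivity)).2 fun i => (h2 i).trans ?_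
    linarith

namespace BoundedInitialC1

variable (h : BoundedInitialC1 a b w₀ L)
include h

theorem hasDerivWithinAt {σ : Side} {r : ℝ} (hr : r ∈ σ.interval a b) (i : Fin 3) :
    HasDerivWithinAt (fun r => w₀ σ r i) (derivWithin (w₀ σ) (σ.interval a b) r i)
      (σ.interval a b) r :=
  (hasDerivWithinAt_pi.1 (((h.contDiffOn σ).differentiableOn (by norm_num)) r hr
    ).hasDerivWithinAt) i

theorem continuousOn_derivWithin (hab : a < b) (σ : Side) (i : Fin 3) :
    ContinuousOn (fun r => derivWithin (w₀ σ) (σ.interval a b) r i) (σ.interval a b) :=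
  (continuous_apply i).comp_continuousOn
    ((h.contDiffOn σ).continuousOn_derivWithin (σ.uniqueDiffOn_interval hab) (by norm_num))

theorem radialC1 (hab : a < b) (T : ℝ) (i : Fin 3) :
    RadialC1 a b T L (fun σ z => w₀ σ z.2 i)
      (fun σ z => derivWithin (w₀ σ) (σ.interval a b) z.2 i) where
  continuousOn σ := ContinuousOn.comp (g := fun r => w₀ σ r i) (t := σ.interval a b)
    ((continuous_apply i).comp_continuousOn (h.contDiffOn σ).continuousOn) continuousOn_snd
    fun _ hp => hp.2
  continuousOn_dr σ := ContinuousOn.comp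
    (g := fun r => derivWithin (w₀ σ) (σ.interval a b) r i) (t := σ.interval a b)
    (h.continuousOn_derivWithin hab σ i) continuousOn_snd fun _ hp => hp.2
  hasDerivWithinAt _ _ _ _ hr := h.hasDerivWithinAt hr i
  bound σ z hz := (norm_le_pi_norm (w₀ σ z.2) i).trans (h.bound σ _ hz.2)
  bound_dr σ z hz := (norm_le_pi_norm (derivWithin (w₀ σ) (σ.interval a b) z.2) i).trans
    (h.deriv_bound σ _ hz.2)

end BoundedInitialC1

/-- Existence for the linearized problem, with the estimate of the gradient. -/
theorem exists_isSolution (hγ : 0 < γ) (hab : a < b) (hT₀ : 0 < T₀) (hK : 0 ≤ K) (hδ : 0 < δ)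
    (hC : 0 ≤ C) : ∃ N, 0 ≤ N ∧ ∀ {T L : ℝ} {U f : Field} {w₀ : InitialField}, 0 < T → T ≤ T₀ →
      IsBackground a b T U K δ → (acoustics γ a b T U).IsAdmissible a b T C →
      BoundedC1 a b T U f L → BoundedInitialC1 a b w₀ L → Compatible γ a b U f w₀ →
      ∃ w, IsSolution γ a b T U f w₀ w ∧ ∀ t ∈ Icc 0 T, ∀ σ, ∀ r ∈ σ.interval a b,
        ‖grad a b T U w σ (t, r)‖ ≤
          N * (supNorm a b (fun σ r => derivWithin (w₀ σ) (σ.interval a b) r) +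
            supNorm a b (fun σ r => f σ (0, r)) +
            ∫ s in (0 : ℝ)..t, (supNorm a b (fun σ r => f σ (s, r)) +
              supNorm a b fun σ r => grad a b T U f σ (s, r))) := by
  obtain ⟨N₁, hN₁, hex⟩ := exists_isAcousticSolution_of_compatible C T₀ hC
  have hba := sub_pos.2 hab
  set P := (b - a + T₀ * K) / (b - a) with hP
  have hP0 : 0 ≤ P := by positivity
  set Q := 1 + K + P with hQ
  have hQ1 : 1 ≤ Q := by linarith
  set N₂ := N₁ + Real.exp (C * T₀) with hN₂
  have hN₂0 : 0 ≤ N₂ := by positivity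
  set N₃ := 1 + (C * Real.exp C ^ 2 + (1 + K) * ((b - a) / δ)) * N₂ with hN₃
  have hcoef : 0 ≤ C * Real.exp C ^ 2 + (1 + K) * ((b - a) / δ) := by positivity
  have hN₃0 : 0 ≤ N₃ := by positivity
  refine ⟨N₃ * (2 * Q), by positivity, ?_⟩
  intro T L U f w₀ hT hTT hU A hf hw₀ hcomp
  have h0 : (0 : ℝ) ∈ Icc 0 T := ⟨le_rfl, hT.le⟩
  have hS := uniqueDiffOn_slab hab hT
  have hL : 0 ≤ L := (norm_nonneg _).trans (hf.bound .minus (0, b) (front_mem_slab hab h0 _))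
  have hfp := fun i σ => hasPartials_apply hab hT (hf.contDiffOn σ) i
  have hLL : L ≤ (1 + P) * L := le_mul_of_one_le_left hL (by linarith)
  have hfb : ∀ i σ, ∀ p ∈ slab a b T σ, |f σ p i| ≤ (1 + P) * L := fun i σ p hp =>
    ((norm_le_pi_norm (f σ p) i).trans (hf.bound σ p hp)).trans hLL
  have hfrb : ∀ i σ, ∀ p ∈ slab a b T σ, |dr (slab a b T σ) (f σ) p i| ≤ (1 + P) * L :=
    fun i σ p hp => (hU.abs_dr_le_grad hab hT hδ hTT f hp i).trans
      (mul_le_mul (by linarith) (hf.grad_bound σ p hp) (norm_nonneg _) (by linarith))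
  have hrad := fun i => (hw₀.radialC1 hab T i).mono hLL
  obtain ⟨w1, w1t, w1r, w2, w2t, w2r, hac, hest⟩ := hex A hTT (hfp 0) (hfp 1) (hfb 0) (hfrb 0)
    (hfb 1) (hfrb 1) (h1 := fun σ r => w₀ σ r 0) (h2 := fun σ r => w₀ σ r 1)
    (h1' := fun σ r => derivWithin (w₀ σ) (σ.interval a b) r 0)
    (h2' := fun σ r => derivWithin (w₀ σ) (σ.interval a b) r 1) (hrad 0) (hrad 1)
    hcomp.order_zero.sheet_fst hcomp.order_zero.sheet_snd hcomp.order_zero.wall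
    (by
      have h := hcomp.order_one.sheet_fst
      simp only [initialTimeDeriv, Pi.sub_apply,
        hU.matB_mulVec_fst hab hδ hγ (front_mem_slab hab h0 _), A.lam_front _ 0 h0,
        A.kap_front 0 h0, A.th_front 0 h0, zero_mul, zero_add] at h
      exact h)
    (by
      have h := hcomp.order_one.sheet_snd
      simp only [initialTimeDeriv, Pi.sub_apply,
        hU.matB_mulVec_snd hab hδ hγ (front_mem_slab hab h0 _), A.lam_front _ 0 h0,
        A.kap_front 0 h0, A.th_front 0 h0, zero_mul, zero_add] at h
      exact h)
    (by
      have h := hcomp.order_one.wall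
      have hm : ((0 : ℝ), a) ∈ slab a b T .minus := ⟨h0, Side.left_mem hab.le⟩
      simp only [initialTimeDeriv, Pi.sub_apply, hU.matB_mulVec_snd hab hδ hγ hm,
        A.lam_wall 0 h0, zero_mul, zero_add] at h
      exact h)
  choose w3 w3t w3r hw3 heq3 hini3 hest3 using fun σ => A.exists_transport σ (hfp 2 σ) (hfrb 2 σ)
    (fun r hr => hw₀.hasDerivWithinAt hr 2) (hw₀.continuousOn_derivWithin hab σ 2)
  have hwc : ∀ σ, ContDiffOn ℝ 1 (fun p => ![w1 σ p, w2 σ p, w3 σ p]) (slab a b T σ) := by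
    intro σ
    refine contDiffOn_pi.2 fun i => ?_
    fin_cases i
    · exact (hac.fst σ).contDiffOn (hS σ)
    · exact (hac.snd σ).contDiffOn (hS σ)
    · exact (hw3 σ).contDiffOn (hS σ)
  have hdt : ∀ σ, ∀ p ∈ slab a b T σ, ∀ i,
      dt (slab a b T σ) (fun p => ![w1 σ p, w2 σ p, w3 σ p]) p i =
        ![w1t σ p, w2t σ p, w3t σ p] i := by
    intro σ p hp i
    rw [dt_apply hab hT hp (hwc σ) i]
    fin_cases i
    · exact (hac.fst σ).dt_eq (hS σ) hp
    · exact (hac.snd σ).dt_eq (hS σ) hp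
    · exact (hw3 σ).dt_eq (hS σ) hp
  have hdr : ∀ σ, ∀ p ∈ slab a b T σ, ∀ i,
      dr (slab a b T σ) (fun p => ![w1 σ p, w2 σ p, w3 σ p]) p i =
        ![w1r σ p, w2r σ p, w3r σ p] i := by
    intro σ p hp i
    rw [dr_apply hab hT hp (hwc σ) i]
    fin_cases i
    · exact (hac.fst σ).dr_eq (hS σ) hp
    · exact (hac.snd σ).dr_eq (hS σ) hp
    · exact (hw3 σ).dr_eq (hS σ) hp
  have hsol : IsSolution γ a b T U f w₀ (fun σ p => ![w1 σ p, w2 σ p, w3 σ p]) := by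
    refine ⟨hwc, fun σ p hp => ?_, fun t ht => ⟨hac.front_fst t ht, hac.front_snd t ht,
      hac.wall t ht⟩, fun σ r hr => ?_⟩
    · ext i
      rw [Pi.add_apply]
      fin_cases i
      · show _ + (matB γ a b U σ p).mulVec _ 0 = _
        rw [hU.matB_mulVec_fst hab hδ hγ hp, ← add_assoc]
        simp only [hdt σ p hp, hdr σ p hp]
        exact hac.equation_fst σ p hp
      · show _ + (matB γ a b U σ p).mulVec _ 1 = _
        rw [hU.matB_mulVec_snd hab hδ hγ hp, ← add_assoc]
        simp only [hdt σ p hp, hdr σ p hp]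
        exact hac.equation_snd σ p hp
      · show _ + (matB γ a b U σ p).mulVec _ 2 = _
        rw [IsBackground.matB_mulVec_trd (T := T)]
        simp only [hdt σ p hp, hdr σ p hp]
        exact heq3 σ p hp
    · ext i
      fin_cases i
      · exact hac.initial_fst σ r hr
      · exact hac.initial_snd σ r hr
      · exact hini3 σ r hr
  refine ⟨_, hsol, fun t ht σ r hr => ?_⟩
  have hsub : ∀ {s}, s ∈ Icc 0 t → s ∈ Icc 0 T := fun hs => ⟨hs.1, hs.2.trans ht.2⟩
  set a₀ := supNorm a b (fun σ r => derivWithin (w₀ σ) (σ.interval a b) r) with ha₀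
  set nf : ℝ → ℝ := fun s => supNorm a b (fun σ r => f σ (s, r)) with hnf
  set ng : ℝ → ℝ := fun s => supNorm a b fun σ r => grad a b T U f σ (s, r) with hng
  have hnfi : IntervalIntegrable nf volume 0 t :=
    intervalIntegrable_supNorm hT.le (fun σ => (hf.contDiffOn σ).continuousOn) hf.bound ht
  have hngi : IntervalIntegrable ng volume 0 t := intervalIntegrable_supNorm hT.le
    (fun σ => hU.continuousOn_grad hab hT hδ (hf.contDiffOn σ)) hf.grad_bound ht
  have hfn : ∀ {s}, s ∈ Icc 0 T → ∀ i σ, ∀ r ∈ σ.interval a b, |f σ (s, r) i| ≤ nf s :=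
    fun hs i σ r hr => (norm_le_pi_norm (f σ _) i).trans
      (norm_le_supNorm (fun σ r hr => hf.bound σ (_, r) ⟨hs, hr⟩) hr)
  have hgn : ∀ {s}, s ∈ Icc 0 T → ∀ σ, ∀ r ∈ σ.interval a b,
      ‖grad a b T U f σ (s, r)‖ ≤ ng s := fun hs σ r hr =>
    norm_le_supNorm (h := fun σ r => grad a b T U f σ (_, r))
      (fun σ r hr => hf.grad_bound σ (_, r) ⟨hs, hr⟩) hr
  have ha₀0 : 0 ≤ a₀ := supNorm_nonneg _
  have hnf0 : ∀ s, 0 ≤ nf s := fun s => supNorm_nonneg _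
  have hng0 : ∀ s, 0 ≤ ng s := fun s => supNorm_nonneg _
  have hw₀n : ∀ i σ, ∀ r ∈ σ.interval a b,
      |derivWithin (w₀ σ) (σ.interval a b) r i| ≤ a₀ := fun i σ r hr =>
    (norm_le_pi_norm (derivWithin (w₀ σ) (σ.interval a b) r) i).trans
      (norm_le_supNorm (h := fun σ r => derivWithin (w₀ σ) (σ.interval a b) r)
        hw₀.deriv_bound hr)
  -- `Q` = 1 + K + P converts the norms of `f` and its gradient into one function ψ that dominates
  -- `f`, its radial derivative and its derivative along λ.
  set J := ∫ s in (0 : ℝ)..t, (nf s + ng s) with hJ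
  have hJ0 : 0 ≤ J := intervalIntegral.integral_nonneg ht.1 fun s _ => add_nonneg (hnf0 s) (hng0 s)
  set ψ : ℝ → ℝ := fun s => Q * (nf s + ng s) with hψ
  have hψi : IntervalIntegrable ψ volume 0 t := (hnfi.add hngi).const_mul Q
  have hψJ : ∫ s in (0 : ℝ)..t, ψ s = Q * J := intervalIntegral.integral_const_mul _ _
  set A₁ := a₀ + nf 0 + Q * J with hA₁
  have hle : ∀ s, nf s ≤ ψ s ∧ P * ng s ≤ ψ s ∧ (1 + K) * ng s ≤ ψ s := fun s => by
    have h1 := hnf0 s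
    have h2 := hng0 s
    have h3 : Q * (nf s + ng s) = nf s + (K + P) * nf s + (P * ng s + (1 + K) * ng s) := by
      rw [hQ]; ring
    have h4 : 0 ≤ (K + P) * nf s := by positivity
    have h5 : 0 ≤ P * ng s := by positivity
    have h6 : 0 ≤ (1 + K) * ng s := by positivity
    exact ⟨by simp only [hψ]; linarith, by simp only [hψ]; linarith, by simp only [hψ]; linarith⟩
  have hdrf : ∀ {s}, s ∈ Icc 0 t → ∀ i σ, ∀ r ∈ σ.interval a b,
      |dr (slab a b T σ) (f σ) (s, r) i| ≤ ψ s := fun hs i σ r hr =>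
    ((hU.abs_dr_le_grad hab hT hδ hTT f ⟨hsub hs, hr⟩ i).trans
      (mul_le_mul_of_nonneg_left (hgn (hsub hs) σ r hr) hP0)).trans (hle _).2.1
  have halong : ∀ {s}, s ∈ Icc 0 t → ∀ i σ, ∀ r ∈ σ.interval a b,
      |dt (slab a b T σ) (f σ) (s, r) i + (acoustics γ a b T U).lam σ (s, r) *
        dr (slab a b T σ) (f σ) (s, r) i| ≤ ψ s := fun hs i σ r hr =>
    ((hU.abs_along_le_grad f ⟨hsub hs, hr⟩ i).trans
      (mul_le_mul_of_nonneg_left (hgn (hsub hs) σ r hr) (by linarith))).trans (hle _).2.2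
  have hQJ : 0 ≤ Q * J := by positivity
  -- Each component of `f` is regarded as transported by λ with its own derivative along λ as
  -- source. So `f` at time t is bounded by `f` at time 0 and an integral, which is why no pointwise
  -- term at time t remains in the estimate.
  have hft : ∀ i σ, ∀ r ∈ σ.interval a b, |f σ (t, r) i| ≤ A₁ := fun i σ r hr => by
    have h := A.abs_le_of_transport (hfp i σ) (fun _ _ => rfl) (A₀ := nf 0) (hfn h0 i σ) ht hψi
      (fun s hs r hr => halong hs i σ r hr) hr
    rw [hψJ] at h
    linarith
  have hf0 : ∀ s, s = 0 ∨ s = t → ∀ i σ, ∀ r ∈ σ.interval a b, |f σ (s, r) i| ≤ A₁ := by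
    rintro s (rfl | rfl) i σ r hr
    · exact (hfn h0 i σ r hr).trans (by linarith)
    · exact hft i σ r hr
  have hA₁' : ∀ i σ, ∀ r ∈ σ.interval a b, |derivWithin (w₀ σ) (σ.interval a b) r i| ≤ A₁ :=
    fun i σ r hr => (hw₀n i σ r hr).trans (by linarith [hnf0 0])
  have e12 := hest t ht A₁ ψ hψi (hA₁' 0) (hA₁' 1) (fun s hs => hf0 s hs 0) (fun s hs => hf0 s hs 1)
    (fun s hs σ r hr => ⟨(hfn (hsub hs) 0 σ r hr).trans (hle s).1, hdrf hs 0 σ r hr,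
      halong hs 0 σ r hr⟩)
    (fun s hs σ r hr => ⟨(hfn (hsub hs) 1 σ r hr).trans (hle s).1, hdrf hs 1 σ r hr,
      halong hs 1 σ r hr⟩) σ r hr
  have e3 := hest3 σ t ht A₁ ψ hψi (hA₁' 2 σ) (fun s hs r hr => hdrf hs 2 σ r hr) r hr
  rw [hψJ] at e12 e3
  set E := A₁ + Q * J with hE
  have hA₁E : A₁ ≤ E := by linarith
  have hE0 : 0 ≤ E := by linarith [hnf0 0]
  have hB : ∀ i, |dr (slab a b T σ) (fun p => ![w1 σ p, w2 σ p, w3 σ p]) (t, r) i| ≤ N₂ * E := by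
    intro i
    rw [hdr σ (t, r) ⟨ht, hr⟩ i]
    have hexp : Real.exp (C * T) ≤ Real.exp (C * T₀) :=
      Real.exp_le_exp.2 (mul_le_mul_of_nonneg_left hTT hC)
    have hN₁2 : N₁ * E ≤ N₂ * E :=
      mul_le_mul_of_nonneg_right (le_add_of_nonneg_right (Real.exp_pos _).le) hE0
    have hN₃2 : Real.exp (C * T) * E ≤ N₂ * E :=
      mul_le_mul_of_nonneg_right (by linarith) hE0
    fin_cases i
    · exact e12.1.trans hN₁2
    · exact e12.2.trans hN₁2
    · exact e3.trans hN₃2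
  have hmain := hsol.norm_grad_le hγ hab hT hU hδ A (p := (t, r)) ⟨ht, hr⟩
    ((pi_norm_le_iff_of_nonneg hE0).2 fun i => (hft i σ r hr).trans hA₁E) hB
  refine hmain.trans ?_
  have hEJ : E ≤ 2 * Q * (a₀ + nf 0 + J) := by
    have h1 : a₀ + nf 0 ≤ 2 * Q * (a₀ + nf 0) :=
      le_mul_of_one_le_left (add_nonneg ha₀0 (hnf0 0)) (by linarith)
    rw [hE, hA₁]
    linarith
  calc E + (C * Real.exp C ^ 2 + (1 + K) * ((b - a) / δ)) * (N₂ * E) = N₃ * E := by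
        rw [hN₃]; ring
    _ ≤ N₃ * (2 * Q * (a₀ + nf 0 + J)) := mul_le_mul_of_nonneg_left hEJ hN₃0
    _ = N₃ * (2 * Q) * (a₀ + nf 0 + J) := by ring

end Solution

end VortexSheet

/-! ### Exponential weights and conclusion -/

namespace VortexSheet
open Filter Topology MeasureTheory

/-- Exponential weights with a nonnegative rate only increase a right-hand side. -/
theorem add_integral_le_exp_weighted {m t x C' C : ℝ} {g : ℝ → ℝ} (hm : 0 ≤ m) (ht : 0 ≤ t)
    (hx : 0 ≤ x) (hg : IntervalIntegrable g volume 0 t) (hg0 : ∀ s, 0 ≤ g s) (hC' : 0 ≤ C')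
    (hC : C' ≤ C) : C' * (x + ∫ s in (0 : ℝ)..t, g s) ≤
      C * (Real.exp (m * C * t) * x + ∫ s in (0 : ℝ)..t, Real.exp (m * C * (t - s)) * g s) := by
  have hC0 : 0 ≤ C := hC'.trans hC
  have hc : Continuous fun s => Real.exp (m * C * (t - s)) := by fun_prop
  have h1 : x ≤ Real.exp (m * C * t) * x :=
    le_mul_of_one_le_left hx (Real.one_le_exp (by positivity))
  have h2 : ∫ s in (0 : ℝ)..t, g s ≤ ∫ s in (0 : ℝ)..t, Real.exp (m * C * (t - s)) * g s :=
    intervalIntegral.integral_mono_on ht hg (hg.continuousOn_mul hc.continuousOn) fun s hs =>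
      le_mul_of_one_le_left (hg0 s)
        (Real.one_le_exp (mul_nonneg (mul_nonneg hm hC0) (sub_nonneg.2 hs.2)))
  have h3 : 0 ≤ ∫ s in (0 : ℝ)..t, g s :=
    intervalIntegral.integral_nonneg ht fun s _ => hg0 s
  exact mul_le_mul hC (add_le_add h1 h2) (add_nonneg hx h3) hC0

end VortexSheet

theorem proposition2p4 (γ a b T₀ K δ : ℝ) (hγ : 0 < γ) (ha : 0 < a) (hab : a < b)
    (hT₀ : 0 < T₀) (hδ : 0 < δ) :
    ∃ C M : ℝ, 0 < C ∧ 0 < M ∧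
      ∀ (T : ℝ) (U : VortexSheet.Field), 0 < T → T ≤ T₀ →
      VortexSheet.IsBackground a b T U K δ →
      (∀ σ, ∀ p ∈ VortexSheet.slab a b T σ, ∀ i j, |VortexSheet.matM γ a b T U σ p i j| ≤ M) ∧
      ∀ (f : VortexSheet.Field) (w₀ : VortexSheet.InitialField),
        (∃ L, VortexSheet.BoundedC1 a b T U f L) →
        (∃ L, VortexSheet.BoundedInitialC1 a b w₀ L) →
        VortexSheet.Compatible γ a b U f w₀ →
        ∃ w : VortexSheet.Field,
          VortexSheet.IsSolution γ a b T U f w₀ w ∧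
          (∃ L, VortexSheet.BoundedC1 a b T U w L) ∧
          (∀ w' : VortexSheet.Field, VortexSheet.IsSolution γ a b T U f w₀ w' →
            ∀ σ, Set.EqOn (w' σ) (w σ) (VortexSheet.slab a b T σ)) ∧
          (∀ M' : ℝ,
            (∀ σ, ∀ p ∈ VortexSheet.slab a b T σ, ∀ i j,
              |VortexSheet.matM γ a b T U σ p i j| ≤ M') →
            ∀ t ∈ Set.Icc 0 T,
              VortexSheet.supNorm a b (fun σ r => w σ (t, r)) ≤
                C * (Real.exp (M' * C * t) * VortexSheet.supNorm a b w₀ +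
                  ∫ s in (0 : ℝ)..t, Real.exp (M' * C * (t - s)) *
                    VortexSheet.supNorm a b (fun σ r => f σ (s, r)))) ∧
          (∀ t ∈ Set.Icc 0 T,
            VortexSheet.supNorm a b (fun σ r => VortexSheet.grad a b T U w σ (t, r)) ≤
              C * (Real.exp (M * C * t) *
                  (VortexSheet.supNorm a b
                      (fun σ r => derivWithin (w₀ σ) (σ.interval a b) r) +
                    VortexSheet.supNorm a b (fun σ r => f σ (0, r))) +
                ∫ s in (0 : ℝ)..t, Real.exp (M * C * (t - s)) *
                  (VortexSheet.supNorm a b (fun σ r => f σ (s, r)) +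
                    VortexSheet.supNorm a b
                      (fun σ r => VortexSheet.grad a b T U f σ (s, r))))) := by
  open VortexSheet in
  by_cases hK : 0 ≤ K
  swap
  -- For negative K there is no background state, so any constants do.
  · exact ⟨1, 1, one_pos, one_pos, fun T U hT _ hU => absurd (hU.bound_nonneg hab hT) hK⟩
  obtain ⟨C₀, M, hC₀, hM, hadm⟩ := exists_isAdmissible hγ hab hT₀ hK hδ
  obtain ⟨N, hN, hex⟩ := exists_isSolution (C := C₀) hγ hab hT₀ hK hδ hC₀
  obtain ⟨D, hD⟩ : ∃ D, D = 1 + 2 * Real.exp C₀ *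
    (2 * Real.exp C₀ * Real.exp (4 * (C₀ + C₀ * C₀) * T₀)) := ⟨_, rfl⟩
  have hD0 : 0 < D := by rw [hD]; positivity
  refine ⟨D + N, M, by linarith, hM, fun T U hT hTT hU => ?_⟩
  obtain ⟨A, hMb⟩ := hadm hT hTT hU
  refine ⟨hMb, ?_⟩
  rintro f w₀ ⟨L₁, hf⟩ ⟨L₂, hw₀⟩ hcomp
  obtain ⟨L, hf, hw₀⟩ : ∃ L, BoundedC1 a b T U f L ∧ BoundedInitialC1 a b w₀ L :=
    ⟨max L₁ L₂, ⟨hf.contDiffOn, fun σ p hp => (hf.bound σ p hp).trans (le_max_left _ _),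
      fun σ p hp => (hf.grad_bound σ p hp).trans (le_max_left _ _)⟩,
      ⟨hw₀.contDiffOn, fun σ r hr => (hw₀.bound σ r hr).trans (le_max_right _ _),
      fun σ r hr => (hw₀.deriv_bound σ r hr).trans (le_max_right _ _)⟩⟩
  obtain ⟨w, hw, hgrad⟩ := hex hT hTT hU A hf hw₀ hcomp
  have hfc : ∀ σ, ContinuousOn (f σ) (slab a b T σ) := fun σ => (hf.contDiffOn σ).continuousOn
  have hnorm := fun {t : ℝ} (ht : t ∈ Set.Icc 0 T) {σ : Side} {r : ℝ}
    (hr : r ∈ σ.interval a b) =>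
      hw.norm_le hγ hab hT hTT hU hδ A hfc hf.bound hw₀.bound ht hr
  rw [← hD] at hnorm
  have hnfi : ∀ {t}, t ∈ Set.Icc 0 T → IntervalIntegrable
      (fun s => supNorm a b fun σ r => f σ (s, r)) MeasureTheory.volume 0 t :=
    fun ht => intervalIntegrable_supNorm hT.le hfc hf.bound ht
  have hngi : ∀ {t}, t ∈ Set.Icc 0 T → IntervalIntegrable
      (fun s => supNorm a b fun σ r => grad a b T U f σ (s, r)) MeasureTheory.volume 0 t :=
    fun ht => intervalIntegrable_supNorm hT.le
      (fun σ => hU.continuousOn_grad hab hT hδ (hf.contDiffOn σ)) hf.grad_bound ht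
  have hmono : ∀ {g : ℝ → ℝ} {t : ℝ}, t ∈ Set.Icc 0 T → (∀ s, 0 ≤ g s) →
      (∀ {t}, t ∈ Set.Icc 0 T → IntervalIntegrable g MeasureTheory.volume 0 t) →
      ∫ s in (0 : ℝ)..t, g s ≤ ∫ s in (0 : ℝ)..T, g s := fun ht hg0 hg =>
    intervalIntegral.integral_mono_interval le_rfl ht.1 ht.2
      (MeasureTheory.ae_of_all _ hg0) (hg ⟨hT.le, le_rfl⟩)
  have hsum0 : ∀ s, 0 ≤ supNorm a b (fun σ r => f σ (s, r)) +
      supNorm a b fun σ r => grad a b T U f σ (s, r) :=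
    fun s => add_nonneg (supNorm_nonneg _) (supNorm_nonneg _)
  refine ⟨w, hw, ?_, fun w' hw' σ p hp => ?_, fun M' hM' t ht => ?_, fun t ht => ?_⟩
  · refine ⟨_, hw.contDiffOn, fun σ p hp => le_max_of_le_left ((hnorm hp.1 hp.2).trans
      (mul_le_mul_of_nonneg_left (add_le_add_right
        (hmono hp.1 (fun s => supNorm_nonneg _) hnfi) _) hD0.le)),
      fun σ p hp => le_max_of_le_right ((hgrad p.1 hp.1 σ p.2 hp.2).trans
        (mul_le_mul_of_nonneg_left (add_le_add_right
          (hmono hp.1 hsum0 fun ht => (hnfi ht).add (hngi ht)) _) hN))⟩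
  -- The supremum estimate does not presuppose that the solution is bounded, so it applies to the
  -- difference of any two solutions, whose data vanish.
  · have h := (hw.sub hab hT hw').norm_le hγ hab hT hTT hU hδ A (fun _ => continuousOn_const)
      (fun _ _ _ => norm_zero.le) (fun _ _ _ => norm_zero.le) hp.1 hp.2
    have h0 : supNorm a b (fun (_ : Side) (_ : ℝ) => (0 : State)) = 0 :=
      le_antisymm (supNorm_le fun _ _ _ => norm_zero.le) (supNorm_nonneg _)
    rw [h0, intervalIntegral.integral_zero, add_zero, mul_zero] at h
    exact sub_eq_zero.1 (norm_le_zero_iff.1 h)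
  -- A bound for absolute values is nonnegative, so the weight with rate M'C is at least 1 and only
  -- enlarges the unweighted bound.
  · have hM'0 : 0 ≤ M' := (abs_nonneg _).trans
      (hM' .minus (0, b) (front_mem_slab hab ⟨le_rfl, hT.le⟩ _) 0 0)
    exact (supNorm_le fun σ r hr => hnorm ht hr).trans
      (add_integral_le_exp_weighted hM'0 ht.1 (supNorm_nonneg _) (hnfi ht)
        (fun s => supNorm_nonneg _) hD0.le (by linarith))
  · exact (supNorm_le fun σ r hr => hgrad t ht σ r hr).trans
      (add_integral_le_exp_weighted hM.le ht.1 (add_nonneg (supNorm_nonneg _) (supNorm_nonneg _))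
        ((hnfi ht).add (hngi ht)) hsum0 hN (by linarith))
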